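/- **Setting.** Let $$A(x)=\sum_{f}\frac{A_{f}}{x-\gamma_f}+\sum_{i}\sum_{m=0}^{r_i}\frac{A_{i,m}}{(x-\gamma_i)^{m+1}}+\sum_{m=1}^{r_\infty}A_{\infty,m}x^{m-1}$$ be an $N\times N$ rational matrix with finitely many distinct finite poles: Fuchsian poles $\gamma_f$ (no restriction on $A_f$) and irregular poles $\gamma_i$ ($r_i\ge 1$), and with an irregular pole at $\infty$ ($r_\infty\ge1$). At an irregular pole $\gamma$ (finite or $\infty$), let $r=r_\gamma$, let $n_1,\dots,n_s$ and $\lambda_1,\dots,\lambda_s$ (not necessarily distinct) be the sizes and eigenvalues of the Jordan blocks of the leading coefficient, and assume that the Lidskii pseudovalues are generic: in a basis in which the leading coefficient of the expansion of $A$ is in (upper triangular) Jordan form, let $\Lambda_{ij}$ be the lower left entry of the $(i,j)$ block of the next coefficient; for every $j_0$ the polynomial $\det\big(\Lambda_{ij}-X\,\delta_{ij}\,[n_i=n_{j_0}]\big)$, where $i,j$ run over the blocks with $\lambda_i=\lambda_{j_0}$, $n_i\ge n_{j_0}$, has simple nonzero roots. *Bare form, times.* Put $u=x-\gamma$ at a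 finite pole, $u=x$ at $\infty$. For a block of size $n$ let $\mathcal H$ be, at $\infty$, the $n\times n$ matrix with $1$ below the diagonal, $x$ in the upper right corner and $0$ elsewhere, and, at a finite pole, the transpose of the same matrix with $(x-\gamma)^{-1}$ in place of $x$; let $G=\mathrm{diag}(0,1,\dots,n-1)$. The times $t_{J,j}^\gamma$ ($1\le J\le rn_j$) and the parameters of formal monodromy $t_{0,j}^\gamma$ are defined by a formal gauge $Y^\gamma$, a power series in $x-\gamma$ (in $x^{-1}$ at $\infty$) with invertible constant term, such that $$\partial_xY^\gamma=AY^\gamma-Y^\gamma D^\gamma,\qquad D^\gamma=\mathrm{diag}_j\Big(\frac1{n_ju}\Big(\sum_{J=0}^{rn_j}t^\gamma_{J,j}\mathcal H_j^J-G_j\Big)\Big),\qquad t^\gamma_{rn_j,j}=n_j\lambda_j .$$ *Normalized isomonodromic flow.* Let $A$, the positions of the poles, the times and the coefficients of the $Y^\gamma$ depend holomorphically on a point of an open subset $U$ of a finite-dimensional complex vector space (for instance an open set of the space with coordinates all $t_{J,j}^\gamma$, $J\ge1$, and all finite poles), with the $r_\gamma$, $s_\gamma$, $n_j^\gamma$ fixed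 and the assumptions above valid at each point. With $\mathrm d$ the differential on $U$, let $$\mathcal T^{\infty,\mathrm{bare}}=\mathrm{diag}_j\Big(\sum_{J=1}^{rn_j}\tfrac1J\mathcal H_j^J\,\mathrm dt^\infty_{J,j}\Big),\qquad \mathcal T^{\gamma,\mathrm{bare}}=-\mathrm{diag}_j\Big(\sum_{J=1}^{rn_j}\tfrac1J\mathcal H_j^J\,\mathrm dt^\gamma_{J,j}\Big)-D^\gamma\,\mathrm d\gamma,$$ $$\mathcal T=\big(Y^\infty\mathcal T^{\infty,\mathrm{bare}}(Y^\infty)^{-1}\big)_{+}+\sum_{i}\big(Y^{\gamma_i}\mathcal T^{\gamma_i,\mathrm{bare}}(Y^{\gamma_i})^{-1}\big)_{pp}-\sum_f\frac{A_f}{x-\gamma_f}\,\mathrm d\gamma_f ,$$ where $(\cdot)_+$ is the polynomial part in $x$ (with constant term) and $(\cdot)_{pp}$ the principal part at the pole. Assume $\mathrm dA=\partial_x\mathcal T+[\mathcal T,A]$ at each $x$ that is not a pole. *Points of the spectral curve.* At an irregular pole $\gamma$ let $\xi=(x-\gamma)^{1/n_j}$ (at $\infty$: $\xi=x^{-1/n_j}$).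 The point $\zeta_\gamma^j$ of the desingularization of $\det(y-A(x))=0$ above $\gamma$ is the branch with local parameter $\xi$ given by a Laurent series $y(\xi)$ with $\det(y-A(x))=0$, ramification index exactly $n_j$, and $y=\frac1{n_j}\big(t_{rn_j,j}+t_{rn_j-1,j}\,\xi+O(\xi^2)\big)(x-\gamma)^{-r-1}$ (at $\infty$: $(\cdots)\,x^{r-1}$). Residues at $\zeta_\gamma^j$ are taken in the local parameter $\xi$; at points above $\infty$ along loops that are positively oriented in the $x$-plane, i.e. $\mathop{\mathrm{res}}_{\zeta_\infty^j}\frac{\mathrm dx}{x}=n_j$. **Proposition.** Under these assumptions the branch $y(\xi)$ at each $\zeta_\gamma^j$ exists and is unique, and: 1. The differential on $U$ $$\mathrm d\ln\tau:=\sum_{j=1}^{s_\infty}\sum_{J=1}^{r_\infty n_j^\infty}\frac1J\Big(\mathop{\mathrm{res}}_{\zeta_\infty^j}x^{J/n_j^\infty}y\,\mathrm dx\Big)\mathrm dt^\infty_{J,j}+\sum_{i}\sum_{j=1}^{s_{\gamma_i}}\sum_{J=1}^{r_in_j^{\gamma_i}}\frac1J\Big(\mathop{\mathrm{res}}_{\zeta_{\gamma_i}^j}(x-\gamma_i)^{-J/n_j^{\gamma_i}}y\,\mathrm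 dx\Big)\mathrm dt^{\gamma_i}_{J,j}+\frac12\sum_{\gamma}\Big(\mathop{\mathrm{res}}_{x=\gamma}\mathrm{Tr}A^2\,\mathrm dx\Big)\mathrm d\gamma$$ (the last sum over all finite poles, Fuchsian and irregular) is holomorphic and closed, hence locally the differential of a function. 2. For every irregular pole, every $j$ and $1\le J\le r_\gamma n_j^\gamma$, $$t^\infty_{J,j}=\mathop{\mathrm{res}}_{\zeta_\infty^j}x^{-J/n_j^\infty}y\,\mathrm dx,\qquad t^\gamma_{J,j}=\mathop{\mathrm{res}}_{\zeta_\gamma^j}(x-\gamma)^{J/n_j^\gamma}y\,\mathrm dx\ (\gamma\ne\infty),\qquad t^\gamma_{0,j}=\mathop{\mathrm{res}}_{\zeta_\gamma^j}y\,\mathrm dx+\frac{n_j^\gamma-1}2\ (\gamma\text{ finite or }\infty).$$ -/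

import Mathlib

/-! Rational connections on the Riemann sphere with Fuchsian poles (indexed by `φ`), finite irregular
poles (indexed by `ι`) and an irregular pole at infinity.  The irregular poles are indexed by
`Option ι`, where `none` is infinity.  Matrices are indexed by `ν`. -/

namespace MinRes

open Polynomial

/-- The discrete data of an irregular singularity: the Poincaré rank `r ≥ 1`, the number `s` of Jordan
blocks of the leading coefficient, their sizes `n j ≥ 1`, and an enumeration of the rows of all blocks
by the index set `ν` of the matrices. -/
structure LocalType (ν : Type*) where
  r : ℕ
  r_pos : 0 < r
  s : ℕ
  n : Fin s → ℕ
  n_pos : ∀ j, 0 < n j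
  e : (Σ j : Fin s, Fin (n j)) ≃ ν

/-- The block diagonal matrix with prescribed blocks. -/
def LocalType.blocks {ν K : Type*} [Zero K] (L : LocalType ν)
    (B : ∀ j, Matrix (Fin (L.n j)) (Fin (L.n j)) K) : Matrix ν ν K :=
  Matrix.reindex L.e L.e (Matrix.blockDiagonal' B)

/-! ### Jordan form and Lidskii genericity -/

/-- The upper triangular Jordan block. -/
def jordanBlock (n : ℕ) (μ : ℂ) : Matrix (Fin n) (Fin n) ℂ :=
  Matrix.of fun a b => if a = b then μ else if (a : ℕ) + 1 = b then 1 else 0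

/-- The Lidskii matrix: the lower left entries of the blocks of `B`. -/
def lidskii {ν : Type*} (L : LocalType ν) (B : Matrix ν ν ℂ) : Matrix (Fin L.s) (Fin L.s) ℂ :=
  Matrix.of fun i j =>
    B (L.e ⟨i, ⟨L.n i - 1, Nat.sub_lt (L.n_pos i) Nat.one_pos⟩⟩) (L.e ⟨j, ⟨0, L.n_pos j⟩⟩)

open scoped Classical in
/-- The Lidskii pseudo-characteristic polynomial attached to the eigenvalue and to the size of the
block `j₀`: the determinant of the submatrix of the Lidskii matrix on the blocks with the same
eigenvalue and at least the same size, minus the variable times the projector on the blocks of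
exactly that size. -/
noncomputable def pseudoCharpoly {ν : Type*} (L : LocalType ν) (lam : Fin L.s → ℂ)
    (B : Matrix ν ν ℂ) (j₀ : Fin L.s) : ℂ[X] :=
  Matrix.det (Matrix.of fun i j : {j : Fin L.s // lam j = lam j₀ ∧ L.n j₀ ≤ L.n j} =>
    C (lidskii L B i j) - if i = j ∧ L.n i = L.n j₀ then X else 0)

/-- All Lidskii pseudovalues are nonzero, and each pseudo-characteristic polynomial has simple
roots. -/
def LidskiiGeneric {ν : Type*} (L : LocalType ν) (lam : Fin L.s → ℂ) (B : Matrix ν ν ℂ) : Prop :=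
  ∀ j₀, (pseudoCharpoly L lam B j₀).eval 0 ≠ 0 ∧ (pseudoCharpoly L lam B j₀).Separable

/-! ### Rational connections and their local expansions -/

/-- The matrix
`A(x) = ∑_f A_f / (x - γ_f) + ∑_i ∑_{m=0}^{r_i} A_{i,m} / (x - γ_i)^{m+1} + ∑_{m=0}^{r_∞-1} A_{∞,m+1} x^m`,
given by its poles and coefficients. -/
structure Connection (φ : Type*) {ι ν : Type*} (L : Option ι → LocalType ν) where
  fuchsPole : φ → ℂ
  irrPole : ι → ℂ
  fuchsCoeff : φ → Matrix ν ν ℂ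
  irrCoeff : ∀ i : ι, Fin ((L (some i)).r + 1) → Matrix ν ν ℂ
  infCoeff : Fin (L none).r → Matrix ν ν ℂ

section
variable {φ ι ν : Type*} [Fintype φ] [Fintype ι] [Fintype ν] [DecidableEq ν]
  {L : Option ι → LocalType ν}

/-- The position of a finite pole. -/
def Connection.pole (A : Connection φ L) : φ ⊕ ι → ℂ := Sum.elim A.fuchsPole A.irrPole

/-- The value of `A` at a point `u` of a field containing `ℂ`; with `u` a Laurent series this is the
expansion of `A(x)` after the substitution `x = u`. -/
noncomputable def Connection.at (A : Connection φ L) {K : Type*} [Field K] [Algebra ℂ K] (u : K) :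
    Matrix ν ν K :=
  ∑ f, (u - algebraMap ℂ K (A.fuchsPole f))⁻¹ • (A.fuchsCoeff f).map (algebraMap ℂ K)
  + ∑ i, ∑ m : Fin ((L (some i)).r + 1), ((u - algebraMap ℂ K (A.irrPole i)) ^ ((m : ℕ) + 1))⁻¹ •
      (A.irrCoeff i m).map (algebraMap ℂ K)
  + ∑ m : Fin (L none).r, u ^ (m : ℕ) • (A.infCoeff m).map (algebraMap ℂ K)

/-- The coordinate `x` as a Laurent series in the local parameter of an `n`-fold branched cover:
`x = γ + ξ^n` at a finite point `γ`. -/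
noncomputable def finCoord (γ : ℂ) (n : ℕ) : LaurentSeries ℂ :=
  algebraMap ℂ (LaurentSeries ℂ) γ + HahnSeries.single (n : ℤ) 1

/-- The coordinate `x = ξ^{-n}` at infinity. -/
noncomputable def infCoord (n : ℕ) : LaurentSeries ℂ := HahnSeries.single (-(n : ℤ)) 1

/-- The coordinate `x` in the local parameter `ξ = (x - γ)^{1/n}`, respectively `ξ = x^{-1/n}`, above
an irregular pole. -/
noncomputable def Connection.coord (A : Connection φ L) : Option ι → ℕ → LaurentSeries ℂ
  | some i, n => finCoord (A.irrPole i) n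
  | none, n => infCoord n

/-- Exponent of `ξ = (x - γ)`, respectively `ξ = x^{-1}`, at the leading term of `A`. -/
def leadExp (L : Option ι → LocalType ν) : Option ι → ℤ
  | some i => -((L (some i)).r + 1 : ℤ)
  | none => 1 - ((L none).r : ℤ)

/-- The matrix coefficient of `ξ^k` in the expansion of `A` at an irregular pole. -/
noncomputable def Connection.expCoeff (A : Connection φ L) (p : Option ι) (k : ℤ) : Matrix ν ν ℂ :=
  (A.at (A.coord p 1)).map fun f => f.coeff k

/-- The leading coefficient at the irregular pole `p` has Jordan blocks of sizes `n_j` and eigenvalues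
`lam j`, and the subleading coefficient, in a basis where the leading one is in Jordan form, has
generic Lidskii pseudovalues. -/
def Connection.MinimallyResonantAt (A : Connection φ L) (p : Option ι) (lam : Fin (L p).s → ℂ) :
    Prop :=
  ∃ P : Matrix ν ν ℂ, IsUnit P.det ∧
    A.expCoeff p (leadExp L p) = P * (L p).blocks (fun j => jordanBlock ((L p).n j) (lam j)) * P⁻¹ ∧
    LidskiiGeneric (L p) lam (P⁻¹ * A.expCoeff p (leadExp L p + 1) * P)

/-! ### The bare system and the formal gauge -/

/-- The matrix with ones below the diagonal and `w` in the upper right corner; its `n`-th power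
is `w`. -/
def shiftMat {K : Type*} [Zero K] [One K] (n : ℕ) (w : K) : Matrix (Fin n) (Fin n) K :=
  Matrix.of fun a b =>
    if (a : ℕ) = b + 1 then 1 else if (a : ℕ) = 0 ∧ (b : ℕ) + 1 = n then w else 0

/-- The matrix `diag(0, 1, …, n - 1)`. -/
def gradMat {K : Type*} [Zero K] [NatCast K] (n : ℕ) : Matrix (Fin n) (Fin n) K :=
  Matrix.diagonal fun a => ((a : ℕ) : K)

/-- The matrix `𝓗` of a block of size `n`, in the local parameter `ξ = x - γ` or `ξ = x^{-1}`.  At a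
finite pole the basis of the block is numbered in the opposite order: with this numbering
`∂_x - (1 / (n (x - γ))) (∑ t_J 𝓗^J - G)` commutes with `∂_{t_J} + 𝓗^J / J`, in the same way as
`∂_x - (1 / (n x)) (∑ t_J 𝓗^J - G)` commutes with `∂_{t_J} - 𝓗^J / J` at infinity. -/
noncomputable def bareH (p : Option ι) (n : ℕ) : Matrix (Fin n) (Fin n) (LaurentSeries ℂ) :=
  match p with
  | some _ => (shiftMat n (HahnSeries.single (-1 : ℤ) 1)).transpose
  | none => shiftMat n (HahnSeries.single (-1 : ℤ) 1)

/-- `1 / (x - γ)`, respectively `1 / x`, in the local parameter `ξ = x - γ`, `ξ = x^{-1}`. -/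
noncomputable def invCoord : Option ι → LaurentSeries ℂ
  | some _ => HahnSeries.single (-1 : ℤ) 1
  | none => HahnSeries.single (1 : ℤ) 1

/-- The bare connection at an irregular pole: block diagonal with the blocks
`(1 / (n_j (x - γ))) (∑_{J=0}^{r n_j} t_{J,j} 𝓗_j^J - G_j)`, with `x` in place of `x - γ` at infinity. -/
noncomputable def bareD (L : Option ι → LocalType ν) (p : Option ι) (t : Fin (L p).s → ℕ → ℂ) :
    Matrix ν ν (LaurentSeries ℂ) :=
  (L p).blocks fun j =>
    (((L p).n j : LaurentSeries ℂ)⁻¹ * invCoord p) •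
      (∑ J ∈ Finset.range ((L p).r * (L p).n j + 1), t j J • bareH p ((L p).n j) ^ J
        - gradMat ((L p).n j))

/-- The sign of the bare deformation: `Ψ^bare` behaves as `exp (± ∑ t_J 𝓗^J / J)`. -/
def bareSign : Option ι → ℂ
  | some _ => -1
  | none => 1

/-- The coefficient `± 𝓗_j^J / J` of `dt_{J,j}` in the bare deformation. -/
noncomputable def bareT (L : Option ι → LocalType ν) (p : Option ι) (j : Fin (L p).s) (J : ℕ) :
    Matrix ν ν (LaurentSeries ℂ) :=
  (bareSign p / J) • (L p).blocks (Pi.single j (bareH p ((L p).n j) ^ J))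

/-- A matrix of formal power series in the local parameter, seen as Laurent series. -/
noncomputable def toLaurent (Y : Matrix ν ν (PowerSeries ℂ)) : Matrix ν ν (LaurentSeries ℂ) :=
  Y.map (HahnSeries.ofPowerSeries ℤ ℂ)

/-- `Y`, a formal series in `ξ = x - γ` (`ξ = x^{-1}` at infinity) with invertible constant term,
gauges `A` to the bare connection with parameters `t`: `dY/dx = A Y - Y D`.  Here
`dY/dξ = (dx/dξ) dY/dx`. -/
def Connection.IsFormalGauge (A : Connection φ L) (p : Option ι) (t : Fin (L p).s → ℕ → ℂ)
    (Y : Matrix ν ν (PowerSeries ℂ)) : Prop :=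
  IsUnit (Y.map (PowerSeries.constantCoeff (R := ℂ))).det ∧
  (toLaurent Y).map (LaurentSeries.derivative ℂ) =
    LaurentSeries.derivative ℂ (A.coord p 1) •
      (A.at (A.coord p 1) * toLaurent Y - toLaurent Y * bareD L p t)

/-! ### Normalized isomonodromic deformations -/

/-- The principal part of a Laurent series in `ξ = x - γ`, at `z = x - γ`. -/
noncomputable def principalPart (f : LaurentSeries ℂ) (z : ℂ) : ℂ :=
  ∑ m ∈ Finset.range (-f.order).toNat, f.coeff (-((m : ℤ) + 1)) * (z ^ (m + 1))⁻¹

/-- The polynomial part in `x`, including the constant term, of a Laurent series in `ξ = x^{-1}`. -/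
noncomputable def polynomialPart (f : LaurentSeries ℂ) (x : ℂ) : ℂ :=
  ∑ m ∈ Finset.range ((-f.order).toNat + 1), f.coeff (-(m : ℤ)) * x ^ m

/-- The value of the bare deformation one-form at a pole on a vector on which `dt_{J,j}` takes the
value `dt j J` and the differential of the position of the pole takes the value `dγ` (which is `0` for
the pole at infinity). -/
noncomputable def bareForm (L : Option ι → LocalType ν) (p : Option ι) (t dt : Fin (L p).s → ℕ → ℂ)
    (dγ : ℂ) : Matrix ν ν (LaurentSeries ℂ) :=
  ∑ j, ∑ J ∈ Finset.Icc 1 ((L p).r * (L p).n j), dt j J • bareT L p j J - dγ • bareD L p t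

/-- The value at `x` of the normalized deformation one-form
`(Y^∞ 𝓣^∞ (Y^∞)⁻¹)_+ + ∑_i (Y^i 𝓣^i (Y^i)⁻¹)_pp - ∑_f A_f / (x - γ_f) dγ_f`. -/
noncomputable def Connection.deformation (A : Connection φ L) (t : ∀ p, Fin (L p).s → ℕ → ℂ)
    (Y : Option ι → Matrix ν ν (PowerSeries ℂ)) (dt : ∀ p, Fin (L p).s → ℕ → ℂ) (dγ : φ ⊕ ι → ℂ)
    (x : ℂ) : Matrix ν ν ℂ :=
  (toLaurent (Y none) * bareForm L none (t none) (dt none) 0 * (toLaurent (Y none))⁻¹).map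
      (fun f => polynomialPart f x)
  + ∑ i, (toLaurent (Y (some i)) * bareForm L (some i) (t (some i)) (dt (some i)) (dγ (.inr i)) *
        (toLaurent (Y (some i)))⁻¹).map (fun f => principalPart f (x - A.irrPole i))
  - ∑ f, (dγ (.inl f) * (x - A.fuchsPole f)⁻¹) • A.fuchsCoeff f

variable {E : Type*} [NormedAddCommGroup E] [NormedSpace ℂ E]

/-- The values on the tangent vector `v` of the differentials of the times. -/
noncomputable def dTimes (t : E → ∀ p, Fin (L p).s → ℕ → ℂ) (z v : E) (p : Option ι)
    (j : Fin (L p).s) (J : ℕ) : ℂ :=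
  fderiv ℂ (fun z' => t z' p j J) z v

/-- The values on the tangent vector `v` of the differentials of the positions of the poles. -/
noncomputable def dPoles (A : E → Connection φ L) (z v : E) (q : φ ⊕ ι) : ℂ :=
  fderiv ℂ (fun z' => (A z').pole q) z v

/-- A holomorphic family of minimally resonant connections over `U ⊆ E`, with times
`t_{J,j}^p` (`1 ≤ J ≤ r_p n_j^p`), parameters of formal monodromy `t_{0,j}^p` and formal gauges `Y^p`,
that solves the normalized isomonodromic deformation equations. -/
structure NormalizedIsomonodromic (U : Set E) (A : E → Connection φ L)
    (t : E → ∀ p, Fin (L p).s → ℕ → ℂ) (Y : E → Option ι → Matrix ν ν (PowerSeries ℂ)) : Prop where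
  analytic_pole : ∀ q, AnalyticOnNhd ℂ (fun z => (A z).pole q) U
  analytic_fuchsCoeff : ∀ f a b, AnalyticOnNhd ℂ (fun z => (A z).fuchsCoeff f a b) U
  analytic_irrCoeff : ∀ i m a b, AnalyticOnNhd ℂ (fun z => (A z).irrCoeff i m a b) U
  analytic_infCoeff : ∀ m a b, AnalyticOnNhd ℂ (fun z => (A z).infCoeff m a b) U
  analytic_times : ∀ p j, ∀ J ∈ Finset.Icc 1 ((L p).r * (L p).n j),
    AnalyticOnNhd ℂ (fun z => t z p j J) U
  analytic_gauge : ∀ p k a b, AnalyticOnNhd ℂ (fun z => PowerSeries.coeff k (Y z p a b)) U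
  distinct_poles : ∀ z ∈ U, Function.Injective (A z).pole
  minimally_resonant : ∀ z ∈ U, ∀ p, (A z).MinimallyResonantAt p fun j =>
    t z p j ((L p).r * (L p).n j) / (L p).n j
  gauge : ∀ z ∈ U, ∀ p, (A z).IsFormalGauge p (t z p) (Y z p)
  /-- `δA = ∂_x M + [M, A]` for the deformation matrix `M` of every tangent vector. -/
  flow : ∀ z ∈ U, ∀ v : E, ∀ x : ℂ, (∀ q, x ≠ (A z).pole q) → ∀ a b,
    fderiv ℂ (fun z' => (A z').at x a b) z v =
      deriv (fun x' => (A z).deformation (t z) (Y z) (dTimes t z v) (dPoles A z v) x' a b) x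
      + ((A z).deformation (t z) (Y z) (dTimes t z v) (dPoles A z v) x * (A z).at x
        - (A z).at x * (A z).deformation (t z) (Y z) (dTimes t z v) (dPoles A z v) x) a b

/-! ### The spectral curve and the tau form -/

/-- `y` is the eigenvalue in the local parameter `ξ = (x - γ)^{1/n_j}` (`ξ = x^{-1/n_j}` at infinity) at
the point `ζ^j` of the desingularized spectral curve: `ξ ↦ (x(ξ), y(ξ))` satisfies
`det (y - A(x)) = 0`, is not a series in `ξ^d` for any common divisor `d > 1`, and
`y = (1 / n_j) (t_{r n_j, j} + t_{r n_j - 1, j} ξ + …) (x - γ)^{- r - 1}`, respectively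
`y = (1 / n_j) (t_{r n_j, j} + t_{r n_j - 1, j} ξ + …) x^{r - 1}`. -/
structure Connection.IsSpectralPoint (A : Connection φ L) (p : Option ι) (t : Fin (L p).s → ℕ → ℂ)
    (j : Fin (L p).s) (y : LaurentSeries ℂ) : Prop where
  root : (A.at (A.coord p ((L p).n j))).charpoly.IsRoot y
  primitive : ∀ d : ℕ, d ∣ (L p).n j → (∀ k ∈ y.support, (d : ℤ) ∣ k) → d = 1
  coeff_lt : ∀ k < (L p).n j * leadExp L p, y.coeff k = 0
  coeff_lead : y.coeff ((L p).n j * leadExp L p) = t j ((L p).r * (L p).n j) / (L p).n j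
  coeff_next : y.coeff ((L p).n j * leadExp L p + 1) = t j ((L p).r * (L p).n j - 1) / (L p).n j

/-- The residue of `f dx` at `ξ = 0`, where `x` and `f` are Laurent series in `ξ`. -/
noncomputable def formRes (x f : LaurentSeries ℂ) : ℂ :=
  (f * LaurentSeries.derivative ℂ x).coeff (-1)

/-- `res_{ζ^j} (x - γ)^{K/n_j} y dx` at a finite pole.  At infinity `res_{ζ^j} x^{-K/n_j} y dx`, where
the residue is taken along a loop that is positively oriented in the `x`-plane, hence the sign. -/
noncomputable def Connection.spectralRes (A : Connection φ L) (p : Option ι) (n : ℕ)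
    (y : LaurentSeries ℂ) (K : ℤ) : ℂ :=
  match p with
  | some i => formRes (A.coord (some i) n) (HahnSeries.single K 1 * y)
  | none => -formRes (A.coord none n) (HahnSeries.single K 1 * y)

/-- The one-form `d ln τ`:
`∑_p ∑_j ∑_{J=1}^{r n_j} (1/J) (res_{ζ_p^j} (x - γ)^{-J/n_j} y dx) dt_{J,j}^p
  + (1/2) ∑_γ (res_{x=γ} Tr A²) dγ`, with `x^{J/n_j}` in place of `(x - γ)^{-J/n_j}` at infinity. -/
noncomputable def tauForm (A : E → Connection φ L) (t : E → ∀ p, Fin (L p).s → ℕ → ℂ)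
    (y : E → ∀ p, Fin (L p).s → LaurentSeries ℂ) (z : E) : E →L[ℂ] ℂ :=
  ∑ p, ∑ j, ∑ J ∈ Finset.Icc 1 ((L p).r * (L p).n j),
    ((1 / J : ℂ) * (A z).spectralRes p ((L p).n j) (y z p j) (-(J : ℤ))) •
      fderiv ℂ (fun z' => t z' p j J) z
  + ∑ q : φ ⊕ ι,
    ((1 / 2 : ℂ) * formRes (finCoord ((A z).pole q) 1)
        ((A z).at (finCoord ((A z).pole q) 1) ^ 2).trace) •
      fderiv ℂ (fun z' => (A z').pole q) z

end

end MinRes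

set_option linter.unusedSectionVars false

namespace MinRes

open HahnSeries

/-! ### Laurent series: lower bounds for the support -/

/-! Write `s` for the local parameter at an irregular pole (`x - γ`, or `x⁻¹` at infinity), `θ = s
d/ds`, `ε = ±1` for the sign `sgn p`, `u = s^ε`, `𝒜 = u A` and `M = u D`. The formal gauge equation
reads `𝒜 Y = Y M + ε θY`. All local work is done over Laurent series, by bookkeeping of lower bounds
for the support (`LB`).

Spectral branches. On the cover `s = σ^N`, with `N` the product of the block sizes, every `𝓗_j` is
diagonalized by an explicit frame `S`. The frame turns `M` into the diagonal matrix of the exponents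
`E = (1/n) ∑ t_J ξ^{-J}`, because the term `-G/n` is absorbed by `θS`. Conjugating by `Y S` presents
`𝒜` as `E` plus a small perturbation, made of `Y⁻¹θY` and of constants coming from `S⁻¹θS`. Lidskii
genericity separates the exponents early enough (`IsLowerJordan.pow_ne_pow`,
`LocalGauge.genericTimes`, `GenericTimes.exists_coeff_ne`) for a contraction argument to give a full
frame of eigenvectors (`exists_eigenvector`, `LocalGauge.exists_eigenframe`). A root of the
characteristic polynomial is then determined by its first terms. Galois conjugation on the cover
makes it a series in `ξ`, whence existence and uniqueness of the branch.

Its expansion (`LocalGauge.exists_spectralBranch`) has the times as polar coefficients. The diagonal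
of the constant perturbation, of value `-(n-1)/(2n)`, produces the shift of `t_0`. For `1 ≤ J ≤ rn`
the coefficient of `ξ^J` in the branch of `u y`, times `n`, is `ε` times the constant coefficient of
`Tr (𝓗^J Y⁻¹θY)`, with one correction: for `J = rn - 1` a second order term `c / t_{rn-1}` appears,
where `c` depends only on the pole type and the block sizes.

Closedness. Up to the closed terms in `d log t_{rn-1}`, the local part of `d ln τ` at an irregular
pole is minus the pairing `⟨B, Y⁻¹θY⟩` of the bare deformation `B` with the logarithmic derivative
of the gauge, where `⟨X, Z⟩` is the constant coefficient of `Tr XZ`. Let `T` be the deformation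
matrix in the frame moving with the pole. Then `Y⁻¹TY = B + Y⁻¹dY + κ` with `κ` regular. The
variation of the bare system forces `κ`, in the eigenframe, to be a constant diagonal matrix, apart
from harmless entries between blocks of size one when `r = 1` (`frame_diag_constant`,
`frame_offDiag`). It also shows that `t_0` is constant (`time_zero_constant`). Since `B` is diagonal
and purely polar in that frame, expanding `⟨θT_v, T_w⟩` leaves exactly the antisymmetrized
derivative of `⟨B, Y⁻¹θY⟩` (`LocalGauge.resPair_deformation`).

Passing from the moving frame back to fixed `x` changes `⟨θT_v, T_w⟩` by terms containing `dγ`.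
These are the exterior derivative of `½ res Tr A² dγ` (`NormalizedIsomonodromic.formD_pole`,
`resPair_movingFlow`). Fuchsian poles contribute nothing else, because there the moving deformation
matrix is regular. The exterior derivative of `d ln τ` is therefore minus the sum over all poles of
the residues of `Tr (T_w dT_v)`. The deformation matrix is rational in `x` with poles only at the
poles of `A`, so the sum vanishes by the residue theorem (`residue_theorem`). Local primitives come
from the Poincaré lemma on a ball. -/

/-- All coefficients of `x` below `b` vanish. -/
def LB (b : ℤ) (x : LaurentSeries ℂ) : Prop := ∀ k < b, x.coeff k = 0

namespace LB

variable {b c : ℤ} {x y : LaurentSeries ℂ}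

theorem mono (h : LB c x) (hb : b ≤ c) : LB b x := fun k hk => h k (hk.trans_le hb)

theorem zero (b : ℤ) : LB b 0 := fun _ _ => rfl

theorem add (hx : LB b x) (hy : LB b y) : LB b (x + y) := fun k hk => by
  simp [hx k hk, hy k hk]

theorem neg (hx : LB b x) : LB b (-x) := fun k hk => by simp [hx k hk]

theorem sub (hx : LB b x) (hy : LB b y) : LB b (x - y) := fun k hk => by
  simp [hx k hk, hy k hk]

theorem sum {α : Type*} {s : Finset α} {f : α → LaurentSeries ℂ} (h : ∀ i ∈ s, LB b (f i)) :
    LB b (∑ i ∈ s, f i) := by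
  classical
  induction s using Finset.induction_on with
  | empty => simpa using zero b
  | insert i s hi ih =>
    rw [Finset.sum_insert hi]
    exact (h i (Finset.mem_insert_self _ _)).add
      (ih fun k hk => h k (Finset.mem_insert_of_mem hk))

theorem single (k : ℤ) (r : ℂ) : LB k (HahnSeries.single k r) := fun i hi => by
  rw [coeff_single_of_ne hi.ne]

theorem single_of_le {k : ℤ} (h : b ≤ k) (r : ℂ) : LB b (HahnSeries.single k r) :=
  (single k r).mono h

theorem C (r : ℂ) : LB 0 (HahnSeries.C r) := single 0 r

theorem one : LB 0 (1 : LaurentSeries ℂ) := single 0 1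

theorem ofPowerSeries (f : PowerSeries ℂ) : LB 0 (HahnSeries.ofPowerSeries ℤ ℂ f) := fun k hk => by
  rw [PowerSeries.coeff_coe, if_pos hk]

theorem order (x : LaurentSeries ℂ) : LB x.order x := fun _ hk =>
  coeff_eq_zero_of_lt_order hk

theorem exists_lb (x : LaurentSeries ℂ) : ∃ b, LB b x := ⟨_, order x⟩

theorem le_order (hx : LB b x) (h : x ≠ 0) : b ≤ x.order := by
  by_contra! hlt
  exact coeff_order_eq_zero.not.mpr h (hx _ hlt)

end LB

/-- The range of summation depends only on the lower bounds and not on the supports. It is thus the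
same for all members of a family, which is what makes products of families differentiable term by
term. -/
theorem coeff_mul_eq_sum {b c : ℤ} {x y : LaurentSeries ℂ} (hx : LB b x) (hy : LB c y) (k : ℤ) :
    (x * y).coeff k = ∑ i ∈ Finset.Icc b (k - c), x.coeff i * y.coeff (k - i) := by
  rw [coeff_mul]
  refine Finset.sum_bij_ne_zero (fun ij _ _ => ij.1) ?_ ?_ ?_ ?_
  · rintro ⟨i, j⟩ h hne
    rw [Finset.mem_antidiagonal] at h
    obtain ⟨h1, h2, h3⟩ := h
    rw [Finset.mem_Icc]
    simp only at h3 ⊢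
    constructor
    · by_contra! hlt
      exact h1 (hx _ hlt)
    · by_contra! hlt
      exact h2 (hy _ (by simp only; omega))
  · rintro ⟨i, j⟩ h _ ⟨i', j'⟩ h' _ heq
    rw [Finset.mem_antidiagonal] at h h'
    obtain ⟨h1, h2, h3⟩ := h
    obtain ⟨h1', h2', h3'⟩ := h'
    simp only at h3 h3' heq
    subst heq
    have : j = j' := by omega
    rw [this]
  · intro i _ hne
    refine ⟨(i, k - i), ?_, hne, rfl⟩
    rw [Finset.mem_antidiagonal]
    exact ⟨left_ne_zero_of_mul hne, right_ne_zero_of_mul hne, by simp⟩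
  · rintro ⟨i, j⟩ h _
    rw [Finset.mem_antidiagonal] at h
    obtain ⟨h1, h2, h3⟩ := h
    simp only at h3 ⊢
    rw [show k - i = j by omega]

theorem LB.mul {b c : ℤ} {x y : LaurentSeries ℂ} (hx : LB b x) (hy : LB c y) :
    LB (b + c) (x * y) := fun k hk => by
  rw [coeff_mul_eq_sum hx hy, Finset.Icc_eq_empty (by omega), Finset.sum_empty]

theorem LB.mul_of_le {a b c : ℤ} {x y : LaurentSeries ℂ} (hx : LB b x) (hy : LB c y)
    (h : a ≤ b + c) : LB a (x * y) := (hx.mul hy).mono h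

theorem coeff_mul_lead {b c : ℤ} {x y : LaurentSeries ℂ} (hx : LB b x) (hy : LB c y) :
    (x * y).coeff (b + c) = x.coeff b * y.coeff c := by
  rw [coeff_mul_eq_sum hx hy]
  simp

theorem coeff_mul_lead' {b c k : ℤ} {x y : LaurentSeries ℂ} (hx : LB b x) (hy : LB c y)
    (hk : k = b + c) : (x * y).coeff k = x.coeff b * y.coeff c := by
  rw [hk, coeff_mul_lead hx hy]

theorem LB.pow {b : ℤ} {x : LaurentSeries ℂ} (h : LB b x) (k : ℕ) : LB (k * b) (x ^ k) := by
  induction k with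
  | zero => simpa using LB.one
  | succ k ih =>
    rw [pow_succ]
    exact ih.mul_of_le h (by push_cast; linarith)

/-- A single nonzero coefficient bounds the order of `x` from above, and orders are additive. No
lower bound for `x` is needed, so one witness of the gap between two exponents controls the inverse
of their difference. -/
theorem LB.inv {b : ℤ} {x : LaurentSeries ℂ} (hb : x.coeff b ≠ 0) : LB (-b) x⁻¹ := by
  have hx : x ≠ 0 := by rintro rfl; simp at hb
  have h1 : x.order ≤ b := order_le_of_coeff_ne_zero hb
  have h2 : x.order + x⁻¹.order = 0 := by
    rw [← order_mul hx (inv_ne_zero hx), mul_inv_cancel₀ hx, order_one]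
  exact (LB.order x⁻¹).mono (by omega)

theorem LB.exists_powerSeries {x : LaurentSeries ℂ} (h : LB 0 x) :
    ∃ f : PowerSeries ℂ, HahnSeries.ofPowerSeries ℤ ℂ f = x := by
  refine ⟨PowerSeries.mk fun k => x.coeff k, ?_⟩
  ext k
  rw [PowerSeries.coeff_coe]
  split_ifs with hk
  · exact (h k hk).symm
  · rw [PowerSeries.coeff_mk, Int.natAbs_of_nonneg (by omega)]

/-! ### The Euler derivation -/

/-- The Euler derivation `ξ d/dξ` of Laurent series. -/
noncomputable def euler : LaurentSeries ℂ →ₗ[ℂ] LaurentSeries ℂ where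
  toFun x := HahnSeries.ofSuppBddBelow (fun k => (k : ℂ) * x.coeff k)
    (BddBelow.mono (fun k hk => right_ne_zero_of_mul hk) (show BddBelow x.support from
      ⟨x.order, fun k hk => order_le_of_coeff_ne_zero hk⟩))
  map_add' x y := by ext k; simp [mul_add]
  map_smul' r x := by ext k; simp; ring

@[simp]
theorem coeff_euler (x : LaurentSeries ℂ) (k : ℤ) : (euler x).coeff k = k * x.coeff k := rfl

theorem LB.euler {b : ℤ} {x : LaurentSeries ℂ} (h : LB b x) : LB b (euler x) := fun k hk => by
  simp [h k hk]

theorem euler_mul (x y : LaurentSeries ℂ) : euler (x * y) = euler x * y + x * euler y := by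
  obtain ⟨b, hx⟩ := LB.exists_lb x
  obtain ⟨c, hy⟩ := LB.exists_lb y
  ext k
  rw [coeff_euler, coeff_add, coeff_mul_eq_sum hx hy, coeff_mul_eq_sum hx.euler hy,
    coeff_mul_eq_sum hx hy.euler, ← Finset.sum_add_distrib, Finset.mul_sum]
  refine Finset.sum_congr rfl fun i _ => ?_
  simp only [coeff_euler]
  push_cast
  ring

theorem euler_single (k : ℤ) (r : ℂ) : euler (single k r) = single k (k * r) := by
  ext i
  rw [coeff_euler]
  by_cases h : i = k
  · subst h; simp
  · simp [coeff_single_of_ne h]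

theorem euler_one : euler 1 = 0 := by
  rw [← single_zero_one, euler_single]; simp

theorem algebraMap_eq_C (r : ℂ) : algebraMap ℂ (LaurentSeries ℂ) r = HahnSeries.C r := by
  rw [HahnSeries.algebraMap_apply' (Γ := ℤ), PowerSeries.algebraMap_apply]
  exact HahnSeries.ofPowerSeries_C r

theorem matrix_smul_eq {m n : Type*} (r : ℂ) (X : Matrix m n (LaurentSeries ℂ)) :
    r • X = (HahnSeries.C r : LaurentSeries ℂ) • X := by
  refine Matrix.ext fun a b => ?_
  exact (HahnSeries.C_mul_eq_smul (Γ := ℤ) (r := r) (x := X a b)).symm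

theorem euler_C (r : ℂ) : euler (HahnSeries.C r) = 0 := by
  rw [C_apply, euler_single]; simp

theorem derivative_eq_single_mul_euler (x : LaurentSeries ℂ) :
    LaurentSeries.derivative ℂ x = single (-1) 1 * euler x := by
  ext k
  rw [coeff_single_mul, LaurentSeries.derivative_apply, LaurentSeries.hasseDeriv_coeff, coeff_euler]
  simp

theorem euler_eq_single_mul_derivative (x : LaurentSeries ℂ) :
    euler x = single 1 1 * LaurentSeries.derivative ℂ x := by
  rw [derivative_eq_single_mul_euler, ← mul_assoc, single_mul_single]
  simp

theorem euler_pow (x : LaurentSeries ℂ) (k : ℕ) :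
    euler (x ^ k) = (k : LaurentSeries ℂ) * x ^ (k - 1) * euler x := by
  induction k with
  | zero => simp [euler_one]
  | succ k ih =>
    rw [pow_succ, euler_mul, ih]
    rcases k with _ | k
    · simp
    · push_cast
      ring

/-! ### Rescaling the parameter -/

/-- The substitution `σ ↦ η σ`. -/
noncomputable def twist (η : ℂˣ) : LaurentSeries ℂ →+* LaurentSeries ℂ where
  toFun x := HahnSeries.ofSuppBddBelow (fun k => ((η ^ k : ℂˣ) : ℂ) * x.coeff k)
    (BddBelow.mono (fun k hk => right_ne_zero_of_mul hk) (show BddBelow x.support from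
      ⟨x.order, fun k hk => order_le_of_coeff_ne_zero hk⟩))
  map_zero' := by ext k; simp
  map_one' := by
    ext k
    simp only [coeff_ofSuppBddBelow, coeff_one]
    split_ifs with h <;> simp [h]
  map_add' x y := by ext k; simp [mul_add]
  map_mul' x y := by
    obtain ⟨b, hx⟩ := LB.exists_lb x
    obtain ⟨c, hy⟩ := LB.exists_lb y
    ext k
    rw [coeff_mul_eq_sum (b := b) (c := c)]
    · simp only [coeff_ofSuppBddBelow]
      rw [coeff_mul_eq_sum hx hy, Finset.mul_sum]
      refine Finset.sum_congr rfl fun i _ => ?_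
      have : (η ^ k : ℂˣ) = η ^ i * η ^ (k - i) := by rw [← zpow_add]; simp
      rw [this]
      push_cast
      ring
    · intro i hi; simp [hx i hi]
    · intro i hi; simp [hy i hi]

@[simp]
theorem coeff_twist (η : ℂˣ) (x : LaurentSeries ℂ) (k : ℤ) :
    (twist η x).coeff k = ((η ^ k : ℂˣ) : ℂ) * x.coeff k := rfl

theorem twist_single (η : ℂˣ) (k : ℤ) (r : ℂ) :
    twist η (single k r) = single k (((η ^ k : ℂˣ) : ℂ) * r) := by
  ext i
  rw [coeff_twist]
  by_cases h : i = k
  · subst h; simp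
  · simp [coeff_single_of_ne h]

/-! ### Ramified covers -/

/-- The substitution `s = σ^m`. -/
noncomputable def ramify (m : ℕ) (hm : 0 < m) : LaurentSeries ℂ →+* LaurentSeries ℂ :=
  embDomainRingHom (AddMonoidHom.mulLeft (m : ℤ))
    (fun a b h => by simpa [hm.ne'] using h)
    (fun a b => by
      simp only [AddMonoidHom.coe_mulLeft]
      exact mul_le_mul_iff_right₀ (by exact_mod_cast hm))

theorem coeff_ramify_mul (m : ℕ) (hm : 0 < m) (x : LaurentSeries ℂ) (k : ℤ) :
    (ramify m hm x).coeff (m * k) = x.coeff k :=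
  embDomain_coeff

theorem coeff_ramify_of_not_dvd (m : ℕ) (hm : 0 < m) (x : LaurentSeries ℂ) {k : ℤ}
    (h : ¬ (m : ℤ) ∣ k) : (ramify m hm x).coeff k = 0 := by
  refine embDomain_of_notMem_range ?_
  rintro ⟨i, rfl⟩
  exact h ⟨i, rfl⟩

theorem ramify_single (m : ℕ) (hm : 0 < m) (k : ℤ) (r : ℂ) :
    ramify m hm (single k r) = single (m * k) r :=
  embDomain_single

theorem ramify_C (m : ℕ) (hm : 0 < m) (r : ℂ) : ramify m hm (HahnSeries.C r) = HahnSeries.C r := by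
  rw [C_apply, ramify_single, mul_zero]

theorem LB.ramify {b : ℤ} {x : LaurentSeries ℂ} (h : LB b x) (m : ℕ) (hm : 0 < m) :
    LB (m * b) (ramify m hm x) := fun k hk => by
  by_cases hd : (m : ℤ) ∣ k
  · obtain ⟨i, rfl⟩ := hd
    rw [coeff_ramify_mul]
    exact h i (lt_of_mul_lt_mul_left hk (by positivity))
  · exact coeff_ramify_of_not_dvd m hm x hd

theorem euler_ramify (m : ℕ) (hm : 0 < m) (x : LaurentSeries ℂ) :
    euler (ramify m hm x) = (m : ℂ) • ramify m hm (euler x) := by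
  ext k
  rw [coeff_euler, coeff_smul]
  by_cases hd : (m : ℤ) ∣ k
  · obtain ⟨i, rfl⟩ := hd
    rw [coeff_ramify_mul, coeff_ramify_mul, coeff_euler]
    push_cast
    simp [mul_assoc]
  · rw [coeff_ramify_of_not_dvd m hm x hd, coeff_ramify_of_not_dvd m hm _ hd]
    simp

theorem twist_ramify {m : ℕ} (hm : 0 < m) {η : ℂˣ} (hη : η ^ m = 1) (x : LaurentSeries ℂ) :
    twist η (ramify m hm x) = ramify m hm x := by
  ext k
  rw [coeff_twist]
  by_cases hd : (m : ℤ) ∣ k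
  · obtain ⟨i, rfl⟩ := hd
    rw [zpow_mul, zpow_natCast, hη]
    simp
  · rw [coeff_ramify_of_not_dvd m hm x hd, mul_zero]

theorem ramify_ramify {m n k : ℕ} (hm : 0 < m) (hn : 0 < n) (hk : 0 < k) (h : m * n = k)
    (x : LaurentSeries ℂ) : ramify m hm (ramify n hn x) = ramify k hk x := by
  subst h
  ext k
  by_cases hd : (m : ℤ) ∣ k
  · obtain ⟨i, rfl⟩ := hd
    rw [coeff_ramify_mul]
    by_cases hd' : (n : ℤ) ∣ i
    · obtain ⟨l, rfl⟩ := hd'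
      rw [coeff_ramify_mul, ← mul_assoc, ← Nat.cast_mul, coeff_ramify_mul]
    · rw [coeff_ramify_of_not_dvd _ _ _ hd', coeff_ramify_of_not_dvd]
      push_cast
      rintro ⟨l, hl⟩
      rw [mul_assoc] at hl
      exact hd' ⟨l, mul_left_cancel₀ (by exact_mod_cast hm.ne') hl⟩
  · rw [coeff_ramify_of_not_dvd _ _ _ hd, coeff_ramify_of_not_dvd]
    push_cast
    rintro ⟨l, hl⟩
    exact hd ⟨n * l, by rw [hl, mul_assoc]⟩

/-- Descent from the cover: used after Galois invariance has shown that only exponents divisible by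
the ramification index occur. -/
theorem exists_ramify_eq {m : ℕ} (hm : 0 < m) {x : LaurentSeries ℂ}
    (h : ∀ k, ¬ (m : ℤ) ∣ k → x.coeff k = 0) : ∃ y, ramify m hm y = x := by
  have hbdd : BddBelow (Function.support fun k : ℤ => x.coeff (m * k)) := by
    refine ⟨-|x.order|, fun k hk => ?_⟩
    by_contra! hlt
    refine hk (coeff_eq_zero_of_lt_order ?_)
    have h1 : (m : ℤ) * k ≤ k := by nlinarith [abs_nonneg x.order, (by exact_mod_cast hm : (1 : ℤ) ≤ m)]
    have h2 := neg_abs_le x.order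
    omega
  refine ⟨HahnSeries.ofSuppBddBelow _ hbdd, ?_⟩
  ext k
  by_cases hd : (m : ℤ) ∣ k
  · obtain ⟨i, rfl⟩ := hd
    rw [coeff_ramify_mul]
    rfl
  · rw [coeff_ramify_of_not_dvd _ _ _ hd, h k hd]

/-! ### Perturbation of eigenvectors over Laurent series -/

/-- Banach's fixed point theorem for the `ξ`-adic topology on formal power series: each iteration
fixes one more coefficient. Working with lower bounds avoids introducing the topology. -/
theorem exists_fixedPoint_of_contracting {I : Type*}
    (F : (I → LaurentSeries ℂ) → I → LaurentSeries ℂ)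
    (hint : ∀ p, (∀ i, LB 0 (p i)) → ∀ i, LB 0 (F p i))
    (hcon : ∀ p q, (∀ i, LB 0 (p i)) → (∀ i, LB 0 (q i)) → ∀ k : ℕ,
      (∀ i, LB k (p i - q i)) → ∀ i, LB ((k + 1 : ℕ) : ℤ) (F p i - F q i)) :
    ∃ p, (∀ i, LB 0 (p i)) ∧ F p = p := by
  set x : ℕ → I → LaurentSeries ℂ := fun k => F^[k] 0 with hx
  have hsucc : ∀ k, x (k + 1) = F (x k) := fun k => Function.iterate_succ_apply' F k 0
  have hx0 : ∀ k i, LB 0 (x k i) := by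
    intro k
    induction k with
    | zero => exact fun i => LB.zero 0
    | succ k ih => rw [hsucc]; exact hint _ ih
  have hstep : ∀ k : ℕ, ∀ i, LB k (x (k + 1) i - x k i) := by
    intro k
    induction k with
    | zero => exact fun i => (hx0 1 i).sub (hx0 0 i)
    | succ k ih =>
      intro i
      rw [hsucc (k + 1), hsucc k]
      exact hcon _ _ (hsucc k ▸ hx0 (k + 1)) (hx0 k) k (hsucc k ▸ ih) i
  have hle : ∀ k m : ℕ, ∀ i, LB k (x (k + m) i - x k i) := by
    intro k m
    induction m with
    | zero => exact fun i => by simpa using LB.zero k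
    | succ m ih =>
      intro i
      have := ((hstep (k + m) i).mono (by push_cast; omega : (k : ℤ) ≤ _)).add (ih i)
      simpa [add_assoc] using this
  -- The coefficient of index `k` no longer changes from the iterate `k + 1` on, so the limit is
  -- read off there.
  let p : I → LaurentSeries ℂ := fun i =>
    HahnSeries.ofPowerSeries ℤ ℂ (PowerSeries.mk fun k => (x (k + 1) i).coeff k)
  have hp0 : ∀ i, LB 0 (p i) := fun i => LB.ofPowerSeries _
  have hpx : ∀ k : ℕ, ∀ i, LB k (p i - x k i) := by
    intro k i m hm
    rcases lt_or_ge m 0 with hm0 | hm0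
    · rw [coeff_sub, hp0 i m hm0, hx0 k i m hm0, sub_zero]
    · lift m to ℕ using hm0
      obtain ⟨d, rfl⟩ : ∃ d, k = m + 1 + d := ⟨k - (m + 1), by omega⟩
      have := hle (m + 1) d i m (by push_cast; omega)
      rw [coeff_sub] at this ⊢
      rw [sub_eq_zero] at this ⊢
      rw [this]
      simp only [p]
      rw [HahnSeries.ofPowerSeries_apply_coeff, PowerSeries.coeff_mk]
  refine ⟨p, hp0, ?_⟩
  ext i k
  -- The coefficients of `F p` and `p` at `k` are compared through the iterate `k.toNat + 1`, which
  -- agrees with `p` beyond order `k`; `toNat` also covers negative `k`.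
  have h1 := (hcon p (x (k.toNat + 1)) hp0 (hx0 _) _ (hpx _) i).mono
    (by omega : (k.toNat + 1 : ℕ) ≤ ((k.toNat + 1 + 1 : ℕ) : ℤ))
  rw [← hsucc] at h1
  have h2 := (h1.add (hstep (k.toNat + 1) i)).sub (hpx (k.toNat + 1) i) k (by push_cast; omega)
  have h3 : F p i - x (k.toNat + 1 + 1) i + (x (k.toNat + 1 + 1) i - x (k.toNat + 1) i) -
      (p i - x (k.toNat + 1) i) = F p i - p i := by ring
  rw [h3, coeff_sub, sub_eq_zero] at h2
  exact h2

/-- The linear and quadratic coefficients are divisible by the parameter, so the right hand side is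
a contraction on power series. Normalizing one entry of an eigenvector and eliminating the
eigenvalue leads to a system of this form. -/
theorem exists_solution_riccati {I : Type*} [Fintype I] (c : I → LaurentSeries ℂ)
    (b d : I → I → LaurentSeries ℂ) (hc : ∀ m, LB 0 (c m)) (hb : ∀ m n, LB 1 (b m n))
    (hd : ∀ m n, LB 1 (d m n)) :
    ∃ q : I → LaurentSeries ℂ, (∀ m, LB 0 (q m)) ∧
      ∀ m, q m = c m + ∑ n, b m n * q n + q m * ∑ n, d m n * q n := by
  suffices h : ∃ q : I → LaurentSeries ℂ, (∀ m, LB 0 (q m)) ∧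
      (fun m => c m + ∑ n, b m n * q n + q m * ∑ n, d m n * q n) = q by
    obtain ⟨q, hq, hF⟩ := h
    exact ⟨q, hq, fun m => (congrFun hF m).symm⟩
  refine exists_fixedPoint_of_contracting
    (fun q m => c m + ∑ n, b m n * q n + q m * ∑ n, d m n * q n) ?_ ?_
  · intro p hp m
    refine ((hc m).add (LB.sum fun n _ => (hb m n).mul_of_le (hp n) (by norm_num))).add ?_
    exact (hp m).mul_of_le (LB.sum fun n _ => (hd m n).mul (hp n)) (by norm_num)
  · intro p q hp hq k hk m
    have h : (c m + ∑ n, b m n * p n + p m * ∑ n, d m n * p n) -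
        (c m + ∑ n, b m n * q n + q m * ∑ n, d m n * q n) =
        ∑ n, b m n * (p n - q n) + ((p m - q m) * ∑ n, d m n * p n +
          q m * ∑ n, d m n * (p n - q n)) := by
      simp only [mul_sub, Finset.sum_sub_distrib]
      ring
    rw [h]
    push_cast
    refine (LB.sum fun n _ => (hb m n).mul_of_le (hk n) (by omega)).add (LB.add ?_ ?_)
    · exact (hk m).mul_of_le (LB.sum fun n _ => (hd m n).mul (hp n)) (by omega)
    · exact (hq m).mul_of_le (LB.sum fun n _ => (hd m n).mul (hk n)) (by omega)

/-- Existence of an eigenvector of `diag E + P` close to the basis vector `l`, with prescribed lower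
bounds `w` for the orders of its other entries. -/
theorem exists_eigenvector {I : Type*} [Fintype I] [DecidableEq I] (E : I → LaurentSeries ℂ)
    (P : Matrix I I (LaurentSeries ℂ)) (l : I) (hE : ∀ m ≠ l, E m ≠ E l)
    (D w : I → ℤ) (β : I → I → ℤ)
    (hD : ∀ m ≠ l, LB (D m) (E m - E l)⁻¹) (hP : ∀ m n, LB (β m n) (P m n))
    (h1 : ∀ m ≠ l, w m ≤ D m + β m l)
    (h2 : ∀ m ≠ l, ∀ n ≠ l, 1 ≤ D m + β m n + w n - w m)
    (h3 : ∀ m ≠ l, 1 ≤ D m + β l l)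
    (h4 : ∀ m ≠ l, ∀ n ≠ l, 1 ≤ D m + β l n + w n) :
    ∃ p : I → LaurentSeries ℂ, p l = 1 ∧ (∀ m ≠ l, LB (w m) (p m)) ∧
      ∀ m, E m * p m + ∑ n, P m n * p n = (E l + ∑ n, P l n * p n) * p m := by
  set X : ℤ → LaurentSeries ℂ := fun k => single k 1 with hX
  have hXmul : ∀ a b, X a * X b = X (a + b) := fun a b => by simp [hX, single_mul_single]
  have hX1 : ∀ a, X a * X (-a) = 1 := fun a => by rw [hXmul]; simp [hX]
  have hXlb : ∀ a, LB a (X a) := fun a => LB.single a 1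
  set Δ : I → LaurentSeries ℂ := fun m => (E m - E l)⁻¹ with hΔ
  -- The entries are rescaled as `p m = X (w m) * q m`, the eigenvalue is eliminated with the row
  -- `l`, and the other rows are divided by the gap `E m - E l`. Coefficients with an index `l` are
  -- set to zero, which forces `q l = 0`; the normalized entry `p l = 1` is put back afterwards. The
  -- hypotheses `h1` to `h4` are exactly integrality and contraction of the rescaled system.
  have hsol := exists_solution_riccati
    (fun m => if m = l then 0 else -(Δ m * X (-w m) * P m l))
    (fun m n => if m = l ∨ n = l then 0 else
      -(Δ m * P m n * (X (w n) * X (-w m))) + if m = n then Δ m * P l l else 0)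
    (fun m n => if m = l ∨ n = l then 0 else Δ m * P l n * X (w n)) ?_ ?_ ?_
  · obtain ⟨q, hq, hqe⟩ := hsol
    have hql : q l = 0 := by simpa using hqe l
    refine ⟨fun m => if m = l then 1 else X (w m) * q m, by simp, fun m hm => ?_, fun m => ?_⟩
    · simpa [hm] using (hXlb (w m)).mul (hq m)
    have hsum : ∀ i, ∑ n, P i n * (if n = l then 1 else X (w n) * q n) =
        P i l + ∑ n, P i n * (X (w n) * q n) := by
      intro i
      have : ∀ n, P i n * (if n = l then 1 else X (w n) * q n) =
          (if n = l then P i n else 0) + P i n * (X (w n) * q n) := by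
        intro n
        split_ifs with h
        · subst h; simp [hql]
        · simp
      simp only [this, Finset.sum_add_distrib, Finset.sum_ite_eq', Finset.mem_univ, if_true]
    rw [hsum, hsum]
    by_cases hm : m = l
    · subst hm; simp
    have hne : E m - E l ≠ 0 := sub_ne_zero.mpr (hE m hm)
    have hΔm : (E m - E l) * Δ m = 1 := mul_inv_cancel₀ hne
    beta_reduce
    rw [if_neg hm]
    have e1 : ∑ n, (if m = l ∨ n = l then 0 else
        -(Δ m * P m n * (X (w n) * X (-w m))) + if m = n then Δ m * P l l else 0) * q n =
        -(Δ m * X (-w m) * ∑ n, P m n * (X (w n) * q n)) + Δ m * P l l * q m := by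
      have : ∀ n, (if m = l ∨ n = l then 0 else
        -(Δ m * P m n * (X (w n) * X (-w m))) + if m = n then Δ m * P l l else 0) * q n =
        -(Δ m * X (-w m) * (P m n * (X (w n) * q n))) + if m = n then Δ m * P l l * q m else 0 := by
        intro n
        by_cases h : n = l
        · subst h; simp [hql, hm]
        · rw [if_neg (by tauto)]
          split_ifs with h'
          · subst h'; ring
          · ring
      simp only [this, Finset.sum_add_distrib, Finset.sum_neg_distrib, ← Finset.mul_sum,
        Finset.sum_ite_eq, Finset.mem_univ, if_true]
    have e2 : ∑ n, (if m = l ∨ n = l then 0 else Δ m * P l n * X (w n)) * q n =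
        Δ m * ∑ n, P l n * (X (w n) * q n) := by
      rw [Finset.mul_sum]
      refine Finset.sum_congr rfl fun n _ => ?_
      by_cases h : n = l
      · subst h; simp [hql]
      · rw [if_neg (by tauto)]; ring
    have hm' := hqe m
    beta_reduce at hm'
    rw [if_neg hm, e1, e2] at hm'
    have hw := hX1 (w m)
    set Tm := ∑ n, P m n * (X (w n) * q n)
    set Tl := ∑ n, P l n * (X (w n) * q n)
    have key : (E m - E l) * (X (w m) * q m) =
        -(P m l + Tm) + (P l l + Tl) * (X (w m) * q m) := by
      have := congrArg (fun z => (E m - E l) * X (w m) * z) hm'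
      beta_reduce at this
      linear_combination this - (X (w m) * X (-w m) * (P m l + Tm) -
        X (w m) * q m * (P l l + Tl)) * hΔm - (P m l + Tm) * hw
    linear_combination key
  · intro m
    split_ifs with h
    · exact LB.zero _
    · exact (((hD m h).mul (hXlb _)).mul (hP m l)).neg.mono (by have := h1 m h; omega)
  · intro m n
    split_ifs with h h'
    · exact LB.zero _
    · obtain ⟨hm, hn⟩ := not_or.mp h
      subst h'
      refine LB.add ?_ (((hD m hm).mul (hP l l)).mono (h3 m hm))
      exact (((hD m hm).mul (hP m m)).mul ((hXlb _).mul (hXlb _))).neg.mono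
        (by have := h2 m hm m hm; omega)
    · obtain ⟨hm, hn⟩ := not_or.mp h
      rw [add_zero]
      exact (((hD m hm).mul (hP m n)).mul ((hXlb _).mul (hXlb _))).neg.mono
        (by have := h2 m hm n hn; omega)
  · intro m n
    split_ifs with h
    · exact LB.zero _
    · obtain ⟨hm, hn⟩ := not_or.mp h
      exact (((hD m hm).mul (hP l n)).mul (hXlb _)).mono (by have := h4 m hm n hn; omega)

end MinRes

namespace MinRes

open Polynomial

/-! ### Consequences of Lidskii genericity -/

section Lidskii

variable {s : ℕ} {n : Fin s → ℕ}

/-- The matrix `R - c`. -/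
def subScalar {I : Type*} [Fintype I] [DecidableEq I] (R : Matrix I I ℂ) (c : ℂ) : Matrix I I ℂ :=
  R - Matrix.scalar I c

theorem subScalar_apply {I : Type*} [Fintype I] [DecidableEq I] (R : Matrix I I ℂ) (c : ℂ) (a b : I) :
    subScalar R c a b = R a b - if a = b then c else 0 := by
  rw [subScalar, Matrix.sub_apply, Matrix.scalar_apply, Matrix.diagonal_apply]

/-- The block diagonal matrix with upper triangular Jordan blocks. -/
def jordanMat (n : Fin s → ℕ) (lam : Fin s → ℂ) :
    Matrix (Σ j : Fin s, Fin (n j)) (Σ j : Fin s, Fin (n j)) ℂ :=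
  Matrix.blockDiagonal' fun j => jordanBlock (n j) (lam j)

theorem jordanMat_apply (lam : Fin s → ℂ) (i j : Fin s) (a : Fin (n i)) (b : Fin (n j)) :
    jordanMat n lam ⟨i, a⟩ ⟨j, b⟩ =
      if i = j then (if (a : ℕ) = b then lam i else if (a : ℕ) + 1 = b then 1 else 0) else 0 := by
  unfold jordanMat
  split_ifs with h h1 h2
  · subst h
    have : a = b := Fin.ext h1
    simp [Matrix.blockDiagonal'_apply, jordanBlock, this]
  · subst h
    have : a ≠ b := fun h => h1 (by rw [h])
    simp [Matrix.blockDiagonal'_apply, jordanBlock, this, h2]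
  · subst h
    have : a ≠ b := fun h => h1 (by rw [h])
    simp [Matrix.blockDiagonal'_apply, jordanBlock, this, h2]
  · exact Matrix.blockDiagonal'_apply_ne _ _ _ h

/-- A block diagonal matrix with lower triangular blocks, with the eigenvalues `lam` on the diagonal
and the entries `τ` below it. -/
structure IsLowerJordan (R : Matrix (Σ j : Fin s, Fin (n j)) (Σ j : Fin s, Fin (n j)) ℂ)
    (lam τ : Fin s → ℂ) : Prop where
  ne : ∀ i j a b, i ≠ j → R ⟨i, a⟩ ⟨j, b⟩ = 0
  lt : ∀ j (a b : Fin (n j)), a < b → R ⟨j, a⟩ ⟨j, b⟩ = 0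
  diag : ∀ j (a : Fin (n j)), R ⟨j, a⟩ ⟨j, a⟩ = lam j
  sub : ∀ j (a b : Fin (n j)), (a : ℕ) = b + 1 → R ⟨j, a⟩ ⟨j, b⟩ = τ j

namespace IsLowerJordan

variable {R : Matrix (Σ j : Fin s, Fin (n j)) (Σ j : Fin s, Fin (n j)) ℂ} {lam τ : Fin s → ℂ}

theorem sum_row (h : IsLowerJordan R lam τ) (i : Fin s) (a : Fin (n i))
    (x : (Σ j : Fin s, Fin (n j)) → ℂ) :
    ∑ y, R ⟨i, a⟩ y * x y = ∑ b, R ⟨i, a⟩ ⟨i, b⟩ * x ⟨i, b⟩ := by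
  rw [Fintype.sum_sigma, Finset.sum_eq_single i]
  · intro j _ hj
    exact Finset.sum_eq_zero fun b _ => by rw [h.ne i j a b hj.symm, zero_mul]
  · simp

theorem sum_col (h : IsLowerJordan R lam τ) (i : Fin s) (b : Fin (n i))
    (x : (Σ j : Fin s, Fin (n j)) → ℂ) :
    ∑ y, x y * R y ⟨i, b⟩ = ∑ a, x ⟨i, a⟩ * R ⟨i, a⟩ ⟨i, b⟩ := by
  rw [Fintype.sum_sigma, Finset.sum_eq_single i]
  · intro j _ hj
    exact Finset.sum_eq_zero fun a _ => by rw [h.ne j i a b hj, mul_zero]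
  · simp

/-- Forward substitution in a lower triangular block. In a block of eigenvalue `c` the row `a + 1`
reads `τ x_a = 0` once the earlier entries vanish, so only the last entry is free; in another block
the diagonal `lam i - c` already kills everything. -/
theorem ker_right (h : IsLowerJordan R lam τ) (hτ : ∀ j, 2 ≤ n j → τ j ≠ 0) {c : ℂ}
    {x : (Σ j : Fin s, Fin (n j)) → ℂ} (hx : ∀ y, ∑ z, R y z * x z = c * x y) (i : Fin s)
    (a : Fin (n i)) (ha : lam i = c → (a : ℕ) + 1 < n i) : x ⟨i, a⟩ = 0 := by
  obtain ⟨a, han⟩ := a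
  induction a using Nat.strong_induction_on with
  | _ a ih =>
    by_cases hc : lam i = c
    · have ha' := ha hc
      have := hx ⟨i, ⟨a + 1, ha'⟩⟩
      rw [h.sum_row] at this
      have hsum : ∑ b, R ⟨i, ⟨a + 1, ha'⟩⟩ ⟨i, b⟩ * x ⟨i, b⟩ =
          τ i * x ⟨i, ⟨a, han⟩⟩ + c * x ⟨i, ⟨a + 1, ha'⟩⟩ := by
        rw [← Finset.sum_subset (Finset.subset_univ {⟨a, han⟩, ⟨a + 1, ha'⟩}),
          Finset.sum_pair (by simp), h.sub _ _ _ rfl, h.diag, hc]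
        intro b _ hb
        simp only [Finset.mem_insert, Finset.mem_singleton, not_or, Fin.ext_iff] at hb
        rcases lt_trichotomy (b : ℕ) a with hlt | heq | hgt
        · have := ih b hlt b.2 (fun _ => by show (b : ℕ) + 1 < n i; omega)
          rw [show b = ⟨b, b.2⟩ from rfl, this, mul_zero]
        · exact absurd heq hb.1
        · rw [h.lt _ _ _ (Fin.lt_def.mpr (by show a + 1 < (b : ℕ); omega)), zero_mul]
      rw [hsum] at this
      have hz : τ i * x ⟨i, ⟨a, han⟩⟩ = 0 := by linear_combination this
      exact (mul_eq_zero.mp hz).resolve_left (hτ i (by simp at ha'; omega))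
    · have := hx ⟨i, ⟨a, han⟩⟩
      rw [h.sum_row, Finset.sum_eq_single ⟨a, han⟩, h.diag] at this
      · have hz : (lam i - c) * x ⟨i, ⟨a, han⟩⟩ = 0 := by linear_combination this
        exact (mul_eq_zero.mp hz).resolve_left (sub_ne_zero.mpr hc)
      · intro b _ hb
        rcases lt_or_gt_of_ne (fun hh => hb (Fin.ext hh) : (b : ℕ) ≠ a) with hlt | hgt
        · have := ih b hlt b.2 (fun hh => absurd hh hc)
          rw [show b = ⟨b, b.2⟩ from rfl, this, mul_zero]
        · rw [h.lt _ _ _ (Fin.lt_def.mpr hgt), zero_mul]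
      · simp

/-- Mirror image of `ker_right`: backward substitution leaves only the first entry of each block of
eigenvalue `c`. -/
theorem ker_left (h : IsLowerJordan R lam τ) (hτ : ∀ j, 2 ≤ n j → τ j ≠ 0) {c : ℂ}
    {x : (Σ j : Fin s, Fin (n j)) → ℂ} (hx : ∀ y, ∑ z, x z * R z y = c * x y) (i : Fin s)
    (a : Fin (n i)) (ha : lam i = c → 0 < (a : ℕ)) : x ⟨i, a⟩ = 0 := by
  obtain ⟨a, han⟩ := a
  obtain ⟨d, hd⟩ : ∃ d, d + a + 1 = n i := ⟨n i - a - 1, by omega⟩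
  induction d using Nat.strong_induction_on generalizing a with
  | _ d ih =>
    by_cases hc : lam i = c
    · have ha' : 0 < a := ha hc
      obtain ⟨a, rfl⟩ : ∃ a', a = a' + 1 := ⟨a - 1, by omega⟩
      have han' : a < n i := by omega
      have := hx ⟨i, ⟨a, han'⟩⟩
      rw [h.sum_col] at this
      have hsum : ∑ b, x ⟨i, b⟩ * R ⟨i, b⟩ ⟨i, ⟨a, han'⟩⟩ =
          x ⟨i, ⟨a, han'⟩⟩ * c + x ⟨i, ⟨a + 1, han⟩⟩ * τ i := by
        rw [← Finset.sum_subset (Finset.subset_univ {⟨a, han'⟩, ⟨a + 1, han⟩}),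
          Finset.sum_pair (by simp), h.diag, h.sub _ _ _ rfl, hc]
        intro b _ hb
        simp only [Finset.mem_insert, Finset.mem_singleton, not_or, Fin.ext_iff] at hb
        rcases lt_trichotomy (b : ℕ) a with hlt | heq | hgt
        · rw [h.lt _ _ _ (Fin.lt_def.mpr hlt), mul_zero]
        · exact absurd heq hb.1
        · have := ih (n i - b - 1) (by omega) b b.2 (fun _ => by show 0 < (b : ℕ); omega) (by omega)
          rw [show b = ⟨b, b.2⟩ from rfl, this, zero_mul]
      rw [hsum] at this
      have hz : τ i * x ⟨i, ⟨a + 1, han⟩⟩ = 0 := by linear_combination this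
      exact (mul_eq_zero.mp hz).resolve_left (hτ i (by omega))
    · have := hx ⟨i, ⟨a, han⟩⟩
      rw [h.sum_col, Finset.sum_eq_single ⟨a, han⟩, h.diag] at this
      · have hz : (lam i - c) * x ⟨i, ⟨a, han⟩⟩ = 0 := by linear_combination this
        exact (mul_eq_zero.mp hz).resolve_left (sub_ne_zero.mpr hc)
      · intro b _ hb
        rcases lt_or_gt_of_ne (fun hh => hb (Fin.ext hh) : (b : ℕ) ≠ a) with hlt | hgt
        · rw [h.lt _ _ _ (Fin.lt_def.mpr hlt), mul_zero]
        · have := ih (n i - b - 1) (by omega) b b.2 (fun hh => absurd hh hc) (by omega)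
          rw [show b = ⟨b, b.2⟩ from rfl, this, zero_mul]
      · simp

/-- After subtraction of its eigenvalue a block is strictly lower triangular, so its `m`-th power
starts on the `m`-th subdiagonal, with the constant entry `τ ^ m`. The deeper entries are arbitrary
and never needed. -/
theorem pow_apply (h : IsLowerJordan R lam τ) (m : ℕ) (c : ℂ) (i j : Fin s) (a : Fin (n i))
    (b : Fin (n j)) :
    (i ≠ j → (subScalar R c ^ m) ⟨i, a⟩ ⟨j, b⟩ = 0) ∧
    (lam i = c → i = j → ((a : ℕ) < b + m → (subScalar R c ^ m) ⟨i, a⟩ ⟨j, b⟩ = 0) ∧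
      ((a : ℕ) = b + m → (subScalar R c ^ m) ⟨i, a⟩ ⟨j, b⟩ = τ i ^ m)) := by
  induction m generalizing i j with
  | zero =>
    refine ⟨fun hij => ?_, ?_⟩
    · rw [pow_zero, Matrix.one_apply_ne]
      rintro ⟨⟩
      exact hij rfl
    · rintro hc rfl
      refine ⟨fun hlt => ?_, fun heq => ?_⟩
      · rw [pow_zero, Matrix.one_apply_ne]
        intro hh
        simp only [Sigma.mk.injEq, heq_eq_eq, true_and] at hh
        subst hh
        omega
      · have : a = b := Fin.ext heq
        subst this
        simp
  | succ m ih =>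
    have hW : ∀ (k l : Fin s) (a : Fin (n k)) (b : Fin (n l)), k ≠ l →
        subScalar R c ⟨k, a⟩ ⟨l, b⟩ = 0 := by
      intro k l a b hkl
      rw [subScalar_apply, h.ne _ _ _ _ hkl, if_neg, sub_zero]
      rintro ⟨⟩
      exact hkl rfl
    have hsplit : (subScalar R c ^ (m + 1)) ⟨i, a⟩ ⟨j, b⟩ =
        ∑ d, (subScalar R c ^ m) ⟨i, a⟩ ⟨i, d⟩ * subScalar R c ⟨i, d⟩ ⟨j, b⟩ := by
      rw [pow_succ, Matrix.mul_apply, Fintype.sum_sigma, Finset.sum_eq_single i]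
      · intro k _ hk
        exact Finset.sum_eq_zero fun d _ => by rw [(ih i k a d).1 hk.symm, zero_mul]
      · simp
    refine ⟨fun hij => ?_, ?_⟩
    · rw [hsplit]
      exact Finset.sum_eq_zero fun d _ => by rw [hW i j d b hij, mul_zero]
    · rintro hc rfl
      have hle : ∀ d : Fin (n i), (d : ℕ) ≤ b → subScalar R c ⟨i, d⟩ ⟨i, b⟩ = 0 := by
        intro d hd
        rcases hd.lt_or_eq with hd | hd
        · rw [subScalar_apply, h.lt _ _ _ (Fin.lt_def.mpr hd), if_neg, sub_zero]
          intro hh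
          simp only [Sigma.mk.injEq, heq_eq_eq, true_and] at hh
          subst hh
          omega
        · have : d = b := Fin.ext hd
          subst this
          simp [subScalar_apply, h.diag, hc]
      refine ⟨fun hlt => ?_, fun heq => ?_⟩
      · rw [hsplit]
        refine Finset.sum_eq_zero fun d _ => ?_
        rcases le_or_gt (d : ℕ) b with hd | hd
        · rw [hle d hd, mul_zero]
        · rw [((ih i i a d).2 hc rfl).1 (by omega), zero_mul]
      · have hb1 : (b : ℕ) + 1 < n i := by have := a.2; omega
        rw [hsplit, Finset.sum_eq_single ⟨b + 1, hb1⟩]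
        · rw [((ih i i a _).2 hc rfl).2 (by simp; omega), subScalar_apply, h.sub _ _ _ rfl,
            if_neg, sub_zero, pow_succ]
          intro hh
          simp [Fin.ext_iff] at hh
        · intro d _ hd
          rcases le_or_gt (d : ℕ) b with hd' | hd'
          · rw [hle d hd', mul_zero]
          · have : (d : ℕ) ≠ b + 1 := fun hh => hd (Fin.ext hh)
            rw [((ih i i a d).2 hc rfl).1 (by omega), zero_mul]
        · simp

end IsLowerJordan

theorem jordanMat_col (lam : Fin s → ℂ) (j : Fin s) (m : ℕ) (hm : m < n j)
    (x : Σ j : Fin s, Fin (n j)) :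
    ((subScalar (jordanMat n lam) (lam j) ^ m) x ⟨j, ⟨m, hm⟩⟩ =
      if x = ⟨j, ⟨0, by omega⟩⟩ then 1 else 0) ∧
    ((subScalar (jordanMat n lam) (lam j) ^ (m + 1)) x ⟨j, ⟨m, hm⟩⟩ = 0) := by
  have hcol : ∀ (m : ℕ) (hm : m < n j) (y : Σ j : Fin s, Fin (n j)),
      subScalar (jordanMat n lam) (lam j) y ⟨j, ⟨m, hm⟩⟩ =
        if h : 0 < m then (if y = ⟨j, ⟨m - 1, by omega⟩⟩ then 1 else 0) else 0 := by
    rintro m hm ⟨i, a⟩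
    rw [subScalar_apply, jordanMat_apply]
    by_cases hij : i = j
    · subst hij
      simp only [if_true, Sigma.mk.injEq, heq_eq_eq, true_and, Fin.ext_iff]
      split_ifs <;> first | omega | simp
    · have h1 : ∀ b : Fin (n j), (⟨i, a⟩ : Σ j : Fin s, Fin (n j)) ≠ ⟨j, b⟩ := by
        rintro b ⟨⟩; exact hij rfl
      simp [hij, h1]
  induction m with
  | zero =>
    constructor
    · rw [pow_zero, Matrix.one_apply]
    · rw [zero_add, pow_one, hcol]; simp
  | succ m ih =>
    have hstep : ∀ k : ℕ, (subScalar (jordanMat n lam) (lam j) ^ (k + 1)) x ⟨j, ⟨m + 1, hm⟩⟩ =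
        (subScalar (jordanMat n lam) (lam j) ^ k) x ⟨j, ⟨m, by omega⟩⟩ := by
      intro k
      rw [pow_succ, Matrix.mul_apply]
      simp [hcol]
    rw [hstep, hstep]
    exact ih (by omega) hcol

theorem subScalar_pow_mul {I : Type*} [Fintype I] [DecidableEq I] {R Q J : Matrix I I ℂ}
    (h : R * Q = Q * J) (c : ℂ) (m : ℕ) : subScalar R c ^ m * Q = Q * subScalar J c ^ m := by
  induction m with
  | zero => simp
  | succ m ih =>
    have h1 : subScalar R c * Q = Q * subScalar J c := by
      rw [subScalar, subScalar, sub_mul, mul_sub, h,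
        (Matrix.scalar_commute c (fun r => Commute.all _ r) Q).eq]
    rw [pow_succ, mul_assoc, h1, ← mul_assoc, ih, mul_assoc, ← pow_succ]

/-- Dimension count for an eigenspace: a vanishing subdiagonal in a block of size at least two would
create more eigenvectors than the Jordan form with the prescribed sizes allows. -/
theorem IsLowerJordan.ne_zero {R Q Qi : Matrix (Σ j : Fin s, Fin (n j)) (Σ j : Fin s, Fin (n j)) ℂ}
    {lam τ : Fin s → ℂ} (h : IsLowerJordan R lam τ) (hQ : Q * Qi = 1)
    (hRQ : R * Q = Q * jordanMat n lam) (hn : ∀ j, 0 < n j) (k : Fin s) (hk : 2 ≤ n k) :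
    τ k ≠ 0 := by
  intro hτ
  classical
  have hQ' : Qi * Q = 1 := mul_eq_one_comm.mp hQ
  set c := lam k with hc
  let S := {j : Fin s // lam j = c}
  -- The last basis vector of each block of eigenvalue `c` is an eigenvector of `R`. If `τ k`
  -- vanished, so would be the last but one vector of the block `k`: one more than the number of
  -- Jordan blocks of eigenvalue `c`.
  let idx : Option S → Σ j : Fin s, Fin (n j) := fun o =>
    o.elim ⟨k, ⟨n k - 2, by omega⟩⟩ fun j => ⟨j.1, ⟨n j.1 - 1, Nat.sub_lt (hn _) one_pos⟩⟩
  have hidx : Function.Injective idx := by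
    rintro (_ | j) (_ | j') hjj
    · rfl
    · simp only [idx, Option.elim, Sigma.mk.injEq] at hjj
      obtain ⟨h1, h2⟩ := hjj
      have h3 := (Fin.heq_ext_iff (by rw [h1])).mp h2
      simp only at h3
      rw [← h1] at h3
      omega
    · simp only [idx, Option.elim, Sigma.mk.injEq] at hjj
      obtain ⟨h1, h2⟩ := hjj
      have h3 := (Fin.heq_ext_iff (by rw [h1])).mp h2
      simp only at h3
      rw [h1] at h3
      omega
    · simp only [idx, Option.elim, Sigma.mk.injEq] at hjj
      rw [Subtype.ext hjj.1]
  have hRidx : ∀ o y, R y (idx o) = if y = idx o then c else 0 := by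
    rintro (_ | j) ⟨i, a⟩
    · simp only [idx, Option.elim]
      by_cases hik : i = k
      · subst hik
        simp only [Sigma.mk.injEq, heq_eq_eq, true_and, Fin.ext_iff]
        rcases lt_trichotomy (a : ℕ) (n i - 2) with hlt | heq | hgt
        · rw [h.lt _ _ _ (Fin.lt_def.mpr hlt), if_neg (by omega)]
        · rw [if_pos heq, show a = ⟨n i - 2, by omega⟩ from Fin.ext heq, h.diag]
        · rw [h.sub i a _ (by show (a : ℕ) = n i - 2 + 1; omega), if_neg (by omega), hτ]
      · refine (h.ne _ _ _ _ hik).trans (if_neg ?_).symm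
        rintro ⟨⟩
        exact hik rfl
    · obtain ⟨j, hj⟩ := j
      simp only [idx, Option.elim]
      by_cases hik : i = j
      · subst hik
        simp only [Sigma.mk.injEq, heq_eq_eq, true_and, Fin.ext_iff]
        rcases lt_or_ge (a : ℕ) (n i - 1) with hlt | hge
        · rw [h.lt _ _ _ (Fin.lt_def.mpr hlt), if_neg (by omega)]
        · have heq : (a : ℕ) = n i - 1 := by omega
          rw [if_pos heq, show a = ⟨n i - 1, by omega⟩ from Fin.ext heq, h.diag, hj]
      · refine (h.ne _ _ _ _ hik).trans (if_neg ?_).symm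
        rintro ⟨⟩
        exact hik rfl
  -- By dimension some nontrivial combination of these eigenvectors, moved to the Jordan basis,
  -- vanishes at the head of every Jordan block of eigenvalue `c`.
  let f : (Option S → ℂ) →ₗ[ℂ] (S → ℂ) :=
    Matrix.mulVecLin (Matrix.of fun (j : S) (o : Option S) => Qi ⟨j.1, ⟨0, hn _⟩⟩ (idx o))
  obtain ⟨x, hx, hx0⟩ := (Submodule.ne_bot_iff _).mp
    (LinearMap.ker_ne_bot_of_finrank_lt (f := f) (by simp))
  let v : (Σ j : Fin s, Fin (n j)) → ℂ := fun y => ∑ o, x o * Qi y (idx o)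
  have hv0 : ∀ j : S, v ⟨j.1, ⟨0, hn _⟩⟩ = 0 := by
    intro j
    have := congrFun (LinearMap.mem_ker.mp hx) j
    simp only [f, Matrix.mulVecLin_apply, Matrix.mulVec, dotProduct, Matrix.of_apply,
      Pi.zero_apply] at this
    simp only [v, ← this]
    exact Finset.sum_congr rfl fun o _ => mul_comm _ _
  have hJv : ∀ y, ∑ z, jordanMat n lam y z * v z = c * v y := by
    have hJQ : jordanMat n lam * Qi = Qi * R := by
      calc jordanMat n lam * Qi = Qi * Q * jordanMat n lam * Qi := by rw [hQ', one_mul]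
        _ = Qi * (R * Q) * Qi := by rw [hRQ]; simp only [mul_assoc]
        _ = Qi * R := by rw [mul_assoc, mul_assoc, hQ, mul_one]
    intro y
    calc ∑ z, jordanMat n lam y z * v z
        = ∑ o, x o * (jordanMat n lam * Qi) y (idx o) := by
          simp only [v, Finset.mul_sum, Matrix.mul_apply]
          rw [Finset.sum_comm]
          exact Finset.sum_congr rfl fun o _ => Finset.sum_congr rfl fun z _ => by ring
      _ = c * v y := by
          rw [hJQ]
          simp only [v, Finset.mul_sum]
          refine Finset.sum_congr rfl fun o _ => ?_
          rw [Matrix.mul_apply, Finset.sum_eq_single (idx o), hRidx, if_pos rfl]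
          · ring
          · intro z _ hz
            rw [hRidx, if_neg hz, mul_zero]
          · simp
  -- In an upper triangular Jordan block an eigenvector is determined by its first entry. This entry
  -- is zero by construction when the eigenvalue is `c`, and by the last row of the block (`hlast`)
  -- otherwise; hence `v = 0`, against the invertibility of `Q`.
  have hrec : ∀ i (a : ℕ) (ha : a + 1 < n i),
      v ⟨i, ⟨a + 1, ha⟩⟩ = (c - lam i) * v ⟨i, ⟨a, by omega⟩⟩ := by
    intro i a ha
    have := hJv ⟨i, ⟨a, by omega⟩⟩
    rw [Fintype.sum_sigma, Finset.sum_eq_single i, ← Finset.sum_subset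
      (Finset.subset_univ {⟨a, by omega⟩, ⟨a + 1, ha⟩}), Finset.sum_pair (by simp)] at this
    · simp only [jordanMat_apply, if_true] at this
      simp at this
      linear_combination this
    · intro b _ hb
      simp only [Finset.mem_insert, Finset.mem_singleton, not_or, Fin.ext_iff] at hb
      rw [jordanMat_apply, if_pos rfl, if_neg (fun h => hb.1 h.symm), if_neg (fun h => hb.2 h.symm),
        zero_mul]
    · intro j _ hj
      exact Finset.sum_eq_zero fun b _ => by rw [jordanMat_apply, if_neg hj.symm, zero_mul]
    · simp
  have hlast : ∀ i, (c - lam i) * v ⟨i, ⟨n i - 1, Nat.sub_lt (hn i) one_pos⟩⟩ = 0 := by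
    intro i
    have := hJv ⟨i, ⟨n i - 1, Nat.sub_lt (hn i) one_pos⟩⟩
    rw [Fintype.sum_sigma, Finset.sum_eq_single i, Finset.sum_eq_single
      ⟨n i - 1, Nat.sub_lt (hn i) one_pos⟩, jordanMat_apply, if_pos rfl, if_pos rfl] at this
    · linear_combination -this
    · intro b _ hb
      have h1 : (b : ℕ) ≠ n i - 1 := fun hh => hb (Fin.ext hh)
      have := hn i
      rw [jordanMat_apply, if_pos rfl, if_neg (fun h => h1 h.symm), if_neg (by simp; omega), zero_mul]
    · simp
    · intro j _ hj
      exact Finset.sum_eq_zero fun b _ => by rw [jordanMat_apply, if_neg hj.symm, zero_mul]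
    · simp
  have hvz : ∀ y, v y = 0 := by
    rintro ⟨i, ⟨a, ha⟩⟩
    by_cases hi : lam i = c
    · rcases a with _ | a
      · exact hv0 ⟨i, hi⟩
      · rw [hrec, hi, sub_self, zero_mul]
    · have hpow : ∀ (a : ℕ) (ha : a < n i), v ⟨i, ⟨a, ha⟩⟩ = (c - lam i) ^ a * v ⟨i, ⟨0, hn i⟩⟩ := by
        intro a
        induction a with
        | zero => intro _; simp
        | succ a ih => intro ha; rw [hrec, ih, pow_succ]; ring
      have hne : c - lam i ≠ 0 := sub_ne_zero.mpr (Ne.symm hi)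
      have h0 : v ⟨i, ⟨0, hn i⟩⟩ = 0 := by
        have := hlast i
        rw [hpow] at this
        simpa [hne] using this
      rw [hpow, h0, mul_zero]
  refine hx0 (funext fun o => ?_)
  have hxo : ∑ z, Q (idx o) z * v z = x o := by
    simp only [v, Finset.mul_sum]
    rw [Finset.sum_comm]
    calc ∑ o', ∑ z, Q (idx o) z * (x o' * Qi z (idx o'))
        = ∑ o', x o' * (Q * Qi) (idx o) (idx o') := by
          refine Finset.sum_congr rfl fun o' _ => ?_
          rw [Matrix.mul_apply, Finset.mul_sum]
          exact Finset.sum_congr rfl fun z _ => by ring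
      _ = x o := by
          rw [hQ, Finset.sum_eq_single o, Matrix.one_apply_eq, mul_one]
          · intro o' _ ho'
            rw [Matrix.one_apply_ne (fun hh => ho' (hidx hh).symm), mul_zero]
          · simp
  rw [← hxo]
  simp [hvz]

/-- The Lidskii pseudo-characteristic polynomial factors over the entries below the diagonal of any
lower triangular normal form of the leading coefficient. -/
theorem IsLowerJordan.pow_ne_pow
    {R Q Qi B R₁ Z : Matrix (Σ j : Fin s, Fin (n j)) (Σ j : Fin s, Fin (n j)) ℂ}
    {lam τ : Fin s → ℂ} (h : IsLowerJordan R lam τ) (hQ : Q * Qi = 1)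
    (hRQ : R * Q = Q * jordanMat n lam) (hn : ∀ j, 0 < n j)
    (hB : Q * B = (R₁ + Z * R - R * Z) * Q)
    (hR₁ : ∀ i j, R₁ ⟨i, ⟨0, hn i⟩⟩ ⟨j, ⟨n j - 1, Nat.sub_lt (hn j) one_pos⟩⟩ =
      if i = j then τ i else 0)
    {c : ℂ} {N : ℕ} [Fintype {j : Fin s // lam j = c ∧ N ≤ n j}]
    [DecidableEq {j : Fin s // lam j = c ∧ N ≤ n j}]
    (M : Matrix {j : Fin s // lam j = c ∧ N ≤ n j} {j : Fin s // lam j = c ∧ N ≤ n j} ℂ[X])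
    (hM : ∀ i j, M i j = C (B ⟨i, ⟨n i - 1, Nat.sub_lt (hn i) one_pos⟩⟩ ⟨j, ⟨0, hn j⟩⟩) -
      if i = j ∧ n i = N then X else 0)
    (h0 : M.det.eval 0 ≠ 0) (hsep : M.det.Separable) (i₀ j₀ : Fin s) (hi : i₀ ≠ j₀)
    (hlami : lam i₀ = c) (hlamj : lam j₀ = c) (hni : n i₀ = N) (hnj : n j₀ = N) :
    τ i₀ ^ N ≠ τ j₀ ^ N := by
  have hτ := h.ne_zero hQ hRQ hn
  have hQ' : Qi * Q = 1 := mul_eq_one_comm.mp hQ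
  let S := {j : Fin s // lam j = c ∧ N ≤ n j}
  let fst : Fin s → Σ j : Fin s, Fin (n j) := fun j => ⟨j, ⟨0, hn j⟩⟩
  let lst : Fin s → Σ j : Fin s, Fin (n j) := fun j => ⟨j, ⟨n j - 1, Nat.sub_lt (hn j) one_pos⟩⟩
  have hJQ : jordanMat n lam * Qi = Qi * R := by
    calc jordanMat n lam * Qi = Qi * Q * jordanMat n lam * Qi := by rw [hQ', one_mul]
      _ = Qi * (R * Q) * Qi := by rw [hRQ]; simp only [mul_assoc]
      _ = Qi * R := by rw [mul_assoc, mul_assoc, hQ, mul_one]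
  have hJcol : ∀ j y, jordanMat n lam y (fst j) = if y = fst j then lam j else 0 := by
    rintro j ⟨i, a⟩
    have : (⟨i, a⟩ : Σ j : Fin s, Fin (n j)) = fst j ↔ i = j ∧ (a : ℕ) = 0 := by
      constructor
      · rintro ⟨⟩; exact ⟨rfl, rfl⟩
      · rintro ⟨rfl, ha⟩; exact congrArg _ (Fin.ext ha)
    simp only [this]
    refine (jordanMat_apply lam i j a _).trans ?_
    by_cases hij : i = j <;> simp [hij]
  have hJrow : ∀ j y, jordanMat n lam (lst j) y = if y = lst j then lam j else 0 := by
    rintro j ⟨i, a⟩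
    have : (⟨i, a⟩ : Σ j : Fin s, Fin (n j)) = lst j ↔ i = j ∧ (a : ℕ) = n i - 1 := by
      constructor
      · rintro ⟨⟩; exact ⟨rfl, rfl⟩
      · rintro ⟨rfl, ha⟩; exact congrArg _ (Fin.ext ha)
    simp only [this]
    refine (jordanMat_apply lam j i _ a).trans ?_
    by_cases hij : i = j
    · subst hij
      have h1 := a.2
      have h2 := hn i
      simp only [if_true, true_and]
      rw [if_neg (by omega : ¬ (n i - 1 + 1 = (a : ℕ)))]
      simp [eq_comm]
    · simp [hij, Ne.symm hij]
  -- The heads of the Jordan blocks give right eigenvectors among the columns of `Q`, and the ends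
  -- of the blocks give left eigenvectors among the rows of `Qi`. Their supports are then restricted
  -- by `ker_right` and `ker_left`.
  have hv : ∀ j : S, ∀ y, ∑ z, R y z * Q z (fst j) = c * Q y (fst j) := by
    intro j y
    rw [← Matrix.mul_apply, hRQ, Matrix.mul_apply, Finset.sum_eq_single (fst j), hJcol, if_pos rfl,
      j.2.1, mul_comm]
    · intro z _ hz
      rw [hJcol, if_neg hz, mul_zero]
    · simp
  have hu : ∀ i : S, ∀ y, ∑ z, Qi (lst i) z * R z y = c * Qi (lst i) y := by
    intro i y
    rw [← Matrix.mul_apply, ← hJQ, Matrix.mul_apply, Finset.sum_eq_single (lst i), hJrow, if_pos rfl,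
      i.2.1]
    · intro z _ hz
      rw [hJrow, if_neg hz, zero_mul]
    · simp
  have hvz : ∀ (j : S) (i : Fin s) (a : Fin (n i)), (lam i = c → (a : ℕ) + 1 < n i) →
      Q ⟨i, a⟩ (fst j) = 0 := fun j i a ha => h.ker_right hτ (hv j) i a ha
  have huz : ∀ (j : S) (i : Fin s) (a : Fin (n i)), (lam i = c → 0 < (a : ℕ)) →
      Qi (lst j) ⟨i, a⟩ = 0 := fun j i a ha => h.ker_left hτ (hu j) i a ha
  -- `Q` intertwines the powers of `R - c` with those of the Jordan matrix minus `c`. Comparing them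
  -- ties the corner entries of `Q` and `Qi` together and makes them vanish according to the block
  -- sizes: these are `hc_lt`, `hc_eq`, `hq_gt` and `hd_lt`.
  have hW : ∀ (m : ℕ) (j : Fin s) (k : Fin s) (a : Fin (n k)), lam j = c →
      (Q * subScalar (jordanMat n lam) c ^ m) ⟨k, a⟩ (lst j) =
        ∑ b, (subScalar R c ^ m) ⟨k, a⟩ ⟨k, b⟩ * Q ⟨k, b⟩ (lst j) := by
    intro m j k a hj
    rw [← subScalar_pow_mul hRQ, Matrix.mul_apply, Fintype.sum_sigma, Finset.sum_eq_single k]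
    · intro i _ hi
      exact Finset.sum_eq_zero fun b _ => by rw [(h.pow_apply m c k i a b).1 hi.symm, zero_mul]
    · simp
  have hQfst : ∀ (j k : Fin s) (a : Fin (n k)), lam j = c →
      Q ⟨k, a⟩ (fst j) = ∑ b, (subScalar R c ^ (n j - 1)) ⟨k, a⟩ ⟨k, b⟩ * Q ⟨k, b⟩ (lst j) := by
    intro j k a hj
    rw [← hW _ _ _ _ hj, Matrix.mul_apply, Finset.sum_eq_single (fst j)]
    · have := (jordanMat_col lam j (n j - 1) (Nat.sub_lt (hn j) one_pos) (fst j)).1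
      rw [hj] at this
      rw [this, if_pos rfl, mul_one]
    · intro y _ hy
      have := (jordanMat_col lam j (n j - 1) (Nat.sub_lt (hn j) one_pos) y).1
      rw [hj] at this
      rw [this, if_neg hy, mul_zero]
    · simp
  have hc_lt : ∀ (j : S) (k : Fin s), n k < n j → Q (lst k) (fst j) = 0 := by
    intro j k hk
    by_cases hkc : lam k = c
    · rw [hQfst _ _ _ j.2.1]
      refine Finset.sum_eq_zero fun b _ => ?_
      rw [((h.pow_apply _ c k k _ b).2 hkc rfl).1, zero_mul]
      have := hn k
      simp only
      omega
    · exact hvz j k _ fun hh => absurd hh hkc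
  have hc_eq : ∀ (j : S) (k : Fin s), lam k = c → n k = n j →
      Q (lst k) (fst j) = τ k ^ (n j - 1) * Q (fst k) (lst j) := by
    intro j k hkc hk
    rw [hQfst _ _ _ j.2.1, Finset.sum_eq_single ⟨0, hn k⟩]
    · rw [((h.pow_apply _ c k k _ _).2 hkc rfl).2]
      simp [hk]
    · intro b _ hb
      have : (b : ℕ) ≠ 0 := fun hh => hb (Fin.ext hh)
      rw [((h.pow_apply _ c k k _ b).2 hkc rfl).1, zero_mul]
      simp only
      omega
    · simp
  have hq_gt : ∀ (j : S) (k : Fin s), lam k = c → n j < n k → Q (fst k) (lst j) = 0 := by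
    intro j k hkc hk
    have h1 := hW (n j) j k ⟨n j, hk⟩ j.2.1
    have h2 : (Q * subScalar (jordanMat n lam) c ^ n j) ⟨k, ⟨n j, hk⟩⟩ (lst j) = 0 := by
      rw [Matrix.mul_apply]
      refine Finset.sum_eq_zero fun y _ => ?_
      have := (jordanMat_col lam j (n j - 1) (Nat.sub_lt (hn j) one_pos) y).2
      rw [j.2.1, show n j.1 - 1 + 1 = n j.1 from Nat.sub_add_cancel (hn j)] at this
      rw [show lst j = ⟨j, ⟨n j - 1, Nat.sub_lt (hn j) one_pos⟩⟩ from rfl, this, mul_zero]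
    rw [h2, Finset.sum_eq_single ⟨0, hn k⟩, ((h.pow_apply _ c k k _ _).2 hkc rfl).2 (by simp)] at h1
    · have hj := hn j
      exact (mul_eq_zero.mp h1.symm).resolve_left (pow_ne_zero _ (hτ k (by omega)))
    · intro b _ hb
      have : (b : ℕ) ≠ 0 := fun hh => hb (Fin.ext hh)
      rw [((h.pow_apply _ c k k _ b).2 hkc rfl).1, zero_mul]
      simp only
      omega
    · simp
  have hd_lt : ∀ (i : S) (k : Fin s), n k < n i → Qi (lst i) (fst k) = 0 := by
    intro i k hk
    by_cases hkc : lam k = c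
    · have hcomm : subScalar (jordanMat n lam) c ^ (n i - 1) * Qi =
          Qi * subScalar R c ^ (n i - 1) := subScalar_pow_mul hJQ c _
      have hrow : ∀ y, (subScalar (jordanMat n lam) c ^ (n i - 1)) (fst i) y =
          if y = lst i then 1 else 0 := by
        have : ∀ (m : ℕ) (hm : m < n i) (y), (subScalar (jordanMat n lam) c ^ m) (fst i) y =
            if y = ⟨i, ⟨m, hm⟩⟩ then 1 else 0 := by
          intro m
          induction m with
          | zero =>
            intro hm y
            rw [pow_zero, Matrix.one_apply]
            simp only [eq_comm]
            rfl
          | succ m ih =>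
            rintro hm ⟨k, b⟩
            rw [pow_succ, Matrix.mul_apply, Finset.sum_eq_single ⟨i, ⟨m, by omega⟩⟩, ih (by omega),
              if_pos rfl, one_mul, subScalar_apply, jordanMat_apply]
            · by_cases hik : i.1 = k
              · obtain ⟨i, hi1, hi2⟩ := i
                subst hik
                simp only [if_true, Sigma.mk.injEq, heq_eq_eq, true_and, Fin.ext_iff, hi1]
                split_ifs <;> first | omega | simp
              · have h1 : ∀ (a : Fin (n i)) , (⟨i, a⟩ : Σ j : Fin s, Fin (n j)) ≠ ⟨k, b⟩ := by
                  rintro a ha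
                  exact hik (congrArg Sigma.fst ha)
                rw [if_neg hik, if_neg (h1 _), if_neg (fun hh => h1 _ hh.symm), sub_zero]
            · intro y _ hy
              rw [ih (by omega), if_neg hy, zero_mul]
            · simp
        exact this _ _
      have e1 : (subScalar (jordanMat n lam) c ^ (n i - 1) * Qi) (fst i) (fst k) =
          Qi (lst i) (fst k) := by
        rw [Matrix.mul_apply, Finset.sum_eq_single (lst i), hrow, if_pos rfl, one_mul]
        · intro y _ hy
          rw [hrow, if_neg hy, zero_mul]
        · simp
      rw [← e1, hcomm, Matrix.mul_apply, Fintype.sum_sigma]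
      refine Finset.sum_eq_zero fun l _ => Finset.sum_eq_zero fun b _ => ?_
      by_cases hlk : l = k
      · subst hlk
        rw [((h.pow_apply _ c l l b _).2 hkc rfl).1, mul_zero]
        have := b.2
        simp only
        omega
      · rw [(h.pow_apply _ c l k b _).1 hlk, mul_zero]
    · exact huz i k _ fun hh => absurd hh hkc
  have hd_lam : ∀ (i : S) (k : Fin s), lam k ≠ c → Qi (lst i) (fst k) = 0 := fun i k hk =>
    huz i k _ fun hh => absurd hh hk
  have hsumS : ∀ f : Fin s → ℂ, (∀ k, ¬ (lam k = c ∧ N ≤ n k) → f k = 0) →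
      ∑ k, f k = ∑ k : S, f k := by
    intro f hf
    classical
    rw [← Finset.sum_subset (Finset.subset_univ (Finset.univ.filter fun k => lam k = c ∧ N ≤ n k))]
    · exact Finset.sum_subtype _ (by simp) f
    · intro k _ hk
      exact hf k (by simpa using hk)
  -- The Lidskii matrix is `U · diag τ · V`, with `U` and `V` formed by the corner entries of `Qi`
  -- and `Q`. Of `R₁` only the upper right corners of its blocks are seen, because of the supports
  -- of the eigenvectors.
  have hΛ : ∀ i j : S, B (lst i) (fst j) = ∑ k : S, Qi (lst i) (fst k) * τ k * Q (lst k) (fst j) := by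
    intro i j
    have hBe : B = Qi * ((R₁ + Z * R - R * Z) * Q) := by rw [← hB, ← mul_assoc, hQ', one_mul]
    -- A commutator with `R` vanishes between a left and a right eigenvector of the same eigenvalue,
    -- so the change of gauge `Z` is invisible.
    have e1 : (Qi * (Z * R * Q)) (lst i) (fst j) = (Qi * (R * Z * Q)) (lst i) (fst j) := by
      have e2 : (Qi * (Z * R * Q)) (lst i) (fst j) = (Qi * Z * (R * Q)) (lst i) (fst j) := by
        simp only [mul_assoc]
      have e3 : (Qi * (R * Z * Q)) (lst i) (fst j) = ((Qi * R) * (Z * Q)) (lst i) (fst j) := by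
        simp only [mul_assoc]
      rw [e2, e3, Matrix.mul_apply, Matrix.mul_apply]
      have e4 : ∀ y, (R * Q) y (fst j) = c * Q y (fst j) := fun y => by
        rw [Matrix.mul_apply]; exact hv j y
      have e5 : ∀ y, (Qi * R) (lst i) y = c * Qi (lst i) y := fun y => by
        rw [Matrix.mul_apply]; exact hu i y
      simp only [e4, e5]
      calc ∑ y, (Qi * Z) (lst i) y * (c * Q y (fst j)) = c * (Qi * Z * Q) (lst i) (fst j) := by
            rw [Matrix.mul_apply, Finset.mul_sum]
            exact Finset.sum_congr rfl fun y _ => by ring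
        _ = ∑ y, c * Qi (lst i) y * (Z * Q) y (fst j) := by
            rw [mul_assoc, Matrix.mul_apply, Finset.mul_sum]
            exact Finset.sum_congr rfl fun y _ => by ring
    have e6 : B (lst i) (fst j) = (Qi * (R₁ * Q)) (lst i) (fst j) := by
      rw [hBe, sub_mul, add_mul, mul_sub, mul_add, Matrix.sub_apply, Matrix.add_apply, e1]
      ring
    rw [e6, Matrix.mul_apply, Fintype.sum_sigma]
    have e7 : ∀ k : Fin s, ∑ a, Qi (lst i) ⟨k, a⟩ * (R₁ * Q) ⟨k, a⟩ (fst j) =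
        Qi (lst i) (fst k) * τ k * Q (lst k) (fst j) := by
      intro k
      rw [Finset.sum_eq_single ⟨0, hn k⟩, Matrix.mul_apply, Fintype.sum_sigma,
        Finset.sum_eq_single k, Finset.sum_eq_single ⟨n k - 1, Nat.sub_lt (hn k) one_pos⟩,
        hR₁, if_pos rfl, mul_assoc]
      · intro b _ hb
        have hb' : (b : ℕ) ≠ n k - 1 := fun hh => hb (Fin.ext hh)
        rw [hvz j k b (fun _ => by omega), mul_zero]
      · simp
      · intro l _ hl
        refine Finset.sum_eq_zero fun b _ => ?_
        by_cases hb : (b : ℕ) + 1 < n l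
        · rw [hvz j l b (fun _ => hb), mul_zero]
        · have hb' : b = ⟨n l - 1, Nat.sub_lt (hn l) one_pos⟩ := Fin.ext (by simp only; omega)
          rw [hb', hR₁, if_neg hl.symm, zero_mul]
      · simp
      · intro a _ ha
        have : (a : ℕ) ≠ 0 := fun hh => ha (Fin.ext hh)
        rw [huz i k a (fun _ => by omega), zero_mul]
      · simp
    simp only [e7]
    refine hsumS _ fun k hk => ?_
    by_cases hkc : lam k = c
    · rw [hd_lt i k ((not_le.mp fun h' => hk ⟨hkc, h'⟩).trans_le i.2.2), zero_mul, zero_mul]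
    · rw [hd_lam i k hkc, zero_mul, zero_mul]
  -- The projector on the blocks of size `N` factors through the same `U` and `V`. For `n j = N`
  -- this is the entry `(lst i, lst j)` of `Qi * Q = 1`, rewritten with `hc_eq`; for larger `n j`
  -- all terms vanish.
  have hproj : ∀ i j : S, ∑ k : S, Qi (lst i) (fst k) * (if n k = N then (τ k ^ (N - 1))⁻¹ else 0) *
      Q (lst k) (fst j) = if i = j ∧ n i = N then 1 else 0 := by
    intro i j
    by_cases hj : n j = N
    · have e1 : ∀ k : S, Qi (lst i) (fst k) * (if n k = N then (τ k ^ (N - 1))⁻¹ else 0) *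
          Q (lst k) (fst j) = Qi (lst i) (fst k) * Q (fst k) (lst j) := by
        intro k
        by_cases hk : n k = N
        · have hne : τ k ^ (N - 1) ≠ 0 := by
            by_cases h2 : 2 ≤ N
            · exact pow_ne_zero _ (hτ k (by omega))
            · rw [show N - 1 = 0 by omega, pow_zero]; exact one_ne_zero
          rw [if_pos hk, hc_eq j k k.2.1 (by omega), hj]
          field_simp
        · rw [if_neg hk, hq_gt j k k.2.1 (by have := k.2.2; omega)]
          simp
      have e2 : ∑ y, Qi (lst i) y * Q y (lst j) = ∑ k : Fin s, Qi (lst i) (fst k) * Q (fst k) (lst j) := by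
        rw [Fintype.sum_sigma]
        refine Finset.sum_congr rfl fun k _ => ?_
        rw [Finset.sum_eq_single ⟨0, hn k⟩]
        · intro a _ ha
          have : (a : ℕ) ≠ 0 := fun hh => ha (Fin.ext hh)
          rw [huz i k a (fun _ => by omega), zero_mul]
        · simp
      simp only [e1]
      rw [← hsumS (fun k => Qi (lst i) (fst k) * Q (fst k) (lst j)), ← e2, ← Matrix.mul_apply, hQ',
        Matrix.one_apply]
      · by_cases hij : i = j
        · subst hij; simp [hj]
        · rw [if_neg, if_neg (fun hh => hij hh.1)]
          intro hh
          exact hij (Subtype.ext (congrArg Sigma.fst hh))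
      · intro k hk
        by_cases hkc : lam k = c
        · rw [hd_lt i k ((not_le.mp fun h' => hk ⟨hkc, h'⟩).trans_le i.2.2), zero_mul]
        · rw [hd_lam i k hkc, zero_mul]
    · rw [if_neg (by rintro ⟨rfl, h⟩; exact hj h)]
      refine Finset.sum_eq_zero fun k _ => ?_
      split_ifs with hk
      · rw [hc_lt j k (by have := j.2.2; omega), mul_zero]
      · simp
  -- Hence the pseudo-characteristic matrix is `U · diag ℓ · V`. The factor of a block of size `N`
  -- is linear with root `τ k ^ N`; the factor of a larger block is the constant `τ k`.
  let ℓ : S → ℂ[X] := fun k => C (τ k) - C (if n k = N then (τ k ^ (N - 1))⁻¹ else 0) * X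
  have hfac : M = (Matrix.of fun i k : S => C (Qi (lst i) (fst k))) * Matrix.diagonal ℓ *
      (Matrix.of fun k j : S => C (Q (lst k) (fst j))) := by
    refine Matrix.ext fun i j => ?_
    rw [hM, Matrix.mul_apply]
    simp only [Matrix.mul_diagonal, Matrix.of_apply]
    have e1 : ∀ k : S, C (Qi (lst i) (fst k)) * ℓ k * C (Q (lst k) (fst j)) =
        C (Qi (lst i) (fst k) * τ k * Q (lst k) (fst j)) -
        C (Qi (lst i) (fst k) * (if n k = N then (τ k ^ (N - 1))⁻¹ else 0) * Q (lst k) (fst j)) * X := by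
      intro k
      simp only [ℓ, C_mul]
      ring
    simp only [e1]
    rw [Finset.sum_sub_distrib, ← Finset.sum_mul, ← map_sum, ← map_sum, ← hΛ, hproj]
    congr 1
    split_ifs <;> simp
  have hdet : ∏ k, ℓ k ∣ M.det := by
    rw [hfac, Matrix.det_mul, Matrix.det_mul, Matrix.det_diagonal]
    exact Dvd.dvd.mul_right (Dvd.intro_left _ rfl) _
  have hτ0 : ∀ k : S, τ k ≠ 0 := by
    intro k hk
    obtain ⟨g, hg⟩ := (Finset.dvd_prod_of_mem ℓ (Finset.mem_univ k)).trans hdet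
    apply h0
    rw [hg, eval_mul]
    simp [ℓ, hk]
  intro hpow
  let i' : S := ⟨i₀, hlami, hni.ge⟩
  let j' : S := ⟨j₀, hlamj, hnj.ge⟩
  have hne' : i' ≠ j' := fun hh => hi (congrArg Subtype.val hh)
  have hNpos : 0 < N := hnj ▸ hn j₀
  have hroot : ∀ k : S, n k = N → τ k ^ N = τ j₀ ^ N → (ℓ k).eval (τ j₀ ^ N) = 0 := by
    intro k hk hkp
    have := hτ0 k
    simp only [ℓ, eval_sub, eval_C, eval_mul, eval_X, if_pos hk]
    rw [← hkp]
    have hp : τ k ^ N = τ k ^ (N - 1) * τ k := by rw [← pow_succ, Nat.sub_add_cancel hNpos]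
    rw [hp]
    field_simp
    ring
  -- Two blocks of size `N` with equal `N`-th powers of `τ` would give a double root, which
  -- separability excludes.
  have hd2 : (X - C (τ j₀ ^ N)) * (X - C (τ j₀ ^ N)) ∣ M.det := by
    refine dvd_trans ?_ hdet
    rw [← Finset.mul_prod_erase _ _ (Finset.mem_univ i'),
      ← Finset.mul_prod_erase _ _ (Finset.mem_erase.mpr ⟨hne'.symm, Finset.mem_univ j'⟩), ← mul_assoc]
    exact Dvd.dvd.mul_right (mul_dvd_mul (dvd_iff_isRoot.mpr (hroot i' hni hpow))
      (dvd_iff_isRoot.mpr (hroot j' hnj rfl))) _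
  exact (not_isUnit_X_sub_C _) (hsep.squarefree _ hd2)

end Lidskii

end MinRes

namespace MinRes

open HahnSeries

/-! ### The common ramified cover and the eigenframe of the bare system -/

/-- The sign `+1` at a finite pole and `-1` at infinity. -/
def sgn {ι : Type*} : Option ι → ℤ
  | some _ => 1
  | none => -1

theorem sgn_mul_self {ι : Type*} (p : Option ι) : sgn p * sgn p = 1 := by
  cases p <;> rfl

section Frame

variable {s : ℕ} {n : Fin s → ℕ}

/-- The degree of a common ramified cover of all branches. -/
def coverDeg (n : Fin s → ℕ) : ℕ := ∏ j, n j

theorem coverDeg_pos (hn : ∀ j, 0 < n j) : 0 < coverDeg n := Finset.prod_pos fun j _ => hn j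

/-- The ramification index of the common cover over the branch `j`. -/
def ram (n : Fin s → ℕ) (j : Fin s) : ℕ := coverDeg n / n j

theorem mul_ram (n : Fin s → ℕ) (j : Fin s) : n j * ram n j = coverDeg n :=
  Nat.mul_div_cancel' (Finset.dvd_prod_of_mem n (Finset.mem_univ j))

theorem ram_mul (n : Fin s → ℕ) (j : Fin s) : ram n j * n j = coverDeg n := by
  rw [mul_comm, mul_ram]

theorem ram_pos (hn : ∀ j, 0 < n j) (j : Fin s) : 0 < ram n j := by
  have h := coverDeg_pos hn
  rw [← mul_ram n j] at h
  exact pos_of_mul_pos_right h (Nat.zero_le _)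

theorem ram_le (hn : ∀ j, 0 < n j) (j : Fin s) : ram n j ≤ coverDeg n := by
  rw [← mul_ram n j]
  exact Nat.le_mul_of_pos_left _ (hn j)

theorem two_mul_ram_le {j : Fin s} (hj : 2 ≤ n j) : 2 * ram n j ≤ coverDeg n := by
  rw [← mul_ram n j]
  exact Nat.mul_le_mul_right _ hj

/-- A primitive root of unity of order the degree of the common cover. -/
noncomputable def rootOfCover (n : Fin s → ℕ) : ℂˣ :=
  Units.mk0 (Complex.exp (2 * Real.pi * Complex.I / coverDeg n)) (Complex.exp_ne_zero _)

theorem rootOfCover_isPrimitiveRoot (hn : ∀ j, 0 < n j) :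
    IsPrimitiveRoot (rootOfCover n) (coverDeg n) := by
  rw [← IsPrimitiveRoot.coe_units_iff]
  exact Complex.isPrimitiveRoot_exp _ (coverDeg_pos hn).ne'

theorem rootOfCover_pow (hn : ∀ j, 0 < n j) : rootOfCover n ^ coverDeg n = 1 :=
  (rootOfCover_isPrimitiveRoot hn).pow_eq_one

/-- The substitution `s = σ ^ coverDeg n`. -/
noncomputable def cov (hn : ∀ j, 0 < n j) : LaurentSeries ℂ →+* LaurentSeries ℂ :=
  ramify (coverDeg n) (coverDeg_pos hn)

/-- The substitution `ξ_j = σ ^ ram n j`. -/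
noncomputable def branch (hn : ∀ j, 0 < n j) (j : Fin s) : LaurentSeries ℂ →+* LaurentSeries ℂ :=
  ramify (ram n j) (ram_pos hn j)

theorem branch_ramify (hn : ∀ j, 0 < n j) (j : Fin s) (x : LaurentSeries ℂ) :
    branch hn j (ramify (n j) (hn j) x) = cov hn x :=
  ramify_ramify _ _ _ (ram_mul n j) x

theorem twist_cov (hn : ∀ j, 0 < n j) (k : ℕ) (x : LaurentSeries ℂ) :
    twist (rootOfCover n ^ k) (cov hn x) = cov hn x := by
  refine twist_ramify _ ?_ x
  rw [← pow_mul, mul_comm, pow_mul, rootOfCover_pow hn, one_pow]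

theorem twist_branch (hn : ∀ j, 0 < n j) (j : Fin s) (x : LaurentSeries ℂ) :
    twist (rootOfCover n ^ n j) (branch hn j x) = branch hn j x := by
  refine twist_ramify _ ?_ x
  rw [← pow_mul, mul_ram, rootOfCover_pow hn]

/-- The eigenvalues `ω^k ξ_j^{-1}` of `𝓗` on the common cover. -/
noncomputable def mu (hn : ∀ j, 0 < n j) (x : Σ j : Fin s, Fin (n j)) : LaurentSeries ℂ :=
  twist (rootOfCover n ^ (x.2 : ℕ)) (branch hn x.1 (single (-1) 1))

theorem mu_eq_single (hn : ∀ j, 0 < n j) (x : Σ j : Fin s, Fin (n j)) :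
    mu hn x = single (-(ram n x.1 : ℤ)) (((rootOfCover n ^ (x.2 : ℕ)) ^ (-(ram n x.1 : ℤ)) : ℂˣ) : ℂ) := by
  rw [mu, branch, ramify_single, twist_single]
  simp

theorem mu_ne_zero (hn : ∀ j, 0 < n j) (x : Σ j : Fin s, Fin (n j)) : mu hn x ≠ 0 := by
  rw [mu_eq_single]
  exact single_ne_zero (Units.ne_zero _)

theorem single_zpow_field (a : ℤ) (c : ℂˣ) (m : ℤ) :
    (single a (c : ℂ) : LaurentSeries ℂ) ^ m = single (a * m) ((c ^ m : ℂˣ) : ℂ) := by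
  cases m with
  | ofNat m =>
    rw [Int.ofNat_eq_natCast, zpow_natCast, single_pow, zpow_natCast]
    simp [mul_comm]
  | negSucc m =>
    rw [zpow_negSucc, single_pow, inv_single, zpow_negSucc]
    congr 1
    · simp [Int.negSucc_eq]; ring_nf
    · simp

theorem mu_zpow (hn : ∀ j, 0 < n j) (x : Σ j : Fin s, Fin (n j)) (m : ℤ) :
    mu hn x ^ m = single (-(ram n x.1 : ℤ) * m)
      ((((rootOfCover n ^ (x.2 : ℕ)) ^ (-(ram n x.1 : ℤ))) ^ m : ℂˣ) : ℂ) := by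
  rw [mu_eq_single, single_zpow_field]

/-- The `n`-th power of `𝓗` is `s⁻¹`, so its eigenvalues are the `n`-th roots of `s⁻¹`; a deck
transformation does not move a function of `s`. -/
theorem mu_pow_card (hn : ∀ j, 0 < n j) (x : Σ j : Fin s, Fin (n j)) :
    mu hn x ^ n x.1 = cov hn (single (-1) 1) := by
  rw [mu, ← map_pow, ← map_pow]
  have : (single (-1) 1 : LaurentSeries ℂ) ^ n x.1 = ramify (n x.1) (hn x.1) (single (-1) 1) := by
    rw [single_pow, ramify_single]
    simp
  rw [this, branch_ramify, twist_cov]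

theorem LB.mu_zpow (hn : ∀ j, 0 < n j) (x : Σ j : Fin s, Fin (n j)) (m : ℤ) :
    LB (-(ram n x.1 : ℤ) * m) (mu hn x ^ m) := by
  rw [MinRes.mu_zpow]
  exact LB.single _ _

theorem LB.twist {b : ℤ} {x : LaurentSeries ℂ} (h : LB b x) (η : ℂˣ) : LB b (twist η x) :=
  fun k hk => by rw [coeff_twist, h k hk, mul_zero]

/-- The Euler derivation `s d/ds` in the parameter of the common cover. -/
noncomputable def covEuler (n : Fin s → ℕ) (x : LaurentSeries ℂ) : LaurentSeries ℂ :=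
  HahnSeries.C ((coverDeg n : ℂ)⁻¹) * euler x

theorem covEuler_cov (hn : ∀ j, 0 < n j) (x : LaurentSeries ℂ) :
    covEuler n (cov hn x) = cov hn (euler x) := by
  have h : (coverDeg n : ℂ) ≠ 0 := by exact_mod_cast (coverDeg_pos hn).ne'
  rw [covEuler, cov, euler_ramify, HahnSeries.C_mul_eq_smul, smul_smul, inv_mul_cancel₀ h, one_smul]

theorem covEuler_mul (n : Fin s → ℕ) (x y : LaurentSeries ℂ) :
    covEuler n (x * y) = covEuler n x * y + x * covEuler n y := by
  rw [covEuler, covEuler, covEuler, euler_mul]; ring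

theorem coeff_covEuler (n : Fin s → ℕ) (x : LaurentSeries ℂ) (k : ℤ) :
    (covEuler n x).coeff k = (coverDeg n : ℂ)⁻¹ * (k * x.coeff k) := by
  rw [covEuler, HahnSeries.C_mul_eq_smul, coeff_smul, coeff_euler, smul_eq_mul]

theorem covEuler_sum {α : Type*} (n : Fin s → ℕ) (S : Finset α) (f : α → LaurentSeries ℂ) :
    covEuler n (∑ i ∈ S, f i) = ∑ i ∈ S, covEuler n (f i) := by
  simp only [covEuler, map_sum, Finset.mul_sum]

/-- `mu` is a monomial of degree `-1/n` in `s`, hence an eigenvector of `θ`. -/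
theorem covEuler_mu_zpow (hn : ∀ j, 0 < n j) (x : Σ j : Fin s, Fin (n j)) (m : ℤ) :
    covEuler n (mu hn x ^ m) = HahnSeries.C (-(m : ℂ) / n x.1) * mu hn x ^ m := by
  have h1 : (n x.1 : ℂ) ≠ 0 := by exact_mod_cast (hn x.1).ne'
  have h2 : (ram n x.1 : ℂ) ≠ 0 := by exact_mod_cast (ram_pos hn x.1).ne'
  rw [mu_zpow, covEuler, euler_single, C_apply, C_apply, single_mul_single, single_mul_single,
    ← mul_ram n x.1]
  congr 1
  push_cast
  field_simp

/-- The frame of eigenvectors of `𝓗` on the common cover. -/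
noncomputable def frame {ι : Type*} (p : Option ι) (hn : ∀ j, 0 < n j) :
    Matrix (Σ j : Fin s, Fin (n j)) (Σ j : Fin s, Fin (n j)) (LaurentSeries ℂ) :=
  Matrix.of fun x y => if x.1 = y.1 then mu hn y ^ (sgn p * (x.2 : ℕ)) else 0

/-- The inverse of `frame`. -/
noncomputable def frameInv {ι : Type*} (p : Option ι) (hn : ∀ j, 0 < n j) :
    Matrix (Σ j : Fin s, Fin (n j)) (Σ j : Fin s, Fin (n j)) (LaurentSeries ℂ) :=
  Matrix.of fun x y => if x.1 = y.1 then
    HahnSeries.C ((n x.1 : ℂ)⁻¹) * mu hn x ^ (-(sgn p * (y.2 : ℕ))) else 0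

variable {ι : Type*} (p : Option ι) (hn : ∀ j, 0 < n j)

theorem frame_apply (i j : Fin s) (a : Fin (n i)) (k : Fin (n j)) :
    frame p hn ⟨i, a⟩ ⟨j, k⟩ = if i = j then mu hn ⟨j, k⟩ ^ (sgn p * (a : ℕ)) else 0 := rfl

theorem frameInv_apply (i j : Fin s) (k : Fin (n i)) (a : Fin (n j)) :
    frameInv p hn ⟨i, k⟩ ⟨j, a⟩ = if i = j then
      HahnSeries.C ((n i : ℂ)⁻¹) * mu hn ⟨i, k⟩ ^ (-(sgn p * (a : ℕ))) else 0 := rfl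

theorem mu_zpow_div (j : Fin s) (k l : Fin (n j)) (m : ℤ) :
    mu hn ⟨j, k⟩ ^ (-m) * mu hn ⟨j, l⟩ ^ m = HahnSeries.C
      ((((rootOfCover n ^ ram n j) ^ ((k : ℤ) - (l : ℤ))) ^ m : ℂˣ) : ℂ) := by
  rw [mu_zpow, mu_zpow, single_mul_single, C_apply]
  congr 1
  · ring_nf
  · rw [← Units.val_mul]
    congr 1
    simp only [← zpow_natCast, ← zpow_mul, ← zpow_add]
    congr 1
    ring

theorem ramRoot_isPrimitiveRoot (hn : ∀ j, 0 < n j) (j : Fin s) :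
    IsPrimitiveRoot (rootOfCover n ^ ram n j) (n j) :=
  (rootOfCover_isPrimitiveRoot hn).pow (coverDeg_pos hn) (by rw [ram_mul])

/-- Inside a block this is the orthogonality of the characters of a cyclic group: the powers of `ξ`
cancel and a geometric sum over a root of unity remains. -/
theorem frameInv_mul_frame : frameInv p hn * frame p hn = 1 := by
  refine Matrix.ext fun ⟨i, k⟩ ⟨j, l⟩ => ?_
  rw [Matrix.mul_apply, Fintype.sum_sigma]
  by_cases hij : i = j
  · subst hij
    rw [Finset.sum_eq_single i]
    · simp only [frame_apply, frameInv_apply, if_true]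
      have h0 : (n i : ℂ) ≠ 0 := by exact_mod_cast (hn i).ne'
      simp only [mul_assoc, mu_zpow_div]
      rw [← Finset.mul_sum, ← map_sum, ← map_mul]
      set ω := rootOfCover n ^ ram n i with hω
      have hprim : IsPrimitiveRoot ω (n i) := ramRoot_isPrimitiveRoot hn i
      have hsum : ∑ a : Fin (n i), (((ω ^ ((k : ℤ) - l)) ^ (sgn p * ((a : ℕ) : ℤ)) : ℂˣ) : ℂ) =
          if k = l then (n i : ℂ) else 0 := by
        split_ifs with hkl
        · subst hkl; simp
        · set q : ℂˣ := (ω ^ ((k : ℤ) - l)) ^ sgn p with hq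
          -- The exponent `k - l` is smaller in absolute value than the order of the primitive root,
          -- so divisibility would force `k = l`.
          have hq1 : (q : ℂ) ≠ 1 := by
            intro h1
            have h1' : q = 1 := Units.ext h1
            have h2 : ω ^ ((k : ℤ) - l) = 1 := by
              cases p <;> simpa [hq, sgn] using h1'
            rw [hprim.zpow_eq_one_iff_dvd] at h2
            have h3 : ((k : ℤ) - l) = 0 := by
              apply Int.eq_zero_of_abs_lt_dvd h2
              rw [abs_lt]
              have := k.2; have := l.2
              constructor <;> omega
            exact hkl (Fin.ext (by omega))
          have hqn : (q : ℂ) ^ n i = 1 := by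
            rw [← Units.val_pow_eq_pow_val]
            have : q ^ n i = 1 := by
              rw [hq, ← zpow_natCast, ← zpow_mul, ← zpow_mul]
              rw [hprim.zpow_eq_one_iff_dvd]
              exact Dvd.intro_left (((k : ℤ) - l) * sgn p) (mul_assoc _ _ _)
            rw [this]; rfl
          have e1 : ∀ a : Fin (n i), (((ω ^ ((k : ℤ) - l)) ^ (sgn p * ((a : ℕ) : ℤ)) : ℂˣ) : ℂ) =
              (q : ℂ) ^ (a : ℕ) := by
            intro a
            rw [zpow_mul, zpow_natCast, Units.val_pow_eq_pow_val]
          simp only [e1]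
          rw [Fin.sum_univ_eq_sum_range (fun a => (q : ℂ) ^ a), geom_sum_eq hq1, hqn, sub_self,
            zero_div]
      rw [hsum, Matrix.one_apply]
      by_cases hkl : k = l
      · subst hkl; simp [h0]
      · simp [hkl]
    · intro j _ hj
      exact Finset.sum_eq_zero fun a _ => by rw [frame_apply, if_neg hj, mul_zero]
    · simp
  · rw [Matrix.one_apply_ne (fun h => hij (congrArg Sigma.fst h))]
    refine Finset.sum_eq_zero fun m _ => Finset.sum_eq_zero fun a _ => ?_
    rw [frame_apply, frameInv_apply]
    split_ifs with h1 h2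
    · exact absurd (h1.trans h2) hij
    all_goals simp

theorem frame_mul_frameInv : frame p hn * frameInv p hn = 1 :=
  mul_eq_one_comm.mp (frameInv_mul_frame p hn)

/-! ### The bare connection in the eigenframe -/

/-- The powers of `c` form an eigenvector of a cyclic shift whose corner entry is `w`; the row
through the corner closes up precisely because `c ^ m = w`. The transposed shift, used at finite
poles, has the opposite powers (`shiftMat_transpose_mulVec`). -/
theorem shiftMat_mulVec {K : Type*} [Field K] {m : ℕ} {w c : K} (hc : c ≠ 0) (h : c ^ m = w)
    (a : Fin m) : ∑ b, shiftMat m w a b * c ^ (-(b : ℕ) : ℤ) = c * c ^ (-(a : ℕ) : ℤ) := by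
  obtain ⟨a, ha⟩ := a
  rcases a with _ | a
  · have hm : m - 1 < m := by omega
    rw [Finset.sum_eq_single ⟨m - 1, hm⟩]
    · have : ¬ (0 = m - 1 + 1) := by omega
      simp only [shiftMat, Matrix.of_apply, this, if_false, true_and]
      rw [if_pos (by omega), ← h]
      have e : (c ^ m : K) = c ^ (m : ℤ) := (zpow_natCast c m).symm
      rw [e, ← zpow_add₀ hc]
      have : ((m - 1 : ℕ) : ℤ) = m - 1 := by omega
      rw [this]
      simp
    · intro b _ hb
      have hb' : (b : ℕ) + 1 ≠ m := fun hh => hb (Fin.ext (by simp only; omega))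
      simp [shiftMat, hb']
    · simp
  · rw [Finset.sum_eq_single ⟨a, by omega⟩]
    · simp only [shiftMat, Matrix.of_apply, if_true, one_mul]
      nth_rewrite 2 [← zpow_one c]
      rw [← zpow_add₀ hc]
      congr 1
      push_cast
      ring
    · intro b _ hb
      have hb' : ¬ (a + 1 = (b : ℕ) + 1) := fun hh => hb (Fin.ext (by simp only; omega))
      have : ¬ (a + 1 = 0 ∧ (b : ℕ) + 1 = m) := by omega
      simp only [shiftMat, Matrix.of_apply]
      rw [if_neg hb', if_neg this, zero_mul]
    · simp

theorem shiftMat_transpose_mulVec {K : Type*} [Field K] {m : ℕ} {w c : K} (h : c ^ m = w)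
    (a : Fin m) : ∑ b, (shiftMat m w).transpose a b * c ^ ((b : ℕ) : ℤ) = c * c ^ ((a : ℕ) : ℤ) := by
  obtain ⟨a, ha⟩ := a
  simp only [zpow_natCast]
  rcases Nat.lt_or_ge (a + 1) m with h1 | h1
  · rw [Finset.sum_eq_single ⟨a + 1, h1⟩]
    · simp [shiftMat, pow_succ, mul_comm]
    · intro b _ hb
      have hb' : ¬ ((b : ℕ) = a + 1) := fun hh => hb (Fin.ext hh)
      have : ¬ ((b : ℕ) = 0 ∧ a + 1 = m) := by omega
      simp only [shiftMat, Matrix.of_apply, Matrix.transpose_apply]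
      rw [if_neg hb', if_neg this, zero_mul]
    · simp
  · have ham : a + 1 = m := by omega
    rw [Finset.sum_eq_single ⟨0, by omega⟩]
    · simp only [shiftMat, Matrix.of_apply, Matrix.transpose_apply]
      rw [if_neg (by simp), if_pos (by simpa using ham), ← h, ← ham]
      simp [pow_succ, mul_comm]
    · intro b _ hb
      have hb' : (b : ℕ) ≠ 0 := fun hh => hb (Fin.ext hh)
      have h2 := b.2
      simp only [shiftMat, Matrix.of_apply, Matrix.transpose_apply]
      rw [if_neg (by omega), if_neg (by omega), zero_mul]
    · simp

theorem shiftMat_map {K K' : Type*} [Semiring K] [Semiring K'] (f : K →+* K') (m : ℕ) (w : K) :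
    (shiftMat m w).map f = shiftMat m (f w) := by
  refine Matrix.ext fun a b => ?_
  simp only [shiftMat, Matrix.map_apply, Matrix.of_apply]
  split_ifs <;> simp

theorem bareH_cov_mulVec (j : Fin s) (k a : Fin (n j)) :
    ∑ b, ((bareH p (n j)).map (cov hn)) a b * mu hn ⟨j, k⟩ ^ (sgn p * (b : ℕ)) =
      mu hn ⟨j, k⟩ * mu hn ⟨j, k⟩ ^ (sgn p * (a : ℕ)) := by
  cases p with
  | none =>
    simp only [bareH, shiftMat_map, sgn, neg_one_mul]
    exact shiftMat_mulVec (mu_ne_zero hn _) (mu_pow_card hn ⟨j, k⟩) a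
  | some i =>
    simp only [bareH, sgn, one_mul]
    rw [Matrix.transpose_map, shiftMat_map]
    exact shiftMat_transpose_mulVec (mu_pow_card hn ⟨j, k⟩) a

theorem bareH_pow_cov_mulVec (j : Fin s) (k a : Fin (n j)) (J : ℕ) :
    ∑ b, ((bareH p (n j) ^ J).map (cov hn)) a b * mu hn ⟨j, k⟩ ^ (sgn p * (b : ℕ)) =
      mu hn ⟨j, k⟩ ^ J * mu hn ⟨j, k⟩ ^ (sgn p * (a : ℕ)) := by
  induction J generalizing a with
  | zero => simp [Matrix.one_apply]
  | succ J ih =>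
    rw [pow_succ', Matrix.map_mul]
    simp only [Matrix.mul_apply, Finset.sum_mul]
    rw [Finset.sum_comm]
    simp only [mul_assoc, ← Finset.mul_sum, ih]
    have := bareH_cov_mulVec p hn j k a
    calc ∑ x, ((bareH p (n j)).map (cov hn)) a x *
          (mu hn ⟨j, k⟩ ^ J * mu hn ⟨j, k⟩ ^ (sgn p * (x : ℕ)))
        = mu hn ⟨j, k⟩ ^ J * ∑ x, ((bareH p (n j)).map (cov hn)) a x *
          mu hn ⟨j, k⟩ ^ (sgn p * (x : ℕ)) := by
          rw [Finset.mul_sum]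
          exact Finset.sum_congr rfl fun x _ => by ring
      _ = _ := by rw [this, pow_succ]; ring

end Frame

/-! ### The exponents of the bare system and their separation -/

section LocalSystem

variable {s : ℕ} {n : Fin s → ℕ} {ι : Type*}

/-- The bare system `u D`, where `u` is the coordinate `x - γ` or `x`. -/
noncomputable def bareM (p : Option ι) (n : Fin s → ℕ) (r : ℕ) (t : Fin s → ℕ → ℂ) :
    Matrix (Σ j : Fin s, Fin (n j)) (Σ j : Fin s, Fin (n j)) (LaurentSeries ℂ) :=
  Matrix.blockDiagonal' fun j => (HahnSeries.C ((n j : ℂ)⁻¹) : LaurentSeries ℂ) •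
    (∑ J ∈ Finset.range (r * n j + 1), (HahnSeries.C (t j J) : LaurentSeries ℂ) • bareH p (n j) ^ J
      - gradMat (n j))

/-- The exponent `(1 / n) ∑ t_J ξ^{-J}` of a branch. -/
noncomputable def branchExp (n : Fin s → ℕ) (r : ℕ) (t : Fin s → ℕ → ℂ) (j : Fin s) :
    LaurentSeries ℂ :=
  ∑ J ∈ Finset.range (r * n j + 1), single (-(J : ℤ)) (t j J / n j)

/-- The eigenvalues of the bare system on the common cover. -/
noncomputable def bareEig (hn : ∀ j, 0 < n j) (r : ℕ) (t : Fin s → ℕ → ℂ)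
    (x : Σ j : Fin s, Fin (n j)) : LaurentSeries ℂ :=
  twist (rootOfCover n ^ (x.2 : ℕ)) (branch hn x.1 (branchExp n r t x.1))

theorem twist_C (η : ℂˣ) (c : ℂ) : twist η (HahnSeries.C c) = HahnSeries.C c := by
  rw [C_apply, twist_single]; simp

theorem bareEig_eq_sum (hn : ∀ j, 0 < n j) (r : ℕ) (t : Fin s → ℕ → ℂ)
    (x : Σ j : Fin s, Fin (n j)) : bareEig hn r t x = HahnSeries.C ((n x.1 : ℂ)⁻¹) *
      ∑ J ∈ Finset.range (r * n x.1 + 1), HahnSeries.C (t x.1 J) * mu hn x ^ J := by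
  rw [bareEig, branchExp, map_sum, map_sum, Finset.mul_sum]
  refine Finset.sum_congr rfl fun J _ => ?_
  have : (single (-(J : ℤ)) (t x.1 J / n x.1) : LaurentSeries ℂ) =
      HahnSeries.C ((n x.1 : ℂ)⁻¹) * (HahnSeries.C (t x.1 J) * single (-1) 1 ^ J) := by
    rw [single_pow, ← mul_assoc, ← map_mul, C_apply, single_mul_single]
    congr 1
    · simp
    · simp; ring
  rw [this, map_mul, map_mul, map_mul, map_mul, branch, ramify_C, ramify_C, twist_C, twist_C,
    mu, branch, map_pow, map_pow]

theorem coeff_branchExp (n : Fin s → ℕ) (r : ℕ) (t : Fin s → ℕ → ℂ) (j : Fin s) {J : ℕ}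
    (hJ : J ≤ r * n j) : (branchExp n r t j).coeff (-(J : ℤ)) = t j J / n j := by
  rw [branchExp, coeff_sum, Finset.sum_eq_single J]
  · simp
  · intro k _ hk
    rw [coeff_single_of_ne (by omega)]
  · intro h
    exact absurd (Finset.mem_range.mpr (by omega)) h

theorem coeff_branchExp_of_pos (n : Fin s → ℕ) (r : ℕ) (t : Fin s → ℕ → ℂ) (j : Fin s) {k : ℤ}
    (hk : 0 < k) : (branchExp n r t j).coeff k = 0 := by
  rw [branchExp, coeff_sum]
  exact Finset.sum_eq_zero fun J _ => by rw [coeff_single_of_ne (by omega)]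

theorem LB.branchExp (n : Fin s → ℕ) (r : ℕ) (t : Fin s → ℕ → ℂ) (j : Fin s) :
    LB (-(r * n j : ℕ)) (branchExp n r t j) := by
  refine LB.sum fun J hJ => LB.single_of_le ?_ _
  rw [Finset.mem_range] at hJ
  omega

theorem coeff_bareEig_mul (hn : ∀ j, 0 < n j) (r : ℕ) (t : Fin s → ℕ → ℂ)
    (x : Σ j : Fin s, Fin (n j)) (k : ℤ) : (bareEig hn r t x).coeff (ram n x.1 * k) =
      (((rootOfCover n ^ ram n x.1) ^ (x.2 * k : ℤ) : ℂˣ) : ℂ) * (branchExp n r t x.1).coeff k := by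
  rw [bareEig, coeff_twist, branch, coeff_ramify_mul]
  congr 2
  simp only [← zpow_natCast, ← zpow_mul]
  congr 1
  ring

theorem coeff_bareEig_of_not_dvd (hn : ∀ j, 0 < n j) (r : ℕ) (t : Fin s → ℕ → ℂ)
    (x : Σ j : Fin s, Fin (n j)) {k : ℤ} (h : ¬ (ram n x.1 : ℤ) ∣ k) :
    (bareEig hn r t x).coeff k = 0 := by
  rw [bareEig, coeff_twist, branch, coeff_ramify_of_not_dvd _ _ _ h, mul_zero]

theorem ram_mul_rank (n : Fin s → ℕ) (r : ℕ) (j : Fin s) :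
    (ram n j : ℤ) * (r * n j : ℕ) = r * coverDeg n := by
  rw [← ram_mul n j]; push_cast; ring

/-- The leading exponent `r n` is a multiple of `n`, so the root of unity of the sheet drops out:
all sheets of a branch share the leading coefficient. The next coefficient (`coeff_bareEig_next`)
carries the root of unity and distinguishes them. -/
theorem coeff_bareEig_lead (hn : ∀ j, 0 < n j) (r : ℕ) (t : Fin s → ℕ → ℂ)
    (x : Σ j : Fin s, Fin (n j)) :
    (bareEig hn r t x).coeff (-(r * coverDeg n : ℤ)) = t x.1 (r * n x.1) / n x.1 := by
  have e := coeff_bareEig_mul hn r t x (-(r * n x.1 : ℕ))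
  rw [mul_neg, ram_mul_rank, coeff_branchExp _ _ _ _ le_rfl] at e
  rw [e]
  have : (rootOfCover n ^ ram n x.1) ^ ((x.2 : ℕ) * -((r * n x.1 : ℕ) : ℤ)) = 1 := by
    rw [(ramRoot_isPrimitiveRoot hn x.1).zpow_eq_one_iff_dvd]
    exact ⟨-((x.2 : ℕ) * r), by push_cast; ring⟩
  rw [this]
  simp

theorem coeff_bareEig_next (hn : ∀ j, 0 < n j) {r : ℕ} (hr : 0 < r) (t : Fin s → ℕ → ℂ)
    (x : Σ j : Fin s, Fin (n j)) :
    (bareEig hn r t x).coeff (-(r * coverDeg n : ℤ) + ram n x.1) =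
      (((rootOfCover n ^ ram n x.1) ^ (x.2 : ℕ) : ℂˣ) : ℂ) * (t x.1 (r * n x.1 - 1) / n x.1) := by
  have h1 : 1 ≤ r * n x.1 := Nat.mul_pos hr (hn _)
  have e := coeff_bareEig_mul hn r t x (-((r * n x.1 - 1 : ℕ) : ℤ))
  rw [coeff_branchExp _ _ _ _ (Nat.sub_le _ _)] at e
  have e2 : (ram n x.1 : ℤ) * -((r * n x.1 - 1 : ℕ) : ℤ) = -(r * coverDeg n : ℤ) + ram n x.1 := by
    rw [← ram_mul_rank n r x.1, Nat.cast_sub h1]; push_cast; ring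
  rw [e2] at e
  rw [e]
  congr 2
  have : (rootOfCover n ^ ram n x.1) ^ ((x.2 : ℕ) * -((r * n x.1 : ℕ) : ℤ)) = 1 := by
    rw [(ramRoot_isPrimitiveRoot hn x.1).zpow_eq_one_iff_dvd]
    exact ⟨-((x.2 : ℕ) * r), by push_cast; ring⟩
  have e3 : ((x.2 : ℕ) : ℤ) * -((r * n x.1 - 1 : ℕ) : ℤ) =
      (x.2 : ℕ) * -((r * n x.1 : ℕ) : ℤ) + (x.2 : ℕ) := by
    rw [Nat.cast_sub h1]; push_cast; ring
  rw [e3, zpow_add, this, one_mul, zpow_natCast]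

/-- Genericity of the leading times, the consequence of the genericity of the Lidskii pseudovalues
that separates the exponents of the branches. -/
structure GenericTimes (n : Fin s → ℕ) (r : ℕ) (t : Fin s → ℕ → ℂ) : Prop where
  ne_zero : ∀ j, 2 ≤ n j → t j (r * n j - 1) ≠ 0
  pow_ne : ∀ i j, i ≠ j → t i (r * n i) / n i = t j (r * n j) / n j → n i = n j →
    (t i (r * n i - 1) / n i) ^ n i ≠ (t j (r * n j - 1) / n j) ^ n i

theorem ramRoot_pow_inj (hn : ∀ j, 0 < n j) (j : Fin s) {k l : Fin (n j)} (h : k ≠ l) :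
    (((rootOfCover n ^ ram n j) ^ (k : ℕ) : ℂˣ) : ℂ) ≠
      (((rootOfCover n ^ ram n j) ^ (l : ℕ) : ℂˣ) : ℂ) := by
  intro he
  exact h (Fin.ext ((ramRoot_isPrimitiveRoot hn j).pow_inj k.2 l.2 (Units.ext he)))

/-- Distinct exponents already differ in one of their first two coefficients. If the leading ones
agree and the sizes differ, the subleading term of the larger block is nonzero at an order which the
ramification of the smaller block forbids. If the sizes agree, the subleading terms are `ω^k τ` and
differ, either by the roots of unity inside one block or because the powers `τ^n` of two blocks
differ. -/
theorem GenericTimes.exists_coeff_ne {r : ℕ} {t : Fin s → ℕ → ℂ} (h : GenericTimes n r t)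
    (hn : ∀ j, 0 < n j) (hr : 0 < r) {x y : Σ j : Fin s, Fin (n j)} (hxy : x ≠ y) :
    ∃ d ≤ -(r * coverDeg n : ℤ) + min (ram n x.1 : ℤ) (ram n y.1),
      (bareEig hn r t x - bareEig hn r t y).coeff d ≠ 0 := by
  have key : ∀ x y : Σ j : Fin s, Fin (n j), n x.1 < n y.1 →
      (bareEig hn r t x).coeff (-(r * coverDeg n : ℤ) + ram n y.1) ≠
        (bareEig hn r t y).coeff (-(r * coverDeg n : ℤ) + ram n y.1) := by
    intro x y hlt
    have hn0 : (n y.1 : ℂ) ≠ 0 := by exact_mod_cast (hn _).ne'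
    rw [coeff_bareEig_next hn hr, coeff_bareEig_of_not_dvd]
    · refine (mul_ne_zero (Units.ne_zero _) (div_ne_zero (h.ne_zero _ ?_) hn0)).symm
      have := hn x.1
      omega
    · rw [← ram_mul_rank n r x.1, ← mul_neg]
      intro hd
      have h1 := (Int.dvd_add_right (Dvd.intro _ rfl)).mp hd
      have h2 : ram n x.1 ≤ ram n y.1 := Nat.le_of_dvd (ram_pos hn _) (by exact_mod_cast h1)
      have h3 := ram_mul n x.1
      have h4 := ram_mul n y.1
      have h5 := ram_pos hn x.1
      nlinarith
  by_cases hlead : t x.1 (r * n x.1) / n x.1 = t y.1 (r * n y.1) / n y.1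
  swap
  · refine ⟨-(r * coverDeg n : ℤ), by omega, ?_⟩
    rw [coeff_sub, coeff_bareEig_lead, coeff_bareEig_lead]
    exact sub_ne_zero.mpr hlead
  have hle : ∀ x y : Σ j : Fin s, Fin (n j), n x.1 ≤ n y.1 → ram n y.1 ≤ ram n x.1 := fun x y hl =>
    Nat.div_le_div_left hl (hn _)
  rcases lt_trichotomy (n x.1) (n y.1) with hlt | heq | hgt
  · refine ⟨-(r * coverDeg n : ℤ) + ram n y.1, ?_, ?_⟩
    · have := hle x y hlt.le
      omega
    · rw [coeff_sub]
      exact sub_ne_zero.mpr (key x y hlt)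
  · have hram : ram n x.1 = ram n y.1 := by rw [ram, ram, heq]
    refine ⟨-(r * coverDeg n : ℤ) + ram n x.1, by rw [hram]; simp, ?_⟩
    rw [coeff_sub, sub_ne_zero]
    nth_rewrite 2 [hram]
    rw [coeff_bareEig_next hn hr, coeff_bareEig_next hn hr]
    obtain ⟨i, k⟩ := x
    obtain ⟨j, l⟩ := y
    simp only at heq hlead hram ⊢
    by_cases hij : i = j
    · subst hij
      have hkl : k ≠ l := fun e => hxy (by rw [e])
      have h2 : 2 ≤ n i := by
        by_contra! hlt
        have := k.2; have := l.2
        exact hkl (Fin.ext (by omega))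
      intro he
      exact ramRoot_pow_inj hn i hkl (mul_right_cancel₀ (div_ne_zero (h.ne_zero i h2)
        (by exact_mod_cast (hn i).ne')) he)
    · intro he
      refine h.pow_ne i j hij hlead heq ?_
      have h1 := congrArg (fun z => z ^ n i) he
      simp only [mul_pow, ← Units.val_pow_eq_pow_val] at h1
      have e1 : ((rootOfCover n ^ ram n i) ^ (k : ℕ)) ^ n i = 1 := by
        rw [← pow_mul, mul_comm, pow_mul, (ramRoot_isPrimitiveRoot hn i).pow_eq_one, one_pow]
      have e2 : ((rootOfCover n ^ ram n j) ^ (l : ℕ)) ^ n i = 1 := by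
        rw [heq, ← pow_mul, mul_comm, pow_mul, (ramRoot_isPrimitiveRoot hn j).pow_eq_one, one_pow]
      rw [e1, e2] at h1
      simpa using h1
  · refine ⟨-(r * coverDeg n : ℤ) + ram n x.1, ?_, ?_⟩
    · have := hle y x hgt.le
      omega
    · rw [coeff_sub]
      exact sub_ne_zero.mpr (key y x hgt).symm

variable (p : Option ι) (hn : ∀ j, 0 < n j)

theorem bareH_block_mul_frame (i j : Fin s) (a : Fin (n i)) (k : Fin (n j)) (B : ∀ j, Matrix (Fin (n j)) (Fin (n j)) (LaurentSeries ℂ)) :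
    (Matrix.blockDiagonal' B * frame p hn) ⟨i, a⟩ ⟨j, k⟩ =
      if i = j then ∑ b, B i a b * mu hn ⟨j, k⟩ ^ (sgn p * (b : ℕ)) else 0 := by
  rw [Matrix.mul_apply, Fintype.sum_sigma, Finset.sum_eq_single i]
  · simp only [Matrix.blockDiagonal'_apply_eq, frame_apply]
    split_ifs with h
    · rfl
    · simp
  · intro m _ hm
    exact Finset.sum_eq_zero fun b _ => by
      rw [Matrix.blockDiagonal'_apply_ne _ _ _ hm.symm, zero_mul]
  · simp

theorem blockDiagonal'_map' {K K' : Type*} [Semiring K] [Semiring K'] (f : K →+* K')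
    (B : ∀ j, Matrix (Fin (n j)) (Fin (n j)) K) :
    (Matrix.blockDiagonal' B).map f = Matrix.blockDiagonal' fun j => (B j).map f :=
  Matrix.blockDiagonal'_map B f (map_zero f)

/-- The frame gauges the bare system to its diagonal exponents. The matrix `G` is there for this
purpose: `-G/n` acts on an eigenvector of `𝓗` exactly as `ε θ` does. -/
theorem bareM_mul_frame (r : ℕ) (t : Fin s → ℕ → ℂ) :
    (bareM p n r t).map (cov hn) * frame p hn = frame p hn * Matrix.diagonal (bareEig hn r t) +
      (HahnSeries.C (sgn p : ℂ) : LaurentSeries ℂ) • (frame p hn).map (covEuler n) := by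
  refine Matrix.ext fun ⟨i, a⟩ ⟨j, k⟩ => ?_
  rw [bareM, blockDiagonal'_map', bareH_block_mul_frame, Matrix.add_apply, Matrix.mul_diagonal,
    Matrix.smul_apply, Matrix.map_apply, frame_apply, smul_eq_mul]
  by_cases hij : i = j
  swap
  · simp [hij, covEuler]
  subst hij
  simp only [if_true]
  rw [covEuler_mu_zpow, bareEig_eq_sum, ← mul_assoc (HahnSeries.C (sgn p : ℂ)), ← map_mul]
  have hH := bareH_pow_cov_mulVec p hn i k a
  set m := mu hn ⟨i, k⟩ with hm
  have e1 : ∀ b, ((HahnSeries.C ((n i : ℂ)⁻¹) : LaurentSeries ℂ) •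
      (∑ J ∈ Finset.range (r * n i + 1), (HahnSeries.C (t i J) : LaurentSeries ℂ) •
        bareH p (n i) ^ J - gradMat (n i))).map (cov hn) a b =
      HahnSeries.C ((n i : ℂ)⁻¹) * (∑ J ∈ Finset.range (r * n i + 1),
        HahnSeries.C (t i J) * ((bareH p (n i) ^ J).map (cov hn)) a b -
          if a = b then ((a : ℕ) : LaurentSeries ℂ) else 0) := by
    intro b
    simp only [Matrix.map_apply, Matrix.smul_apply, Matrix.sub_apply, Matrix.sum_apply, smul_eq_mul,
      map_mul, map_sub, map_sum, cov, ramify_C, gradMat, Matrix.diagonal_apply]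
    congr 2
    split_ifs <;> simp
  simp only [e1, mul_assoc, ← Finset.mul_sum]
  simp only [sub_mul, Finset.sum_sub_distrib, Finset.sum_mul, mul_assoc]
  rw [Finset.sum_comm]
  simp only [← Finset.mul_sum, hH, ite_mul, zero_mul, Finset.sum_ite_eq,
    Finset.mem_univ, if_true]
  have e2 : (sgn p : ℂ) * (-((sgn p * (a : ℕ) : ℤ) : ℂ) / (n i : ℂ)) = -((n i : ℂ)⁻¹ * (a : ℕ)) := by
    have : (sgn p : ℂ) * (sgn p : ℂ) = 1 := by exact_mod_cast sgn_mul_self p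
    push_cast
    linear_combination (-(a : ℂ) / (n i : ℂ)) * this
  rw [e2, map_neg, map_mul, mul_sub]
  have e3 : (HahnSeries.C ((a : ℕ) : ℂ) : LaurentSeries ℂ) = ((a : ℕ) : LaurentSeries ℂ) := map_natCast _ _
  rw [e3]
  have e4 : ∑ J ∈ Finset.range (r * n i + 1), HahnSeries.C (t i J) * (m ^ J * m ^ (sgn p * (a : ℕ))) =
      m ^ (sgn p * (a : ℕ)) * ∑ J ∈ Finset.range (r * n i + 1), HahnSeries.C (t i J) * m ^ J := by
    rw [Finset.mul_sum]
    exact Finset.sum_congr rfl fun J _ => by ring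
  rw [e4]
  ring

end LocalSystem

/-! ### Scalars of matrices of Laurent series -/

theorem laurent_mul_smul {I : Type*} [Fintype I] (c : LaurentSeries ℂ)
    (X Z : Matrix I I (LaurentSeries ℂ)) : X * (c • Z) = c • (X * Z) := by
  exact Matrix.mul_smul X c Z

theorem laurent_smul_mul {I : Type*} [Fintype I] (c : LaurentSeries ℂ)
    (X Z : Matrix I I (LaurentSeries ℂ)) : (c • X) * Z = c • (X * Z) := by
  exact Matrix.smul_mul c X Z

theorem laurent_smul_add {I : Type*} (c : LaurentSeries ℂ)
    (X Z : Matrix I I (LaurentSeries ℂ)) : c • (X + Z) = c • X + c • Z := by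
  exact smul_add c X Z

/-! ### Invertible matrices of formal power series -/

theorem coeff_zero_det {I : Type*} [Fintype I] [DecidableEq I] {X : Matrix I I (LaurentSeries ℂ)}
    (hX : ∀ a b, LB 0 (X a b)) :
    X.det.coeff 0 = (X.map fun f => f.coeff 0).det ∧ LB 0 X.det := by
  choose Z hZ using fun a b => (hX a b).exists_powerSeries
  have e : X = (Matrix.of Z).map (HahnSeries.ofPowerSeries ℤ ℂ) :=
    Matrix.ext fun a b => (hZ a b).symm
  have e1 : X.det = HahnSeries.ofPowerSeries ℤ ℂ (Matrix.of Z).det := by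
    rw [e]; exact ((HahnSeries.ofPowerSeries ℤ ℂ).map_det _).symm
  refine ⟨?_, by rw [e1]; exact LB.ofPowerSeries _⟩
  have h0 : ∀ f : PowerSeries ℂ, (HahnSeries.ofPowerSeries ℤ ℂ f).coeff 0 =
      PowerSeries.constantCoeff (R := ℂ) f := fun f => by
    rw [PowerSeries.coeff_coe]; simp
  rw [e1, h0, RingHom.map_det]
  congr 1
  refine Matrix.ext fun a b => ?_
  rw [Matrix.map_apply, ← hZ, h0]
  rfl

/-- A matrix of power series with invertible constant term has an inverse of power series: the
determinant is a unit and the adjugate is integral. -/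
theorem exists_inverse_of_coeff_zero {I : Type*} [Fintype I] [DecidableEq I]
    {X : Matrix I I (LaurentSeries ℂ)} (hX : ∀ a b, LB 0 (X a b))
    (hdet : (X.map fun f => f.coeff 0).det ≠ 0) :
    X.det ≠ 0 ∧ X * X⁻¹ = 1 ∧ X⁻¹ * X = 1 ∧ ∀ a b, LB 0 (X⁻¹ a b) := by
  obtain ⟨h0, -⟩ := coeff_zero_det hX
  rw [← h0] at hdet
  have hne : X.det ≠ 0 := by intro h; rw [h] at hdet; simp at hdet
  refine ⟨hne, Matrix.mul_nonsing_inv _ hne.isUnit, Matrix.nonsing_inv_mul _ hne.isUnit,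
    fun a b => ?_⟩
  rw [Matrix.inv_def, Matrix.smul_apply, smul_eq_mul, Ring.inverse_eq_inv']
  refine (LB.inv hdet).mul_of_le (c := 0) ?_ (by norm_num)
  rw [Matrix.adjugate_apply]
  refine (coeff_zero_det fun i k => ?_).2
  rw [Matrix.updateRow_apply]
  split_ifs
  · by_cases hk : k = a
    · subst hk; simpa using LB.one
    · simpa [hk] using LB.zero 0
  · exact hX i k

theorem det_coeff_zero_of_sub_one {I : Type*} [Fintype I] [DecidableEq I]
    {X : Matrix I I (LaurentSeries ℂ)} (hX : ∀ a b, LB 1 ((X - 1) a b)) :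
    (∀ a b, LB 0 (X a b)) ∧ (X.map fun f => f.coeff 0).det ≠ 0 := by
  have h : ∀ a b, X a b = (X - 1) a b + (1 : Matrix I I (LaurentSeries ℂ)) a b := fun a b => by
    simp
  have h1 : ∀ a b, LB 0 ((1 : Matrix I I (LaurentSeries ℂ)) a b) := fun a b => by
    rw [Matrix.one_apply]
    split_ifs
    · exact LB.one
    · exact LB.zero 0
  refine ⟨fun a b => ?_, ?_⟩
  · rw [h]
    exact ((hX a b).mono (by norm_num)).add (h1 a b)
  · have : (X.map fun f => f.coeff 0) = 1 := by
      refine Matrix.ext fun a b => ?_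
      rw [Matrix.map_apply, h, coeff_add, hX a b 0 (by norm_num), zero_add, Matrix.one_apply,
        Matrix.one_apply]
      split_ifs <;> simp
    rw [this]
    simp

theorem LB.matrix_mul {I : Type*} [Fintype I] {b c : ℤ} {X Z : Matrix I I (LaurentSeries ℂ)}
    (hX : ∀ i k, LB b (X i k)) (hZ : ∀ i k, LB c (Z i k)) (i k : I) : LB (b + c) ((X * Z) i k) := by
  rw [Matrix.mul_apply]
  exact LB.sum fun m _ => (hX i m).mul (hZ m k)

theorem LB.cov {s : ℕ} {n : Fin s → ℕ} (hn : ∀ j, 0 < n j) {b : ℤ} {x : LaurentSeries ℂ}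
    (h : LB b x) : LB (b * coverDeg n) (cov hn x) := by
  have := h.ramify (coverDeg n) (coverDeg_pos hn)
  rwa [mul_comm] at this

/-! ### The gauged system in the eigenframe as a perturbation of the exponents -/

section LocalGauge

variable {s : ℕ} {n : Fin s → ℕ} {ι : Type*} (p : Option ι) (hn : ∀ j, 0 < n j)

/-- A matrix in the eigenframe of the bare system. -/
noncomputable def toFrame (a : Matrix (Σ j : Fin s, Fin (n j)) (Σ j : Fin s, Fin (n j)) (LaurentSeries ℂ)) :
    Matrix (Σ j : Fin s, Fin (n j)) (Σ j : Fin s, Fin (n j)) (LaurentSeries ℂ) :=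
  frameInv p hn * a.map (cov hn) * frame p hn

theorem toFrame_apply (a : Matrix (Σ j : Fin s, Fin (n j)) (Σ j : Fin s, Fin (n j)) (LaurentSeries ℂ))
    (i j : Fin s) (k : Fin (n i)) (l : Fin (n j)) : toFrame p hn a ⟨i, k⟩ ⟨j, l⟩ =
      HahnSeries.C ((n i : ℂ)⁻¹) * ∑ c : Fin (n i), ∑ d : Fin (n j),
        mu hn ⟨i, k⟩ ^ (-(sgn p * (c : ℕ))) * cov hn (a ⟨i, c⟩ ⟨j, d⟩) *
          mu hn ⟨j, l⟩ ^ (sgn p * (d : ℕ)) := by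
  have h1 : ∀ y, (frameInv p hn * a.map (cov hn)) ⟨i, k⟩ y = HahnSeries.C ((n i : ℂ)⁻¹) *
      ∑ c : Fin (n i), mu hn ⟨i, k⟩ ^ (-(sgn p * (c : ℕ))) * cov hn (a ⟨i, c⟩ y) := by
    intro y
    rw [Matrix.mul_apply, Fintype.sum_sigma, Finset.sum_eq_single i]
    · simp only [frameInv_apply, if_true, Matrix.map_apply, mul_assoc, Finset.mul_sum]
    · intro m _ hm
      exact Finset.sum_eq_zero fun b _ => by rw [frameInv_apply, if_neg hm.symm, zero_mul]
    · simp
  rw [toFrame, Matrix.mul_apply, Fintype.sum_sigma, Finset.sum_eq_single j]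
  · simp only [h1, frame_apply, if_true, mul_assoc, Finset.mul_sum, Finset.sum_mul]
    rw [Finset.sum_comm]
  · intro m _ hm
    exact Finset.sum_eq_zero fun b _ => by rw [frame_apply, if_neg hm, mul_zero]
  · simp

/-- Of the two factors of the conjugation only one has negative powers of `σ`: the frame at a finite
pole, its inverse at infinity. Their exponent is at worst `(n - 1) ram = N - ram`, so slightly less
than one power of `s = σ^N` is lost. -/
theorem LB.toFrame {a : Matrix (Σ j : Fin s, Fin (n j)) (Σ j : Fin s, Fin (n j)) (LaurentSeries ℂ)}
    {b : ℤ} (ha : ∀ x y, LB b (a x y)) (x y : Σ j : Fin s, Fin (n j)) :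
    LB ((b - 1) * coverDeg n + min (ram n x.1 : ℤ) (ram n y.1)) (toFrame p hn a x y) := by
  obtain ⟨i, k⟩ := x
  obtain ⟨j, l⟩ := y
  rw [toFrame_apply]
  refine (LB.C _).mul_of_le (LB.sum fun c _ => LB.sum fun d _ =>
    (((LB.mu_zpow hn _ _).mul ((ha _ _).cov hn)).mul (LB.mu_zpow hn _ _)).mono ?_) (zero_add _).ge
  have h1 := mul_ram n i
  have h2 := mul_ram n j
  have h3 : ((c : ℕ) + 1) * ram n i ≤ n i * ram n i := Nat.mul_le_mul_right _ c.2
  have h4 : ((d : ℕ) + 1) * ram n j ≤ n j * ram n j := Nat.mul_le_mul_right _ d.2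
  rw [h1] at h3
  rw [h2] at h4
  have h5 : 0 ≤ ((c : ℕ) : ℤ) * ram n i := by positivity
  have h6 : 0 ≤ ((d : ℕ) : ℤ) * ram n j := by positivity
  zify at h3 h4
  have h7 := min_le_left (ram n i : ℤ) (ram n j)
  have h8 := min_le_right (ram n i : ℤ) (ram n j)
  cases p with
  | none => simp only [sgn]; nlinarith
  | some i => simp only [sgn]; nlinarith

theorem twist_mu (j : Fin s) (k : Fin (n j)) :
    twist (rootOfCover n ^ (k : ℕ)) (mu hn ⟨j, ⟨0, hn j⟩⟩) = mu hn ⟨j, k⟩ := by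
  simp only [mu, pow_zero]
  congr 1
  ext i
  simp

/-- The matrix `a` lives downstairs, so deck transformations merely permute the sheets: the diagonal
entries of a block are Galois conjugate. -/
theorem twist_toFrame_diag
    (a : Matrix (Σ j : Fin s, Fin (n j)) (Σ j : Fin s, Fin (n j)) (LaurentSeries ℂ))
    (j : Fin s) (k : Fin (n j)) : twist (rootOfCover n ^ (k : ℕ))
      (toFrame p hn a ⟨j, ⟨0, hn j⟩⟩ ⟨j, ⟨0, hn j⟩⟩) = toFrame p hn a ⟨j, k⟩ ⟨j, k⟩ := by
  rw [toFrame_apply, toFrame_apply]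
  simp only [map_mul, map_sum, map_zpow₀, twist_C, twist_cov, twist_mu]

/-- The constants `-(1/n²) ∑_a a ω^{± a (k - l)}`. -/
noncomputable def gradConst (j : Fin s) (k l : Fin (n j)) : ℂ :=
  -((n j : ℂ) ^ 2)⁻¹ * ∑ a : Fin (n j), (a : ℕ) *
    ((((rootOfCover n ^ ram n j) ^ ((k : ℤ) - (l : ℤ))) ^ (sgn p * (a : ℕ)) : ℂˣ) : ℂ)

/-- The contribution of the variation of the eigenframe. -/
noncomputable def gradPart : Matrix (Σ j : Fin s, Fin (n j)) (Σ j : Fin s, Fin (n j)) (LaurentSeries ℂ) :=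
  (HahnSeries.C (sgn p : ℂ) : LaurentSeries ℂ) • (frameInv p hn * (frame p hn).map (covEuler n))

theorem gradPart_apply_eq (j : Fin s) (k l : Fin (n j)) :
    gradPart p hn ⟨j, k⟩ ⟨j, l⟩ = HahnSeries.C (gradConst p j k l) := by
  rw [gradPart, Matrix.smul_apply, Matrix.mul_apply, Fintype.sum_sigma, Finset.sum_eq_single j]
  · simp only [Matrix.map_apply, frame_apply, frameInv_apply, if_true, covEuler_mu_zpow, smul_eq_mul,
      gradConst]
    rw [Finset.mul_sum, map_mul, map_sum, Finset.mul_sum]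
    refine Finset.sum_congr rfl fun a _ => ?_
    rw [map_mul, ← mu_zpow_div hn j k l]
    have h0 : (n j : ℂ) ≠ 0 := by exact_mod_cast (hn j).ne'
    have e : HahnSeries.C (sgn p : ℂ) * (HahnSeries.C ((n j : ℂ)⁻¹) *
        HahnSeries.C (-((sgn p * (a : ℕ) : ℤ) : ℂ) / n j)) =
        (HahnSeries.C (-((n j : ℂ) ^ 2)⁻¹) : LaurentSeries ℂ) * HahnSeries.C ((a : ℕ) : ℂ) := by
      rw [← map_mul, ← map_mul, ← map_mul]
      congr 1
      have : (sgn p : ℂ) * (sgn p : ℂ) = 1 := by exact_mod_cast sgn_mul_self p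
      push_cast
      field_simp
      linear_combination (-(a : ℂ)) * this
    linear_combination (mu hn ⟨j, k⟩ ^ (-(sgn p * (a : ℕ))) * mu hn ⟨j, l⟩ ^ (sgn p * (a : ℕ))) * e
  · intro m _ hm
    exact Finset.sum_eq_zero fun b _ => by rw [frameInv_apply, if_neg hm.symm, zero_mul]
  · simp

theorem gradPart_apply_ne {i j : Fin s} (h : i ≠ j) (k : Fin (n i)) (l : Fin (n j)) :
    gradPart p hn ⟨i, k⟩ ⟨j, l⟩ = 0 := by
  rw [gradPart, Matrix.smul_apply, Matrix.mul_apply, Finset.sum_eq_zero, smul_zero]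
  rintro ⟨m, a⟩ _
  rw [Matrix.map_apply, frame_apply, frameInv_apply]
  split_ifs with h1 h2
  · exact absurd (h1.trans h2) h
  all_goals simp [covEuler]

/-- On the diagonal the roots of unity cancel and the mean of `0, …, n - 1` remains. This is the
origin of the shift `(n - 1) / 2` of the parameter of formal monodromy. -/
theorem gradConst_diag (j : Fin s) (k : Fin (n j)) (h : 0 < n j) :
    gradConst p j k k = -((n j : ℂ) - 1) / (2 * n j) := by
  have h0 : (n j : ℂ) ≠ 0 := by exact_mod_cast h.ne'
  rw [gradConst]
  simp only [sub_self, zpow_zero, one_zpow, Units.val_one, mul_one]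
  have h1 : (∑ a : Fin (n j), ((a : ℕ) : ℂ)) * 2 = n j * (n j - 1) := by
    rw [Fin.sum_univ_eq_sum_range (fun a => (a : ℂ))]
    have := Finset.sum_range_id_mul_two (n j)
    have h2 : ((∑ i ∈ Finset.range (n j), i : ℕ) : ℂ) * 2 = ((n j * (n j - 1) : ℕ) : ℂ) := by
      exact_mod_cast this
    rw [Nat.cast_mul, Nat.cast_sub h] at h2
    simpa using h2
  field_simp
  linear_combination -h1

theorem gradConst_of_one (j : Fin s) (k l : Fin (n j)) (h : n j = 1) : gradConst p j k l = 0 := by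
  rw [gradConst, Finset.sum_eq_zero, mul_zero]
  intro a _
  have : (a : ℕ) = 0 := by have := a.2; omega
  rw [this]; simp

/-- A formal gauge from the system `𝒜 = u A` to the bare system, on the index set of the blocks. -/
structure LocalGauge (r : ℕ) (t : Fin s → ℕ → ℂ)
    (𝒜 Y Yi : Matrix (Σ j : Fin s, Fin (n j)) (Σ j : Fin s, Fin (n j)) (LaurentSeries ℂ)) : Prop where
  lb : ∀ a b, LB 0 (Y a b)
  lb_inv : ∀ a b, LB 0 (Yi a b)
  inv_mul : Yi * Y = 1
  eq : 𝒜 * Y = Y * bareM p n r t + (HahnSeries.C (sgn p : ℂ) : LaurentSeries ℂ) • Y.map euler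

/-- The perturbation of the bare system in the eigenframe. -/
noncomputable def pert (a : Matrix (Σ j : Fin s, Fin (n j)) (Σ j : Fin s, Fin (n j)) (LaurentSeries ℂ)) :
    Matrix (Σ j : Fin s, Fin (n j)) (Σ j : Fin s, Fin (n j)) (LaurentSeries ℂ) :=
  (HahnSeries.C (sgn p : ℂ) : LaurentSeries ℂ) • toFrame p hn a + gradPart p hn

variable {p} {r : ℕ} {t : Fin s → ℕ → ℂ}
  {𝒜 Y Yi : Matrix (Σ j : Fin s, Fin (n j)) (Σ j : Fin s, Fin (n j)) (LaurentSeries ℂ)}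

theorem LocalGauge.mul_inv (G : LocalGauge p r t 𝒜 Y Yi) : Y * Yi = 1 :=
  mul_eq_one_comm.mp G.inv_mul

/-- The Euler derivation kills constant terms. This gain of one order is the source of all later
estimates. -/
theorem LocalGauge.lb_log (G : LocalGauge p r t 𝒜 Y Yi) (x y) : LB 1 ((Yi * Y.map euler) x y) := by
  refine LB.matrix_mul (b := 0) (c := 1) G.lb_inv (fun a b => ?_) x y
  intro k hk
  rw [Matrix.map_apply, coeff_euler]
  rcases eq_or_ne k 0 with rfl | hk0
  · simp
  · rw [G.lb a b k (by omega), mul_zero]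

/-- The gauge equation read as a similarity of matrices: both derivative terms, of `Y` and of the
frame, become part of the perturbation. This passes from the connection to its spectral curve. -/
theorem LocalGauge.conj (G : LocalGauge p r t 𝒜 Y Yi) :
    𝒜.map (cov hn) * (Y.map (cov hn) * frame p hn) = (Y.map (cov hn) * frame p hn) *
      (Matrix.diagonal (bareEig hn r t) + pert p hn (Yi * Y.map euler)) := by
  have h1 := congrArg (fun X => X.map (cov hn)) G.eq
  have h2 : ∀ (c : ℂ) (X : Matrix (Σ j : Fin s, Fin (n j)) (Σ j : Fin s, Fin (n j)) (LaurentSeries ℂ)),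
      ((HahnSeries.C c : LaurentSeries ℂ) • X).map (cov hn) =
        (HahnSeries.C c : LaurentSeries ℂ) • X.map (cov hn) := fun c X => by
    refine Matrix.ext fun a b => ?_
    exact (map_mul (cov hn) _ _).trans (by rw [cov, ramify_C]; rfl)
  simp only [Matrix.map_mul, Matrix.map_add _ (map_add (cov hn)), h2] at h1
  have hY : Y.map (cov hn) * Yi.map (cov hn) = 1 := by
    rw [← Matrix.map_mul, G.mul_inv, Matrix.map_one _ (map_zero _) (map_one _)]
  have e1 : Y.map (cov hn) * frame p hn * toFrame p hn (Yi * Y.map euler) =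
      (Y.map euler).map (cov hn) * frame p hn := by
    rw [toFrame, Matrix.map_mul]
    calc _ = Y.map (cov hn) * (frame p hn * frameInv p hn) * (Yi.map (cov hn) *
          (Y.map euler).map (cov hn)) * frame p hn := by simp only [Matrix.mul_assoc]
      _ = (Y.map (cov hn) * Yi.map (cov hn)) * (Y.map euler).map (cov hn) * frame p hn := by
          rw [frame_mul_frameInv, Matrix.mul_one]; simp only [Matrix.mul_assoc]
      _ = _ := by rw [hY, Matrix.one_mul]
  have e2 : Y.map (cov hn) * frame p hn * gradPart p hn =
      Y.map (cov hn) * ((HahnSeries.C (sgn p : ℂ) : LaurentSeries ℂ) •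
        (frame p hn).map (covEuler n)) := by
    rw [gradPart, laurent_mul_smul, laurent_mul_smul, Matrix.mul_assoc,
      ← Matrix.mul_assoc (frame p hn), frame_mul_frameInv, Matrix.one_mul]
  rw [← Matrix.mul_assoc, h1, Matrix.mul_add, pert, Matrix.mul_add, laurent_mul_smul, e1, e2,
    Matrix.add_mul, Matrix.mul_assoc, bareM_mul_frame, Matrix.mul_add, laurent_smul_mul,
    ← Matrix.mul_assoc]
  abel

theorem LB.pert_ne {a : Matrix (Σ j : Fin s, Fin (n j)) (Σ j : Fin s, Fin (n j)) (LaurentSeries ℂ)}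
    (ha : ∀ x y, LB 1 (a x y)) {x y : Σ j : Fin s, Fin (n j)} (h : x.1 ≠ y.1) :
    LB (min (ram n x.1 : ℤ) (ram n y.1)) (pert p hn a x y) := by
  have h1 := LB.toFrame p hn ha x y
  rw [sub_self, zero_mul, zero_add] at h1
  obtain ⟨i, k⟩ := x
  obtain ⟨j, l⟩ := y
  rw [pert, Matrix.add_apply, Matrix.smul_apply, smul_eq_mul, gradPart_apply_ne p hn h, add_zero]
  exact (LB.C _).mul_of_le h1 (zero_add _).ge

theorem LB.toFrame_of_one {a : Matrix (Σ j : Fin s, Fin (n j)) (Σ j : Fin s, Fin (n j)) (LaurentSeries ℂ)}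
    (ha : ∀ x y, LB 1 (a x y)) (j : Fin s) (k l : Fin (n j)) :
    LB (ram n j) (MinRes.toFrame p hn a ⟨j, k⟩ ⟨j, l⟩) := by
  have h1 := LB.toFrame p hn ha ⟨j, k⟩ ⟨j, l⟩
  rwa [sub_self, zero_mul, zero_add, min_self] at h1

theorem pert_apply_eq (a : Matrix (Σ j : Fin s, Fin (n j)) (Σ j : Fin s, Fin (n j)) (LaurentSeries ℂ))
    (j : Fin s) (k l : Fin (n j)) : pert p hn a ⟨j, k⟩ ⟨j, l⟩ =
      HahnSeries.C (sgn p : ℂ) * toFrame p hn a ⟨j, k⟩ ⟨j, l⟩ +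
        HahnSeries.C (gradConst p j k l) := by
  rw [pert, Matrix.add_apply, Matrix.smul_apply, smul_eq_mul, gradPart_apply_eq]

/-- Inside a block the perturbation starts with the constants `gradConst`, which vanish only for
blocks of size one. Between different blocks they are absent (`LB.pert_ne`). -/
theorem LB.pert_eq {a : Matrix (Σ j : Fin s, Fin (n j)) (Σ j : Fin s, Fin (n j)) (LaurentSeries ℂ)}
    (ha : ∀ x y, LB 1 (a x y)) {x y : Σ j : Fin s, Fin (n j)} (h : x.1 = y.1) :
    LB (if n x.1 = 1 then 1 else 0) (pert p hn a x y) := by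
  obtain ⟨i, k⟩ := x
  obtain ⟨j, l⟩ := y
  obtain rfl : i = j := h
  have h1 := LB.toFrame_of_one (p := p) hn ha i k l
  have h2 := ram_pos hn i
  rw [pert_apply_eq]
  split_ifs with h3
  · rw [gradConst_of_one p i k l h3, map_zero, add_zero]
    exact (LB.C _).mul_of_le h1 (by omega)
  · exact ((LB.C _).mul_of_le h1 (by omega)).add (LB.C _)

/-- The gaps between the exponents dominate the perturbation, so `exists_eigenvector` applies at
every `l`. The precise orders of the off-diagonal entries are recorded because the expansion of the
eigenvalue is needed up to order `r N`. -/
theorem LocalGauge.exists_eigenframe (G : LocalGauge p r t 𝒜 Y Yi) (hr : 0 < r)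
    (hgen : GenericTimes n r t) :
    ∃ (y : (Σ j : Fin s, Fin (n j)) → LaurentSeries ℂ)
      (g : Matrix (Σ j : Fin s, Fin (n j)) (Σ j : Fin s, Fin (n j)) (LaurentSeries ℂ)),
      (∀ l, g l l = 1) ∧
      (∀ m l, m ≠ l → LB (if m.1 = l.1 then r * coverDeg n - ram n l.1 else r * coverDeg n)
        (g m l)) ∧
      (Matrix.diagonal (bareEig hn r t) + pert p hn (Yi * Y.map euler)) * g =
        g * Matrix.diagonal y := by
  set P := pert p hn (Yi * Y.map euler) with hP
  set E := bareEig hn r t with hE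
  have hN : 0 < coverDeg n := coverDeg_pos hn
  have hR : (coverDeg n : ℤ) ≤ r * coverDeg n := by nlinarith
  set R : ℤ := r * coverDeg n with hRdef
  have hfact : ∀ j, (1 : ℤ) ≤ ram n j ∧ (ram n j : ℤ) ≤ R ∧ (2 ≤ n j → 2 * (ram n j : ℤ) ≤ R) := by
    intro j
    have h1 := ram_pos hn j
    have h2 := ram_le hn j
    refine ⟨by omega, by omega, fun h => ?_⟩
    have := two_mul_ram_le h
    omega
  have htwo : ∀ x y : Σ j : Fin s, Fin (n j), x ≠ y → x.1 = y.1 → 2 ≤ n x.1 := by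
    rintro ⟨i, k⟩ ⟨j, l⟩ h1 h2
    obtain rfl : i = j := h2
    by_contra! hlt
    simp only at hlt
    have := k.2; have := l.2
    exact h1 (by rw [Fin.ext (show (k : ℕ) = l by omega)])
  have key : ∀ l, ∃ q : (Σ j : Fin s, Fin (n j)) → LaurentSeries ℂ, q l = 1 ∧
      (∀ m ≠ l, LB (if m.1 = l.1 then R - ram n l.1 else R) (q m)) ∧
      ∀ m, E m * q m + ∑ k, P m k * q k = (E l + ∑ k, P l k * q k) * q m := by
    intro l
    have hdiff : ∀ m ≠ l, LB (R - min (ram n m.1 : ℤ) (ram n l.1)) (E m - E l)⁻¹ := by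
      intro m hm
      obtain ⟨d, hd, hne⟩ := hgen.exists_coeff_ne hn hr hm
      exact (LB.inv hne).mono (by omega)
    -- The weights are the orders predicted by first order perturbation theory, coupling over gap.
    -- Inside the block of `l` the coupling may be constant. Towards another block it has at least
    -- the order `min ram` by which the inverse gap falls short of `R`. The remaining inequalities
    -- rest on `2 ram ≤ R` for blocks of size at least two.
    refine exists_eigenvector E P l ?_ (fun m => R - min (ram n m.1 : ℤ) (ram n l.1))
      (fun m => if m.1 = l.1 then R - ram n l.1 else R)
      (fun x y => if x.1 = y.1 then (if n x.1 = 1 then 1 else 0) else min (ram n x.1 : ℤ) (ram n y.1))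
      hdiff ?_ ?_ ?_ ?_ ?_
    · intro m hm he
      obtain ⟨d, hd, hne⟩ := hgen.exists_coeff_ne hn hr hm
      exact hne (by rw [← hE, he, sub_self, coeff_zero])
    · intro x y
      split_ifs with h1 h2
      · have := LB.pert_eq (p := p) hn G.lb_log h1
        rwa [if_pos h2] at this
      · have := LB.pert_eq (p := p) hn G.lb_log h1
        rwa [if_neg h2] at this
      · exact LB.pert_ne hn G.lb_log h1
    · intro m hm
      have f1 := hfact m.1
      have f2 := hfact l.1
      by_cases h1 : m.1 = l.1
      · have := htwo m l hm h1
        simp only [h1, if_true]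
        split_ifs <;> omega
      · simp only [h1, if_false]; omega
    · intro m hm k hk
      have f1 := hfact m.1
      have f2 := hfact l.1
      have f3 := hfact k.1
      have n1 := hn m.1
      by_cases h1 : m.1 = l.1
      · have t1 := htwo m l hm h1
        rw [h1] at t1
        by_cases h2 : k.1 = l.1
        · simp only [h1, h2, if_true, min_self]; split_ifs <;> omega
        · have h3 : l.1 ≠ k.1 := fun h => h2 h.symm
          simp only [h1, h2, h3, if_true, if_false, min_self]; omega
      · by_cases h2 : k.1 = l.1
        · have t2 := htwo k l hk h2
          rw [h2] at t2
          simp only [h1, h2, if_true, if_false]; omega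
        · by_cases h3 : m.1 = k.1
          · rw [← h3] at h2 f3 ⊢
            simp only [h1, if_true, if_false]; split_ifs <;> omega
          · simp only [h1, h2, h3, if_false]; omega
    · intro m hm
      have f1 := hfact m.1
      have f2 := hfact l.1
      have n1 := hn l.1
      simp only [if_true]
      split_ifs <;> omega
    · intro m hm k hk
      have f1 := hfact m.1
      have f2 := hfact l.1
      have f3 := hfact k.1
      by_cases h2 : k.1 = l.1
      · have t2 := htwo k l hk h2
        rw [h2] at t2
        simp only [h2, if_true]; split_ifs <;> omega
      · have h3 : l.1 ≠ k.1 := fun h => h2 h.symm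
        simp only [h2, h3, if_false]; omega
  choose q hq1 hq2 hq3 using key
  refine ⟨fun l => E l + ∑ k, P l k * q l k, Matrix.of fun m l => q l m, fun l => hq1 l,
    fun m l h => hq2 l m h, Matrix.ext fun m l => ?_⟩
  rw [Matrix.add_mul, Matrix.add_apply, Matrix.diagonal_mul, Matrix.mul_diagonal, Matrix.mul_apply]
  simp only [Matrix.of_apply]
  rw [hq3 l m, mul_comm]

end LocalGauge

/-! ### Eigenvalues of the system and expansion of the spectral branches -/

section SpectralBranch

variable {s : ℕ} {n : Fin s → ℕ} {ι : Type*} (p : Option ι) (hn : ∀ j, 0 < n j)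

/-- The `J`-th power of `𝓗` in the block `j`. -/
noncomputable def blockH (n : Fin s → ℕ) (j : Fin s) (J : ℕ) :
    Matrix (Σ j : Fin s, Fin (n j)) (Σ j : Fin s, Fin (n j)) (LaurentSeries ℂ) :=
  Matrix.blockDiagonal' (Pi.single j (bareH p (n j) ^ J))

theorem blockH_mul_frame (j : Fin s) (J : ℕ) : (blockH p n j J).map (cov hn) * frame p hn =
    frame p hn * Matrix.diagonal (fun x => if x.1 = j then mu hn x ^ J else 0) := by
  refine Matrix.ext fun ⟨i, a⟩ ⟨m, k⟩ => ?_
  rw [blockH, blockDiagonal'_map', bareH_block_mul_frame, Matrix.mul_diagonal, frame_apply]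
  by_cases him : i = m
  swap
  · simp [him]
  subst him
  simp only [if_true]
  by_cases hij : i = j
  · subst hij
    simp only [Pi.single_eq_same, if_true]
    rw [bareH_pow_cov_mulVec p hn, mul_comm]
  · simp [hij]

theorem toFrame_blockH (j : Fin s) (J : ℕ) : toFrame p hn (blockH p n j J) =
    Matrix.diagonal (fun x => if x.1 = j then mu hn x ^ J else 0) := by
  rw [toFrame, Matrix.mul_assoc, blockH_mul_frame, ← Matrix.mul_assoc, frameInv_mul_frame,
    Matrix.one_mul]

theorem toFrame_mul
    (a b : Matrix (Σ j : Fin s, Fin (n j)) (Σ j : Fin s, Fin (n j)) (LaurentSeries ℂ)) :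
    toFrame p hn (a * b) = toFrame p hn a * toFrame p hn b := by
  simp only [toFrame, Matrix.map_mul, Matrix.mul_assoc]
  rw [← Matrix.mul_assoc (frame p hn) (frameInv p hn), frame_mul_frameInv, Matrix.one_mul]

theorem toFrame_add
    (a b : Matrix (Σ j : Fin s, Fin (n j)) (Σ j : Fin s, Fin (n j)) (LaurentSeries ℂ)) :
    toFrame p hn (a + b) = toFrame p hn a + toFrame p hn b := by
  simp only [toFrame, Matrix.map_add _ (map_add (cov hn)), Matrix.mul_add, Matrix.add_mul]

theorem coeff_zero_cov (f : LaurentSeries ℂ) : (cov hn f).coeff 0 = f.coeff 0 := by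
  have := coeff_ramify_mul (coverDeg n) (coverDeg_pos hn) f 0
  rwa [mul_zero] at this

theorem trace_toFrame
    (a : Matrix (Σ j : Fin s, Fin (n j)) (Σ j : Fin s, Fin (n j)) (LaurentSeries ℂ)) :
    (toFrame p hn a).trace = cov hn a.trace := by
  rw [toFrame, Matrix.trace_mul_comm, ← Matrix.mul_assoc, frame_mul_frameInv, Matrix.one_mul]
  simp [Matrix.trace, map_sum]

theorem coeff_zero_twist (η : ℂˣ) (f : LaurentSeries ℂ) : (twist η f).coeff 0 = f.coeff 0 := by
  simp

theorem coeff_zero_mu_mul (j : Fin s) (J : ℕ) (f : LaurentSeries ℂ) :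
    (mu hn ⟨j, ⟨0, hn j⟩⟩ ^ J * f).coeff 0 = f.coeff (ram n j * J) := by
  rw [mu_eq_single, single_pow, coeff_single_mul]
  simp [mul_comm]

/-- In the eigenframe `𝓗^J` is diagonal and the `n` diagonal entries of `a` in the block are
conjugate. The trace is therefore `n` times one term, which extracts a single coefficient of the
first diagonal entry. -/
theorem coeff_zero_trace_blockH_mul
    (a : Matrix (Σ j : Fin s, Fin (n j)) (Σ j : Fin s, Fin (n j)) (LaurentSeries ℂ))
    (j : Fin s) (J : ℕ) : (blockH p n j J * a).trace.coeff 0 =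
      n j * (toFrame p hn a ⟨j, ⟨0, hn j⟩⟩ ⟨j, ⟨0, hn j⟩⟩).coeff (ram n j * J) := by
  rw [← coeff_zero_cov hn, ← trace_toFrame p, toFrame_mul, toFrame_blockH, Matrix.trace,
    Fintype.sum_sigma, Finset.sum_eq_single j]
  · simp only [Matrix.diag_apply, Matrix.diagonal_mul, if_true]
    rw [coeff_sum, Finset.sum_congr rfl (g := fun _ => (toFrame p hn a ⟨j, ⟨0, hn j⟩⟩
      ⟨j, ⟨0, hn j⟩⟩).coeff (ram n j * J))]
    · simp
    · intro k _
      rw [← twist_mu hn j k, ← twist_toFrame_diag p hn a j k, ← map_pow, ← map_mul,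
        coeff_zero_twist, coeff_zero_mu_mul]
  · intro i _ hi
    simp [hi]
  · simp

/-- Eigenvalues and eigenvectors of a perturbation of the bare system in the eigenframe. -/
structure IsEigenframe (r : ℕ) (t : Fin s → ℕ → ℂ)
    (a : Matrix (Σ j : Fin s, Fin (n j)) (Σ j : Fin s, Fin (n j)) (LaurentSeries ℂ))
    (y : (Σ j : Fin s, Fin (n j)) → LaurentSeries ℂ)
    (g : Matrix (Σ j : Fin s, Fin (n j)) (Σ j : Fin s, Fin (n j)) (LaurentSeries ℂ)) : Prop where
  lb : ∀ x y, LB 1 (a x y)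
  diag : ∀ l, g l l = 1
  off : ∀ m l, m ≠ l → LB (if m.1 = l.1 then r * coverDeg n - ram n l.1 else r * coverDeg n) (g m l)
  eq : (Matrix.diagonal (bareEig hn r t) + pert p hn a) * g = g * Matrix.diagonal y

variable {p hn} {r : ℕ} {t : Fin s → ℕ → ℂ}
  {a : Matrix (Σ j : Fin s, Fin (n j)) (Σ j : Fin s, Fin (n j)) (LaurentSeries ℂ)}
  {y : (Σ j : Fin s, Fin (n j)) → LaurentSeries ℂ}
  {g : Matrix (Σ j : Fin s, Fin (n j)) (Σ j : Fin s, Fin (n j)) (LaurentSeries ℂ)}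

theorem two_le_of_ne {x y : Σ j : Fin s, Fin (n j)} (h1 : x ≠ y) (h2 : x.1 = y.1) : 2 ≤ n x.1 := by
  obtain ⟨i, k⟩ := x
  obtain ⟨j, l⟩ := y
  obtain rfl : i = j := h2
  by_contra! hlt
  simp only at hlt
  have := k.2; have := l.2
  exact h1 (by rw [Fin.ext (show (k : ℕ) = l by omega)])

theorem rank_facts (hn : ∀ j, 0 < n j) (hr : 0 < r) (j : Fin s) :
    (1 : ℤ) ≤ ram n j ∧ (ram n j : ℤ) ≤ r * coverDeg n ∧
      (2 ≤ n j → 2 * (ram n j : ℤ) ≤ r * coverDeg n) ∧ (n j = 1 → (ram n j : ℤ) = coverDeg n) ∧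
      (coverDeg n : ℤ) ≤ r * coverDeg n := by
  have h1 := ram_pos hn j
  have h2 := ram_le hn j
  have hR : (coverDeg n : ℤ) ≤ r * coverDeg n := by
    have := coverDeg_pos hn
    nlinarith
  refine ⟨by omega, by omega, fun h => ?_, fun h => ?_, hR⟩
  · have := two_mul_ram_le h
    omega
  · have := mul_ram n j
    rw [h, one_mul] at this
    omega

namespace IsEigenframe

theorem sub_one (F : IsEigenframe p hn r t a y g) (hr : 0 < r) (x z) : LB 1 ((g - 1) x z) := by
  rw [Matrix.sub_apply, Matrix.one_apply]
  split_ifs with h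
  · subst h; rw [F.diag, sub_self]; exact LB.zero 1
  · rw [sub_zero]
    refine (F.off x z h).mono ?_
    have f := rank_facts hn hr z.1
    split_ifs with h1
    · have := two_le_of_ne h h1
      rw [h1] at this
      omega
    · omega

/-- The part of the eigenvalue of second order in the perturbation. -/
theorem eigenvalue_eq (F : IsEigenframe p hn r t a y g) (l) : y l = bareEig hn r t l +
    pert p hn a l l + ∑ k ∈ Finset.univ.erase l, pert p hn a l k * g k l := by
  have h := congrFun (congrFun F.eq l) l
  rw [Matrix.add_mul, Matrix.add_apply, Matrix.diagonal_mul, Matrix.mul_diagonal, F.diag, mul_one,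
    one_mul, Matrix.mul_apply, ← Finset.add_sum_erase _ _ (Finset.mem_univ l), F.diag, mul_one] at h
  rw [← h]
  ring

theorem term_same (F : IsEigenframe p hn r t a y g) {k l : Σ j : Fin s, Fin (n j)}
    (hkl : k ≠ l) (h : k.1 = l.1) : LB (r * coverDeg n - ram n l.1) (pert p hn a l k * g k l) := by
  have h1 := F.off k l hkl
  rw [if_pos h] at h1
  have h2 := LB.pert_eq (p := p) hn F.lb h.symm
  refine (h2.mono (b := 0) ?_).mul_of_le h1 (by omega)
  split_ifs <;> omega

theorem term_cross (F : IsEigenframe p hn r t a y g) {k l m : Σ j : Fin s, Fin (n j)}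
    (h : l.1 = m.1) (h' : k.1 ≠ l.1) : LB (r * coverDeg n + 1) (pert p hn a m k * g k l) := by
  have h1 := F.off k l (fun e => h' (by rw [e]))
  rw [if_neg h'] at h1
  refine ((LB.pert_ne (p := p) hn F.lb (show m.1 ≠ k.1 by rw [← h]; exact h'.symm)).mono
    (b := 1) ?_).mul_of_le h1 (by omega)
  have := ram_pos hn m.1
  have := ram_pos hn k.1
  omega

/-- Only entries inside the block matter up to order `r N`; the contributions of other blocks begin
beyond it (`term_cross`). -/
theorem second_order (F : IsEigenframe p hn r t a y g) (l) :
    LB (if n l.1 = 1 then r * coverDeg n + 1 else r * coverDeg n - ram n l.1)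
      (∑ k ∈ Finset.univ.erase l, pert p hn a l k * g k l) := by
  refine LB.sum fun k hk => ?_
  have hkl := Finset.ne_of_mem_erase hk
  by_cases h : k.1 = l.1
  · have := two_le_of_ne hkl h
    rw [if_neg (by rw [← h]; omega)]
    exact F.term_same hkl h
  · refine (F.term_cross rfl h).mono ?_
    split_ifs <;> omega

theorem sub_bareEig (F : IsEigenframe p hn r t a y g) (hr : 0 < r) (l) :
    LB (if n l.1 = 1 then 1 else 0) (y l - bareEig hn r t l) := by
  rw [F.eigenvalue_eq l]
  have e : ∀ A B C : LaurentSeries ℂ, A + B + C - A = B + C := fun A B C => by ring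
  rw [e]
  refine (LB.pert_eq (p := p) hn F.lb rfl).add ((F.second_order l).mono ?_)
  have := rank_facts hn hr l.1
  have := hn l.1
  split_ifs <;> omega

theorem close (F : IsEigenframe p hn r t a y g) (hr : 0 < r) (l) :
    LB (-(r * coverDeg n) + ram n l.1 + 1) (y l - bareEig hn r t l) := by
  refine (F.sub_bareEig hr l).mono ?_
  have := rank_facts hn hr l.1
  have := hn l.1
  split_ifs <;> omega

/-- An eigenvalue differs from its own exponent only after the order at which distinct exponents
separate, so its initial terms identify it. -/
theorem eq_of_close (F : IsEigenframe p hn r t a y g) (hr : 0 < r) (hgen : GenericTimes n r t)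
    {l m} (h : LB (-(r * coverDeg n) + ram n l.1 + 1) (y m - bareEig hn r t l)) : m = l := by
  by_contra hne
  obtain ⟨d, hd, hc⟩ := hgen.exists_coeff_ne hn hr hne
  apply hc
  have e : bareEig hn r t m - bareEig hn r t l =
      (y m - bareEig hn r t l) - (y m - bareEig hn r t m) := by ring
  rw [e, coeff_sub, h d (by omega), F.sub_bareEig hr m d, sub_zero]
  have := rank_facts hn hr m.1
  have := hn m.1
  split_ifs <;> omega

variable {𝒜 Y Yi : Matrix (Σ j : Fin s, Fin (n j)) (Σ j : Fin s, Fin (n j)) (LaurentSeries ℂ)}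

/-- The eigenframe is congruent to the identity modulo `σ`, hence invertible. The system is thus
diagonalized on the cover and the characteristic polynomial splits with exactly these roots. -/
theorem isRoot_iff (F : IsEigenframe p hn r t (Yi * Y.map euler) y g) (hr : 0 < r)
    (G : LocalGauge p r t 𝒜 Y Yi) (x : LaurentSeries ℂ) :
    (𝒜.map (cov hn)).charpoly.IsRoot x ↔ ∃ l, x = y l := by
  set W := Y.map (cov hn) * frame p hn * g with hW
  have h1 : 𝒜.map (cov hn) * W = W * Matrix.diagonal y := by
    rw [hW, ← Matrix.mul_assoc, G.conj hn, Matrix.mul_assoc, F.eq, ← Matrix.mul_assoc]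
  have hg : IsUnit g := by
    obtain ⟨h2, h3⟩ := det_coeff_zero_of_sub_one (F.sub_one hr)
    exact (Matrix.isUnit_iff_isUnit_det g).mpr (exists_inverse_of_coeff_zero h2 h3).1.isUnit
  have hYu : IsUnit (Y.map (cov hn)) := by
    refine IsUnit.of_mul_eq_one (Yi.map (cov hn)) ?_
    rw [← Matrix.map_mul, G.mul_inv, Matrix.map_one _ (map_zero _) (map_one _)]
  have hS : IsUnit (frame p hn) := IsUnit.of_mul_eq_one _ (frame_mul_frameInv p hn)
  obtain ⟨u, hu⟩ : IsUnit W := (hYu.mul hS).mul hg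
  have h2 : 𝒜.map (cov hn) = u.val * Matrix.diagonal y * (u⁻¹).val := by
    rw [hu, ← h1, ← hu, Matrix.mul_assoc, Units.mul_inv, Matrix.mul_one]
  rw [h2, Matrix.charpoly_mul_comm, ← Matrix.mul_assoc, Units.inv_mul, Matrix.one_mul,
    Matrix.charpoly_diagonal, Polynomial.isRoot_prod]
  simp only [Polynomial.root_X_sub_C, Finset.mem_univ, true_and]
  exact ⟨fun ⟨l, hl⟩ => ⟨l, hl.symm⟩, fun ⟨l, hl⟩ => ⟨l, hl.symm⟩⟩

theorem eq_of_isRoot (F : IsEigenframe p hn r t (Yi * Y.map euler) y g) (hr : 0 < r)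
    (hgen : GenericTimes n r t) (G : LocalGauge p r t 𝒜 Y Yi) {x : LaurentSeries ℂ} {l}
    (hx : (𝒜.map (cov hn)).charpoly.IsRoot x)
    (h : LB (-(r * coverDeg n) + ram n l.1 + 1) (x - bareEig hn r t l)) : x = y l := by
  obtain ⟨m, rfl⟩ := (F.isRoot_iff hr G x).mp hx
  rw [F.eq_of_close hr hgen h]

theorem isRoot_twist (𝒜 : Matrix (Σ j : Fin s, Fin (n j)) (Σ j : Fin s, Fin (n j)) (LaurentSeries ℂ))
    {x : LaurentSeries ℂ} (hx : (𝒜.map (cov hn)).charpoly.IsRoot x) (k : ℕ) :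
    (𝒜.map (cov hn)).charpoly.IsRoot (twist (rootOfCover n ^ k) x) := by
  have h1 := hx.map (f := twist (rootOfCover n ^ k))
  rw [← Matrix.charpoly_map] at h1
  have : (𝒜.map (cov hn)).map (twist (rootOfCover n ^ k)) = 𝒜.map (cov hn) := by
    refine Matrix.ext fun a b => ?_
    simp only [Matrix.map_apply, twist_cov]
  rwa [this] at h1

/-- A deck transformation maps roots to roots and exponents to exponents, and a root is determined
by its closeness to an exponent. -/
theorem twist_eigenvalue (F : IsEigenframe p hn r t (Yi * Y.map euler) y g) (hr : 0 < r)
    (hgen : GenericTimes n r t) (G : LocalGauge p r t 𝒜 Y Yi) (j : Fin s) (k : Fin (n j)) :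
    twist (rootOfCover n ^ (k : ℕ)) (y ⟨j, ⟨0, hn j⟩⟩) = y ⟨j, k⟩ := by
  refine F.eq_of_isRoot hr hgen G (isRoot_twist 𝒜 ((F.isRoot_iff hr G _).mpr ⟨_, rfl⟩) _) ?_
  have e : bareEig hn r t ⟨j, k⟩ =
      twist (rootOfCover n ^ (k : ℕ)) (bareEig hn r t ⟨j, ⟨0, hn j⟩⟩) := by
    simp only [bareEig, pow_zero]
    congr 1
    ext i
    simp
  rw [e, ← map_sub]
  exact (F.close hr ⟨j, ⟨0, hn j⟩⟩).twist _

/-- The same rigidity shows that the root is fixed by the deck transformations of the cover over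
`ξ_j`; only powers of `σ^ram` survive, so the root is a series in `ξ_j`. -/
theorem exists_branch_eq (F : IsEigenframe p hn r t (Yi * Y.map euler) y g) (hr : 0 < r)
    (hgen : GenericTimes n r t) (G : LocalGauge p r t 𝒜 Y Yi) (j : Fin s) :
    ∃ z, branch hn j z = y ⟨j, ⟨0, hn j⟩⟩ := by
  have h : twist (rootOfCover n ^ n j) (y ⟨j, ⟨0, hn j⟩⟩) = y ⟨j, ⟨0, hn j⟩⟩ := by
    refine F.eq_of_isRoot hr hgen G (isRoot_twist 𝒜 ((F.isRoot_iff hr G _).mpr ⟨_, rfl⟩) _) ?_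
    have e : bareEig hn r t ⟨j, ⟨0, hn j⟩⟩ =
        twist (rootOfCover n ^ n j) (bareEig hn r t ⟨j, ⟨0, hn j⟩⟩) := by
      have e1 : bareEig hn r t ⟨j, ⟨0, hn j⟩⟩ = branch hn j (branchExp n r t j) := by
        simp only [bareEig, pow_zero]
        ext i
        simp
      rw [e1, twist_branch]
    rw [e, ← map_sub]
    exact (F.close hr _).twist _
  refine exists_ramify_eq (ram_pos hn j) fun k hk => ?_
  have h1 := congrArg (fun f => f.coeff k) h
  simp only [coeff_twist] at h1
  by_contra hne
  have h2 : ((rootOfCover n ^ n j) ^ k : ℂˣ) = 1 := Units.ext (by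
    simpa using mul_right_cancel₀ hne (h1.trans (one_mul _).symm))
  rw [← zpow_natCast, ← zpow_mul, (rootOfCover_isPrimitiveRoot hn).zpow_eq_one_iff_dvd,
    ← mul_ram n j, Nat.cast_mul] at h2
  exact hk (Int.dvd_of_mul_dvd_mul_left (by exact_mod_cast (hn j).ne') h2)

/-- At order `r N` the second order terms of the individual eigenvalues need not vanish, but their
sum over a block does. The diagonal block of the eigenframe conjugates the block of the system to
its eigenvalues up to the error `Z` of order `r N + 1`, and traces are invariant under conjugation.
-/
theorem coeff_block_trace (F : IsEigenframe p hn r t a y g) (hr : 0 < r) (j : Fin s) :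
    ∑ k, (y ⟨j, k⟩).coeff (r * coverDeg n) =
      ∑ k, (bareEig hn r t ⟨j, k⟩ + pert p hn a ⟨j, k⟩ ⟨j, k⟩).coeff (r * coverDeg n) := by
  set gb : Matrix (Fin (n j)) (Fin (n j)) (LaurentSeries ℂ) :=
    Matrix.of fun k l => g ⟨j, k⟩ ⟨j, l⟩ with hgb
  set Pb : Matrix (Fin (n j)) (Fin (n j)) (LaurentSeries ℂ) :=
    Matrix.diagonal (fun k => bareEig hn r t ⟨j, k⟩) +
      Matrix.of fun k l => pert p hn a ⟨j, k⟩ ⟨j, l⟩ with hPb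
  set Z : Matrix (Fin (n j)) (Fin (n j)) (LaurentSeries ℂ) := Matrix.of fun k l =>
    ∑ i ∈ Finset.univ.erase j, ∑ m, pert p hn a ⟨j, k⟩ ⟨i, m⟩ * g ⟨i, m⟩ ⟨j, l⟩ with hZ
  have hsub : ∀ k l, LB 1 ((gb - 1) k l) := by
    intro k l
    have := F.sub_one hr ⟨j, k⟩ ⟨j, l⟩
    rw [Matrix.sub_apply, Matrix.one_apply] at this ⊢
    simpa [hgb] using this
  obtain ⟨h1, h2⟩ := det_coeff_zero_of_sub_one hsub
  obtain ⟨-, h3, h4, h5⟩ := exists_inverse_of_coeff_zero h1 h2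
  have heq : Pb * gb + Z = gb * Matrix.diagonal (fun k => y ⟨j, k⟩) := by
    refine Matrix.ext fun k l => ?_
    have h := congrFun (congrFun F.eq ⟨j, k⟩) ⟨j, l⟩
    rw [Matrix.add_mul, Matrix.add_apply, Matrix.diagonal_mul, Matrix.mul_diagonal, Matrix.mul_apply,
      Fintype.sum_sigma, ← Finset.add_sum_erase _ _ (Finset.mem_univ j)] at h
    rw [Matrix.add_apply, hPb, Matrix.add_mul, Matrix.add_apply, Matrix.diagonal_mul,
      Matrix.mul_diagonal, Matrix.mul_apply]
    simp only [hgb, hZ, Matrix.of_apply]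
    rw [← h]
    ring
  have hZlb : ∀ k l, LB (r * coverDeg n + 1) (Z k l) := by
    intro k l
    rw [hZ, Matrix.of_apply]
    refine LB.sum fun i hi => LB.sum fun m _ => ?_
    exact F.term_cross (k := ⟨i, m⟩) (l := ⟨j, l⟩) (m := ⟨j, k⟩) rfl (Finset.ne_of_mem_erase hi)
  have htr : (∑ k, y ⟨j, k⟩) = Pb.trace + (Z * gb⁻¹).trace := by
    have e1 := congrArg (fun X => (X * gb⁻¹).trace) heq
    simp only [Matrix.add_mul, Matrix.trace_add] at e1
    rw [Matrix.mul_assoc Pb, h3, Matrix.mul_one,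
      Matrix.trace_mul_comm (gb * _), ← Matrix.mul_assoc, h4,
      Matrix.one_mul, Matrix.trace_diagonal] at e1
    exact e1.symm
  have h6 : (Z * gb⁻¹).trace.coeff (r * coverDeg n) = 0 := by
    rw [Matrix.trace, coeff_sum]
    refine Finset.sum_eq_zero fun k _ => ?_
    exact LB.matrix_mul hZlb h5 k k _ (by omega)
  rw [← coeff_sum, htr, coeff_add, h6, add_zero, Matrix.trace, coeff_sum]
  simp [hPb]

/-- First order perturbation theory: the leading coefficient of the eigenvector is the constant
coupling divided by the leading coefficient of the gap, which inside a block is a difference of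
roots of unity times `t_{rn-1} / n`. -/
theorem coeff_offDiag (F : IsEigenframe p hn r t a y g) (hr : 0 < r) (hgen : GenericTimes n r t)
    (j : Fin s) {k l : Fin (n j)} (hkl : k ≠ l) :
    (g ⟨j, k⟩ ⟨j, l⟩).coeff (r * coverDeg n - ram n j) = gradConst p j k l * n j /
      (((((rootOfCover n ^ ram n j) ^ (l : ℕ) : ℂˣ) : ℂ) -
        (((rootOfCover n ^ ram n j) ^ (k : ℕ) : ℂˣ) : ℂ)) * t j (r * n j - 1)) := by
  have hne : (⟨j, k⟩ : Σ j : Fin s, Fin (n j)) ≠ ⟨j, l⟩ := by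
    intro h
    exact hkl (by simpa using h)
  have h2 : 2 ≤ n j := two_le_of_ne hne rfl
  have hf := rank_facts hn hr j
  have hn0 : (n j : ℂ) ≠ 0 := by exact_mod_cast (hn j).ne'
  have h := congrFun (congrFun F.eq ⟨j, k⟩) ⟨j, l⟩
  rw [Matrix.add_mul, Matrix.add_apply, Matrix.diagonal_mul, Matrix.mul_diagonal, Matrix.mul_apply,
    ← Finset.add_sum_erase _ _ (Finset.mem_univ (⟨j, l⟩ : Σ j : Fin s, Fin (n j))), F.diag,
    mul_one] at h
  have h' : g ⟨j, k⟩ ⟨j, l⟩ * (y ⟨j, l⟩ - bareEig hn r t ⟨j, k⟩) = pert p hn a ⟨j, k⟩ ⟨j, l⟩ +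
      ∑ m ∈ Finset.univ.erase ⟨j, l⟩, pert p hn a ⟨j, k⟩ m * g m ⟨j, l⟩ := by
    linear_combination -h
  have hg := F.off _ _ hne
  rw [if_pos rfl] at hg
  have hy : LB (-(r * coverDeg n) + ram n j) (y ⟨j, l⟩ - bareEig hn r t ⟨j, k⟩) := by
    have e : y ⟨j, l⟩ - bareEig hn r t ⟨j, k⟩ = (y ⟨j, l⟩ - bareEig hn r t ⟨j, l⟩) +
      (bareEig hn r t ⟨j, l⟩ - bareEig hn r t ⟨j, k⟩) := by ring
    rw [e]
    refine ((F.close hr ⟨j, l⟩).mono (by simp only; omega)).add fun i hi => ?_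
    rw [coeff_sub]
    by_cases hd : (ram n j : ℤ) ∣ i
    · obtain ⟨q, rfl⟩ := hd
      have hq : q < -(r * n j : ℕ) + 1 := by
        have e := ram_mul_rank n r j
        by_contra! hlt
        have := mul_le_mul_of_nonneg_left hlt (by omega : (0 : ℤ) ≤ ram n j)
        rw [mul_add, mul_neg, e] at this
        omega
      rcases eq_or_ne q (-(r * n j : ℕ)) with rfl | hq'
      · have e1 := coeff_bareEig_lead hn r t ⟨j, l⟩
        have e2 := coeff_bareEig_lead hn r t ⟨j, k⟩
        rw [mul_neg, ram_mul_rank, e1, e2, sub_self]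
      · have e1 := coeff_bareEig_mul hn r t ⟨j, l⟩ q
        have e2 := coeff_bareEig_mul hn r t ⟨j, k⟩ q
        rw [e1, e2, LB.branchExp n r t j q (by omega), mul_zero, mul_zero, sub_zero]
    · rw [coeff_bareEig_of_not_dvd hn r t ⟨j, l⟩ hd, coeff_bareEig_of_not_dvd hn r t ⟨j, k⟩ hd,
        sub_zero]
  have h0 := congrArg (fun f => f.coeff 0) h'
  simp only [coeff_add] at h0
  rw [coeff_mul_lead' hg hy (by simp only; omega)] at h0
  have e1 : (y ⟨j, l⟩ - bareEig hn r t ⟨j, k⟩).coeff (-(r * coverDeg n) + ram n j) =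
      ((((rootOfCover n ^ ram n j) ^ (l : ℕ) : ℂˣ) : ℂ) -
        (((rootOfCover n ^ ram n j) ^ (k : ℕ) : ℂˣ) : ℂ)) * (t j (r * n j - 1) / n j) := by
    have e : y ⟨j, l⟩ - bareEig hn r t ⟨j, k⟩ = (y ⟨j, l⟩ - bareEig hn r t ⟨j, l⟩) +
      (bareEig hn r t ⟨j, l⟩ - bareEig hn r t ⟨j, k⟩) := by ring
    have c1 := coeff_bareEig_next hn hr t ⟨j, l⟩
    have c2 := coeff_bareEig_next hn hr t ⟨j, k⟩
    simp only at c1 c2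
    rw [e, coeff_add, F.close hr ⟨j, l⟩ _ (by simp only; omega), coeff_sub, c1, c2]
    ring
  have e2 : (pert p hn a ⟨j, k⟩ ⟨j, l⟩).coeff 0 = gradConst p j k l := by
    rw [pert_apply_eq, coeff_add]
    rw [((LB.C _).mul (LB.toFrame_of_one hn F.lb j k l)) 0 (by omega)]
    simp
  have e3 : (∑ m ∈ Finset.univ.erase ⟨j, l⟩, pert p hn a ⟨j, k⟩ m * g m ⟨j, l⟩).coeff 0 = 0 := by
    rw [coeff_sum]
    refine Finset.sum_eq_zero fun m hm => ?_
    have hm := Finset.ne_of_mem_erase hm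
    by_cases hmj : m.1 = j
    · have q1 := F.off _ _ hm
      rw [if_pos hmj] at q1
      have q2 := (LB.pert_eq (p := p) (x := ⟨j, k⟩) (y := m) hn F.lb hmj.symm).mono (b := 0)
        (by split_ifs <;> omega)
      exact (q2.mul q1) 0 (by simp only; omega)
    · exact F.term_cross (k := m) (l := ⟨j, l⟩) (m := ⟨j, k⟩) rfl hmj 0 (by omega)
  simp only [e1, e2, e3, add_zero] at h0
  rw [← h0]
  have ht := hgen.ne_zero j h2
  have hω := sub_ne_zero.mpr (ramRoot_pow_inj hn j hkl.symm)
  field_simp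

end IsEigenframe

/-- The constant of the correction of second order. -/
noncomputable def secondOrderConst {ι : Type*} (p : Option ι) (hn : ∀ j, 0 < n j) (j : Fin s) : ℂ :=
  n j * ∑ k ∈ Finset.univ.erase (⟨0, hn j⟩ : Fin (n j)), gradConst p j ⟨0, hn j⟩ k *
    (gradConst p j k ⟨0, hn j⟩ * n j / (1 - (((rootOfCover n ^ ram n j) ^ (k : ℕ) : ℂˣ) : ℂ)))

namespace IsEigenframe

/-- The numerator depends only on the block sizes and the type of the pole. The correction to the
residues is thus a constant over `t_{rn-1}`, whose contribution to the tau form is a logarithmic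
differential. -/
theorem coeff_second_order (F : IsEigenframe p hn r t a y g) (hr : 0 < r)
    (hgen : GenericTimes n r t) (j : Fin s) :
    n j * (∑ k ∈ Finset.univ.erase ⟨j, ⟨0, hn j⟩⟩, pert p hn a ⟨j, ⟨0, hn j⟩⟩ k *
      g k ⟨j, ⟨0, hn j⟩⟩).coeff (r * coverDeg n - ram n j) =
      secondOrderConst p hn j / t j (r * n j - 1) := by
  have hf := rank_facts hn hr j
  have e : ∀ f : (Σ j : Fin s, Fin (n j)) → LaurentSeries ℂ,
      ∑ k ∈ Finset.univ.erase ⟨j, ⟨0, hn j⟩⟩, f k =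
        ∑ k ∈ Finset.univ.erase (⟨0, hn j⟩ : Fin (n j)), f ⟨j, k⟩ +
          ∑ i ∈ Finset.univ.erase j, ∑ k, f ⟨i, k⟩ := by
    intro f
    have h1 := Finset.add_sum_erase Finset.univ f
      (Finset.mem_univ (⟨j, ⟨0, hn j⟩⟩ : Σ j : Fin s, Fin (n j)))
    have h2 := Finset.add_sum_erase Finset.univ (fun k => f ⟨j, k⟩)
      (Finset.mem_univ (⟨0, hn j⟩ : Fin (n j)))
    have h3 := Finset.add_sum_erase Finset.univ (fun i => ∑ k, f ⟨i, k⟩) (Finset.mem_univ j)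
    rw [Fintype.sum_sigma, ← h3, ← h2, add_assoc] at h1
    exact add_left_cancel h1
  rw [e, coeff_add, coeff_sum, coeff_sum, secondOrderConst, mul_div_assoc]
  have hz : ∑ i ∈ Finset.univ.erase j, (∑ k, pert p hn a ⟨j, ⟨0, hn j⟩⟩ ⟨i, k⟩ *
      g ⟨i, k⟩ ⟨j, ⟨0, hn j⟩⟩).coeff (r * coverDeg n - ram n j) = 0 := by
    refine Finset.sum_eq_zero fun i hi => ?_
    rw [coeff_sum]
    exact Finset.sum_eq_zero fun k _ => F.term_cross (k := ⟨i, k⟩) (l := ⟨j, ⟨0, hn j⟩⟩)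
      (m := ⟨j, ⟨0, hn j⟩⟩) rfl (Finset.ne_of_mem_erase hi) _ (by omega)
  rw [hz, add_zero, Finset.sum_div]
  congr 1
  refine Finset.sum_congr rfl fun k hk => ?_
  have hk0 := Finset.ne_of_mem_erase hk
  have hne : (⟨j, k⟩ : Σ j : Fin s, Fin (n j)) ≠ ⟨j, ⟨0, hn j⟩⟩ := by
    intro h
    exact hk0 (by simpa using h)
  have h2 : 2 ≤ n j := two_le_of_ne hne rfl
  have q1 := F.off _ _ hne
  rw [if_pos rfl] at q1
  rw [pert_apply_eq, add_mul, coeff_add,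
    (((LB.C _).mul (LB.toFrame_of_one (p := p) hn F.lb j ⟨0, hn j⟩ k)).mul q1) _
      (by simp only; omega), zero_add, HahnSeries.C_mul_eq_smul, coeff_smul, smul_eq_mul,
    F.coeff_offDiag hr hgen j hk0]
  have ht := hgen.ne_zero j h2
  have hω := sub_ne_zero.mpr (ramRoot_pow_inj hn j hk0.symm)
  simp only [pow_zero, Units.val_one] at hω ⊢
  field_simp

end IsEigenframe

variable {𝒜 Y Yi : Matrix (Σ j : Fin s, Fin (n j)) (Σ j : Fin s, Fin (n j)) (LaurentSeries ℂ)}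

/-- The spectral branch of a system gauged to the bare system, and its expansion. -/
theorem LocalGauge.exists_spectralBranch (hn : ∀ j, 0 < n j) (G : LocalGauge p r t 𝒜 Y Yi)
    (hr : 0 < r) (hgen : GenericTimes n r t) (j : Fin s) :
    ∃ z : LaurentSeries ℂ, (𝒜.map (ramify (n j) (hn j))).charpoly.IsRoot z ∧
      (∀ x : LaurentSeries ℂ, (𝒜.map (ramify (n j) (hn j))).charpoly.IsRoot x →
        LB (-(r * n j : ℕ) + 2) (x - branchExp n r t j) → x = z) ∧
      LB (-(r * n j : ℕ)) z ∧
      (∀ J : ℕ, 1 ≤ J → J ≤ r * n j → n j * z.coeff (-(J : ℤ)) = t j J) ∧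
      n j * z.coeff 0 = t j 0 - (n j - 1) / 2 ∧
      ∀ J : ℕ, 1 ≤ J → J ≤ r * n j → n j * z.coeff J =
        sgn p * (blockH p n j J * (Yi * Y.map euler)).trace.coeff 0 +
          if J = r * n j - 1 then secondOrderConst p hn j / t j (r * n j - 1) else 0 := by
  obtain ⟨y, g, h1, h2, h3⟩ := G.exists_eigenframe hn hr hgen
  have F : IsEigenframe p hn r t (Yi * Y.map euler) y g := ⟨G.lb_log, h1, h2, h3⟩
  obtain ⟨z, hz⟩ := F.exists_branch_eq hr hgen G j
  have hn0 : (n j : ℂ) ≠ 0 := by exact_mod_cast (hn j).ne'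
  have hf := rank_facts hn hr j
  have hrank := ram_mul_rank n r j
  have hinj : Function.Injective (branch hn j) := (branch hn j).injective
  have hmap : (𝒜.map (ramify (n j) (hn j))).map (branch hn j) = 𝒜.map (cov hn) :=
    Matrix.ext fun a b => by simp only [Matrix.map_apply, branch_ramify]
  have hroot : ∀ x, (𝒜.map (ramify (n j) (hn j))).charpoly.IsRoot x ↔
      (𝒜.map (cov hn)).charpoly.IsRoot (branch hn j x) := by
    intro x
    rw [← hmap, Matrix.charpoly_map (𝒜.map (ramify (n j) (hn j)))]
    exact ⟨fun h => h.map, fun h => h.of_map hinj⟩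
  have hE0 : bareEig hn r t ⟨j, ⟨0, hn j⟩⟩ = branch hn j (branchExp n r t j) := by
    simp only [bareEig, pow_zero]
    ext i
    simp
  have hcoeff : ∀ k : ℤ, z.coeff k = (y ⟨j, ⟨0, hn j⟩⟩).coeff (ram n j * k) := fun k => by
    rw [← hz, branch, coeff_ramify_mul]
  set X := toFrame p hn (Yi * Y.map euler) ⟨j, ⟨0, hn j⟩⟩ ⟨j, ⟨0, hn j⟩⟩ with hX
  set Q := ∑ k ∈ Finset.univ.erase ⟨j, ⟨0, hn j⟩⟩, pert p hn (Yi * Y.map euler) ⟨j, ⟨0, hn j⟩⟩ k *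
      g k ⟨j, ⟨0, hn j⟩⟩ with hQ
  -- Three contributions: the exponent of the bare system, the diagonal of the perturbation with its
  -- constant part, and the second order part `Q`. The first lives in degrees at most zero, the
  -- nonconstant part of the second in positive degrees, the third in degrees at least `r n - 1` and
  -- never at degree zero or below.
  have hexp : ∀ k : ℤ, z.coeff k = (branchExp n r t j).coeff k +
      (sgn p * X.coeff (ram n j * k) + if k = 0 then -((n j : ℂ) - 1) / (2 * n j) else 0) +
        Q.coeff (ram n j * k) := by
    intro k
    rw [hcoeff, F.eigenvalue_eq, coeff_add, coeff_add, hE0, branch, coeff_ramify_mul, pert_apply_eq,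
      coeff_add, HahnSeries.C_mul_eq_smul, coeff_smul, smul_eq_mul, gradConst_diag p j _ (hn j)]
    congr 3
    rw [C_apply]
    split_ifs with hk
    · rw [hk, mul_zero]; simp
    · rw [coeff_single_of_ne]
      exact mul_ne_zero (by omega) hk
  have hXlb : ∀ k : ℤ, k < 1 → X.coeff (ram n j * k) = 0 := fun k hk =>
    LB.toFrame_of_one hn F.lb j _ _ _ (by nlinarith)
  have hQ0 := F.second_order ⟨j, ⟨0, hn j⟩⟩
  simp only at hQ0
  rw [← hQ] at hQ0
  have hQlb : ∀ k : ℤ, k < r * n j - 1 → Q.coeff (ram n j * k) = 0 := by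
    intro k hk
    refine hQ0 _ ?_
    have e : (ram n j : ℤ) * k ≤ ram n j * (r * n j - 2) :=
      mul_le_mul_of_nonneg_left (by omega) (by omega)
    have e2 : (ram n j : ℤ) * (r * n j - 2) = r * coverDeg n - 2 * ram n j := by
      rw [← hrank]; push_cast; ring
    split_ifs <;> omega
  have hQlb0 : ∀ k : ℤ, k ≤ 0 → Q.coeff (ram n j * k) = 0 := by
    intro k hk
    refine hQ0 _ ?_
    have e : (ram n j : ℤ) * k ≤ 0 := mul_nonpos_of_nonneg_of_nonpos (by omega) hk
    have := hn j
    split_ifs <;> omega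
  refine ⟨z, (hroot z).mpr ?_, ?_, ?_, ?_, ?_, ?_⟩
  · rw [hz]
    exact (F.isRoot_iff hr G _).mpr ⟨_, rfl⟩
  · intro x hx hlb
    apply hinj
    rw [hz]
    refine F.eq_of_isRoot hr hgen G ((hroot x).mp hx) ?_
    rw [hE0, ← map_sub]
    refine (hlb.ramify _ _).mono ?_
    rw [mul_add, mul_neg, hrank]
    simp only
    omega
  · intro k hk
    have hk0 : k ≤ 0 := by omega
    rw [hexp, LB.branchExp n r t j k hk, hXlb k (by omega), hQlb0 k hk0, if_neg (by omega)]
    simp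
  · intro J hJ1 hJ
    rw [hexp, coeff_branchExp _ _ _ _ hJ, hXlb _ (by omega), hQlb0 _ (by omega), if_neg (by omega)]
    field_simp
    ring
  · have := coeff_branchExp n r t j (Nat.zero_le (r * n j))
    simp only [Nat.cast_zero, neg_zero] at this
    rw [hexp, this, hXlb _ (by omega), hQlb0 _ (by omega), if_pos rfl]
    field_simp
    ring
  · intro J hJ1 hJ
    rw [coeff_zero_trace_blockH_mul p hn]
    rcases lt_or_eq_of_le hJ with hlt | heq
    · rw [hexp, coeff_branchExp_of_pos _ _ _ _ (by omega), if_neg (by omega)]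
      -- Below `J = r n` the second order part can be seen only at `J = r n - 1`.
      split_ifs with hJ2
      · have e : (ram n j : ℤ) * J = r * coverDeg n - ram n j := by
          rw [hJ2, Nat.cast_sub (by omega), mul_sub, hrank]; simp
        have := F.coeff_second_order hr hgen j
        rw [← this, ← hQ, e]
        ring
      · rw [hQlb J (by have h0 : ((r * n j : ℕ) : ℤ) = r * n j := Nat.cast_mul _ _; omega)]
        ring
    -- At `J = r n` the coefficient is recovered from the block trace: it belongs to the exponent `r
    -- N`, a multiple of `N`, so all `n` conjugate branches share it.
    · subst heq
      rw [if_neg (by omega)]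
      have htr := F.coeff_block_trace hr j
      have hpos : (0 : ℤ) < r * coverDeg n := by omega
      have hinv : ∀ (k : ℕ) (f : LaurentSeries ℂ), (twist (rootOfCover n ^ k) f).coeff
          (r * coverDeg n) = f.coeff (r * coverDeg n) := by
        intro k f
        rw [coeff_twist]
        have : ((rootOfCover n ^ k) ^ (r * coverDeg n : ℤ) : ℂˣ) = 1 := by
          rw [← zpow_natCast, ← zpow_mul, (rootOfCover_isPrimitiveRoot hn).zpow_eq_one_iff_dvd]
          exact ⟨k * r, by ring⟩
        rw [this]; simp
      have hterm : ∀ k, (bareEig hn r t ⟨j, k⟩ + pert p hn (Yi * Y.map euler) ⟨j, k⟩ ⟨j, k⟩).coeff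
          (r * coverDeg n) = sgn p * X.coeff (r * coverDeg n) := by
        intro k
        have e1 : (bareEig hn r t ⟨j, k⟩).coeff (r * coverDeg n) = 0 := by
          have := coeff_bareEig_mul hn r t ⟨j, k⟩ (r * n j : ℕ)
          simp only at this
          rw [hrank] at this
          rw [this, coeff_branchExp_of_pos, mul_zero]
          have := Nat.mul_pos hr (hn j)
          omega
        rw [coeff_add, e1, zero_add, pert_apply_eq, coeff_add, HahnSeries.C_mul_eq_smul, coeff_smul,
          smul_eq_mul, ← twist_toFrame_diag p hn _ j k, hinv, C_apply, coeff_single_of_ne hpos.ne',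
          add_zero]
      simp only [hterm] at htr
      rw [Finset.sum_congr rfl (g := fun _ => z.coeff ((r * n j : ℕ) : ℤ))] at htr
      · simp only [Finset.sum_const, Finset.card_univ, Fintype.card_fin, nsmul_eq_mul] at htr
        rw [htr, hrank]
        ring
      · intro k _
        rw [← F.twist_eigenvalue hr hgen G j k, hinv, hcoeff, hrank]

end SpectralBranch

/-! ### Genericity of the times -/

theorem coeff_mul_next {b c k : ℤ} {x y : LaurentSeries ℂ} (hx : LB b x) (hy : LB c y)
    (hk : k = b + c + 1) :
    (x * y).coeff k = x.coeff b * y.coeff (c + 1) + x.coeff (b + 1) * y.coeff c := by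
  rw [coeff_mul_eq_sum hx hy]
  have : Finset.Icc b (k - c) = {b, b + 1} := by
    ext i
    simp only [Finset.mem_Icc, Finset.mem_insert, Finset.mem_singleton]
    omega
  rw [this, Finset.sum_pair (by omega)]
  congr 3 <;> omega

/-- The matrix of the coefficients of a matrix of Laurent series. -/
def coeffMat {I : Type*} (k : ℤ) (X : Matrix I I (LaurentSeries ℂ)) : Matrix I I ℂ :=
  X.map fun f => f.coeff k

theorem coeffMat_apply {I : Type*} (k : ℤ) (X : Matrix I I (LaurentSeries ℂ)) (a b : I) :
    coeffMat k X a b = (X a b).coeff k := rfl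

theorem coeffMat_mul_lead {I : Type*} [Fintype I] {b c k : ℤ} {X Z : Matrix I I (LaurentSeries ℂ)}
    (hX : ∀ i j, LB b (X i j)) (hZ : ∀ i j, LB c (Z i j)) (hk : k = b + c) :
    coeffMat k (X * Z) = coeffMat b X * coeffMat c Z := by
  refine Matrix.ext fun i j => ?_
  rw [coeffMat_apply, Matrix.mul_apply, Matrix.mul_apply, coeff_sum]
  exact Finset.sum_congr rfl fun m _ => coeff_mul_lead' (hX i m) (hZ m j) hk

theorem coeffMat_mul_next {I : Type*} [Fintype I] {b c k : ℤ} {X Z : Matrix I I (LaurentSeries ℂ)}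
    (hX : ∀ i j, LB b (X i j)) (hZ : ∀ i j, LB c (Z i j)) (hk : k = b + c + 1) :
    coeffMat k (X * Z) = coeffMat b X * coeffMat (c + 1) Z + coeffMat (b + 1) X * coeffMat c Z := by
  refine Matrix.ext fun i j => ?_
  rw [coeffMat_apply, Matrix.mul_apply, Matrix.add_apply, Matrix.mul_apply, Matrix.mul_apply,
    coeff_sum, ← Finset.sum_add_distrib]
  exact Finset.sum_congr rfl fun m _ => coeff_mul_next (hX i m) (hZ m j) hk

theorem coeffMat_add {I : Type*} (k : ℤ) (X Z : Matrix I I (LaurentSeries ℂ)) :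
    coeffMat k (X + Z) = coeffMat k X + coeffMat k Z :=
  Matrix.ext fun i j => by simp [coeffMat]

/-- The shift is homogeneous for the grading in which a row index has weight one and `s⁻¹` has
weight `m`; an entry of its `J`-th power is a single monomial or zero. -/
theorem coeff_shiftMat_pow {m : ℕ} (J : ℕ) (a b : Fin m) (k : ℤ) :
    ((shiftMat m (single (-1 : ℤ) (1 : ℂ) : LaurentSeries ℂ) ^ J) a b).coeff k =
      if (J : ℤ) + b - a = -(m * k) then 1 else 0 := by
  induction J generalizing a k with
  | zero =>
    have hm : 0 < m := a.pos
    rw [pow_zero, Matrix.one_apply]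
    by_cases hab : a = b
    · subst hab
      rw [if_pos rfl, coeff_one]
      by_cases hk : k = 0
      · subst hk; simp
      · rw [if_neg hk, if_neg]
        simp only [Nat.cast_zero, zero_add, sub_self]
        intro h
        have : (m : ℤ) * k = 0 := by omega
        rcases mul_eq_zero.mp this with h1 | h1
        · omega
        · exact hk h1
    · rw [if_neg hab, coeff_zero, if_neg]
      intro h
      have ha := a.2
      have hb := b.2
      have h1 : (m : ℤ) ∣ (b : ℤ) - a := ⟨-k, by push_cast at h; linarith⟩
      have h2 := Int.eq_zero_of_abs_lt_dvd h1 (by rw [abs_lt]; constructor <;> omega)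
      exact hab (Fin.ext (by omega))
  | succ J ih =>
    rw [pow_succ', Matrix.mul_apply]
    obtain ⟨a, ha⟩ := a
    rcases a with _ | a
    · have hm : m - 1 < m := by omega
      rw [Finset.sum_eq_single ⟨m - 1, hm⟩]
      · have hS : shiftMat m (single (-1 : ℤ) (1 : ℂ) : LaurentSeries ℂ) ⟨0, ha⟩ ⟨m - 1, hm⟩ =
            single (-1) 1 := by
          have h1 : ¬ (0 = m - 1 + 1) := by omega
          have h2 : 0 = 0 ∧ m - 1 + 1 = m := by omega
          rw [shiftMat, Matrix.of_apply, if_neg h1, if_pos h2]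
        rw [hS, coeff_single_mul, one_mul, sub_neg_eq_add, ih ⟨m - 1, hm⟩ (k + 1)]
        congr 1
        simp only
        have h3 : ((m - 1 : ℕ) : ℤ) = m - 1 := by omega
        rw [h3]
        push_cast
        rw [eq_iff_iff]
        constructor <;> intro h <;> linarith
      · intro c _ hc
        have hc' : (c : ℕ) + 1 ≠ m := fun hh => hc (Fin.ext (by simp only; omega))
        simp [shiftMat, hc']
      · simp
    · rw [Finset.sum_eq_single ⟨a, by omega⟩]
      · have hS : shiftMat m (single (-1 : ℤ) (1 : ℂ) : LaurentSeries ℂ) ⟨a + 1, ha⟩ ⟨a, by omega⟩ =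
            1 := by
          rw [shiftMat, Matrix.of_apply, if_pos rfl]
        rw [hS, one_mul, ih ⟨a, by omega⟩ k]
        congr 1
        simp only
        push_cast
        rw [eq_iff_iff]
        constructor <;> intro h <;> linarith
      · intro c _ hc
        have hc' : ¬ (a + 1 = (c : ℕ) + 1) := fun hh => hc (Fin.ext (by simp only; omega))
        have : ¬ (a + 1 = 0 ∧ (c : ℕ) + 1 = m) := by omega
        simp only [shiftMat, Matrix.of_apply]
        rw [if_neg hc', if_neg this, zero_mul]
      · simp

section

variable {s : ℕ} {n : Fin s → ℕ} {ι : Type*} (p : Option ι)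

/-- The order of the basis of a block in which the leading coefficient of the bare system is lower
triangular. -/
def lowerOrder (m : ℕ) : Fin m ≃ Fin m :=
  match p with
  | some _ => Equiv.refl _
  | none => Fin.revPerm

/-- Reversing the basis at infinity reproduces the numbering used at finite poles, so that one
formula serves both. -/
theorem coeff_bareH_pow {m : ℕ} (J : ℕ) (a b : Fin m) (k : ℤ) :
    ((bareH p m ^ J) (lowerOrder p m a) (lowerOrder p m b)).coeff k =
      if (J : ℤ) + a - b = -(m * k) then 1 else 0 := by
  cases p with
  | none =>
    simp only [bareH, lowerOrder, coeff_shiftMat_pow, Fin.revPerm_apply, Fin.val_rev]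
    congr 1
    have ha := a.2
    have hb := b.2
    rw [Nat.cast_sub (by omega), Nat.cast_sub (by omega)]
    push_cast
    rw [eq_iff_iff]
    constructor <;> intro h <;> linarith
  | some i =>
    simp only [bareH, lowerOrder, ← Matrix.transpose_pow, Matrix.transpose_apply, Equiv.refl_apply,
      coeff_shiftMat_pow]

theorem coeff_bareM (r : ℕ) (t : Fin s → ℕ → ℂ) (j : Fin s) (a b : Fin (n j)) (k : ℤ) :
    (bareM p n r t ⟨j, lowerOrder p _ a⟩ ⟨j, lowerOrder p _ b⟩).coeff k = (n j : ℂ)⁻¹ *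
      (∑ J ∈ Finset.range (r * n j + 1), (if (J : ℤ) + a - b = -(n j * k) then t j J else 0) -
        if k = 0 ∧ a = b then ((lowerOrder p (n j) a : ℕ) : ℂ) else 0) := by
  rw [bareM, Matrix.blockDiagonal'_apply_eq, Matrix.smul_apply, Matrix.sub_apply, Matrix.sum_apply,
    smul_eq_mul, HahnSeries.C_mul_eq_smul, coeff_smul, coeff_sub, coeff_sum, smul_eq_mul]
  congr 2
  · refine Finset.sum_congr rfl fun J _ => ?_
    rw [Matrix.smul_apply, smul_eq_mul, HahnSeries.C_mul_eq_smul, coeff_smul, coeff_bareH_pow]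
    simp
  · rw [gradMat, Matrix.diagonal_apply]
    have e : (((lowerOrder p (n j) a : ℕ) : LaurentSeries ℂ)) =
        single 0 ((lowerOrder p (n j) a : ℕ) : ℂ) :=
      ((map_natCast (HahnSeries.C (Γ := ℤ) (R := ℂ)) _).symm)
    by_cases hab : a = b
    · subst hab
      rw [if_pos rfl, e]
      by_cases hk : k = 0
      · simp [hk]
      · rw [coeff_single_of_ne hk, if_neg (by simp [hk])]
    · simp [hab]

theorem LB.bareM (r : ℕ) (t : Fin s → ℕ → ℂ) (x y) :
    LB (-(r : ℤ)) (bareM p n r t x y) := by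
  intro k hk
  obtain ⟨i, a⟩ := x
  obtain ⟨j, b⟩ := y
  by_cases hij : i = j
  · subst hij
    obtain ⟨a, rfl⟩ := (lowerOrder p (n i)).surjective a
    obtain ⟨b, rfl⟩ := (lowerOrder p (n i)).surjective b
    rw [coeff_bareM, Finset.sum_eq_zero, if_neg (by omega)]
    · simp
    · intro J hJ
      rw [Finset.mem_range] at hJ
      rw [if_neg]
      intro h
      have ha := a.2
      have hb := b.2
      have h1 : (n i : ℤ) * (r + 1) ≤ n i * (-k) := mul_le_mul_of_nonneg_left (by omega) (by omega)
      have h2 : ((r * n i : ℕ) : ℤ) = n i * r := by push_cast; ring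
      rw [mul_add, mul_one, mul_neg, ← h2, ← h] at h1
      omega
  · rw [MinRes.bareM, Matrix.blockDiagonal'_apply_ne _ _ _ hij, coeff_zero]

variable {p}

/-- The order of the basis in which the leading coefficient of the bare system is lower
triangular. -/
def lowerIndex (p : Option ι) (n : Fin s → ℕ) : (Σ j : Fin s, Fin (n j)) ≃ Σ j : Fin s, Fin (n j) :=
  Equiv.sigmaCongrRight fun j => lowerOrder p (n j)

/-- At order `-r` the entry `(a, b)` of a block selects the time of index `r n - (a - b)`. The
matrix `G` sits at order zero and does not interfere, as `r > 0`. -/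
theorem isLowerJordan_bareM (hn : ∀ j, 0 < n j) {r : ℕ} (hr : 0 < r) (t : Fin s → ℕ → ℂ) :
    IsLowerJordan ((coeffMat (-(r : ℤ)) (bareM p n r t)).submatrix (lowerIndex p n) (lowerIndex p n))
      (fun j => t j (r * n j) / n j) (fun j => t j (r * n j - 1) / n j) := by
  have key : ∀ (j : Fin s) (a b : Fin (n j)) (J : ℕ), J ≤ r * n j → (J : ℤ) + a - b = r * n j →
      (coeffMat (-(r : ℤ)) (bareM p n r t)).submatrix (lowerIndex p n) (lowerIndex p n) ⟨j, a⟩ ⟨j, b⟩ =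
        t j J / n j := by
    intro j a b J hJ h
    rw [Matrix.submatrix_apply, coeffMat_apply]
    refine (coeff_bareM p r t j a b _).trans ?_
    rw [Finset.sum_eq_single J, if_pos (by linarith), if_neg (by omega), sub_zero]
    · ring
    · intro J' _ hJ'
      rw [if_neg]
      intro h'
      exact hJ' (by have : (n j : ℤ) * -r = -(r * n j) := by ring
                    rw [this] at h'; omega)
    · intro hJ'
      exact absurd (Finset.mem_range.mpr (by omega)) hJ'
  constructor
  · intro i j a b hij
    rw [Matrix.submatrix_apply, coeffMat_apply]
    exact (congrArg (fun f : LaurentSeries ℂ => f.coeff (-(r : ℤ))) (Matrix.blockDiagonal'_apply_ne _ _ _ hij)).trans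
      (by simp)
  · intro j a b hab
    rw [Matrix.submatrix_apply, coeffMat_apply]
    refine (coeff_bareM p r t j a b _).trans ?_
    rw [Finset.sum_eq_zero, if_neg (by omega)]
    · simp
    · intro J hJ
      rw [Finset.mem_range] at hJ
      rw [if_neg]
      have h2 : ((r * n j : ℕ) : ℤ) = n j * r := by push_cast; ring
      rw [mul_neg, ← h2]
      have : (a : ℕ) < b := hab
      omega
  · intro j a
    exact key j a a _ le_rfl (by push_cast; ring)
  · intro j a b hab
    have := Nat.mul_pos hr (hn j)
    refine key j a b _ (Nat.sub_le _ _) ?_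
    have h2 : ((r * n j : ℕ) : ℤ) = r * n j := by push_cast; ring
    omega

/-- The upper right corner at the next order is governed by the same time `t_{rn-1}` as the
subdiagonal of the leading coefficient; this links the Lidskii matrix to the times. The matrix `G`
could enter only if `r = n = 1`, where its entry is zero. -/
theorem coeff_bareM_corner (hn : ∀ j, 0 < n j) {r : ℕ} (hr : 0 < r) (t : Fin s → ℕ → ℂ)
    (i j : Fin s) : (coeffMat (-(r : ℤ) + 1) (bareM p n r t)).submatrix (lowerIndex p n)
      (lowerIndex p n) ⟨i, ⟨0, hn i⟩⟩ ⟨j, ⟨n j - 1, Nat.sub_lt (hn j) one_pos⟩⟩ =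
      if i = j then t i (r * n i - 1) / n i else 0 := by
  rw [Matrix.submatrix_apply, coeffMat_apply]
  split_ifs with hij
  · subst hij
    refine (coeff_bareM p r t i _ _ _).trans ?_
    have hpos := Nat.mul_pos hr (hn i)
    have h2 : ((r * n i : ℕ) : ℤ) = n i * r := by push_cast; ring
    have hni := hn i
    rw [Finset.sum_eq_single (r * n i - 1), if_pos]
    · have h3 : (if -(r : ℤ) + 1 = 0 ∧ (⟨0, hn i⟩ : Fin (n i)) =
          ⟨n i - 1, Nat.sub_lt (hn i) one_pos⟩ then
          ((lowerOrder p (n i) ⟨0, hn i⟩ : ℕ) : ℂ) else 0) = 0 := by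
        split_ifs with h4
        · have h5 : 0 = n i - 1 := congrArg Fin.val h4.2
          have h6 := (lowerOrder p (n i) ⟨0, hn i⟩).2
          have : (lowerOrder p (n i) ⟨0, hn i⟩ : ℕ) = 0 := by omega
          rw [this]; simp
        · rfl
      rw [h3]
      ring
    · rw [mul_add, mul_neg, ← h2]
      simp only
      omega
    · intro J _ hJ
      rw [if_neg]
      rw [mul_add, mul_neg, ← h2]
      simp only
      omega
    · intro h
      exact absurd (Finset.mem_range.mpr (by omega)) h
  · exact (congrArg (fun f : LaurentSeries ℂ => f.coeff (-(r : ℤ) + 1)) (Matrix.blockDiagonal'_apply_ne _ _ _ hij)).trans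
      (by simp)

variable {r : ℕ} {t : Fin s → ℕ → ℂ}
  {𝒜 Y Yi : Matrix (Σ j : Fin s, Fin (n j)) (Σ j : Fin s, Fin (n j)) (LaurentSeries ℂ)}

theorem LocalGauge.lb_system (G : LocalGauge p r t 𝒜 Y Yi) (x y) :
    LB (-(r : ℤ)) (𝒜 x y) := by
  have h : 𝒜 = (Y * bareM p n r t + (HahnSeries.C (sgn p : ℂ) : LaurentSeries ℂ) • Y.map euler) *
      Yi := by
    rw [← G.eq, Matrix.mul_assoc, G.mul_inv, Matrix.mul_one]
  rw [h]
  refine (LB.matrix_mul (b := -(r : ℤ)) (c := 0) (fun i k => ?_) G.lb_inv x y).mono (by omega)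
  refine ((LB.matrix_mul G.lb (LB.bareM p r t) i k).mono (by omega)).add ?_
  exact (LB.C _).mul_of_le (G.lb i k).euler (by omega)

/-- The derivative of `Y` starts at order one, so the first two orders of the gauge equation are
purely algebraic. -/
theorem LocalGauge.lead (hr : 0 < r) (G : LocalGauge p r t 𝒜 Y Yi) :
    coeffMat (-(r : ℤ)) 𝒜 * coeffMat 0 Y = coeffMat 0 Y * coeffMat (-(r : ℤ)) (bareM p n r t) ∧
    coeffMat (-(r : ℤ)) 𝒜 * coeffMat 1 Y + coeffMat (-(r : ℤ) + 1) 𝒜 * coeffMat 0 Y =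
      coeffMat 0 Y * coeffMat (-(r : ℤ) + 1) (bareM p n r t) +
        coeffMat 1 Y * coeffMat (-(r : ℤ)) (bareM p n r t) := by
  have hz : ∀ k : ℤ, k ≤ 0 → coeffMat k ((HahnSeries.C (sgn p : ℂ) : LaurentSeries ℂ) •
      Y.map euler) = 0 := by
    intro k hk
    refine Matrix.ext fun a b => ?_
    rw [coeffMat_apply, Matrix.smul_apply, smul_eq_mul, HahnSeries.C_mul_eq_smul, coeff_smul,
      Matrix.map_apply, coeff_euler]
    rcases eq_or_ne k 0 with rfl | hk0
    · simp
    · rw [G.lb a b k (by omega)]; simp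
  constructor
  · have h := congrArg (coeffMat (-(r : ℤ))) G.eq
    rwa [coeffMat_add, hz _ (by omega), add_zero, coeffMat_mul_lead (G.lb_system) G.lb (by omega),
      coeffMat_mul_lead G.lb (LB.bareM p r t) (by omega)] at h
  · have h := congrArg (coeffMat (-(r : ℤ) + 1)) G.eq
    rwa [coeffMat_add, hz _ (by omega), add_zero, coeffMat_mul_next (G.lb_system) G.lb (by omega),
      coeffMat_mul_next G.lb (LB.bareM p r t) (by omega)] at h

/-- Two normal forms of the same leading coefficient, upper triangular in the hypothesis and lower
triangular in the bare system, are conjugate by `Z0 * P`. The subleading coefficients then agree up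
to a commutator with the leading one, which is the situation of `IsLowerJordan.ne_zero` and
`IsLowerJordan.pow_ne_pow`. -/
theorem LocalGauge.genericTimes {ν : Type*} (L : LocalType ν) {t : Fin L.s → ℕ → ℂ}
    {𝒜 Y Yi : Matrix (Σ j : Fin L.s, Fin (L.n j)) (Σ j : Fin L.s, Fin (L.n j)) (LaurentSeries ℂ)}
    (G : LocalGauge p L.r t 𝒜 Y Yi)
    {P Pi : Matrix (Σ j : Fin L.s, Fin (L.n j)) (Σ j : Fin L.s, Fin (L.n j)) ℂ} (hP : P * Pi = 1)
    (hlead : coeffMat (-(L.r : ℤ)) 𝒜 * P =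
      P * jordanMat L.n (fun j => t j (L.r * L.n j) / L.n j))
    (B : Matrix ν ν ℂ) (hB : B.submatrix L.e L.e = Pi * coeffMat (-(L.r : ℤ) + 1) 𝒜 * P)
    (hgen : LidskiiGeneric L (fun j => t j (L.r * L.n j) / L.n j) B) : GenericTimes L.n L.r t := by
  classical
  have hn : ∀ j, 0 < L.n j := L.n_pos
  obtain ⟨h1, h2⟩ := G.lead L.r_pos
  set ρ := lowerIndex p L.n with hρ
  set Y0 := coeffMat 0 Y
  set Y1 := coeffMat 1 Y
  set Z0 := coeffMat 0 Yi
  set A0 := coeffMat (-(L.r : ℤ)) 𝒜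
  set A1 := coeffMat (-(L.r : ℤ) + 1) 𝒜
  set R := coeffMat (-(L.r : ℤ)) (bareM p L.n L.r t) with hR
  set R₁ := coeffMat (-(L.r : ℤ) + 1) (bareM p L.n L.r t) with hR₁
  have hY : Z0 * Y0 = 1 := by
    have := congrArg (coeffMat 0) G.inv_mul
    rw [coeffMat_mul_lead G.lb_inv G.lb (by omega)] at this
    rw [this]
    refine Matrix.ext fun a b => ?_
    rw [coeffMat_apply, Matrix.one_apply, Matrix.one_apply]
    split_ifs <;> simp
  have hY' : Y0 * Z0 = 1 := mul_eq_one_comm.mp hY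
  have hP' : Pi * P = 1 := mul_eq_one_comm.mp hP
  have hQ : (Z0 * P) * (Pi * Y0) = 1 := by
    rw [Matrix.mul_assoc, ← Matrix.mul_assoc P, hP, Matrix.one_mul, hY]
  have hRA : R * Z0 = Z0 * A0 := by
    calc R * Z0 = Z0 * Y0 * R * Z0 := by rw [hY, Matrix.one_mul]
      _ = Z0 * (A0 * Y0) * Z0 := by rw [h1]; simp only [Matrix.mul_assoc]
      _ = Z0 * A0 := by rw [Matrix.mul_assoc, Matrix.mul_assoc, hY', Matrix.mul_one]
  have hRQ : R * (Z0 * P) = (Z0 * P) * jordanMat L.n (fun j => t j (L.r * L.n j) / L.n j) := by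
    rw [← Matrix.mul_assoc, hRA, Matrix.mul_assoc, hlead, Matrix.mul_assoc]
  have hA1 : Z0 * A1 = (R₁ + (Z0 * Y1) * R - R * (Z0 * Y1)) * Z0 := by
    have e : A1 * Y0 = Y0 * R₁ + Y1 * R - A0 * Y1 := by rw [← h2]; abel
    calc Z0 * A1 = Z0 * (A1 * Y0) * Z0 := by
          rw [Matrix.mul_assoc, Matrix.mul_assoc, hY', Matrix.mul_one]
      _ = (Z0 * Y0 * R₁ + Z0 * Y1 * R - Z0 * A0 * Y1) * Z0 := by
          rw [e]; simp only [Matrix.mul_add, Matrix.mul_sub, Matrix.mul_assoc]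
      _ = _ := by rw [hY, Matrix.one_mul, ← hRA, Matrix.mul_assoc R]
  have hQB : (Z0 * P) * (B.submatrix L.e L.e) =
      (R₁ + (Z0 * Y1) * R - R * (Z0 * Y1)) * (Z0 * P) := by
    rw [hB, Matrix.mul_assoc Z0, ← Matrix.mul_assoc P, ← Matrix.mul_assoc P, hP, Matrix.one_mul,
      ← Matrix.mul_assoc, hA1, Matrix.mul_assoc]
  have hJ := isLowerJordan_bareM (p := p) hn L.r_pos t
  have sub_mul : ∀ X Z : Matrix (Σ j : Fin L.s, Fin (L.n j)) (Σ j : Fin L.s, Fin (L.n j)) ℂ,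
      ∀ e : (Σ j : Fin L.s, Fin (L.n j)) → (Σ j : Fin L.s, Fin (L.n j)),
      (X * Z).submatrix ρ e = X.submatrix ρ ρ * Z.submatrix ρ e := fun X Z e =>
    (Matrix.submatrix_mul_equiv X Z ρ ρ e).symm
  have hQ₂ : (Z0 * P).submatrix ρ id * (Pi * Y0).submatrix id ρ = 1 := by
    have := Matrix.submatrix_mul_equiv (Z0 * P) (Pi * Y0) ρ (Equiv.refl _) ρ
    rw [hQ] at this
    refine this.trans ?_
    exact Matrix.submatrix_one_equiv ρ
  have hRQ₂ : R.submatrix ρ ρ * (Z0 * P).submatrix ρ id = (Z0 * P).submatrix ρ id *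
      jordanMat L.n (fun j => t j (L.r * L.n j) / L.n j) := by
    rw [← sub_mul, hRQ]
    rfl
  constructor
  · intro j hj h0
    refine hJ.ne_zero hQ₂ hRQ₂ hn j hj ?_
    rw [h0, zero_div]
  · intro i j hij hlam hnij
    refine hJ.pow_ne_pow (B := B.submatrix L.e L.e) (R₁ := R₁.submatrix ρ ρ)
      (Z := (Z0 * Y1).submatrix ρ ρ) hQ₂ hRQ₂ hn ?_ (coeff_bareM_corner hn L.r_pos t)
      (c := t i (L.r * L.n i) / L.n i) (N := L.n i) _ (fun _ _ => rfl) (hgen i).1 (hgen i).2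
      i j hij rfl hlam.symm rfl hnij.symm
    rw [← sub_mul, ← sub_mul]
    exact (congrArg (fun X => X.submatrix ρ id) hQB).trans (sub_mul _ _ id)

end

/-! ### Spectral points of the connection at an irregular pole -/

section Application

variable {φ ι ν : Type*} [Fintype φ] [Fintype ι] [Fintype ν] [DecidableEq ν]
  {L : Option ι → LocalType ν}

theorem Connection.map_at (A : Connection φ L) {K K' : Type*} [Field K] [Algebra ℂ K] [Field K']
    [Algebra ℂ K'] (f : K →+* K') (hf : ∀ c, f (algebraMap ℂ K c) = algebraMap ℂ K' c) (u : K) :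
    (A.at u).map f = A.at (f u) := by
  refine Matrix.ext fun a b => ?_
  simp only [Connection.at, Matrix.map_apply, Matrix.add_apply, Matrix.sum_apply, Matrix.smul_apply,
    smul_eq_mul, map_add, map_sum, map_mul, map_inv₀, map_sub, map_pow, hf]

theorem finCoord_eq (γ : ℂ) (m : ℕ) : finCoord γ m = HahnSeries.C γ + single (m : ℤ) 1 := by
  rw [finCoord, algebraMap_eq_C]

theorem Connection.ramify_coord (A : Connection φ L) (p : Option ι) (m : ℕ) (hm : 0 < m) :
    ramify m hm (A.coord p 1) = A.coord p m := by
  cases p with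
  | none => simp [Connection.coord, infCoord, ramify_single]
  | some i => simp [Connection.coord, finCoord_eq, map_add, ramify_single]

theorem Connection.euler_coord (A : Connection φ L) (p : Option ι) (m : ℕ) :
    euler (A.coord p m) = single (sgn p * m) ((sgn p * m : ℂ)) := by
  cases p with
  | none => simp [Connection.coord, infCoord, euler_single, sgn]
  | some i => simp [Connection.coord, finCoord_eq, euler_single, sgn]

theorem formRes_eq (x f : LaurentSeries ℂ) : formRes x f = (f * euler x).coeff 0 := by
  rw [formRes, derivative_eq_single_mul_euler, mul_left_comm, coeff_single_mul]
  simp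

/-- The sign of the orientation at infinity cancels the sign in `θ x = ε m ξ^{ε m}`, so residues at
all poles are coefficients of `u y` by one formula. -/
theorem Connection.spectralRes_eq (A : Connection φ L) (p : Option ι) (m : ℕ) (y : LaurentSeries ℂ)
    (K : ℤ) : A.spectralRes p m y K = m * (single (sgn p * m) 1 * y).coeff (-K) := by
  have h : A.spectralRes p m y K = sgn p * formRes (A.coord p m) (single K 1 * y) := by
    cases p <;> simp [Connection.spectralRes, sgn]
  rw [h, formRes_eq, A.euler_coord]
  have e : (single (sgn p * m) ((sgn p * m : ℂ)) : LaurentSeries ℂ) =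
      HahnSeries.C (sgn p * m : ℂ) * single (sgn p * m) 1 := by
    rw [C_apply, single_mul_single]; simp
  have e2 : single K 1 * y * single (sgn p * (m : ℤ)) ((sgn p : ℂ) * m) =
      HahnSeries.C (sgn p * m : ℂ) * (single K 1 * (single (sgn p * m) 1 * y)) := by
    rw [e]; ring
  rw [e2, HahnSeries.C_mul_eq_smul, coeff_smul, coeff_single_mul, smul_eq_mul, zero_sub, one_mul]
  have : (sgn p : ℂ) * (sgn p : ℂ) = 1 := by exact_mod_cast sgn_mul_self p
  linear_combination (m * (single (sgn p * m) 1 * y).coeff (-K)) * this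

/-- The system `u A` at an irregular pole, indexed by the rows of the blocks. -/
noncomputable def Connection.localSystem (A : Connection φ L) (p : Option ι) :
    Matrix (Σ j : Fin (L p).s, Fin ((L p).n j)) (Σ j : Fin (L p).s, Fin ((L p).n j))
      (LaurentSeries ℂ) :=
  ((single (sgn p) 1 : LaurentSeries ℂ) • A.at (A.coord p 1)).submatrix (L p).e (L p).e

theorem Connection.localSystem_map (A : Connection φ L) (p : Option ι) (m : ℕ) (hm : 0 < m) :
    (A.localSystem p).map (ramify m hm) = ((single (sgn p * m) 1 : LaurentSeries ℂ) •
      A.at (A.coord p m)).submatrix (L p).e (L p).e := by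
  have h := A.map_at (ramify m hm) (fun c => by rw [algebraMap_eq_C, ramify_C]) (A.coord p 1)
  rw [A.ramify_coord] at h
  refine Matrix.ext fun a b => ?_
  rw [Matrix.submatrix_apply, Matrix.smul_apply, ← h]
  simp only [Connection.localSystem, Matrix.map_apply, Matrix.submatrix_apply, Matrix.smul_apply,
    smul_eq_mul, map_mul, ramify_single]
  rw [mul_comm (m : ℤ)]

theorem charpoly_smul_isRoot {K : Type*} [Field K] (M : Matrix ν ν K) {c : K}
    (hc : c ≠ 0) (y : K) : (c • M).charpoly.IsRoot (c * y) ↔ M.charpoly.IsRoot y := by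
  rw [Polynomial.IsRoot, Polynomial.IsRoot, Matrix.eval_charpoly, Matrix.eval_charpoly]
  have : Matrix.scalar ν (c * y) - c • M = c • (Matrix.scalar ν y - M) := by
    rw [smul_sub]
    congr 1
    refine Matrix.ext fun a b => ?_
    simp [Matrix.diagonal_apply]
  rw [this, Matrix.det_smul]
  simp [hc]

theorem Connection.isRoot_localSystem (A : Connection φ L) (p : Option ι) (m : ℕ) (hm : 0 < m)
    (y : LaurentSeries ℂ) : ((A.localSystem p).map (ramify m hm)).charpoly.IsRoot
      (single (sgn p * m) 1 * y) ↔ (A.at (A.coord p m)).charpoly.IsRoot y := by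
  rw [A.localSystem_map, ← charpoly_smul_isRoot (A.at (A.coord p m))
    (c := single (sgn p * m) 1) (single_ne_zero one_ne_zero)]
  rw [← Matrix.charpoly_reindex (L p).e.symm]
  rfl

theorem invCoord_eq (p : Option ι) : invCoord p = single (-sgn p) 1 := by
  cases p <;> simp [invCoord, sgn]

theorem bareD_submatrix (p : Option ι) (t : Fin (L p).s → ℕ → ℂ) :
    ((single (sgn p) 1 : LaurentSeries ℂ) • bareD L p t).submatrix (L p).e (L p).e =
      bareM p (L p).n (L p).r t := by
  refine Matrix.ext fun ⟨i, a⟩ ⟨j, b⟩ => ?_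
  rw [Matrix.submatrix_apply, Matrix.smul_apply, bareD, LocalType.blocks, Matrix.reindex_apply,
    Matrix.submatrix_apply, Equiv.symm_apply_apply, Equiv.symm_apply_apply, bareM]
  by_cases hij : i = j
  · subst hij
    rw [Matrix.blockDiagonal'_apply_eq, Matrix.blockDiagonal'_apply_eq, Matrix.smul_apply,
      Matrix.smul_apply, smul_eq_mul, smul_eq_mul, smul_eq_mul, ← mul_assoc]
    have e : (single (sgn p) 1 : LaurentSeries ℂ) * ((((L p).n i : LaurentSeries ℂ))⁻¹ *
        invCoord p) = HahnSeries.C ((((L p).n i : ℂ))⁻¹) := by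
      rw [invCoord_eq, mul_left_comm, single_mul_single, map_inv₀, map_natCast]
      simp
    rw [e]
    simp only [matrix_smul_eq]
  · rw [Matrix.blockDiagonal'_apply_ne _ _ _ hij, Matrix.blockDiagonal'_apply_ne _ _ _ hij]
    exact mul_zero _

/-- A formal gauge, indexed by the rows of the blocks. -/
noncomputable def localGaugeMat (T : LocalType ν) (Y : Matrix ν ν (PowerSeries ℂ)) :
    Matrix (Σ j : Fin T.s, Fin (T.n j)) (Σ j : Fin T.s, Fin (T.n j)) (LaurentSeries ℂ) :=
  (toLaurent Y).submatrix T.e T.e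

theorem toLaurent_inverse {Y : Matrix ν ν (PowerSeries ℂ)}
    (h : IsUnit (Y.map (PowerSeries.constantCoeff (R := ℂ))).det) :
    (toLaurent Y).det ≠ 0 ∧ toLaurent Y * (toLaurent Y)⁻¹ = 1 ∧ (toLaurent Y)⁻¹ * toLaurent Y = 1 ∧
      ∀ a b, LB 0 ((toLaurent Y)⁻¹ a b) := by
  refine exists_inverse_of_coeff_zero (fun a b => LB.ofPowerSeries _) ?_
  have : ((toLaurent Y).map fun f => f.coeff 0) = Y.map (PowerSeries.constantCoeff (R := ℂ)) := by
    refine Matrix.ext fun a b => ?_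
    simp only [toLaurent, Matrix.map_apply]
    rw [PowerSeries.coeff_coe]
    simp
  rw [this]
  exact h.ne_zero

theorem Connection.IsFormalGauge.localGauge {A : Connection φ L} {p : Option ι}
    {t : Fin (L p).s → ℕ → ℂ} {Y : Matrix ν ν (PowerSeries ℂ)} (h : A.IsFormalGauge p t Y) :
    LocalGauge p (L p).r t (A.localSystem p) (localGaugeMat (L p) Y)
      ((toLaurent Y)⁻¹.submatrix (L p).e (L p).e) := by
  obtain ⟨h1, h2⟩ := h
  obtain ⟨-, -, h3, h4⟩ := toLaurent_inverse h1
  refine ⟨fun a b => LB.ofPowerSeries _, fun a b => h4 _ _, ?_, ?_⟩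
  · rw [localGaugeMat, Matrix.submatrix_mul_equiv, h3]
    exact Matrix.submatrix_one_equiv _
  · have e : (toLaurent Y).map euler = (HahnSeries.C (sgn p : ℂ) * single (sgn p) 1 : LaurentSeries ℂ) •
        (A.at (A.coord p 1) * toLaurent Y - toLaurent Y * bareD L p t) := by
      refine Matrix.ext fun a b => ?_
      have h5 := congrFun (congrFun h2 a) b
      rw [Matrix.map_apply, Matrix.smul_apply, smul_eq_mul] at h5
      rw [Matrix.map_apply, Matrix.smul_apply, euler_eq_single_mul_derivative, h5, ← mul_assoc,
        ← euler_eq_single_mul_derivative, A.euler_coord, smul_eq_mul, C_apply, single_mul_single]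
      simp
    have e2 : (single (sgn p) 1 : LaurentSeries ℂ) • A.at (A.coord p 1) * toLaurent Y = toLaurent Y *
        ((single (sgn p) 1 : LaurentSeries ℂ) • bareD L p t) +
          (HahnSeries.C (sgn p : ℂ) : LaurentSeries ℂ) • (toLaurent Y).map euler := by
      rw [e, laurent_smul_mul, laurent_mul_smul]
      refine Matrix.ext fun a b => ?_
      simp only [Matrix.add_apply, Matrix.smul_apply, Matrix.sub_apply, smul_eq_mul]
      have e3 : (HahnSeries.C (sgn p : ℂ) * HahnSeries.C (sgn p : ℂ) : LaurentSeries ℂ) = 1 := by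
        rw [← map_mul]
        have : (sgn p : ℂ) * (sgn p : ℂ) = 1 := by exact_mod_cast sgn_mul_self p
        rw [this, map_one]
      linear_combination (-single (sgn p) 1 * ((A.at (A.coord p 1) * toLaurent Y) a b -
        (toLaurent Y * bareD L p t) a b)) * e3
    rw [← bareD_submatrix, Connection.localSystem, localGaugeMat, Matrix.submatrix_mul_equiv, e2,
      Matrix.submatrix_mul_equiv]
    rfl

theorem leadExp_eq (p : Option ι) : leadExp L p = -((L p).r : ℤ) - sgn p := by
  cases p <;> simp only [leadExp, sgn] <;> ring

theorem Connection.coeffMat_localSystem (A : Connection φ L) (p : Option ι) (k : ℤ) :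
    coeffMat (k + sgn p) (A.localSystem p) = (A.expCoeff p k).submatrix (L p).e (L p).e := by
  refine Matrix.ext fun a b => ?_
  rw [coeffMat_apply, Connection.localSystem, Matrix.submatrix_apply, Matrix.smul_apply, smul_eq_mul,
    coeff_single_mul]
  simp [Connection.expCoeff]

theorem Connection.IsFormalGauge.genericTimes {A : Connection φ L} {p : Option ι}
    {t : Fin (L p).s → ℕ → ℂ} {Y : Matrix ν ν (PowerSeries ℂ)} (h : A.IsFormalGauge p t Y)
    (hm : A.MinimallyResonantAt p fun j => t j ((L p).r * (L p).n j) / (L p).n j) :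
    GenericTimes (L p).n (L p).r t := by
  obtain ⟨P, hP, h1, h2⟩ := hm
  have e1 := A.coeffMat_localSystem p (leadExp L p)
  have e2 := A.coeffMat_localSystem p (leadExp L p + 1)
  rw [show leadExp L p + sgn p = -((L p).r : ℤ) by rw [leadExp_eq]; ring] at e1
  rw [show leadExp L p + 1 + sgn p = -((L p).r : ℤ) + 1 by rw [leadExp_eq]; ring] at e2
  refine h.localGauge.genericTimes (P := P.submatrix (L p).e (L p).e)
    (Pi := P⁻¹.submatrix (L p).e (L p).e) (L p) ?_ ?_ _ ?_ h2
  · rw [Matrix.submatrix_mul_equiv, Matrix.mul_nonsing_inv _ hP]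
    exact Matrix.submatrix_one_equiv _
  · rw [e1, Matrix.submatrix_mul_equiv, h1, Matrix.mul_assoc, Matrix.nonsing_inv_mul _ hP,
      Matrix.mul_one, ← Matrix.submatrix_mul_equiv _ _ _ (L p).e]
    congr 1
    rw [LocalType.blocks]
    simp [jordanMat]
  · rw [e2, Matrix.submatrix_mul_equiv, Matrix.submatrix_mul_equiv]

/-- The term of second order in the expansion of the spectral branches. -/
noncomputable def secondOrderTerm (T : LocalType ν) (p : Option ι) (t : Fin T.s → ℕ → ℂ)
    (j : Fin T.s) (J : ℕ) : ℂ :=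
  if J = T.r * T.n j - 1 then secondOrderConst p T.n_pos j / t j (T.r * T.n j - 1) else 0

/-- Multiplication by `u` turns the spectral points of `A` into the branches of
`LocalGauge.exists_spectralBranch`, and the first two prescribed coefficients are exactly the
closeness that singles out one root. -/
theorem Connection.IsFormalGauge.existsUnique_spectralPoint {A : Connection φ L} {p : Option ι}
    {t : Fin (L p).s → ℕ → ℂ} {Y : Matrix ν ν (PowerSeries ℂ)} (h : A.IsFormalGauge p t Y)
    (hm : A.MinimallyResonantAt p fun j => t j ((L p).r * (L p).n j) / (L p).n j)
    (j : Fin (L p).s) :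
    (∃! y, A.IsSpectralPoint p t j y) ∧ ∀ y, A.IsSpectralPoint p t j y →
      (∀ J ∈ Finset.Icc 1 ((L p).r * (L p).n j), t j J = A.spectralRes p ((L p).n j) y J) ∧
      t j 0 = A.spectralRes p ((L p).n j) y 0 + ((L p).n j - 1 : ℂ) / 2 ∧
      ∀ J ∈ Finset.Icc 1 ((L p).r * (L p).n j), A.spectralRes p ((L p).n j) y (-(J : ℤ)) =
        sgn p * (blockH p (L p).n j J * ((toLaurent Y)⁻¹.submatrix (L p).e (L p).e *
          (localGaugeMat (L p) Y).map euler)).trace.coeff 0 + secondOrderTerm (L p) p t j J := by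
  have hn := (L p).n_pos
  have hr := (L p).r_pos
  have hgen := h.genericTimes hm
  obtain ⟨z, z1, z2, z3, z4, z5, z6⟩ := h.localGauge.exists_spectralBranch hn hr hgen j
  set n := (L p).n j with hndef
  set r := (L p).r with hrdef
  have hn0 : (n : ℂ) ≠ 0 := by exact_mod_cast (hn j).ne'
  set X : ℤ → LaurentSeries ℂ := fun k => single k 1 with hX
  have hXX : ∀ k y, X k * (X (-k) * y) = y := fun k y => by
    simp [hX, ← mul_assoc, single_mul_single]
  have hXX' : ∀ k y, X (-k) * (X k * y) = y := fun k y => by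
    simp [hX, ← mul_assoc, single_mul_single]
  have hlead : (n : ℤ) * leadExp L p = -(r * n : ℕ) - sgn p * n := by
    rw [leadExp_eq]; push_cast; ring
  have hrn : 1 ≤ r * n := Nat.mul_pos hr (hn j)
  have hcoef : ∀ (x : LaurentSeries ℂ) (k : ℤ),
      (X (-(sgn p * n)) * x).coeff k = x.coeff (k + sgn p * n) := fun x k => by
    rw [hX, coeff_single_mul, one_mul, sub_neg_eq_add]
  have zlead : z.coeff (-(r * n : ℕ)) = t j (r * n) / n := by
    rw [eq_div_iff hn0, mul_comm]
    exact z4 _ hrn le_rfl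
  have znext : z.coeff (-(r * n : ℕ) + 1) = t j (r * n - 1) / n := by
    -- If `r n = 1` the next coefficient is the constant one and belongs to `t_0`; the shift `(n -
    -- 1) / 2` vanishes since then `n = 1`.
    rcases Nat.eq_or_lt_of_le hrn with h1 | h1
    · have h2 : n = 1 := by
        have := Nat.eq_one_of_mul_eq_one_left h1.symm
        exact this
      rw [← h1]
      simp only [Nat.cast_one, neg_add_cancel, Nat.sub_self]
      rw [eq_div_iff hn0, mul_comm]
      rw [z5, h2]; simp
    · rw [eq_div_iff hn0, mul_comm, ← z4 (r * n - 1) (by omega) (Nat.sub_le _ _)]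
      congr 2
      omega
  have huniq : ∀ y, A.IsSpectralPoint p t j y → X (sgn p * n) * y = z := by
    intro y hy
    have hc : ∀ k, (X (sgn p * n) * y).coeff k = y.coeff (k - sgn p * n) := fun k => by
      rw [hX, coeff_single_mul, one_mul]
    refine z2 _ ((A.isRoot_localSystem p n (hn j) y).mpr hy.root) fun k hk => ?_
    have hk' : k < -(r * n : ℕ) + 2 := hk
    rw [coeff_sub, hc]
    rcases lt_trichotomy k (-(r * n : ℕ)) with h1 | h1 | h1
    · rw [hy.coeff_lt _ (by rw [← hndef, hlead]; omega), LB.branchExp _ _ _ _ k h1, sub_zero]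
    · have e := hy.coeff_lead
      rw [← hndef, hlead] at e
      rw [h1, e, coeff_branchExp _ _ _ _ le_rfl, sub_self]
    · have h2 : k = -((r * n - 1 : ℕ) : ℤ) := by omega
      have e := hy.coeff_next
      rw [← hndef, hlead] at e
      rw [h2, coeff_branchExp _ _ _ _ (Nat.sub_le _ _), sub_eq_zero, ← e]
      congr 1
      omega
  have hex : A.IsSpectralPoint p t j (X (-(sgn p * n)) * z) := by
    have hnx : (X (-(sgn p * n)) * z).coeff (n * leadExp L p + 1) = t j (r * n - 1) / n := by
      rw [hcoef, hlead, ← znext]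
      congr 1
      ring
    refine ⟨?_, ?_, ?_, ?_, hnx⟩
    · rw [← A.isRoot_localSystem p n (hn j)]
      have := hXX (sgn p * n) z
      rw [hX] at this ⊢
      simp only at this ⊢
      rwa [this]
    -- For `n ≥ 2` the coefficient at `n * leadExp + 1` is nonzero by genericity, and this exponent
    -- is prime to `n`.
    · intro d hd hsupp
      by_cases h2 : 2 ≤ n
      · have h3 : ((n : ℤ) * leadExp L p + 1) ∈ (X (-(sgn p * n)) * z).support := by
          rw [HahnSeries.mem_support, hnx]
          exact div_ne_zero (hgen.ne_zero j h2) hn0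
        have h4 := hsupp _ h3
        have h5 : (d : ℤ) ∣ (n : ℤ) * leadExp L p := Dvd.dvd.mul_right (by exact_mod_cast hd) _
        have h6 : (d : ℤ) ∣ 1 := (Int.dvd_add_right h5).mp h4
        exact_mod_cast Int.eq_one_of_dvd_one (by omega) h6
      · have h3 : n = 1 := by have := hn j; omega
        rw [← hndef, h3] at hd
        exact Nat.dvd_one.mp hd
    · intro k hk
      rw [hcoef]
      rw [← hndef, hlead] at hk
      exact z3 _ (by omega)
    · rw [hcoef, ← hndef, hlead, ← zlead]
      congr 1
      ring
  refine ⟨⟨_, hex, fun y hy => ?_⟩, fun y hy => ?_⟩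
  · rw [← huniq y hy, hXX']
  · have hz := huniq y hy
    have hres : ∀ K : ℤ, A.spectralRes p n y K = n * z.coeff (-K) := by
      intro K
      rw [A.spectralRes_eq, ← hz]
    refine ⟨fun J hJ => ?_, ?_, fun J hJ => ?_⟩
    · rw [Finset.mem_Icc] at hJ
      rw [hres, z4 J hJ.1 hJ.2]
    · rw [hres, neg_zero, z5]
      ring
    · rw [Finset.mem_Icc] at hJ
      rw [hres, neg_neg, z6 J hJ.1 hJ.2, secondOrderTerm]

end Application

section Deformation

variable {s : ℕ} {n : Fin s → ℕ} {ι : Type*} (p : Option ι) (hn : ∀ j, 0 < n j)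

/-! ### Isomonodromic deformations of a local system -/

/-- The variation of the bare system under a variation of the times. -/
noncomputable def bareVar (n : Fin s → ℕ) (r : ℕ) (dt : Fin s → ℕ → ℂ) :
    Matrix (Σ j : Fin s, Fin (n j)) (Σ j : Fin s, Fin (n j)) (LaurentSeries ℂ) :=
  ∑ j, ∑ J ∈ Finset.range (r * n j + 1),
    (HahnSeries.C (dt j J / n j) : LaurentSeries ℂ) • blockH p n j J

/-- The bare deformation matrix. -/
noncomputable def bareB (n : Fin s → ℕ) (r : ℕ) (dt : Fin s → ℕ → ℂ) :
    Matrix (Σ j : Fin s, Fin (n j)) (Σ j : Fin s, Fin (n j)) (LaurentSeries ℂ) :=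
  ∑ j, ∑ J ∈ Finset.Icc 1 (r * n j),
    (HahnSeries.C (-(sgn p : ℂ) * dt j J / J) : LaurentSeries ℂ) • blockH p n j J

/-- The bare deformation in the eigenframe. -/
noncomputable def bareBEig (r : ℕ) (dt : Fin s → ℕ → ℂ) (x : Σ j : Fin s, Fin (n j)) :
    LaurentSeries ℂ :=
  ∑ J ∈ Finset.Icc 1 (r * n x.1), HahnSeries.C (-(sgn p : ℂ) * dt x.1 J / J) * mu hn x ^ J

theorem toFrame_smul (c : ℂ)
    (a : Matrix (Σ j : Fin s, Fin (n j)) (Σ j : Fin s, Fin (n j)) (LaurentSeries ℂ)) :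
    toFrame p hn ((HahnSeries.C c : LaurentSeries ℂ) • a) =
      (HahnSeries.C c : LaurentSeries ℂ) • toFrame p hn a := by
  have : ((HahnSeries.C c : LaurentSeries ℂ) • a).map (cov hn) =
      (HahnSeries.C c : LaurentSeries ℂ) • a.map (cov hn) := by
    refine Matrix.ext fun a b => ?_
    exact (map_mul (cov hn) _ _).trans (by rw [cov, ramify_C]; rfl)
  rw [toFrame, this, laurent_mul_smul, laurent_smul_mul, toFrame]

theorem toFrame_sum {α : Type*} (S : Finset α)
    (a : α → Matrix (Σ j : Fin s, Fin (n j)) (Σ j : Fin s, Fin (n j)) (LaurentSeries ℂ)) :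
    toFrame p hn (∑ i ∈ S, a i) = ∑ i ∈ S, toFrame p hn (a i) := by
  classical
  induction S using Finset.induction_on with
  | empty =>
    have : (0 : Matrix (Σ j : Fin s, Fin (n j)) (Σ j : Fin s, Fin (n j)) (LaurentSeries ℂ)).map
        (cov hn) = 0 := Matrix.map_zero _ (map_zero _)
    rw [Finset.sum_empty, Finset.sum_empty, toFrame, this, Matrix.mul_zero, Matrix.zero_mul]
  | insert i S hi ih => rw [Finset.sum_insert hi, Finset.sum_insert hi, toFrame_add, ih]

theorem toFrame_sub
    (a b : Matrix (Σ j : Fin s, Fin (n j)) (Σ j : Fin s, Fin (n j)) (LaurentSeries ℂ)) :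
    toFrame p hn (a - b) = toFrame p hn a - toFrame p hn b := by
  rw [eq_sub_iff_add_eq, ← toFrame_add, sub_add_cancel]

theorem toFrame_combination (S : Fin s → Finset ℕ) (c : Fin s → ℕ → ℂ) :
    toFrame p hn (∑ j, ∑ J ∈ S j, (HahnSeries.C (c j J) : LaurentSeries ℂ) • blockH p n j J) =
      Matrix.diagonal fun x => ∑ J ∈ S x.1, HahnSeries.C (c x.1 J) * mu hn x ^ J := by
  simp only [toFrame_sum, toFrame_smul, toFrame_blockH]
  refine Matrix.ext fun x y => ?_
  simp only [Matrix.sum_apply, Matrix.smul_apply, smul_eq_mul, Matrix.diagonal_apply]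
  by_cases hxy : x = y
  · subst hxy
    simp only [if_true]
    rw [Finset.sum_eq_single x.1]
    · simp
    · intro j _ hj
      exact Finset.sum_eq_zero fun J _ => by rw [if_neg hj.symm, mul_zero]
    · simp
  · simp [hxy]

theorem toFrame_bareB (r : ℕ) (dt : Fin s → ℕ → ℂ) :
    toFrame p hn (bareB p n r dt) = Matrix.diagonal (bareBEig p hn r dt) :=
  toFrame_combination p hn _ _

theorem covEuler_C_mul (n : Fin s → ℕ) (c : ℂ) (x : LaurentSeries ℂ) :
    covEuler n (HahnSeries.C c * x) = HahnSeries.C c * covEuler n x := by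
  have : covEuler n (HahnSeries.C c) = 0 := by rw [covEuler, euler_C, mul_zero]
  rw [covEuler_mul, this, zero_mul, zero_add]

theorem toFrame_bareVar (r : ℕ) (dt : Fin s → ℕ → ℂ) :
    toFrame p hn (bareVar p n r dt) = Matrix.diagonal fun x => HahnSeries.C (dt x.1 0 / n x.1) +
      HahnSeries.C (sgn p : ℂ) * covEuler n (bareBEig p hn r dt x) := by
  refine (toFrame_combination p hn _ _).trans ?_
  congr 1
  funext x
  have h0 : (n x.1 : ℂ) ≠ 0 := by exact_mod_cast (hn x.1).ne'
  rw [bareBEig, covEuler_sum, Finset.mul_sum, Finset.sum_range_eq_add_Ico _ (by omega)]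
  congr 1
  · simp
  · refine Finset.sum_congr ?_ fun J hJ => ?_
    · ext J; simp only [Finset.mem_Ico, Finset.mem_Icc]; omega
    · have hJ0 : (J : ℂ) ≠ 0 := by
        have := (Finset.mem_Ico.mp hJ).1
        exact_mod_cast (by omega : J ≠ 0)
      have e := covEuler_mu_zpow hn x J
      rw [zpow_natCast] at e
      rw [covEuler_C_mul, e, ← mul_assoc, ← mul_assoc, ← map_mul, ← map_mul]
      congr 2
      have : (sgn p : ℂ) * (sgn p : ℂ) = 1 := by exact_mod_cast sgn_mul_self p
      push_cast
      field_simp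
      linear_combination (-dt x.1 J) * this

theorem LB.bareBEig (r : ℕ) (dt : Fin s → ℕ → ℂ) (x : Σ j : Fin s, Fin (n j)) :
    LB (-(r * coverDeg n)) (bareBEig p hn r dt x) := by
  refine LB.sum fun J hJ => (LB.C _).mul_of_le ?_ (zero_add _).ge
  rw [← zpow_natCast]
  refine (LB.mu_zpow hn x J).mono ?_
  have h1 := (Finset.mem_Icc.mp hJ).2
  rw [← ram_mul_rank n r x.1, neg_mul, neg_le_neg_iff]
  exact mul_le_mul_of_nonneg_left (by omega) (by omega)

theorem coeff_bareBEig_of_nonneg (r : ℕ) (dt : Fin s → ℕ → ℂ) (x : Σ j : Fin s, Fin (n j)) {k : ℤ}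
    (hk : 0 ≤ k) : (bareBEig p hn r dt x).coeff k = 0 := by
  rw [bareBEig, coeff_sum]
  refine Finset.sum_eq_zero fun J hJ => ?_
  have h1 := (Finset.mem_Icc.mp hJ).1
  rw [HahnSeries.C_mul_eq_smul, coeff_smul, ← zpow_natCast, mu_zpow, coeff_single_of_ne, smul_zero]
  have h2 := ram_pos hn x.1
  have : 0 < (ram n x.1 : ℤ) * J := by positivity
  rw [neg_mul]
  omega

/-- The variation `S⁻¹ θ S` of the eigenframe. -/
noncomputable def frameLog :
    Matrix (Σ j : Fin s, Fin (n j)) (Σ j : Fin s, Fin (n j)) (LaurentSeries ℂ) :=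
  frameInv p hn * (frame p hn).map (covEuler n)

theorem map_covEuler_mul
    (a b : Matrix (Σ j : Fin s, Fin (n j)) (Σ j : Fin s, Fin (n j)) (LaurentSeries ℂ)) :
    (a * b).map (covEuler n) = a.map (covEuler n) * b + a * b.map (covEuler n) := by
  refine Matrix.ext fun x y => ?_
  rw [Matrix.map_apply, Matrix.mul_apply, covEuler_sum, Matrix.add_apply, Matrix.mul_apply,
    Matrix.mul_apply, ← Finset.sum_add_distrib]
  exact Finset.sum_congr rfl fun z _ => covEuler_mul _ _ _

theorem frame_mul_toFrame
    (a : Matrix (Σ j : Fin s, Fin (n j)) (Σ j : Fin s, Fin (n j)) (LaurentSeries ℂ)) :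
    frame p hn * toFrame p hn a = a.map (cov hn) * frame p hn := by
  rw [toFrame, ← Matrix.mul_assoc, ← Matrix.mul_assoc, frame_mul_frameInv, Matrix.one_mul]

theorem toFrame_euler
    (a : Matrix (Σ j : Fin s, Fin (n j)) (Σ j : Fin s, Fin (n j)) (LaurentSeries ℂ)) :
    toFrame p hn (a.map euler) = (toFrame p hn a).map (covEuler n) +
      (frameLog p hn * toFrame p hn a - toFrame p hn a * frameLog p hn) := by
  have h := congrArg (fun X => frameInv p hn * X.map (covEuler n)) (frame_mul_toFrame p hn a)
  simp only [map_covEuler_mul, Matrix.mul_add] at h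
  have e1 : frameInv p hn * ((frame p hn).map (covEuler n) * toFrame p hn a) =
      frameLog p hn * toFrame p hn a := by rw [frameLog, Matrix.mul_assoc]
  have e2 : frameInv p hn * (frame p hn * (toFrame p hn a).map (covEuler n)) =
      (toFrame p hn a).map (covEuler n) := by
    rw [← Matrix.mul_assoc, frameInv_mul_frame, Matrix.one_mul]
  have e3 : frameInv p hn * ((a.map (cov hn)).map (covEuler n) * frame p hn) =
      toFrame p hn (a.map euler) := by
    rw [toFrame, Matrix.mul_assoc]
    congr 2
    exact Matrix.ext fun x y => covEuler_cov hn _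
  have e4 : frameInv p hn * (a.map (cov hn) * (frame p hn).map (covEuler n)) =
      toFrame p hn a * frameLog p hn := by
    rw [toFrame, frameLog, Matrix.mul_assoc (frameInv p hn * _), ← Matrix.mul_assoc (frame p hn),
      frame_mul_frameInv, Matrix.one_mul, Matrix.mul_assoc]
  rw [e1, e2, e3, e4] at h
  rw [← sub_eq_iff_eq_add] at h
  rw [← h]
  abel

theorem toFrame_bareM (r : ℕ) (t : Fin s → ℕ → ℂ) : toFrame p hn (bareM p n r t) =
    Matrix.diagonal (bareEig hn r t) +
      (HahnSeries.C (sgn p : ℂ) : LaurentSeries ℂ) • frameLog p hn := by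
  rw [toFrame, Matrix.mul_assoc, bareM_mul_frame, Matrix.mul_add, ← Matrix.mul_assoc,
    frameInv_mul_frame, Matrix.one_mul, laurent_mul_smul, frameLog]

theorem frameLog_apply_ne {i j : Fin s} (h : i ≠ j) (k : Fin (n i)) (l : Fin (n j)) :
    frameLog p hn ⟨i, k⟩ ⟨j, l⟩ = 0 := by
  rw [frameLog, Matrix.mul_apply, Finset.sum_eq_zero]
  rintro ⟨m, a⟩ _
  rw [Matrix.map_apply, frame_apply, frameInv_apply]
  split_ifs with h1 h2
  · exact absurd (h1.trans h2) h
  all_goals simp [covEuler]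

variable {p hn} {r : ℕ} {t dt : Fin s → ℕ → ℂ}
  {κ N : Matrix (Σ j : Fin s, Fin (n j)) (Σ j : Fin s, Fin (n j)) (LaurentSeries ℂ)}

/-- The regular part of the gauged deformation satisfies a linear equation in the eigenframe. -/
theorem frame_equation
    (h : bareVar p n r dt = (HahnSeries.C (sgn p : ℂ) : LaurentSeries ℂ) • N.map euler +
      (N * bareM p n r t - bareM p n r t * N)) (x y : Σ j : Fin s, Fin (n j)) :
    HahnSeries.C (sgn p : ℂ) * covEuler n (toFrame p hn (N - bareB p n r dt) x y) +
      toFrame p hn (N - bareB p n r dt) x y * (bareEig hn r t y - bareEig hn r t x) =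
      if x = y then HahnSeries.C (dt x.1 0 / n x.1) else 0 := by
  have h1 := congrFun (congrFun (congrArg (toFrame p hn) h) x) y
  rw [toFrame_add, toFrame_sub, toFrame_smul, toFrame_mul, toFrame_mul, toFrame_euler, toFrame_bareM,
    toFrame_bareVar] at h1
  set Γ := frameLog p hn
  set Nh := toFrame p hn N with hNh
  have hκ : toFrame p hn (N - bareB p n r dt) x y = Nh x y -
      if x = y then bareBEig p hn r dt x else 0 := by
    rw [toFrame_sub, toFrame_bareB, Matrix.sub_apply, Matrix.diagonal_apply]
  rw [hκ]
  rw [laurent_smul_add] at h1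
  have h2 : (Nh * (Matrix.diagonal (bareEig hn r t) + (HahnSeries.C (sgn p : ℂ) : LaurentSeries ℂ) • Γ) -
      (Matrix.diagonal (bareEig hn r t) + (HahnSeries.C (sgn p : ℂ) : LaurentSeries ℂ) • Γ) * Nh) x y =
      Nh x y * (bareEig hn r t y - bareEig hn r t x) -
        HahnSeries.C (sgn p : ℂ) * (Γ * Nh - Nh * Γ) x y := by
    rw [Matrix.mul_add, Matrix.add_mul, laurent_mul_smul, laurent_smul_mul]
    simp only [Matrix.sub_apply, Matrix.add_apply, Matrix.smul_apply, smul_eq_mul,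
      Matrix.mul_diagonal, Matrix.diagonal_mul]
    ring
  rw [Matrix.add_apply, Matrix.add_apply, h2, Matrix.smul_apply, Matrix.smul_apply, smul_eq_mul,
    smul_eq_mul, Matrix.map_apply, Matrix.diagonal_apply] at h1
  have hsub : ∀ u v : LaurentSeries ℂ, covEuler n (u - v) = covEuler n u - covEuler n v := by
    intro u v
    rw [covEuler, covEuler, covEuler, map_sub]; ring
  by_cases hxy : x = y
  · subst hxy
    simp only [if_true] at h1 ⊢
    rw [hsub]
    linear_combination -h1
  · simp only [hxy, if_false, sub_zero] at h1 ⊢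
    linear_combination -h1

/-- On the diagonal the commutator disappears and a `θ`-derivative has no constant coefficient: an
isomonodromic flow preserves the formal monodromy. -/
theorem time_zero_constant (hn : ∀ j, 0 < n j)
    (h : bareVar p n r dt = (HahnSeries.C (sgn p : ℂ) : LaurentSeries ℂ) • N.map euler +
      (N * bareM p n r t - bareM p n r t * N)) (j : Fin s) : dt j 0 = 0 := by
  have h1 := frame_equation (hn := hn) h ⟨j, ⟨0, hn j⟩⟩ ⟨j, ⟨0, hn j⟩⟩
  rw [sub_self, mul_zero, add_zero, if_pos rfl] at h1
  have h2 := congrArg (fun f : LaurentSeries ℂ => f.coeff 0) h1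
  simp only [HahnSeries.C_mul_eq_smul, coeff_smul, coeff_covEuler, Int.cast_zero, zero_mul, mul_zero,
    smul_zero] at h2
  have h3 : dt j 0 / (n j : ℂ) = 0 := by
    rw [C_apply, coeff_single_same] at h2
    exact h2.symm
  have h0 : (n j : ℂ) ≠ 0 := by exact_mod_cast (hn j).ne'
  rcases div_eq_zero_iff.mp h3 with h4 | h4
  · exact h4
  · exact absurd h4 h0

theorem frame_diag_constant (hn : ∀ j, 0 < n j)
    (h : bareVar p n r dt = (HahnSeries.C (sgn p : ℂ) : LaurentSeries ℂ) • N.map euler +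
      (N * bareM p n r t - bareM p n r t * N)) (x : Σ j : Fin s, Fin (n j)) :
    covEuler n (toFrame p hn (N - bareB p n r dt) x x) = 0 := by
  have h1 := frame_equation (hn := hn) h x x
  rw [sub_self, mul_zero, add_zero, if_pos rfl, time_zero_constant hn h, zero_div, map_zero] at h1
  refine (mul_eq_zero.mp h1).resolve_left ((map_ne_zero (HahnSeries.C : ℂ →+* LaurentSeries ℂ)).mpr ?_)
  cases p <;> simp [sgn]

/-- Off the diagonal the equation is `k Δ = -ε θk`, with `Δ` the gap of two exponents. As `θ` does
not lower the order, a nonzero solution needs `Δ` of nonnegative order; the separation of exponents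
allows this only for `r = 1` and two blocks of size one. In that case comparison of the constant
terms makes the solution vanish at the pole. -/
theorem frame_offDiag (hn : ∀ j, 0 < n j) (hr : 0 < r) (hgen : GenericTimes n r t)
    (h : bareVar p n r dt = (HahnSeries.C (sgn p : ℂ) : LaurentSeries ℂ) • N.map euler +
      (N * bareM p n r t - bareM p n r t * N))
    (hreg : ∀ x y, LB 0 ((N - bareB p n r dt) x y)) {x y : Σ j : Fin s, Fin (n j)} (hxy : x ≠ y) :
    toFrame p hn (N - bareB p n r dt) x y = 0 ∨ (r = 1 ∧ n x.1 = 1 ∧ n y.1 = 1 ∧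
      LB 1 (toFrame p hn (N - bareB p n r dt) x y)) := by
  set k := toFrame p hn (N - bareB p n r dt) x y with hk
  by_cases hk0 : k = 0
  · exact Or.inl hk0
  right
  have h1 := frame_equation (hn := hn) h x y
  rw [if_neg hxy, ← hk] at h1
  obtain ⟨d, hd, hne⟩ := hgen.exists_coeff_ne hn hr hxy.symm
  set Δ := bareEig hn r t y - bareEig hn r t x with hΔ
  have hΔ0 : Δ ≠ 0 := by rintro h0; rw [h0] at hne; simp at hne
  have hod : Δ.order ≤ d := order_le_of_coeff_ne_zero hne
  have hprod : k * Δ = HahnSeries.C (-(sgn p : ℂ)) * covEuler n k := by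
    rw [map_neg]; linear_combination h1
  have hlb : LB k.order (k * Δ) := by
    rw [hprod]
    refine (LB.C _).mul_of_le (?_ : LB k.order _) (zero_add _).ge
    intro i hi
    rw [coeff_covEuler, LB.order k i hi, mul_zero, mul_zero]
  have h2 := hlb.le_order (mul_ne_zero hk0 hΔ0)
  rw [order_mul hk0 hΔ0] at h2
  have f1 := rank_facts hn hr x.1
  have f2 := rank_facts hn hr y.1
  have n1 := hn x.1
  have n2 := hn y.1
  have hN : (0 : ℤ) < coverDeg n := by exact_mod_cast coverDeg_pos hn
  have hx1 : n x.1 = 1 := by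
    by_contra hh
    have := f1.2.2.1 (by omega)
    omega
  have hy1 : n y.1 = 1 := by
    by_contra hh
    have := f2.2.2.1 (by omega)
    omega
  have e1 := f1.2.2.2.1 hx1
  have e2 := f2.2.2.2.1 hy1
  have hr1 : r = 1 := by
    have h3 : (r : ℤ) * coverDeg n ≤ coverDeg n := by omega
    have h4 : (r : ℤ) ≤ 1 := by nlinarith
    omega
  refine ⟨hr1, hx1, hy1, ?_⟩
  have hΔord : Δ.order = 0 := by
    have : (r : ℤ) * coverDeg n = coverDeg n := by rw [hr1]; ring
    omega
  have hk_lb : LB 0 k := by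
    have := LB.toFrame p hn hreg x y
    rw [e1, e2, min_self] at this
    refine this.mono (by ring_nf; omega)
  have hord0 := hk_lb.le_order hk0
  have hne0 : k.order ≠ 0 := by
    intro ho
    have h3 := congrArg (fun f : LaurentSeries ℂ => f.coeff 0) hprod
    simp only [HahnSeries.C_mul_eq_smul, coeff_smul, coeff_covEuler] at h3
    rw [coeff_mul_lead' (LB.order k) (LB.order Δ) (by omega)] at h3
    simp only [Int.cast_zero, zero_mul, mul_zero, smul_zero] at h3
    rcases mul_eq_zero.mp h3 with h4 | h4
    · exact (coeff_order_eq_zero.not.mpr hk0) h4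
    · exact (coeff_order_eq_zero.not.mpr hΔ0) h4
  exact (LB.order k).mono (by omega)

/-! ### The residue pairing -/

/-- The constant coefficient of the trace of a product. -/
noncomputable def resPair {I : Type*} [Fintype I] (X Z : Matrix I I (LaurentSeries ℂ)) : ℂ :=
  (X * Z).trace.coeff 0

section Pairing

variable {I : Type*} [Fintype I]

theorem resPair_add_left (X X' Z : Matrix I I (LaurentSeries ℂ)) :
    resPair (X + X') Z = resPair X Z + resPair X' Z := by
  rw [resPair, Matrix.add_mul, Matrix.trace_add, coeff_add]; rfl

theorem resPair_add_right (X Z Z' : Matrix I I (LaurentSeries ℂ)) :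
    resPair X (Z + Z') = resPair X Z + resPair X Z' := by
  rw [resPair, Matrix.mul_add, Matrix.trace_add, coeff_add]; rfl

theorem resPair_comm (X Z : Matrix I I (LaurentSeries ℂ)) : resPair X Z = resPair Z X := by
  rw [resPair, resPair, Matrix.trace_mul_comm]

theorem resPair_eq_zero_of_lb {b c : ℤ} {X Z : Matrix I I (LaurentSeries ℂ)}
    (hX : ∀ i k, LB b (X i k)) (hZ : ∀ i k, LB c (Z i k)) (h : 0 < b + c) : resPair X Z = 0 := by
  rw [resPair, Matrix.trace, coeff_sum]
  exact Finset.sum_eq_zero fun i _ => LB.matrix_mul hX hZ i i 0 h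

theorem map_euler_mul (X Z : Matrix I I (LaurentSeries ℂ)) :
    (X * Z).map euler = X.map euler * Z + X * Z.map euler := by
  refine Matrix.ext fun x y => ?_
  rw [Matrix.map_apply, Matrix.mul_apply, map_sum, Matrix.add_apply, Matrix.mul_apply,
    Matrix.mul_apply, ← Finset.sum_add_distrib]
  exact Finset.sum_congr rfl fun z _ => euler_mul _ _

theorem coeff_zero_trace_map_euler (X : Matrix I I (LaurentSeries ℂ)) :
    (X.map euler).trace.coeff 0 = 0 := by
  rw [Matrix.trace, coeff_sum]
  exact Finset.sum_eq_zero fun i _ => by simp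

/-- The covariant Euler derivative. -/
noncomputable def nabla (a X : Matrix I I (LaurentSeries ℂ)) : Matrix I I (LaurentSeries ℂ) :=
  X.map euler + (a * X - X * a)

theorem nabla_add (a X Z : Matrix I I (LaurentSeries ℂ)) :
    nabla a (X + Z) = nabla a X + nabla a Z := by
  rw [nabla, nabla, nabla, Matrix.map_add _ (map_add euler), Matrix.mul_add, Matrix.add_mul]
  abel

theorem nabla_mul (a X Z : Matrix I I (LaurentSeries ℂ)) :
    nabla a (X * Z) = nabla a X * Z + X * nabla a Z := by
  simp only [nabla, map_euler_mul, Matrix.add_mul, Matrix.mul_add, Matrix.sub_mul, Matrix.mul_sub,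
    Matrix.mul_assoc]
  abel

/-- Integration by parts: `nabla` is a derivation, and the trace of a covariant derivative is a
`θ`-derivative, without constant coefficient. -/
theorem resPair_nabla (a X Z : Matrix I I (LaurentSeries ℂ)) :
    resPair (nabla a X) Z = -resPair X (nabla a Z) := by
  have h : (nabla a (X * Z)).trace.coeff 0 = 0 := by
    rw [nabla, Matrix.trace_add, Matrix.trace_sub, Matrix.trace_mul_comm a, sub_self, add_zero,
      coeff_zero_trace_map_euler]
  rw [nabla_mul, Matrix.trace_add, coeff_add] at h
  exact eq_neg_of_add_eq_zero_left h

theorem LB.nabla {a X : Matrix I I (LaurentSeries ℂ)} (ha : ∀ i k, LB 1 (a i k))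
    (hX : ∀ i k, LB 0 (X i k)) (i k : I) : LB 1 (nabla a X i k) := by
  refine LB.add ?_ (((LB.matrix_mul ha hX i k).mono (by omega)).sub
    ((LB.matrix_mul hX ha i k).mono (by omega)))
  intro m hm
  rw [Matrix.map_apply, coeff_euler]
  rcases eq_or_ne m 0 with rfl | hm0
  · simp
  · rw [hX i k m (by omega), mul_zero]

end Pairing

theorem resPair_toFrame (hn : ∀ j, 0 < n j)
    (X Z : Matrix (Σ j : Fin s, Fin (n j)) (Σ j : Fin s, Fin (n j)) (LaurentSeries ℂ)) :
    resPair X Z = (toFrame p hn X * toFrame p hn Z).trace.coeff 0 := by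
  rw [← toFrame_mul, trace_toFrame, coeff_zero_cov, resPair]

theorem trace_diagonal_mul_comm_sub {I : Type*} [Fintype I] [DecidableEq I] (β : I → LaurentSeries ℂ)
    (Q k : Matrix I I (LaurentSeries ℂ)) :
    (Matrix.diagonal β * (Q * k - k * Q)).trace = ∑ x, ∑ y, β x * (Q x y * k y x - k x y * Q y x) := by
  rw [Matrix.trace]
  refine Finset.sum_congr rfl fun x _ => ?_
  rw [Matrix.diag_apply, Matrix.diagonal_mul, Matrix.sub_apply, Matrix.mul_apply, Matrix.mul_apply,
    ← Finset.sum_sub_distrib, Finset.mul_sum]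

/-- In the eigenframe both bare deformations are diagonal, so the commutator terms have zero trace,
and both have only negative exponents, so that `β θβ'` has no constant coefficient. -/
theorem resPair_bareB_nabla_bareB (hn : ∀ j, 0 < n j)
    (a : Matrix (Σ j : Fin s, Fin (n j)) (Σ j : Fin s, Fin (n j)) (LaurentSeries ℂ))
    (dt' : Fin s → ℕ → ℂ) : resPair (bareB p n r dt) (nabla a (bareB p n r dt')) = 0 := by
  rw [resPair_toFrame hn, nabla, toFrame_add, toFrame_sub, toFrame_mul, toFrame_mul, toFrame_euler,
    toFrame_bareB, toFrame_bareB, Matrix.mul_add, Matrix.mul_add, Matrix.trace_add, Matrix.trace_add,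
    trace_diagonal_mul_comm_sub, trace_diagonal_mul_comm_sub]
  have hz : ∀ Q : Matrix (Σ j : Fin s, Fin (n j)) (Σ j : Fin s, Fin (n j)) (LaurentSeries ℂ),
      ∑ x, ∑ y, bareBEig p hn r dt x * (Q x y * Matrix.diagonal (bareBEig p hn r dt') y x -
        Matrix.diagonal (bareBEig p hn r dt') x y * Q y x) = 0 := by
    intro Q
    refine Finset.sum_eq_zero fun x _ => Finset.sum_eq_zero fun y _ => ?_
    by_cases hxy : x = y
    · subst hxy; simp only [Matrix.diagonal_apply_eq]; ring
    · rw [Matrix.diagonal_apply_ne _ hxy, Matrix.diagonal_apply_ne' _ hxy]; ring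
  rw [hz, hz, add_zero, add_zero, Matrix.trace, coeff_sum]
  refine Finset.sum_eq_zero fun x _ => ?_
  rw [Matrix.diag_apply, Matrix.diagonal_mul, Matrix.map_apply, Matrix.diagonal_apply_eq]
  have h1 := LB.bareBEig p hn r dt x
  have h2 : LB (-(r * coverDeg n)) (covEuler n (bareBEig p hn r dt' x)) := fun k hk => by
    rw [coeff_covEuler, LB.bareBEig p hn r dt' x k hk, mul_zero, mul_zero]
  rw [coeff_mul_eq_sum h1 h2]
  refine Finset.sum_eq_zero fun i _ => ?_
  rcases le_or_gt 0 i with hi | hi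
  · rw [coeff_bareBEig_of_nonneg p hn r dt x hi, zero_mul]
  · rw [coeff_covEuler, coeff_bareBEig_of_nonneg p hn r dt' x (by omega), mul_zero, mul_zero, mul_zero]

/-- The regular remainder is a constant diagonal matrix in the eigenframe, hence annihilated by `θ`
and commuting with the diagonal bare deformation under the trace. The exceptional off-diagonal
entries occur for `r = 1` between blocks of size one: there `frameLog` vanishes, and the product
with `a` has order above `N`, which beats the pole of order at most `N` of the bare deformation. -/
theorem resPair_bareB_nabla_regular (hn : ∀ j, 0 < n j) (hr : 0 < r) (hgen : GenericTimes n r t)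
    {a : Matrix (Σ j : Fin s, Fin (n j)) (Σ j : Fin s, Fin (n j)) (LaurentSeries ℂ)}
    (ha : ∀ x y, LB 1 (a x y)) (dt' : Fin s → ℕ → ℂ)
    (h : bareVar p n r dt = (HahnSeries.C (sgn p : ℂ) : LaurentSeries ℂ) • N.map euler +
      (N * bareM p n r t - bareM p n r t * N))
    (hreg : ∀ x y, LB 0 ((N - bareB p n r dt) x y)) :
    resPair (bareB p n r dt') (nabla a (N - bareB p n r dt)) = 0 := by
  rw [resPair_toFrame hn, nabla, toFrame_add, toFrame_sub, toFrame_mul, toFrame_mul, toFrame_euler,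
    toFrame_bareB, Matrix.mul_add, Matrix.mul_add, Matrix.trace_add, Matrix.trace_add,
    trace_diagonal_mul_comm_sub, trace_diagonal_mul_comm_sub]
  set k := toFrame p hn (N - bareB p n r dt) with hk
  have hoff : ∀ x y, x ≠ y → k x y = 0 ∨ (r = 1 ∧ n x.1 = 1 ∧ n y.1 = 1 ∧ LB 1 (k x y)) :=
    fun x y hxy => frame_offDiag hn hr hgen h hreg hxy
  have h1 : (Matrix.diagonal (bareBEig p hn r dt') * k.map (covEuler n)).trace = 0 := by
    rw [Matrix.trace]
    refine Finset.sum_eq_zero fun x _ => ?_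
    rw [Matrix.diag_apply, Matrix.diagonal_mul, Matrix.map_apply, hk, frame_diag_constant hn h, mul_zero]
  have h2 : ∑ x, ∑ y, bareBEig p hn r dt' x * (frameLog p hn x y * k y x -
      k x y * frameLog p hn y x) = 0 := by
    refine Finset.sum_eq_zero fun x _ => Finset.sum_eq_zero fun y _ => ?_
    by_cases hxy : x = y
    · subst hxy; ring
    · have hz : ∀ x y : Σ j : Fin s, Fin (n j), x ≠ y → frameLog p hn x y * k y x = 0 := by
        intro x y hxy
        rcases hoff y x (Ne.symm hxy) with h3 | h3
        · rw [h3, mul_zero]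
        · have : x.1 ≠ y.1 := fun he => by
            have := two_le_of_ne hxy he
            omega
          obtain ⟨i, a⟩ := x
          obtain ⟨j, b⟩ := y
          rw [frameLog_apply_ne p hn this, zero_mul]
      rw [hz x y hxy, mul_comm (k x y), hz y x (Ne.symm hxy), sub_zero, mul_zero]
  have h3 : (∑ x, ∑ y, bareBEig p hn r dt' x * (toFrame p hn a x y * k y x -
      k x y * toFrame p hn a y x)).coeff 0 = 0 := by
    rw [coeff_sum]
    refine Finset.sum_eq_zero fun x _ => ?_
    rw [coeff_sum]
    refine Finset.sum_eq_zero fun y _ => ?_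
    by_cases hxy : x = y
    · subst hxy
      rw [mul_comm (k x x), sub_self, mul_zero, coeff_zero]
    · have hz : ∀ x' y' : Σ j : Fin s, Fin (n j), x' ≠ y' →
          LB (coverDeg n + 1) (toFrame p hn a x' y' * k y' x') ∧ r = 1 ∨ k y' x' = 0 := by
        intro x' y' hxy
        rcases hoff y' x' (Ne.symm hxy) with h3 | ⟨h3, h4, h5, h6⟩
        · exact Or.inr h3
        · left
          have q := LB.toFrame p hn ha x' y'
          have f1 := (rank_facts hn hr x'.1).2.2.2.1 h5
          have f2 := (rank_facts hn hr y'.1).2.2.2.1 h4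
          rw [f1, f2, min_self] at q
          exact ⟨q.mul_of_le h6 (by omega), h3⟩
      have hz' : ∀ x' y' : Σ j : Fin s, Fin (n j), x' ≠ y' →
          LB 1 (bareBEig p hn r dt' x * (toFrame p hn a x' y' * k y' x')) := by
        intro x' y' hxy
        rcases hz x' y' hxy with ⟨h3, h4⟩ | h3
        · refine (LB.bareBEig p hn r dt' x).mul_of_le h3 ?_
          rw [h4]; push_cast; omega
        · rw [h3, mul_zero, mul_zero]; exact LB.zero 1
      rw [mul_sub, mul_comm (k x y)]
      exact ((hz' x y hxy).sub (hz' y x (Ne.symm hxy))) 0 (by norm_num)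
  rw [h1, h2, zero_add, zero_add, h3]

variable {𝒜 Y Yi : Matrix (Σ j : Fin s, Fin (n j)) (Σ j : Fin s, Fin (n j)) (LaurentSeries ℂ)}

theorem LocalGauge.map_euler_inv (G : LocalGauge p r t 𝒜 Y Yi) :
    Yi.map euler = -(Yi * Y.map euler * Yi) := by
  have h := map_euler_mul Yi Y
  rw [G.inv_mul] at h
  have h0 : (1 : Matrix (Σ j : Fin s, Fin (n j)) (Σ j : Fin s, Fin (n j)) (LaurentSeries ℂ)).map
      euler = 0 := by
    refine Matrix.ext fun x y => ?_
    rw [Matrix.map_apply, Matrix.one_apply]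
    split_ifs <;> simp [euler_one]
  rw [h0] at h
  have h1 := congrArg (fun X => X * Yi) h
  simp only [Matrix.zero_mul, Matrix.add_mul] at h1
  rw [Matrix.mul_assoc, G.mul_inv, Matrix.mul_one] at h1
  exact eq_neg_of_add_eq_zero_left h1.symm

/-- In the gauge `Y` the Euler derivation becomes covariant, with connection form the logarithmic
derivative of `Y`. -/
theorem LocalGauge.conj_nabla (G : LocalGauge p r t 𝒜 Y Yi)
    (T : Matrix (Σ j : Fin s, Fin (n j)) (Σ j : Fin s, Fin (n j)) (LaurentSeries ℂ)) :
    Yi * T.map euler * Y = nabla (Yi * Y.map euler) (Yi * T * Y) := by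
  rw [nabla, map_euler_mul, map_euler_mul, G.map_euler_inv]
  have e : Yi * T * Y * (Yi * Y.map euler) = Yi * T * Y.map euler := by
    rw [Matrix.mul_assoc, ← Matrix.mul_assoc Y, G.mul_inv, Matrix.one_mul]
  have e2 : Yi * Y.map euler * (Yi * T * Y) = Yi * Y.map euler * Yi * T * Y := by
    simp only [Matrix.mul_assoc]
  rw [e, e2]
  simp only [Matrix.add_mul, Matrix.neg_mul]
  abel

/-- The exterior derivative of the local Hamiltonian form, in terms of the residue pairing of the
deformation matrices. -/
theorem LocalGauge.resPair_deformation (hn : ∀ j, 0 < n j) (G : LocalGauge p r t 𝒜 Y Yi)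
    (hr : 0 < r) (hgen : GenericTimes n r t) {dt' : Fin s → ℕ → ℂ}
    {T T' b b' : Matrix (Σ j : Fin s, Fin (n j)) (Σ j : Fin s, Fin (n j)) (LaurentSeries ℂ)}
    (hb : ∀ x y, LB 0 (b x y)) (hb' : ∀ x y, LB 0 (b' x y))
    (h : bareVar p n r dt = (HahnSeries.C (sgn p : ℂ) : LaurentSeries ℂ) • (Yi * T * Y - b).map euler +
      ((Yi * T * Y - b) * bareM p n r t - bareM p n r t * (Yi * T * Y - b)))
    (h' : bareVar p n r dt' = (HahnSeries.C (sgn p : ℂ) : LaurentSeries ℂ) •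
      (Yi * T' * Y - b').map euler +
      ((Yi * T' * Y - b') * bareM p n r t - bareM p n r t * (Yi * T' * Y - b')))
    (hreg : ∀ x y, LB 0 ((Yi * T * Y - bareB p n r dt) x y))
    (hreg' : ∀ x y, LB 0 ((Yi * T' * Y - bareB p n r dt') x y)) :
    resPair (bareB p n r dt') (nabla (Yi * Y.map euler) b) -
      resPair (bareB p n r dt) (nabla (Yi * Y.map euler) b') = resPair (T.map euler) T' := by
  set a := Yi * Y.map euler with ha
  set κ := Yi * T * Y - b - bareB p n r dt with hκ
  set κ' := Yi * T' * Y - b' - bareB p n r dt' with hκ'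
  have hκ_lb : ∀ x y, LB 0 (κ x y) := fun x y => by
    have : κ = Yi * T * Y - bareB p n r dt - b := by rw [hκ]; abel
    rw [this]
    exact (hreg x y).sub (hb x y)
  have hκ_lb' : ∀ x y, LB 0 (κ' x y) := fun x y => by
    have : κ' = Yi * T' * Y - bareB p n r dt' - b' := by rw [hκ']; abel
    rw [this]
    exact (hreg' x y).sub (hb' x y)
  have e1 : resPair (T.map euler) T' = resPair (nabla a (Yi * T * Y)) (Yi * T' * Y) := by
    rw [ha, ← G.conj_nabla, resPair, resPair]
    have : Yi * T.map euler * Y * (Yi * T' * Y) = Yi * (T.map euler * T') * Y := by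
      rw [Matrix.mul_assoc Yi T', Matrix.mul_assoc (Yi * T.map euler), ← Matrix.mul_assoc Y, G.mul_inv,
        Matrix.one_mul]
      simp only [Matrix.mul_assoc]
    rw [this, Matrix.trace_mul_comm (Yi * _), ← Matrix.mul_assoc, G.mul_inv, Matrix.one_mul]
  -- Polar bare part, variation of the gauge, regular remainder. In the expansion of the pairing
  -- bare against bare, regular against regular and bare against remainder all vanish; only bare
  -- against gauge variation is left.
  have e2 : Yi * T * Y = bareB p n r dt + (b + κ) := by rw [hκ]; abel
  have e3 : Yi * T' * Y = bareB p n r dt' + (b' + κ') := by rw [hκ']; abel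
  have hz : resPair (nabla a (b + κ)) (b' + κ') = 0 :=
    resPair_eq_zero_of_lb (b := 1) (c := 0)
      (LB.nabla G.lb_log fun x y => (hb x y).add (hκ_lb x y))
      (fun x y => (hb' x y).add (hκ_lb' x y)) (by norm_num)
  rw [e1, e2, e3, nabla_add, resPair_add_left, resPair_add_right,
    resPair_add_right (nabla a (b + κ)) (bareB p n r dt'), hz, resPair_nabla, resPair_bareB_nabla_bareB hn, resPair_nabla, nabla_add a b', resPair_add_right,
    resPair_bareB_nabla_regular hn hr hgen G.lb_log dt h' hκ_lb', resPair_comm _ (bareB p n r dt'),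
    nabla_add a b, resPair_add_right, resPair_bareB_nabla_regular hn hr hgen G.lb_log dt' h hκ_lb]
  ring

end Deformation

/-! ### Analytic families of Laurent series -/

section Family

variable {E : Type*} [NormedAddCommGroup E] [NormedSpace ℂ E] {U : Set E}

/-- A family of Laurent series with analytic coefficients and uniformly bounded poles. -/
structure Fam (U : Set E) (F : E → LaurentSeries ℂ) : Prop where
  lb : ∃ b, ∀ z ∈ U, LB b (F z)
  an : ∀ k, AnalyticOnNhd ℂ (fun z => (F z).coeff k) U

open scoped Classical in
/-- The derivative of a family of Laurent series in the direction `v`, with the parameter of the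
series fixed. -/
noncomputable def dir (F : E → LaurentSeries ℂ) (z v : E) : LaurentSeries ℂ :=
  if h : BddBelow (Function.support fun k : ℤ => fderiv ℂ (fun z' => (F z').coeff k) z v) then
    HahnSeries.ofSuppBddBelow _ h else 0

theorem Fam.const (f : LaurentSeries ℂ) : Fam U fun _ => f :=
  ⟨⟨_, fun _ _ => LB.order f⟩, fun _ => analyticOnNhd_const⟩

theorem Fam.add {F G : E → LaurentSeries ℂ} (hF : Fam U F) (hG : Fam U G) :
    Fam U fun z => F z + G z := by
  obtain ⟨b, hb⟩ := hF.lb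
  obtain ⟨c, hc⟩ := hG.lb
  exact ⟨⟨min b c, fun z hz => ((hb z hz).mono (min_le_left _ _)).add
    ((hc z hz).mono (min_le_right _ _))⟩, fun k => (hF.an k).add (hG.an k)⟩

theorem Fam.neg {F : E → LaurentSeries ℂ} (hF : Fam U F) : Fam U fun z => -F z := by
  obtain ⟨b, hb⟩ := hF.lb
  exact ⟨⟨b, fun z hz => (hb z hz).neg⟩, fun k => (hF.an k).neg⟩

theorem Fam.sub {F G : E → LaurentSeries ℂ} (hF : Fam U F) (hG : Fam U G) :
    Fam U fun z => F z - G z := by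
  simpa only [sub_eq_add_neg] using hF.add hG.neg

theorem Fam.sum {α : Type*} {S : Finset α} {F : α → E → LaurentSeries ℂ}
    (hF : ∀ i ∈ S, Fam U (F i)) : Fam U fun z => ∑ i ∈ S, F i z := by
  classical
  induction S using Finset.induction_on with
  | empty => simpa using Fam.const 0
  | insert i S hi ih =>
    simp only [Finset.sum_insert hi]
    exact (hF i (Finset.mem_insert_self _ _)).add (ih fun k hk => hF k (Finset.mem_insert_of_mem hk))

theorem Fam.single {c : E → ℂ} (hc : AnalyticOnNhd ℂ c U) (m : ℤ) :
    Fam U fun z => HahnSeries.single m (c z) := by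
  refine ⟨⟨m, fun z _ => LB.single _ _⟩, fun k => ?_⟩
  by_cases hk : k = m
  · subst hk; simpa using hc
  · simp only [coeff_single_of_ne hk]; exact analyticOnNhd_const

theorem Fam.C {c : E → ℂ} (hc : AnalyticOnNhd ℂ c U) :
    Fam U fun z => (HahnSeries.C (c z) : LaurentSeries ℂ) := Fam.single hc 0

theorem Fam.mul (hU : IsOpen U) {F G : E → LaurentSeries ℂ} (hF : Fam U F) (hG : Fam U G) :
    Fam U fun z => F z * G z := by
  obtain ⟨b, hb⟩ := hF.lb
  obtain ⟨c, hc⟩ := hG.lb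
  refine ⟨⟨b + c, fun z hz => (hb z hz).mul (hc z hz)⟩, fun k => ?_⟩
  refine AnalyticOnNhd.congr (f := fun z => ∑ i ∈ Finset.Icc b (k - c),
    (F z).coeff i * (G z).coeff (k - i)) hU ?_ fun z hz =>
      (coeff_mul_eq_sum (hb z hz) (hc z hz) k).symm
  exact Finset.analyticOnNhd_fun_sum _ fun i _ => (hF.an i).mul (hG.an (k - i))

theorem Fam.euler {F : E → LaurentSeries ℂ} (hF : Fam U F) : Fam U fun z => euler (F z) := by
  obtain ⟨b, hb⟩ := hF.lb
  refine ⟨⟨b, fun z hz => (hb z hz).euler⟩, fun k => ?_⟩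
  simp only [coeff_euler]
  exact analyticOnNhd_const.mul (hF.an k)

theorem Fam.congr (hU : IsOpen U) {F G : E → LaurentSeries ℂ} (hF : Fam U F)
    (h : ∀ z ∈ U, F z = G z) : Fam U G := by
  obtain ⟨b, hb⟩ := hF.lb
  exact ⟨⟨b, fun z hz => h z hz ▸ hb z hz⟩, fun k => (hF.an k).congr hU fun z hz => by
    simp only [h z hz]⟩

theorem Fam.prod (hU : IsOpen U) {α : Type*} {S : Finset α} {F : α → E → LaurentSeries ℂ}
    (hF : ∀ i ∈ S, Fam U (F i)) : Fam U fun z => ∏ i ∈ S, F i z := by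
  classical
  induction S using Finset.induction_on with
  | empty => simpa using Fam.const 1
  | insert i S hi ih =>
    simp only [Finset.prod_insert hi]
    exact (hF i (Finset.mem_insert_self _ _)).mul hU
      (ih fun k hk => hF k (Finset.mem_insert_of_mem hk))

/-- The coefficients of the inverse obey a recursion in which only the leading coefficient is
divided by. The order must be the same over the whole of `U`, hence the two hypotheses on `b`. -/
theorem Fam.inv (hU : IsOpen U) {F : E → LaurentSeries ℂ} (hF : Fam U F) {b : ℤ}
    (hb : ∀ z ∈ U, LB b (F z)) (h0 : ∀ z ∈ U, (F z).coeff b ≠ 0) : Fam U fun z => (F z)⁻¹ := by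
  have hlb : ∀ z ∈ U, LB (-b) (F z)⁻¹ := fun z hz => LB.inv (h0 z hz)
  refine ⟨⟨-b, hlb⟩, ?_⟩
  have key : ∀ m : ℕ, AnalyticOnNhd ℂ (fun z => ((F z)⁻¹).coeff (m - b)) U := by
    intro m
    induction m using Nat.strong_induction_on with
    | _ m ih =>
      refine AnalyticOnNhd.congr (f := fun z => ((F z).coeff b)⁻¹ * ((if (m : ℤ) = 0 then 1 else 0) -
        ∑ i ∈ Finset.Icc (b + 1) (b + m), (F z).coeff i * ((F z)⁻¹).coeff (m - i))) hU ?_ ?_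
      · refine ((hF.an b).inv h0).mul (analyticOnNhd_const.sub
          (Finset.analyticOnNhd_fun_sum _ fun i hi => (hF.an i).mul ?_))
        rw [Finset.mem_Icc] at hi
        have := ih (m - (i - b).toNat) (by omega)
        have e : ((m - (i - b).toNat : ℕ) : ℤ) - b = m - i := by omega
        rwa [e] at this
      · intro z hz
        have hne : F z ≠ 0 := fun h => h0 z hz (by rw [h]; simp)
        have h1 := coeff_mul_eq_sum (hb z hz) (hlb z hz) m
        rw [mul_inv_cancel₀ hne, coeff_one] at h1
        have h2 : Finset.Icc b ((m : ℤ) - -b) = insert b (Finset.Icc (b + 1) (b + m)) := by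
          ext i; simp only [Finset.mem_Icc, Finset.mem_insert]; omega
        rw [h2, Finset.sum_insert (by simp)] at h1
        simp only
        have h3 : (if (m : ℤ) = 0 then 1 else 0 : ℂ) - ∑ i ∈ Finset.Icc (b + 1) (b + m),
            (F z).coeff i * ((F z)⁻¹).coeff (m - i) = (F z).coeff b * ((F z)⁻¹).coeff (m - b) := by
          rw [sub_eq_iff_eq_add, ← h1]
          congr
        refine Eq.trans ?_ (inv_mul_cancel_left₀ (h0 z hz) (((F z)⁻¹).coeff (m - b)))
        rw [← h3]
  intro k
  rcases le_or_gt (-b) k with hk | hk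
  · have := key (k + b).toNat
    have e : (((k + b).toNat : ℕ) : ℤ) - b = k := by omega
    rwa [e] at this
  · exact AnalyticOnNhd.congr (f := fun _ => 0) hU analyticOnNhd_const fun z hz => (hlb z hz k hk).symm

/-- The common lower bound of the family bounds the support of the derivative, so the default value
in `dir` is never taken. -/
theorem Fam.coeff_dir (hU : IsOpen U) {F : E → LaurentSeries ℂ} (hF : Fam U F) {z : E} (hz : z ∈ U)
    (v : E) (k : ℤ) : (dir F z v).coeff k = fderiv ℂ (fun z' => (F z').coeff k) z v := by
  obtain ⟨b, hb⟩ := hF.lb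
  have h : BddBelow (Function.support fun k : ℤ => fderiv ℂ (fun z' => (F z').coeff k) z v) := by
    refine ⟨b, fun k hk => ?_⟩
    by_contra! hlt
    refine hk ?_
    have : (fun z' => (F z').coeff k) =ᶠ[nhds z] fun _ => 0 := by
      filter_upwards [hU.mem_nhds hz] with z' hz' using hb z' hz' k hlt
    simp [this.fderiv_eq]
  rw [dir, dif_pos h]
  rfl

theorem Fam.differentiableAt_coeff {F : E → LaurentSeries ℂ} (hF : Fam U F) {z : E}
    (hz : z ∈ U) (k : ℤ) : DifferentiableAt ℂ (fun z' => (F z').coeff k) z :=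
  (hF.an k z hz).differentiableAt

theorem Fam.dir_lb (hU : IsOpen U) {F : E → LaurentSeries ℂ} (hF : Fam U F) {z : E} (hz : z ∈ U)
    (v : E) {b : ℤ} (hb : ∀ z ∈ U, LB b (F z)) : LB b (dir F z v) := by
  intro k hk
  rw [hF.coeff_dir hU hz]
  have : (fun z' => (F z').coeff k) =ᶠ[nhds z] fun _ => 0 := by
    filter_upwards [hU.mem_nhds hz] with z' hz' using hb z' hz' k hk
  simp [this.fderiv_eq]

theorem dir_congr (hU : IsOpen U) {F G : E → LaurentSeries ℂ} (h : ∀ z ∈ U, F z = G z) {z : E}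
    (hz : z ∈ U) (v : E) : dir F z v = dir G z v := by
  have : (fun k : ℤ => fderiv ℂ (fun z' => (F z').coeff k) z v) =
      fun k : ℤ => fderiv ℂ (fun z' => (G z').coeff k) z v := by
    funext k
    refine congrArg (fun f : E →L[ℂ] ℂ => f v) ?_
    refine Filter.EventuallyEq.fderiv_eq ?_
    filter_upwards [hU.mem_nhds hz] with z' hz'
    rw [h z' hz']
  have e : ∀ f g : ℤ → ℂ, f = g → (open scoped Classical in
      if h : BddBelow (Function.support f) then HahnSeries.ofSuppBddBelow f h else 0) =
      (open scoped Classical in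
      if h : BddBelow (Function.support g) then HahnSeries.ofSuppBddBelow g h else 0) := by
    rintro f _ rfl
    rfl
  exact e _ _ this

theorem dir_const (f : LaurentSeries ℂ) (z v : E) : dir (fun _ => f) z v = 0 := by
  ext k
  rw [(Fam.const (U := Set.univ) f).coeff_dir isOpen_univ (Set.mem_univ z)]
  simp

theorem dir_single (hU : IsOpen U) {c : E → ℂ} (hc : AnalyticOnNhd ℂ c U) (m : ℤ) {z : E}
    (hz : z ∈ U) (v : E) :
    dir (fun z => single m (c z)) z v = single m (fderiv ℂ c z v) := by
  ext k
  rw [(Fam.single hc m).coeff_dir hU hz]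
  by_cases hk : k = m
  · subst hk; simp
  · simp [coeff_single_of_ne hk]

theorem dir_C (hU : IsOpen U) {c : E → ℂ} (hc : AnalyticOnNhd ℂ c U) {z : E} (hz : z ∈ U) (v : E) :
    dir (fun z => (HahnSeries.C (c z) : LaurentSeries ℂ)) z v = HahnSeries.C (fderiv ℂ c z v) :=
  dir_single hU hc 0 hz v

theorem Fam.dir_add (hU : IsOpen U) {F G : E → LaurentSeries ℂ} (hF : Fam U F) (hG : Fam U G)
    {z : E} (hz : z ∈ U) (v : E) : dir (fun z => F z + G z) z v = dir F z v + dir G z v := by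
  ext k
  rw [(hF.add hG).coeff_dir hU hz, coeff_add, hF.coeff_dir hU hz, hG.coeff_dir hU hz]
  simp only [coeff_add]
  rw [fderiv_fun_add (hF.differentiableAt_coeff hz k) (hG.differentiableAt_coeff hz k)]
  rfl

theorem Fam.dir_sum (hU : IsOpen U) {α : Type*} {S : Finset α} {F : α → E → LaurentSeries ℂ}
    (hF : ∀ i ∈ S, Fam U (F i)) {z : E} (hz : z ∈ U) (v : E) :
    dir (fun z => ∑ i ∈ S, F i z) z v = ∑ i ∈ S, dir (F i) z v := by
  ext k
  rw [(Fam.sum hF).coeff_dir hU hz, coeff_sum]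
  simp only [coeff_sum]
  rw [fderiv_fun_sum fun i hi => (hF i hi).differentiableAt_coeff hz k, sum_apply]
  exact Finset.sum_congr rfl fun i hi => ((hF i hi).coeff_dir hU hz v k).symm

theorem Fam.dir_mul (hU : IsOpen U) {F G : E → LaurentSeries ℂ} (hF : Fam U F) (hG : Fam U G)
    {z : E} (hz : z ∈ U) (v : E) :
    dir (fun z => F z * G z) z v = dir F z v * G z + F z * dir G z v := by
  obtain ⟨b, hb⟩ := hF.lb
  obtain ⟨c, hc⟩ := hG.lb
  ext k
  rw [(hF.mul hU hG).coeff_dir hU hz, coeff_add,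
    coeff_mul_eq_sum (hF.dir_lb hU hz v hb) (hc z hz), coeff_mul_eq_sum (hb z hz)
      (hG.dir_lb hU hz v hc), ← Finset.sum_add_distrib]
  have : (fun z' => (F z' * G z').coeff k) =ᶠ[nhds z] fun z' => ∑ i ∈ Finset.Icc b (k - c),
      (F z').coeff i * (G z').coeff (k - i) := by
    filter_upwards [hU.mem_nhds hz] with z' hz'
    exact coeff_mul_eq_sum (hb z' hz') (hc z' hz') k
  rw [this.fderiv_eq, fderiv_fun_sum fun i _ =>
      (hF.differentiableAt_coeff hz i).fun_mul (hG.differentiableAt_coeff hz (k - i)),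
    sum_apply]
  refine Finset.sum_congr rfl fun i _ => ?_
  rw [fderiv_fun_mul (hF.differentiableAt_coeff hz i) (hG.differentiableAt_coeff hz (k - i)), hF.coeff_dir hU hz,
    hG.coeff_dir hU hz]
  simp
  ring

theorem Fam.dir_euler (hU : IsOpen U) {F : E → LaurentSeries ℂ} (hF : Fam U F) {z : E} (hz : z ∈ U)
    (v : E) : dir (fun z => MinRes.euler (F z)) z v = MinRes.euler (dir F z v) := by
  ext k
  rw [hF.euler.coeff_dir hU hz, coeff_euler, hF.coeff_dir hU hz]
  simp only [coeff_euler]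
  rw [fderiv_const_mul (hF.differentiableAt_coeff hz k)]
  rfl

/-- An analytic family of matrices of Laurent series. -/
def FamM {I : Type*} (U : Set E) (X : E → Matrix I I (LaurentSeries ℂ)) : Prop :=
  ∀ a b, Fam U fun z => X z a b

/-- The derivative of a family of matrices of Laurent series. -/
noncomputable def dirM {I : Type*} (X : E → Matrix I I (LaurentSeries ℂ)) (z v : E) :
    Matrix I I (LaurentSeries ℂ) :=
  Matrix.of fun a b => dir (fun z => X z a b) z v

variable {I : Type*} [Fintype I] {X Z : E → Matrix I I (LaurentSeries ℂ)}

theorem FamM.mul (hU : IsOpen U) (hX : FamM U X) (hZ : FamM U Z) : FamM U fun z => X z * Z z := by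
  intro a b
  simp only [Matrix.mul_apply]
  exact Fam.sum fun c _ => (hX a c).mul hU (hZ c b)

theorem FamM.dirM_mul (hU : IsOpen U) (hX : FamM U X) (hZ : FamM U Z) {z : E} (hz : z ∈ U) (v : E) :
    dirM (fun z => X z * Z z) z v = dirM X z v * Z z + X z * dirM Z z v := by
  refine Matrix.ext fun a b => ?_
  rw [Matrix.add_apply, Matrix.mul_apply, Matrix.mul_apply, ← Finset.sum_add_distrib]
  simp only [dirM, Matrix.of_apply, Matrix.mul_apply]
  rw [Fam.dir_sum hU (fun c _ => (hX a c).mul hU (hZ c b)) hz]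
  exact Finset.sum_congr rfl fun c _ => (hX a c).dir_mul hU (hZ c b) hz v

theorem FamM.euler (hX : FamM U X) : FamM U fun z => (X z).map euler := fun a b => (hX a b).euler

theorem FamM.dirM_euler (hU : IsOpen U) (hX : FamM U X) {z : E} (hz : z ∈ U) (v : E) :
    dirM (fun z => (X z).map MinRes.euler) z v = (dirM X z v).map MinRes.euler :=
  Matrix.ext fun a b => (hX a b).dir_euler hU hz v

theorem FamM.add (hX : FamM U X) (hZ : FamM U Z) : FamM U fun z => X z + Z z :=
  fun a b => (hX a b).add (hZ a b)

theorem FamM.dirM_add (hU : IsOpen U) (hX : FamM U X) (hZ : FamM U Z) {z : E} (hz : z ∈ U) (v : E) :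
    dirM (fun z => X z + Z z) z v = dirM X z v + dirM Z z v :=
  Matrix.ext fun a b => (hX a b).dir_add hU (hZ a b) hz v

theorem FamM.smul (hU : IsOpen U) {c : E → LaurentSeries ℂ} (hc : Fam U c) (hX : FamM U X) :
    FamM U fun z => c z • X z := fun a b => hc.mul hU (hX a b)

theorem FamM.dirM_const_smul (hU : IsOpen U) (c : LaurentSeries ℂ) (hX : FamM U X) {z : E}
    (hz : z ∈ U) (v : E) : dirM (fun z => c • X z) z v = c • dirM X z v := by
  refine Matrix.ext fun a b => ?_
  refine ((Fam.const c).dir_mul hU (hX a b) hz v).trans ?_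
  rw [dir_const, zero_mul, zero_add]
  rfl

theorem FamM.trace (hX : FamM U X) : Fam U fun z => (X z).trace := Fam.sum fun a _ => hX a a

theorem FamM.dir_trace (hU : IsOpen U) (hX : FamM U X) {z : E} (hz : z ∈ U) (v : E) :
    dir (fun z => (X z).trace) z v = (dirM X z v).trace :=
  Fam.dir_sum hU (fun a _ => hX a a) hz v

theorem FamM.det [DecidableEq I] (hU : IsOpen U) (hX : FamM U X) : Fam U fun z => (X z).det := by
  simp only [Matrix.det_apply']
  exact Fam.sum fun σ _ => (Fam.const _).mul hU (Fam.prod hU fun i _ => hX _ _)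

theorem FamM.inv [DecidableEq I] (hU : IsOpen U) (hX : FamM U X)
    (h0 : ∀ z ∈ U, ∀ a b, LB 0 (X z a b))
    (hdet : ∀ z ∈ U, ((X z).map fun f => f.coeff 0).det ≠ 0) : FamM U fun z => (X z)⁻¹ := by
  intro a b
  have h1 : Fam U fun z => ((X z).det)⁻¹ := (hX.det hU).inv hU (b := 0)
    (fun z hz => (coeff_zero_det (h0 z hz)).2)
    (fun z hz => by rw [(coeff_zero_det (h0 z hz)).1]; exact hdet z hz)
  have h2 : Fam U fun z => (X z).adjugate a b := by
    simp only [Matrix.adjugate_apply]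
    refine FamM.det (X := fun z => (X z).updateRow b (Pi.single a 1)) hU fun i k => ?_
    simp only [Matrix.updateRow_apply]
    split_ifs
    · exact Fam.const _
    · exact hX i k
  refine (h1.mul hU h2).congr hU fun z _ => ?_
  change _ = (X z)⁻¹ a b
  rw [Matrix.inv_def, Ring.inverse_eq_inv']
  rfl

end Family

/-! ### Rational functions and their expansions -/

section Rational

/-- An element algebraic over the algebraically closed field `ℂ` is a constant, and constants are
killed by the Euler derivation. Rational functions may therefore be expanded at any `u` with nonzero
derivative. -/
theorem transcendental_of_euler_ne_zero {u : LaurentSeries ℂ} (hu : euler u ≠ 0) :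
    Transcendental ℂ u := by
  intro h
  have h1 := IsAlgClosed.degree_eq_one_of_irreducible ℂ (minpoly.irreducible h.isIntegral)
  obtain ⟨c, hc⟩ := minpoly.mem_range_of_degree_eq_one ℂ u h1
  rw [← hc, algebraMap_eq_C, euler_C] at hu
  exact hu rfl

theorem aeval_mem_nonZeroDivisors {u : LaurentSeries ℂ} (hu : euler u ≠ 0) :
    nonZeroDivisors (Polynomial ℂ) ≤
      (nonZeroDivisors (LaurentSeries ℂ)).comap (Polynomial.aeval (R := ℂ) u) := fun p hp => by
  rw [Submonoid.mem_comap]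
  refine mem_nonZeroDivisors_of_ne_zero fun h => nonZeroDivisors.ne_zero hp ?_
  exact (transcendental_iff.1 (transcendental_of_euler_ne_zero hu)) p h

/-- The expansion of a rational function after the substitution `x = u`. -/
noncomputable def ratExpand (u : LaurentSeries ℂ) (hu : euler u ≠ 0) :
    RatFunc ℂ →ₐ[ℂ] LaurentSeries ℂ :=
  RatFunc.liftAlgHom (Polynomial.aeval u) (aeval_mem_nonZeroDivisors hu)

theorem ratExpand_algebraMap (u : LaurentSeries ℂ) (hu : euler u ≠ 0) (p : Polynomial ℂ) :
    ratExpand u hu (algebraMap _ _ p) = Polynomial.aeval u p := by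
  have := RatFunc.liftAlgHom_apply_div (Polynomial.aeval u) (aeval_mem_nonZeroDivisors hu) p 1
  rw [map_one, map_one, div_one, div_one] at this
  exact this

theorem ratExpand_X (u : LaurentSeries ℂ) (hu : euler u ≠ 0) : ratExpand u hu RatFunc.X = u := by
  rw [← RatFunc.algebraMap_X, ratExpand_algebraMap, Polynomial.aeval_X]

/-- The derivative of a rational function. -/
noncomputable def ratDeriv (R : RatFunc ℂ) : RatFunc ℂ :=
  algebraMap _ _ (Polynomial.derivative R.num * R.denom - R.num * Polynomial.derivative R.denom) /
    algebraMap _ _ (R.denom ^ 2)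

theorem euler_aeval (u : LaurentSeries ℂ) (p : Polynomial ℂ) :
    euler (Polynomial.aeval u p) = euler u * Polynomial.aeval u (Polynomial.derivative p) := by
  induction p using Polynomial.induction_on' with
  | add p q hp hq => simp only [map_add, hp, hq, mul_add]
  | monomial n a =>
    rw [Polynomial.aeval_monomial, euler_mul, algebraMap_eq_C, euler_C, zero_mul, zero_add,
      euler_pow, Polynomial.derivative_monomial, Polynomial.aeval_monomial, map_mul,
      algebraMap_eq_C, map_natCast]
    ring

theorem euler_ratExpand (u : LaurentSeries ℂ) (hu : euler u ≠ 0) (R : RatFunc ℂ) :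
    euler (ratExpand u hu R) = euler u * ratExpand u hu (ratDeriv R) := by
  have hq : Polynomial.aeval u R.denom ≠ 0 := fun h => R.denom_ne_zero
    ((transcendental_iff.1 (transcendental_of_euler_ne_zero hu)) _ h)
  have h1 : ratExpand u hu R * Polynomial.aeval u R.denom = Polynomial.aeval u R.num := by
    have h := congrArg (ratExpand u hu) R.num_div_denom
    rw [map_div₀, ratExpand_algebraMap, ratExpand_algebraMap] at h
    rw [← h, div_mul_cancel₀ _ hq]
  have h2 := congrArg euler h1
  rw [euler_mul, euler_aeval, euler_aeval] at h2
  have h3 : ratExpand u hu (ratDeriv R) * Polynomial.aeval u R.denom ^ 2 =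
      Polynomial.aeval u (Polynomial.derivative R.num) * Polynomial.aeval u R.denom -
        Polynomial.aeval u R.num * Polynomial.aeval u (Polynomial.derivative R.denom) := by
    rw [ratDeriv, map_div₀, ratExpand_algebraMap, ratExpand_algebraMap, map_pow,
      div_mul_cancel₀ _ (pow_ne_zero 2 hq), map_sub, map_mul, map_mul]
  refine mul_right_cancel₀ (pow_ne_zero 2 hq) ?_
  linear_combination Polynomial.aeval u R.denom * h2 - euler u * h3 -
    euler u * Polynomial.aeval u (Polynomial.derivative R.denom) * h1

open Filter in
/-- `R` takes the same values as `f` up to finitely many points. -/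
def Rep (f : ℂ → ℂ) (R : RatFunc ℂ) : Prop :=
  ∀ᶠ x in cofinite, RatFunc.eval (RingHom.id ℂ) x R = f x

theorem eventually_denom_ne_zero (R : RatFunc ℂ) :
    ∀ᶠ x in Filter.cofinite, Polynomial.eval₂ (RingHom.id ℂ) x R.denom ≠ 0 := by
  rw [Filter.eventually_cofinite]
  refine (R.denom.roots.toFinset.finite_toSet).subset fun x hx => ?_
  rw [Set.mem_ofPred_eq, not_not] at hx
  simpa [R.denom_ne_zero, Polynomial.IsRoot] using hx

namespace Rep

variable {f g : ℂ → ℂ} {R S : RatFunc ℂ}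

theorem const (c : ℂ) : Rep (fun _ => c) (algebraMap ℂ _ c) :=
  Filter.Eventually.of_forall fun x => by simp [RatFunc.algebraMap_eq_C]

theorem id : Rep (fun x => x) RatFunc.X := Filter.Eventually.of_forall fun x => by simp

theorem polynomial (p : Polynomial ℂ) : Rep (fun x => p.eval x) (algebraMap _ _ p) :=
  Filter.Eventually.of_forall fun x => by
    rw [RatFunc.eval_algebraMap]
    simp

theorem add (hf : Rep f R) (hg : Rep g S) : Rep (fun x => f x + g x) (R + S) := by
  filter_upwards [hf, hg, eventually_denom_ne_zero R, eventually_denom_ne_zero S] with x h1 h2 h3 h4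
  rw [RatFunc.eval_add _ _ h3 h4, h1, h2]

theorem mul (hf : Rep f R) (hg : Rep g S) : Rep (fun x => f x * g x) (R * S) := by
  filter_upwards [hf, hg, eventually_denom_ne_zero R, eventually_denom_ne_zero S] with x h1 h2 h3 h4
  rw [RatFunc.eval_mul _ _ h3 h4, h1, h2]

theorem congr (hf : Rep f R) (h : ∀ᶠ x in Filter.cofinite, f x = g x) : Rep g R := by
  filter_upwards [hf, h] with x h1 h2 using h1.trans h2

theorem sub (hf : Rep f R) (hg : Rep g S) : Rep (fun x => f x - g x) (R - S) := by
  have := hf.add ((const (-1)).mul hg)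
  rw [map_neg, map_one, neg_one_mul, ← sub_eq_add_neg] at this
  exact this.congr (Filter.Eventually.of_forall fun x => by ring)

theorem sum {α : Type*} {T : Finset α} {f : α → ℂ → ℂ} {R : α → RatFunc ℂ}
    (h : ∀ i ∈ T, Rep (f i) (R i)) : Rep (fun x => ∑ i ∈ T, f i x) (∑ i ∈ T, R i) := by
  classical
  induction T using Finset.induction_on with
  | empty => simpa using const 0
  | insert i T hi ih =>
    simp only [Finset.sum_insert hi]
    exact (h i (Finset.mem_insert_self _ _)).add (ih fun k hk => h k (Finset.mem_insert_of_mem hk))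

theorem pow (hf : Rep f R) (k : ℕ) : Rep (fun x => f x ^ k) (R ^ k) := by
  induction k with
  | zero => simpa using const 1
  | succ k ih => simpa only [pow_succ] using ih.mul hf

theorem inv (hf : Rep f R) (h0 : R ≠ 0) : Rep (fun x => (f x)⁻¹) R⁻¹ := by
  filter_upwards [hf, eventually_denom_ne_zero R, eventually_denom_ne_zero R⁻¹] with x h1 h2 h3
  have h := RatFunc.eval_mul _ _ h2 h3
  rw [mul_inv_cancel₀ h0, RatFunc.eval_one, h1] at h
  exact eq_inv_of_mul_eq_one_right h.symm

/-- The numerator of the difference has infinitely many zeros. This converts the deformation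
equation, given pointwise in `x`, into an identity of rational functions that can be expanded at
each pole. -/
theorem eq (hf : Rep f R) (hg : Rep f S) : R = S := by
  have h := hf.sub hg
  simp only [sub_self] at h
  have h2 : (R - S).num = 0 := by
    refine Polynomial.eq_zero_of_infinite_isRoot _ ?_
    have h3 := h.and (eventually_denom_ne_zero (R - S))
    refine Set.Infinite.mono (s := {x | RatFunc.eval (RingHom.id ℂ) x (R - S) = 0 ∧
      Polynomial.eval₂ (RingHom.id ℂ) x (R - S).denom ≠ 0}) (fun x hx => ?_)
      (Filter.frequently_cofinite_iff_infinite.1 h3.frequently)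
    obtain ⟨h4, h5⟩ := hx
    rw [RatFunc.eval, div_eq_zero_iff, or_iff_left h5] at h4
    exact h4
  exact sub_eq_zero.1 (RatFunc.num_eq_zero_iff.1 h2)

/-- The exceptional set is finite, hence closed, so off it the functions agree in a neighbourhood
and have the same derivative. -/
theorem deriv (hf : Rep f R) : Rep (deriv f) (ratDeriv R) := by
  have hfin : ∀ᶠ x in Filter.cofinite, f =ᶠ[nhds x] fun x => RatFunc.eval (RingHom.id ℂ) x R := by
    rw [Rep, Filter.eventually_cofinite] at hf
    rw [Filter.eventually_cofinite]
    refine hf.subset fun x hx => ?_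
    rw [Set.mem_ofPred_eq] at hx
    by_contra hc
    refine hx ?_
    filter_upwards [hf.isClosed.isOpen_compl.mem_nhds hc] with y hy
    simpa using (not_not.1 hy).symm
  have hq := (polynomial R.denom).pow 2
  have hnum := polynomial (Polynomial.derivative R.num * R.denom -
    R.num * Polynomial.derivative R.denom)
  rw [ratDeriv, div_eq_mul_inv, map_pow]
  refine (hnum.mul (hq.inv (pow_ne_zero 2 (RatFunc.algebraMap_ne_zero R.denom_ne_zero)))).congr ?_
  filter_upwards [hfin, eventually_denom_ne_zero R] with x h1 h2
  rw [h1.deriv_eq]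
  have h3 := (R.num.hasDerivAt x).div (R.denom.hasDerivAt x) h2
  rw [show (fun x => RatFunc.eval (RingHom.id ℂ) x R) =
    fun x => R.num.eval x / R.denom.eval x from rfl]
  refine Eq.trans ?_ h3.deriv.symm
  rw [Polynomial.eval_sub, Polynomial.eval_mul, Polynomial.eval_mul, div_eq_mul_inv]

end Rep

/-! ### The residue theorem -/

section Residue

variable {κ : Type*}

/-- `1 / (x - c)`. -/
noncomputable def ratPole (c : ℂ) : RatFunc ℂ := (RatFunc.X - algebraMap ℂ _ c)⁻¹

theorem X_sub_ne_zero (c : ℂ) : (RatFunc.X : RatFunc ℂ) - algebraMap ℂ _ c ≠ 0 := by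
  intro h
  have h1 := congrArg (ratExpand (single 1 1) (by
    rw [euler_single]; exact single_ne_zero (by simp))) h
  rw [map_sub, ratExpand_X, AlgHom.commutes, algebraMap_eq_C, map_zero] at h1
  have h2 := congrArg (fun f : LaurentSeries ℂ => f.coeff 1) h1
  simp [C_apply] at h2

theorem X_mul_ratPole (c : ℂ) :
    RatFunc.X * ratPole c = 1 + algebraMap ℂ _ c * ratPole c := by
  have h : (RatFunc.X - algebraMap ℂ _ c) * ratPole c = 1 := mul_inv_cancel₀ (X_sub_ne_zero c)
  linear_combination h

theorem ratPole_mul_ratPole {a b : ℂ} (hab : a ≠ b) :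
    ratPole a * ratPole b = (a - b)⁻¹ • (ratPole a - ratPole b) := by
  have h1 := X_mul_ratPole a
  have h2 := X_mul_ratPole b
  have h3 : algebraMap ℂ (RatFunc ℂ) (a - b) * (ratPole a * ratPole b) =
      ratPole a - ratPole b := by
    rw [map_sub]
    linear_combination ratPole a * h2 - ratPole b * h1
  rw [← h3, Algebra.smul_def, ← mul_assoc, ← map_mul, inv_mul_cancel₀ (sub_ne_zero.2 hab), map_one,
    one_mul]

/-- The rational functions with poles at most at the points `γ q` and at infinity. -/
noncomputable def polarAlg (γ : κ → ℂ) : Subalgebra ℂ (RatFunc ℂ) :=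
  Algebra.adjoin ℂ ({RatFunc.X} ∪ Set.range fun q => ratPole (γ q))

theorem X_mem_polarAlg (γ : κ → ℂ) : RatFunc.X ∈ polarAlg γ :=
  Algebra.subset_adjoin (Or.inl rfl)

theorem ratPole_mem_polarAlg (γ : κ → ℂ) (q : κ) : ratPole (γ q) ∈ polarAlg γ :=
  Algebra.subset_adjoin (Or.inr ⟨q, rfl⟩)

/-- Sums of elementary fractions. -/
noncomputable def partialFractions (γ : κ → ℂ) : Submodule ℂ (RatFunc ℂ) :=
  Submodule.span ℂ (Set.range (fun m : ℕ => RatFunc.X ^ m) ∪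
    Set.range fun q : κ × ℕ => ratPole (γ q.1) ^ (q.2 + 1))

theorem X_pow_mem (γ : κ → ℂ) (m : ℕ) : RatFunc.X ^ m ∈ partialFractions γ :=
  Submodule.subset_span (Or.inl ⟨m, rfl⟩)

theorem ratPole_pow_mem (γ : κ → ℂ) (q : κ) (m : ℕ) : ratPole (γ q) ^ m ∈ partialFractions γ := by
  cases m with
  | zero => simpa using X_pow_mem γ 0
  | succ m => exact Submodule.subset_span (Or.inr ⟨(q, m), rfl⟩)

theorem X_mul_mem {γ : κ → ℂ} {R : RatFunc ℂ} (hR : R ∈ partialFractions γ) :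
    RatFunc.X * R ∈ partialFractions γ := by
  induction hR using Submodule.span_induction with
  | zero => simp
  | add x y _ _ hx hy => rw [mul_add]; exact add_mem hx hy
  | smul c x _ hx => rw [mul_smul_comm]; exact Submodule.smul_mem _ _ hx
  | mem x hx =>
    obtain ⟨m, rfl⟩ | ⟨⟨q, m⟩, rfl⟩ := hx
    · simpa only [pow_succ'] using X_pow_mem γ (m + 1)
    · have : RatFunc.X * ratPole (γ q) ^ (m + 1) =
          ratPole (γ q) ^ m + γ q • ratPole (γ q) ^ (m + 1) := by
        rw [pow_succ', ← mul_assoc, X_mul_ratPole, Algebra.smul_def]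
        ring
      simp only
      rw [this]
      exact add_mem (ratPole_pow_mem γ q m) (Submodule.smul_mem _ _ (ratPole_pow_mem γ q _))

theorem ratPole_mul_mem {γ : κ → ℂ} (hγ : Function.Injective γ) (q : κ) {R : RatFunc ℂ}
    (hR : R ∈ partialFractions γ) : ratPole (γ q) * R ∈ partialFractions γ := by
  induction hR using Submodule.span_induction with
  | zero => simp
  | add x y _ _ hx hy => rw [mul_add]; exact add_mem hx hy
  | smul c x _ hx => rw [mul_smul_comm]; exact Submodule.smul_mem _ _ hx
  | mem x hx =>
    obtain ⟨m, rfl⟩ | ⟨⟨q', m⟩, rfl⟩ := hx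
    · induction m with
      | zero => simpa using ratPole_pow_mem γ q 1
      | succ m ih =>
        have : ratPole (γ q) * RatFunc.X ^ (m + 1) =
            RatFunc.X ^ m + γ q • (ratPole (γ q) * RatFunc.X ^ m) := by
          rw [pow_succ', ← mul_assoc, mul_comm (ratPole _), X_mul_ratPole, Algebra.smul_def]
          ring
        simp only at ih ⊢
        rw [this]
        exact add_mem (X_pow_mem γ m) (Submodule.smul_mem _ _ ih)
    · rcases eq_or_ne q q' with rfl | hq
      · simpa only [pow_succ'] using ratPole_pow_mem γ q (m + 1 + 1)
      · simp only
        have key : ∀ m : ℕ, ratPole (γ q) * ratPole (γ q') ^ m ∈ partialFractions γ := by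
          intro m
          induction m with
          | zero => simpa using ratPole_pow_mem γ q 1
          | succ m ih =>
            rw [pow_succ', ← mul_assoc, ratPole_mul_ratPole (hγ.ne hq), smul_mul_assoc, sub_mul,
              ← pow_succ']
            exact Submodule.smul_mem _ _ (sub_mem ih (ratPole_pow_mem γ q' _))
        exact key _

/-- Partial fractions: the span of the powers of `x` and of the `1 / (x - γ q)` is stable under
multiplication by each generator of the algebra, and so contains all products. -/
theorem polarAlg_le {γ : κ → ℂ} (hγ : Function.Injective γ) {R : RatFunc ℂ}
    (hR : R ∈ polarAlg γ) : R ∈ partialFractions γ := by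
  rw [polarAlg, ← Subalgebra.mem_toSubmodule, Algebra.adjoin_eq_span] at hR
  refine Submodule.span_le.2 ?_ hR
  intro y hy
  induction hy using Submonoid.closure_induction_left with
  | one => simpa using X_pow_mem γ 0
  | mul_left x hx y _ ih =>
    obtain hx | ⟨q, rfl⟩ := hx
    · rw [Set.mem_singleton_iff] at hx
      rw [hx]
      exact X_mul_mem ih
    · exact ratPole_mul_mem hγ q ih

/-- The coordinate `x` at the points `γ q` and at infinity. -/
noncomputable def nodeCoord (γ : κ → ℂ) : Option κ → LaurentSeries ℂ
  | none => infCoord 1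
  | some q => finCoord (γ q) 1

theorem euler_nodeCoord (γ : κ → ℂ) (P : Option κ) :
    euler (nodeCoord γ P) = single (sgn P) (sgn P : ℂ) := by
  cases P with
  | none => simp [nodeCoord, infCoord, euler_single, sgn]
  | some q => simp [nodeCoord, finCoord_eq, euler_single, sgn]

theorem euler_nodeCoord_ne_zero (γ : κ → ℂ) (P : Option κ) : euler (nodeCoord γ P) ≠ 0 := by
  rw [euler_nodeCoord]
  exact single_ne_zero (by cases P <;> simp [sgn])

/-- The expansion of a rational function at one of the points `γ q` or at infinity. -/
noncomputable def nodeExpand (γ : κ → ℂ) (P : Option κ) : RatFunc ℂ →ₐ[ℂ] LaurentSeries ℂ :=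
  ratExpand (nodeCoord γ P) (euler_nodeCoord_ne_zero γ P)

theorem nodeExpand_ratPole (γ : κ → ℂ) (P : Option κ) (c : ℂ) :
    nodeExpand γ P (ratPole c) = (nodeCoord γ P - HahnSeries.C c)⁻¹ := by
  rw [nodeExpand, ratPole, map_inv₀, map_sub, ratExpand_X, AlgHom.commutes, algebraMap_eq_C]

theorem nodeExpand_ratPole_self (γ : κ → ℂ) (q : κ) :
    nodeExpand γ (some q) (ratPole (γ q)) = single (-1) 1 := by
  rw [nodeExpand_ratPole, nodeCoord, finCoord_eq, add_sub_cancel_left]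
  refine inv_eq_of_mul_eq_one_right ?_
  rw [single_mul_single]
  simp

theorem lb_nodeExpand_ratPole (γ : κ → ℂ) {q : κ} {c : ℂ} (h : γ q ≠ c) :
    LB 0 (nodeExpand γ (some q) (ratPole c)) := by
  rw [nodeExpand_ratPole, nodeCoord, finCoord_eq]
  have := LB.inv (b := 0) (x := HahnSeries.C (γ q) + single ((1 : ℕ) : ℤ) 1 - HahnSeries.C c) (by
    simp only [coeff_sub, coeff_add, C_apply, coeff_single_same]
    rw [coeff_single_of_ne (by simp), add_zero]
    exact sub_ne_zero.2 h)
  simpa using this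

theorem lb_nodeExpand_none_ratPole (γ : κ → ℂ) (c : ℂ) :
    LB 1 (nodeExpand γ none (ratPole c)) ∧ (nodeExpand γ none (ratPole c)).coeff 1 = 1 := by
  have hlb : LB (-1) (single (-1) 1 - HahnSeries.C c : LaurentSeries ℂ) :=
    (LB.single _ _).sub ((LB.C c).mono (by norm_num))
  have hc : (single (-1) 1 - HahnSeries.C c : LaurentSeries ℂ).coeff (-1) = 1 := by
    simp only [coeff_sub, C_apply, coeff_single_same]
    rw [coeff_single_of_ne (by simp), sub_zero]
  have h1 : nodeExpand γ none (ratPole c) = (single (-1) 1 - HahnSeries.C c)⁻¹ := by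
    rw [nodeExpand_ratPole, nodeCoord, infCoord]
    simp
  have h2 := LB.inv (b := -1) (x := single (-1) 1 - HahnSeries.C c) (by rw [hc]; exact one_ne_zero)
  rw [neg_neg] at h2
  rw [h1]
  refine ⟨h2, ?_⟩
  have h3 := coeff_mul_lead hlb h2
  rw [mul_inv_cancel₀ (fun h => by rw [h] at hc; simp at hc), hc, one_mul] at h3
  simpa using h3.symm

theorem lb_nodeExpand_X (γ : κ → ℂ) (q : κ) : LB 0 (nodeExpand γ (some q) RatFunc.X) := by
  rw [nodeExpand, ratExpand_X, nodeCoord, finCoord_eq]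
  exact (LB.C _).add (LB.single_of_le (by simp) _)

theorem lb_pow_zero {x : LaurentSeries ℂ} (h : LB 0 x) (m : ℕ) : LB 0 (x ^ m) := by
  simpa using h.pow m

/-- By linearity only elementary fractions matter, and among these only `1 / (x - γ q)` has
residues: `1` at its pole and `-1` at infinity. Each summand is the residue of `R dx`, because `θ x`
times the expansion is taken at degree zero. -/
theorem residue_theorem [Fintype κ] {γ : κ → ℂ} (hγ : Function.Injective γ) {R : RatFunc ℂ}
    (hR : R ∈ polarAlg γ) :
    ∑ P, (euler (nodeCoord γ P) * nodeExpand γ P R).coeff 0 = 0 := by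
  classical
  have hR' := polarAlg_le hγ hR
  have hc : ∀ (P : Option κ) (f : LaurentSeries ℂ), (euler (nodeCoord γ P) * f).coeff 0 =
      sgn P * f.coeff (-sgn P) := by
    intro P f
    rw [euler_nodeCoord, coeff_single_mul, zero_sub]
  simp only [hc]
  clear hR
  induction hR' using Submodule.span_induction with
  | zero => simp
  | add x y _ _ hx hy =>
    simp only [map_add, coeff_add, mul_add, Finset.sum_add_distrib, hx, hy, add_zero]
  | smul c x _ hx =>
    have : ∀ P : Option κ, (sgn P : ℂ) * (nodeExpand γ P (c • x)).coeff (-sgn P) =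
        c * ((sgn P : ℂ) * (nodeExpand γ P x).coeff (-sgn P)) := by
      intro P
      rw [Algebra.smul_def, map_mul, AlgHom.commutes, algebraMap_eq_C, HahnSeries.C_mul_eq_smul,
        coeff_smul, smul_eq_mul]
      ring
    simp only [this, ← Finset.mul_sum, hx, mul_zero]
  | mem x hx =>
    rw [Fintype.sum_option]
    obtain ⟨m, rfl⟩ | ⟨⟨q, m⟩, rfl⟩ := hx
    · simp only [map_pow]
      rw [Finset.sum_eq_zero fun q _ => ?_, add_zero]
      · rw [nodeExpand, ratExpand_X, nodeCoord, infCoord, single_pow]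
        rw [coeff_single_of_ne, mul_zero]
        simp [sgn]
        omega
      · rw [lb_pow_zero (lb_nodeExpand_X γ q) m _ (by simp [sgn]), mul_zero]
    · simp only [map_pow]
      rw [Finset.sum_eq_single q, nodeExpand_ratPole_self, single_pow]
      · obtain ⟨h1, h2⟩ := lb_nodeExpand_none_ratPole γ (γ q)
        rcases Nat.eq_zero_or_pos m with rfl | hm
        · simp [sgn, h2]
        · rw [coeff_single_of_ne (by simp [sgn]; omega), h1.pow (m + 1) _ (by simp [sgn]; omega)]
          simp
      · intro q' _ hq'
        rw [lb_pow_zero (lb_nodeExpand_ratPole γ (hγ.ne hq')) (m + 1) _ (by simp [sgn]), mul_zero]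
      · simp

theorem nodeExpand_injective (γ : κ → ℂ) (P : Option κ) : Function.Injective (nodeExpand γ P) :=
  (nodeExpand γ P).toRingHom.injective

theorem euler_nodeExpand (γ : κ → ℂ) (P : Option κ) (R : RatFunc ℂ) :
    euler (nodeExpand γ P R) = euler (nodeCoord γ P) * nodeExpand γ P (ratDeriv R) :=
  euler_ratExpand _ _ _

theorem ratDeriv_mem {γ : κ → ℂ} {R : RatFunc ℂ} (hR : R ∈ polarAlg γ) :
    ratDeriv R ∈ polarAlg γ := by
  have hne := euler_nodeCoord_ne_zero γ none
  have inj := nodeExpand_injective γ none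
  -- `ratDeriv` is defined through a reduced fraction, which is inconvenient for sums and products.
  -- The expansion at infinity is injective and turns it into `θ / θx`, so the rules of calculus are
  -- checked there.
  have key : ∀ R S, euler (nodeExpand γ none R) =
      euler (nodeCoord γ none) * nodeExpand γ none S → ratDeriv R = S := by
    intro R S h
    rw [euler_nodeExpand] at h
    exact inj (mul_left_cancel₀ hne h)
  induction hR using Algebra.adjoin_induction with
  | mem x hx =>
    obtain hx | ⟨q, rfl⟩ := hx
    · rw [Set.mem_singleton_iff] at hx
      rw [hx, key _ 1 (by rw [nodeExpand, ratExpand_X, map_one, mul_one])]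
      exact one_mem _
    · rw [key (ratPole (γ q)) (-(ratPole (γ q) ^ 2)) ?_]
      · exact neg_mem (pow_mem (ratPole_mem_polarAlg γ q) 2)
      · have h1 : (nodeCoord γ none - HahnSeries.C (γ q)) * nodeExpand γ none (ratPole (γ q)) = 1 := by
          rw [nodeExpand_ratPole, mul_inv_cancel₀]
          intro h
          have h2 := congrArg euler h
          rw [map_sub, euler_C, sub_zero, map_zero] at h2
          exact hne h2
        have h2 := congrArg euler h1
        rw [euler_mul, map_sub, euler_C, sub_zero, euler_one] at h2
        rw [map_neg, map_pow]
        linear_combination nodeExpand γ none (ratPole (γ q)) * h2 -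
          euler (nodeExpand γ none (ratPole (γ q))) * h1
  | algebraMap r =>
    rw [key _ 0 (by rw [AlgHom.commutes, algebraMap_eq_C, euler_C, map_zero, mul_zero])]
    exact zero_mem _
  | add x y hx hy h1 h2 =>
    rw [key (x + y) (ratDeriv x + ratDeriv y) (by
      simp only [map_add, euler_nodeExpand, mul_add])]
    exact add_mem h1 h2
  | mul x y hx hy h1 h2 =>
    rw [key (x * y) (ratDeriv x * y + x * ratDeriv y) (by
      rw [map_mul, euler_mul, euler_nodeExpand, euler_nodeExpand, map_add, map_mul, map_mul]
      ring)]
    exact add_mem (mul_mem h1 hy) (mul_mem hx h2)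

/-- The sum of the residues of `G dF` vanishes. -/
theorem sum_coeff_zero_euler_mul [Fintype κ] {γ : κ → ℂ} (hγ : Function.Injective γ)
    {R S : RatFunc ℂ} (hR : R ∈ polarAlg γ) (hS : S ∈ polarAlg γ) :
    ∑ P, (euler (nodeExpand γ P R) * nodeExpand γ P S).coeff 0 = 0 := by
  rw [← residue_theorem hγ (mul_mem (ratDeriv_mem hR) hS)]
  refine Finset.sum_congr rfl fun P _ => ?_
  rw [euler_nodeExpand, map_mul, mul_assoc]

end Residue

end Rational

/-! ### Deformations of the connection matrix -/

section Deformation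

variable {φ ι ν : Type*} [Fintype φ] [Fintype ι] [Fintype ν] [DecidableEq ν]
  {L : Option ι → LocalType ν}
  {E : Type*} [NormedAddCommGroup E] [NormedSpace ℂ E] {U : Set E}

theorem Connection.at_apply (A : Connection φ L) {K : Type*} [Field K] [Algebra ℂ K] (u : K)
    (a b : ν) : A.at u a b =
      ∑ f, (u - algebraMap ℂ K (A.pole (.inl f)))⁻¹ * algebraMap ℂ K (A.fuchsCoeff f a b)
      + ∑ i, ∑ m : Fin ((L (some i)).r + 1), (u - algebraMap ℂ K (A.pole (.inr i)))⁻¹ ^ ((m : ℕ) + 1) *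
        algebraMap ℂ K (A.irrCoeff i m a b)
      + ∑ m : Fin (L none).r, u ^ (m : ℕ) * algebraMap ℂ K (A.infCoeff m a b) := by
  simp only [Connection.at, Connection.pole, Matrix.add_apply, Matrix.sum_apply, Matrix.smul_apply,
    Matrix.map_apply, smul_eq_mul, Sum.elim_inl, Sum.elim_inr, inv_pow]

/-- The derivative at `z` in the direction `v` of the entries of `A(u)`, with `u` fixed. -/
noncomputable def atDot (A : E → Connection φ L) (z v : E) {K : Type*} [Field K] [Algebra ℂ K]
    (u : K) (a b : ν) : K :=
  ∑ f, ((u - algebraMap ℂ K ((A z).pole (.inl f)))⁻¹ *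
      algebraMap ℂ K (fderiv ℂ (fun z' => (A z').fuchsCoeff f a b) z v)
    + algebraMap ℂ K (dPoles A z v (.inl f)) * (u - algebraMap ℂ K ((A z).pole (.inl f)))⁻¹ ^ 2 *
      algebraMap ℂ K ((A z).fuchsCoeff f a b))
  + ∑ i, ∑ m : Fin ((L (some i)).r + 1),
    ((u - algebraMap ℂ K ((A z).pole (.inr i)))⁻¹ ^ ((m : ℕ) + 1) *
      algebraMap ℂ K (fderiv ℂ (fun z' => (A z').irrCoeff i m a b) z v)
    + ((m : ℕ) + 1 : ℕ) * algebraMap ℂ K (dPoles A z v (.inr i)) *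
      (u - algebraMap ℂ K ((A z).pole (.inr i)))⁻¹ ^ ((m : ℕ) + 2) *
      algebraMap ℂ K ((A z).irrCoeff i m a b))
  + ∑ m : Fin (L none).r, u ^ (m : ℕ) *
      algebraMap ℂ K (fderiv ℂ (fun z' => (A z').infCoeff m a b) z v)

theorem map_atDot (A : E → Connection φ L) (z v : E) {K K' : Type*} [Field K] [Algebra ℂ K] [Field K']
    [Algebra ℂ K'] (f : K →+* K') (hf : ∀ c, f (algebraMap ℂ K c) = algebraMap ℂ K' c) (u : K)
    (a b : ν) : f (atDot A z v u a b) = atDot A z v (f u) a b := by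
  simp only [atDot, map_add, map_sum, map_mul, map_inv₀, map_sub, map_pow, hf, map_natCast]

/-- The family `F` has at `z` in the direction `v` the derivative `D + ρ θF`. -/
structure Drv (U : Set E) (z v : E) (ρ : LaurentSeries ℂ) (F : E → LaurentSeries ℂ)
    (D : LaurentSeries ℂ) : Prop where
  fam : Fam U F
  dir_eq : dir F z v = D + ρ * euler (F z)

namespace Drv

variable {z v : E} {ρ D D' : LaurentSeries ℂ} {F G : E → LaurentSeries ℂ}

theorem congr_right (hF : Drv U z v ρ F D) (h : D = D') : Drv U z v ρ F D' := h ▸ hF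

theorem add (hU : IsOpen U) (hz : z ∈ U) (hF : Drv U z v ρ F D) (hG : Drv U z v ρ G D') :
    Drv U z v ρ (fun z => F z + G z) (D + D') := by
  refine ⟨hF.fam.add hG.fam, ?_⟩
  rw [hF.fam.dir_add hU hG.fam hz, hF.dir_eq, hG.dir_eq, map_add]
  ring

theorem mul (hU : IsOpen U) (hz : z ∈ U) (hF : Drv U z v ρ F D) (hG : Drv U z v ρ G D') :
    Drv U z v ρ (fun z => F z * G z) (D * G z + F z * D') := by
  refine ⟨hF.fam.mul hU hG.fam, ?_⟩
  rw [hF.fam.dir_mul hU hG.fam hz, hF.dir_eq, hG.dir_eq, euler_mul]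
  ring

theorem const (f : LaurentSeries ℂ) (hf : MinRes.euler f = 0) : Drv U z v ρ (fun _ => f) 0 :=
  ⟨Fam.const f, by rw [dir_const, hf, mul_zero, add_zero]⟩

theorem sub (hU : IsOpen U) (hz : z ∈ U) (hF : Drv U z v ρ F D) (hG : Drv U z v ρ G D') :
    Drv U z v ρ (fun z => F z - G z) (D - D') := by
  have h := hF.add hU hz ((const (-1) (by rw [map_neg, euler_one, neg_zero])).mul hU hz hG)
  have e : (fun z => F z + -1 * G z) = fun z => F z - G z := by
    funext z
    ring
  rw [e] at h
  exact h.congr_right (by ring)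

theorem C (hU : IsOpen U) (hz : z ∈ U) {c : E → ℂ} (hc : AnalyticOnNhd ℂ c U) :
    Drv U z v ρ (fun z => algebraMap ℂ (LaurentSeries ℂ) (c z))
      (algebraMap ℂ (LaurentSeries ℂ) (fderiv ℂ c z v)) := by
  simp only [algebraMap_eq_C]
  refine ⟨Fam.C hc, ?_⟩
  rw [dir_C hU hc hz, euler_C, mul_zero, add_zero]

theorem sum (hU : IsOpen U) (hz : z ∈ U) {α : Type*} {S : Finset α} {F : α → E → LaurentSeries ℂ}
    {D : α → LaurentSeries ℂ} (h : ∀ i ∈ S, Drv U z v ρ (F i) (D i)) :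
    Drv U z v ρ (fun z => ∑ i ∈ S, F i z) (∑ i ∈ S, D i) := by
  refine ⟨Fam.sum fun i hi => (h i hi).fam, ?_⟩
  rw [Fam.dir_sum hU (fun i hi => (h i hi).fam) hz, Finset.sum_congr rfl fun i hi => (h i hi).dir_eq,
    Finset.sum_add_distrib, map_sum, Finset.mul_sum]

theorem pow (hU : IsOpen U) (hz : z ∈ U) (hF : Drv U z v ρ F D) (k : ℕ) :
    Drv U z v ρ (fun z => F z ^ (k + 1)) ((k + 1 : ℕ) * F z ^ k * D) := by
  induction k with
  | zero => simpa using hF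
  | succ k ih =>
    simp only [pow_succ _ (k + 1)]
    refine (ih.mul hU hz hF).congr_right ?_
    push_cast
    ring

theorem inv (hU : IsOpen U) (hz : z ∈ U) (hF : Drv U z v ρ F D) (h0 : ∀ z ∈ U, F z ≠ 0)
    (hi : Fam U fun z => (F z)⁻¹) : Drv U z v ρ (fun z => (F z)⁻¹) (-((F z)⁻¹ ^ 2 * D)) := by
  refine ⟨hi, ?_⟩
  have h1 := hF.fam.dir_mul hU hi hz v
  rw [dir_congr hU (G := fun _ => 1) (fun z hz => mul_inv_cancel₀ (h0 z hz)) hz, dir_const,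
    hF.dir_eq] at h1
  have h2 := congrArg MinRes.euler (mul_inv_cancel₀ (h0 z hz))
  rw [euler_mul, euler_one] at h2
  have h3 := mul_inv_cancel₀ (h0 z hz)
  linear_combination -(F z)⁻¹ * h1 - ρ * (F z)⁻¹ * h2 -
    (dir (fun z => (F z)⁻¹) z v - ρ * MinRes.euler ((F z)⁻¹)) * h3

end Drv

variable {A : E → Connection φ L} {t : E → ∀ p, Fin (L p).s → ℕ → ℂ}
  {Y : E → Option ι → Matrix ν ν (PowerSeries ℂ)}

/-- Chain rule for `A(u)` when `u` itself moves only by the drift `ρ θu`: the derivative is the one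
at fixed `u` plus the same drift. The open set `V` may be smaller than `U` so as to keep a fixed
number away from the poles. -/
theorem NormalizedIsomonodromic.drv_at (h : NormalizedIsomonodromic U A t Y) {V : Set E}
    (hV : IsOpen V) (hVU : V ⊆ U) {z : E} (hz : z ∈ V) (v : E) {ρ : LaurentSeries ℂ}
    {u : E → LaurentSeries ℂ} (hu : Drv V z v ρ u 0)
    (h0 : ∀ q, ∀ z ∈ V, u z - algebraMap ℂ _ ((A z).pole q) ≠ 0)
    (hi : ∀ q, Fam V fun z => (u z - algebraMap ℂ _ ((A z).pole q))⁻¹) (a b : ν) :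
    Drv V z v ρ (fun z => (A z).at (u z) a b) (atDot A z v (u z) a b) := by
  have hpole : ∀ q, Drv V z v ρ (fun z => (u z - algebraMap ℂ _ ((A z).pole q))⁻¹)
      (algebraMap ℂ _ (dPoles A z v q) * (u z - algebraMap ℂ _ ((A z).pole q))⁻¹ ^ 2) := by
    intro q
    have h1 : Drv V z v ρ (fun z => u z - algebraMap ℂ _ ((A z).pole q))
        (-algebraMap ℂ _ (dPoles A z v q)) := by
      refine (hu.sub hV hz (Drv.C hV hz ((h.analytic_pole q).mono hVU))).congr_right ?_
      rw [zero_sub]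
      rfl
    refine (h1.inv hV hz (h0 q) (hi q)).congr_right ?_
    ring
  have hupow : ∀ m : ℕ, Drv V z v ρ (fun z => u z ^ m) 0 := by
    intro m
    cases m with
    | zero =>
      simp only [pow_zero]
      exact Drv.const 1 euler_one
    | succ m => exact (hu.pow hV hz m).congr_right (mul_zero _)
  simp only [Connection.at_apply]
  refine ((Drv.sum hV hz fun f _ => ?_).add hV hz (Drv.sum hV hz fun i _ =>
    Drv.sum hV hz fun m _ => ?_)).add hV hz (Drv.sum hV hz fun m _ => ?_)
  · refine ((hpole (.inl f)).mul hV hz (Drv.C hV hz ((h.analytic_fuchsCoeff f a b).mono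
      hVU))).congr_right ?_
    ring
  · refine (((hpole (.inr i)).pow hV hz m).mul hV hz (Drv.C hV hz ((h.analytic_irrCoeff i m a b).mono
      hVU))).congr_right ?_
    ring
  · refine ((hupow m).mul hV hz (Drv.C hV hz ((h.analytic_infCoeff m a b).mono
      hVU))).congr_right ?_
    ring

/-- An ordinary point `x`, seen as a constant Laurent series, is a special case of `drv_at` with
zero drift; no separate computation of the derivative is needed. -/
theorem NormalizedIsomonodromic.fderiv_at (h : NormalizedIsomonodromic U A t Y) (hU : IsOpen U)
    {z : E} (hz : z ∈ U) (v : E) {x : ℂ} (hx : ∀ q, x ≠ (A z).pole q) (a b : ν) :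
    fderiv ℂ (fun z' => (A z').at x a b) z v = atDot A z v x a b := by
  set V : Set E := U ∩ ⋂ q, U ∩ (fun z => (A z).pole q) ⁻¹' {x}ᶜ with hVdef
  have hV : IsOpen V := hU.inter (isOpen_iInter_of_finite fun q =>
    (h.analytic_pole q).continuousOn.isOpen_inter_preimage hU isOpen_compl_singleton)
  have hmem : ∀ z ∈ V, ∀ q, x - (A z).pole q ≠ 0 := by
    intro z hz q
    have h1 := (Set.mem_iInter.1 hz.2 q).2
    exact fun h2 => h1 (sub_eq_zero.1 h2).symm
  have hzV : z ∈ V := ⟨hz, Set.mem_iInter.2 fun q => ⟨hz, fun h => hx q h.symm⟩⟩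
  have hVU : V ⊆ U := Set.inter_subset_left
  have hconst : Drv V z v 0 (fun _ => algebraMap ℂ (LaurentSeries ℂ) x) 0 :=
    Drv.const _ (by rw [algebraMap_eq_C, euler_C])
  have e : ∀ z q, algebraMap ℂ (LaurentSeries ℂ) x - algebraMap ℂ _ ((A z).pole q) =
      algebraMap ℂ _ (x - (A z).pole q) := fun z q => (map_sub _ _ _).symm
  have key := h.drv_at hV hVU hzV v hconst (fun q z hz => by
    rw [e]; exact (map_ne_zero _).2 (hmem z hz q)) (fun q => by
    simp only [e, ← map_inv₀]
    simp only [algebraMap_eq_C]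
    exact Fam.C ((analyticOnNhd_const.sub ((h.analytic_pole q).mono hVU)).inv fun z hz =>
      hmem z hz q)) a b
  have e2 : ∀ z, (A z).at (algebraMap ℂ (LaurentSeries ℂ) x) a b =
      algebraMap ℂ _ ((A z).at x a b) := fun z => by
    rw [← (A z).map_at (algebraMap ℂ (LaurentSeries ℂ)) (fun _ => rfl), Matrix.map_apply]
  simp only [e2] at key
  have h1 := key.dir_eq
  rw [zero_mul, add_zero, ← map_atDot A z v (algebraMap ℂ (LaurentSeries ℂ)) (fun _ => rfl)] at h1
  have h2 := key.fam.coeff_dir hV hzV v 0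
  rw [h1] at h2
  simp only [algebraMap_eq_C, C_apply, coeff_single_same] at h2
  exact h2.symm

/-- With the local parameter fixed the coordinate `x = γ + s` moves along with the pole; the drift
`dγ / θx` applied to `θ` is `dγ ∂_x`. -/
theorem NormalizedIsomonodromic.drv_node (h : NormalizedIsomonodromic U A t Y) (hU : IsOpen U)
    {z : E} (hz : z ∈ U) (v : E) (P : Option (φ ⊕ ι)) (a b : ν) :
    Drv U z v (HahnSeries.C (P.elim 0 (dPoles A z v)) * (euler (nodeCoord (A z).pole P))⁻¹)
      (fun z => (A z).at (nodeCoord (A z).pole P) a b)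
      (atDot A z v (nodeCoord (A z).pole P) a b) := by
  have hfam : Fam U fun z => nodeCoord (A z).pole P := by
    cases P with
    | none => exact Fam.const _
    | some q => simp only [nodeCoord, finCoord_eq]; exact (Fam.C (h.analytic_pole q)).add (Fam.const _)
  have hdrv : Drv U z v (HahnSeries.C (P.elim 0 (dPoles A z v)) *
      (euler (nodeCoord (A z).pole P))⁻¹) (fun z => nodeCoord (A z).pole P) 0 := by
    refine ⟨hfam, ?_⟩
    rw [zero_add, inv_mul_cancel_right₀ (euler_nodeCoord_ne_zero _ _)]
    cases P with
    | none => simp only [nodeCoord, dir_const, Option.elim_none, map_zero]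
    | some q =>
      simp only [nodeCoord, finCoord_eq, Option.elim_some]
      rw [(Fam.C (h.analytic_pole q)).dir_add hU (Fam.const _) hz, dir_const, add_zero,
        dir_C hU (h.analytic_pole q) hz]
      rfl
  -- The order of `x - γ_q` at a given node is constant on `U` because the poles stay distinct;
  -- `Fam.inv` requires this.
  have hlead : ∀ q, ∃ k : ℤ, ∀ z ∈ U,
      LB k (nodeCoord (A z).pole P - algebraMap ℂ _ ((A z).pole q)) ∧
      (nodeCoord (A z).pole P - algebraMap ℂ _ ((A z).pole q)).coeff k ≠ 0 := by
    intro q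
    simp only [algebraMap_eq_C]
    cases P with
    | none =>
      refine ⟨-1, fun z _ => ⟨?_, ?_⟩⟩
      · simp only [nodeCoord, infCoord]
        exact (LB.single_of_le (by simp) _).sub ((LB.C _).mono (by norm_num))
      · simp only [nodeCoord, infCoord, coeff_sub, C_apply]
        rw [coeff_single_of_ne (a := (0 : ℤ)) (by simp)]
        simp
    | some q' =>
      simp only [nodeCoord, finCoord_eq]
      by_cases hq : q' = q
      · subst hq
        refine ⟨1, fun z _ => ?_⟩
        rw [add_sub_cancel_left]
        exact ⟨LB.single_of_le (by simp) _, by simp⟩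
      · refine ⟨0, fun z hz => ⟨((LB.C _).add (LB.single_of_le (by simp) _)).sub (LB.C _), ?_⟩⟩
        simp only [coeff_sub, coeff_add, C_apply, coeff_single_same]
        rw [coeff_single_of_ne (by simp), add_zero]
        exact sub_ne_zero.2 ((h.distinct_poles z hz).ne hq)
  refine h.drv_at hU subset_rfl hz v hdrv (fun q z hz => ?_) (fun q => ?_) a b
  · obtain ⟨k, hk⟩ := hlead q
    intro h0
    refine (hk z hz).2 ?_
    rw [h0, coeff_zero]
  · obtain ⟨k, hk⟩ := hlead q
    refine Fam.inv hU (hfam.sub ?_) (fun z hz => (hk z hz).1) (fun z hz => (hk z hz).2)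
    simp only [algebraMap_eq_C]
    exact Fam.C (h.analytic_pole q)

end Deformation

/-! ### The deformation matrix as a matrix of rational functions -/

section RationalDeformation

variable {κ : Type*}

/-- The principal part at `c` of a Laurent series, as a rational function. -/
noncomputable def ratPrincipalPart (c : ℂ) (f : LaurentSeries ℂ) : RatFunc ℂ :=
  ∑ m ∈ Finset.range (-f.order).toNat, algebraMap ℂ _ (f.coeff (-((m : ℤ) + 1))) * ratPole c ^ (m + 1)

/-- The polynomial part of a Laurent series in `x⁻¹`, as a rational function. -/
noncomputable def ratPolynomialPart (f : LaurentSeries ℂ) : RatFunc ℂ :=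
  ∑ m ∈ Finset.range ((-f.order).toNat + 1), algebraMap ℂ _ (f.coeff (-(m : ℤ))) * RatFunc.X ^ m

theorem rep_ratPole (c : ℂ) : Rep (fun x => (x - c)⁻¹) (ratPole c) :=
  (Rep.id.sub (Rep.const c)).inv (X_sub_ne_zero c)

theorem rep_ratPrincipalPart (c : ℂ) (f : LaurentSeries ℂ) :
    Rep (fun x => principalPart f (x - c)) (ratPrincipalPart c f) := by
  simp only [principalPart, ← inv_pow]
  exact Rep.sum fun m _ => (Rep.const _).mul ((rep_ratPole c).pow (m + 1))

theorem rep_ratPolynomialPart (f : LaurentSeries ℂ) :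
    Rep (polynomialPart f) (ratPolynomialPart f) :=
  Rep.sum fun m _ => (Rep.const _).mul (Rep.id.pow m)

theorem ratPrincipalPart_mem (γ : κ → ℂ) (q : κ) (f : LaurentSeries ℂ) :
    ratPrincipalPart (γ q) f ∈ polarAlg γ :=
  sum_mem fun _ _ => mul_mem (Subalgebra.algebraMap_mem _ _) (pow_mem (ratPole_mem_polarAlg γ q) _)

theorem ratPolynomialPart_mem (γ : κ → ℂ) (f : LaurentSeries ℂ) :
    ratPolynomialPart f ∈ polarAlg γ :=
  sum_mem fun _ _ => mul_mem (Subalgebra.algebraMap_mem _ _) (pow_mem (X_mem_polarAlg γ) _)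

theorem lb_nodeExpand_ratPrincipalPart (γ : κ → ℂ) {P : Option κ} {c : ℂ} (h : ∀ q, P = some q → γ q ≠ c)
    (f : LaurentSeries ℂ) : LB 0 (nodeExpand γ P (ratPrincipalPart c f)) := by
  rw [ratPrincipalPart, map_sum]
  refine LB.sum fun m _ => ?_
  rw [map_mul, map_pow, AlgHom.commutes, algebraMap_eq_C]
  refine (LB.C _).mul_of_le (lb_pow_zero ?_ (m + 1)) (by simp)
  cases P with
  | none => exact (lb_nodeExpand_none_ratPole γ c).1.mono (by norm_num)
  | some q => exact lb_nodeExpand_ratPole γ (h q rfl)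

theorem lb_nodeExpand_ratPolynomialPart (γ : κ → ℂ) (q : κ) (f : LaurentSeries ℂ) :
    LB 0 (nodeExpand γ (some q) (ratPolynomialPart f)) := by
  rw [ratPolynomialPart, map_sum]
  refine LB.sum fun m _ => ?_
  rw [map_mul, map_pow, AlgHom.commutes, algebraMap_eq_C]
  exact (LB.C _).mul_of_le (lb_pow_zero (lb_nodeExpand_X γ q) m) (by simp)

theorem lb_nodeExpand_ratPrincipalPart_sub (γ : κ → ℂ) (q : κ) (f : LaurentSeries ℂ) :
    LB 0 (nodeExpand γ (some q) (ratPrincipalPart (γ q) f) - f) := by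
  intro k hk
  rw [coeff_sub, sub_eq_zero, ratPrincipalPart, map_sum, coeff_sum]
  have h1 : ∀ m : ℕ, (nodeExpand γ (some q) (algebraMap ℂ _ (f.coeff (-((m : ℤ) + 1))) *
      ratPole (γ q) ^ (m + 1))).coeff k = if (m : ℤ) = -k - 1 then f.coeff k else 0 := by
    intro m
    rw [map_mul, map_pow, AlgHom.commutes, algebraMap_eq_C, nodeExpand_ratPole_self, single_pow,
      HahnSeries.C_mul_eq_smul, coeff_smul, smul_eq_mul, coeff_single]
    split_ifs with h2 h3 h3
    · subst h2; simp
    · exfalso; simp at h2; omega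
    · exfalso; simp at h2; omega
    · simp
  simp only [h1]
  by_cases hf : f.order ≤ k
  · rw [Finset.sum_eq_single (-k - 1).toNat]
    · rw [if_pos (by omega)]
    · intro m _ hm
      rw [if_neg (by omega)]
    · intro hm
      rw [Finset.mem_range] at hm
      omega
  · rw [coeff_eq_zero_of_lt_order (not_le.1 hf)]
    simp

theorem lb_nodeExpand_ratPolynomialPart_sub (γ : κ → ℂ) (f : LaurentSeries ℂ) :
    LB 0 (nodeExpand γ none (ratPolynomialPart f) - f) := by
  intro k hk
  rw [coeff_sub, sub_eq_zero, ratPolynomialPart, map_sum, coeff_sum]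
  have h1 : ∀ m : ℕ, (nodeExpand γ none (algebraMap ℂ _ (f.coeff (-(m : ℤ))) *
      RatFunc.X ^ m)).coeff k = if (m : ℤ) = -k then f.coeff k else 0 := by
    intro m
    rw [map_mul, map_pow, AlgHom.commutes, algebraMap_eq_C, nodeExpand, ratExpand_X, nodeCoord,
      infCoord, single_pow, HahnSeries.C_mul_eq_smul, coeff_smul, smul_eq_mul, coeff_single]
    split_ifs with h2 h3 h3
    · subst h2; simp
    · exfalso; simp at h2; omega
    · exfalso; simp at h2; omega
    · simp
  simp only [h1]
  by_cases hf : f.order ≤ k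
  · rw [Finset.sum_eq_single (-k).toNat]
    · rw [if_pos (by omega)]
    · intro m _ hm
      rw [if_neg (by omega)]
    · intro hm
      rw [Finset.mem_range] at hm
      omega
  · rw [coeff_eq_zero_of_lt_order (not_le.1 hf)]
    simp

variable {φ ι ν : Type*} [Fintype φ] [Fintype ι] [Fintype ν] [DecidableEq ν]
  {L : Option ι → LocalType ν}

theorem Connection.rep_at (A : Connection φ L) (a b : ν) :
    Rep (fun x => A.at x a b) (A.at RatFunc.X a b) := by
  simp only [Connection.at_apply]
  refine ((Rep.sum fun f _ => ?_).add (Rep.sum fun i _ => Rep.sum fun m _ => ?_)).add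
    (Rep.sum fun m _ => ?_)
  · exact (rep_ratPole _).mul (Rep.const _)
  · exact ((rep_ratPole _).pow _).mul (Rep.const _)
  · exact (Rep.id.pow _).mul (Rep.const _)

theorem Connection.nodeExpand_at (A : Connection φ L) (P : Option (φ ⊕ ι)) :
    (A.at RatFunc.X).map (nodeExpand A.pole P) = A.at (nodeCoord A.pole P) := by
  have h := A.map_at (nodeExpand A.pole P).toRingHom (fun c => AlgHom.commutes _ c) RatFunc.X
  have e : (nodeExpand A.pole P).toRingHom RatFunc.X = nodeCoord A.pole P := ratExpand_X _ _
  rw [e] at h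
  exact h

/-- At a pole of first order the expansion of `A` is its residue over the local parameter. -/
theorem Connection.lb_at_fuchs (A : Connection φ L) (hA : Function.Injective A.pole) (f : φ)
    (a b : ν) : LB 0 (A.at (nodeCoord A.pole (some (.inl f))) a b -
      nodeExpand A.pole (some (.inl f)) (ratPole (A.pole (.inl f))) *
        HahnSeries.C (A.fuchsCoeff f a b)) := by
  classical
  have hn : ∀ q, nodeExpand A.pole (some (.inl f)) (ratPole (A.pole q)) =
      (nodeCoord A.pole (some (.inl f)) - algebraMap ℂ _ (A.pole q))⁻¹ := fun q => by
    rw [nodeExpand_ratPole, algebraMap_eq_C]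
  rw [Connection.at_apply]
  simp only [← hn]
  have e : ∀ x y w v : LaurentSeries ℂ, x + y + w - v = (x - v) + y + w := fun _ _ _ _ => by ring
  rw [e, ← algebraMap_eq_C, ← Finset.sum_erase_eq_sub (Finset.mem_univ f)]
  refine ((LB.sum fun f' hf' => ?_).add (LB.sum fun i _ => LB.sum fun m _ => ?_)).add
    (LB.sum fun m _ => ?_)
  · rw [algebraMap_eq_C]
    exact (lb_nodeExpand_ratPole _ (hA.ne fun h => (Finset.ne_of_mem_erase hf')
      (Sum.inl_injective h).symm)).mul_of_le (LB.C _) (by simp)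
  · rw [algebraMap_eq_C]
    exact (lb_pow_zero (lb_nodeExpand_ratPole _ (hA.ne Sum.inl_ne_inr)) _).mul_of_le (LB.C _)
      (by simp)
  · rw [algebraMap_eq_C]
    refine (lb_pow_zero ?_ _).mul_of_le (LB.C _) (by simp)
    have := lb_nodeExpand_X A.pole (.inl f : φ ⊕ ι)
    rwa [nodeExpand, ratExpand_X] at this

/-- The conjugate of the bare deformation by the formal gauge. -/
noncomputable def gaugedForm (t : ∀ p, Fin (L p).s → ℕ → ℂ)
    (Y : Option ι → Matrix ν ν (PowerSeries ℂ)) (dt : ∀ p, Fin (L p).s → ℕ → ℂ) (dγ : φ ⊕ ι → ℂ)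
    (p : Option ι) : Matrix ν ν (LaurentSeries ℂ) :=
  toLaurent (Y p) * bareForm L p (t p) (dt p) (p.elim 0 fun i => dγ (.inr i)) * (toLaurent (Y p))⁻¹

/-- The deformation matrix, as a matrix of rational functions. -/
noncomputable def Connection.ratDeformation (A : Connection φ L) (t : ∀ p, Fin (L p).s → ℕ → ℂ)
    (Y : Option ι → Matrix ν ν (PowerSeries ℂ)) (dt : ∀ p, Fin (L p).s → ℕ → ℂ) (dγ : φ ⊕ ι → ℂ) :
    Matrix ν ν (RatFunc ℂ) :=
  Matrix.of fun a b => ratPolynomialPart (gaugedForm t Y dt dγ none a b)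
    + ∑ i, ratPrincipalPart (A.pole (.inr i)) (gaugedForm t Y dt dγ (some i) a b)
    - ∑ f, algebraMap ℂ _ (dγ (.inl f)) * ratPole (A.pole (.inl f)) *
        algebraMap ℂ _ (A.fuchsCoeff f a b)

variable (A : Connection φ L) (t : ∀ p, Fin (L p).s → ℕ → ℂ)
    (Y : Option ι → Matrix ν ν (PowerSeries ℂ)) (dt : ∀ p, Fin (L p).s → ℕ → ℂ) (dγ : φ ⊕ ι → ℂ)

theorem Connection.rep_deformation (a b : ν) : Rep (fun x => A.deformation t Y dt dγ x a b)
    (A.ratDeformation t Y dt dγ a b) := by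
  simp only [Connection.deformation, Matrix.sub_apply, Matrix.add_apply, Matrix.sum_apply,
    Matrix.map_apply, Matrix.smul_apply, smul_eq_mul]
  exact ((rep_ratPolynomialPart _).add (Rep.sum fun i _ => rep_ratPrincipalPart _ _)).sub
    (Rep.sum fun f _ => ((Rep.const _).mul (rep_ratPole _)).mul (Rep.const _))

theorem Connection.ratDeformation_mem (a b : ν) :
    A.ratDeformation t Y dt dγ a b ∈ polarAlg A.pole :=
  sub_mem (add_mem (ratPolynomialPart_mem _ _) (sum_mem fun i _ =>
    ratPrincipalPart_mem A.pole (.inr i) _)) (sum_mem fun f _ =>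
    mul_mem (mul_mem (Subalgebra.algebraMap_mem _ _) (ratPole_mem_polarAlg A.pole (.inl f)))
      (Subalgebra.algebraMap_mem _ _))

theorem Connection.lb_ratDeformation_inf (a b : ν) :
    LB 0 (nodeExpand A.pole none (A.ratDeformation t Y dt dγ a b) -
      gaugedForm t Y dt dγ none a b) := by
  rw [Connection.ratDeformation, Matrix.of_apply, map_sub, map_add, map_sum, map_sum]
  have e : ∀ x y w v : LaurentSeries ℂ, x + y - w - v = (x - v) + y - w := fun _ _ _ _ => by ring
  rw [e]
  refine ((lb_nodeExpand_ratPolynomialPart_sub _ _).add (LB.sum fun i _ => ?_)).sub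
    (LB.sum fun f _ => ?_)
  · exact lb_nodeExpand_ratPrincipalPart _ (by simp) _
  · rw [map_mul, map_mul, AlgHom.commutes, AlgHom.commutes, algebraMap_eq_C, algebraMap_eq_C]
    exact ((LB.C _).mul_of_le (lb_nodeExpand_none_ratPole _ _).1 (b := 0) (a := 0)
      (by norm_num)).mul_of_le (LB.C _) (by norm_num)

/-- Only the principal part taken at this pole is singular there, and it reproduces all negative
exponents of the gauged form. -/
theorem Connection.lb_ratDeformation_irr (hA : Function.Injective A.pole) (i : ι) (a b : ν) :
    LB 0 (nodeExpand A.pole (some (.inr i)) (A.ratDeformation t Y dt dγ a b) -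
      gaugedForm t Y dt dγ (some i) a b) := by
  classical
  rw [Connection.ratDeformation, Matrix.of_apply, map_sub, map_add, map_sum, map_sum,
    ← Finset.add_sum_erase _ _ (Finset.mem_univ i)]
  have e : ∀ x y y' w v : LaurentSeries ℂ, x + (y + y') - w - v = (x + (y - v) + y') - w :=
    fun _ _ _ _ _ => by ring
  rw [e]
  refine (((lb_nodeExpand_ratPolynomialPart _ _ _).add
    (lb_nodeExpand_ratPrincipalPart_sub A.pole (.inr i) _)).add (LB.sum fun i' hi' => ?_)).sub
    (LB.sum fun f _ => ?_)
  · refine lb_nodeExpand_ratPrincipalPart _ (fun q hq => hA.ne ?_) _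
    rw [← Option.some.inj hq]
    exact fun h => Finset.ne_of_mem_erase hi' (Sum.inr_injective h).symm
  · rw [map_mul, map_mul, AlgHom.commutes, AlgHom.commutes, algebraMap_eq_C, algebraMap_eq_C]
    exact ((LB.C _).mul_of_le (lb_nodeExpand_ratPole _ (hA.ne Sum.inr_ne_inl)) (b := 0) (a := 0)
      (by norm_num)).mul_of_le (LB.C _) (by norm_num)

/-- The Fuchsian term of the deformation matrix is normalized so as to cancel the simple pole of `dγ
A`: in the moving frame the deformation is regular. -/
theorem Connection.lb_ratDeformation_fuchs (hA : Function.Injective A.pole) (f : φ) (a b : ν) :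
    LB 0 (nodeExpand A.pole (some (.inl f)) (A.ratDeformation t Y dt dγ a b) +
      HahnSeries.C (dγ (.inl f)) * A.at (nodeCoord A.pole (some (.inl f))) a b) := by
  classical
  have h1 := (LB.C (dγ (.inl f))).mul_of_le (A.lb_at_fuchs hA f a b) (a := 0) (by norm_num)
  rw [Connection.ratDeformation, Matrix.of_apply, map_sub, map_add, map_sum, map_sum,
    ← Finset.add_sum_erase _ _ (Finset.mem_univ f)]
  simp only [map_mul, AlgHom.commutes, algebraMap_eq_C]
  have e : ∀ x y c w d w' m : LaurentSeries ℂ, x + y - (c * w * d + w') + c * m =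
      x + y + c * (m - w * d) - w' := fun _ _ _ _ _ _ _ => by ring
  rw [e]
  refine (((lb_nodeExpand_ratPolynomialPart _ _ _).add (LB.sum fun i _ => ?_)).add h1).sub
    (LB.sum fun f' hf' => ?_)
  · refine lb_nodeExpand_ratPrincipalPart _ (fun q hq => hA.ne ?_) _
    rw [← Option.some.inj hq]
    exact Sum.inl_ne_inr
  · exact ((LB.C _).mul_of_le (lb_nodeExpand_ratPole _ (hA.ne fun h => (Finset.ne_of_mem_erase hf')
      (Sum.inl_injective h).symm)) (b := 0) (a := 0) (by norm_num)).mul_of_le (LB.C _) (by norm_num)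

end RationalDeformation

/-! ### The deformation equation at the poles -/

section Flow

variable {φ ι ν : Type*} [Fintype φ] [Fintype ι] [Fintype ν] [DecidableEq ν]
  {L : Option ι → LocalType ν}
  {E : Type*} [NormedAddCommGroup E] [NormedSpace ℂ E] {U : Set E}

theorem rep_atDot (A : E → Connection φ L) (z v : E) (a b : ν) :
    Rep (fun x => atDot A z v x a b) (atDot A z v RatFunc.X a b) := by
  simp only [atDot]
  refine ((Rep.sum fun f _ => ?_).add (Rep.sum fun i _ => Rep.sum fun m _ => ?_)).add
    (Rep.sum fun m _ => ?_)
  · exact ((rep_ratPole _).mul (Rep.const _)).add (((Rep.const _).mul ((rep_ratPole _).pow _)).mul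
      (Rep.const _))
  · refine (((rep_ratPole _).pow _).mul (Rep.const _)).add (((Rep.mul ?_ (Rep.const _)).mul
      ((rep_ratPole _).pow _)).mul (Rep.const _))
    have := Rep.const (((m : ℕ) + 1 : ℕ) : ℂ)
    rwa [map_natCast] at this
  · exact (Rep.id.pow _).mul (Rep.const _)

variable (A : E → Connection φ L) (t : E → ∀ p, Fin (L p).s → ℕ → ℂ)
  (Y : E → Option ι → Matrix ν ν (PowerSeries ℂ))

/-- The deformation matrix of the tangent vector `v`, as a matrix of rational functions. -/
noncomputable def flowMat (z v : E) : Matrix ν ν (RatFunc ℂ) :=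
  (A z).ratDeformation (t z) (Y z) (dTimes t z v) (dPoles A z v)

/-- The expansion of `A` at a pole. -/
noncomputable def nodeAt (P : Option (φ ⊕ ι)) (z : E) : Matrix ν ν (LaurentSeries ℂ) :=
  (A z).at (nodeCoord (A z).pole P)

/-- The expansion at a pole of the deformation matrix. -/
noncomputable def nodeFlow (P : Option (φ ⊕ ι)) (z v : E) : Matrix ν ν (LaurentSeries ℂ) :=
  (flowMat A t Y z v).map (nodeExpand (A z).pole P)

/-- The deformation matrix in the frame that moves with the pole. -/
noncomputable def movingFlow (P : Option (φ ⊕ ι)) (z v : E) : Matrix ν ν (LaurentSeries ℂ) :=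
  nodeFlow A t Y P z v + (HahnSeries.C (P.elim 0 (dPoles A z v)) : LaurentSeries ℂ) • nodeAt A P z

variable {A t Y}

/-- Both sides represent the same function off the finitely many poles, so they agree as rational
functions by `Rep.eq`. -/
theorem NormalizedIsomonodromic.rat_flow (h : NormalizedIsomonodromic U A t Y) (hU : IsOpen U)
    {z : E} (hz : z ∈ U) (v : E) (a b : ν) : atDot A z v RatFunc.X a b =
      ratDeriv (flowMat A t Y z v a b) + (flowMat A t Y z v * (A z).at RatFunc.X -
        (A z).at RatFunc.X * flowMat A t Y z v : Matrix ν ν (RatFunc ℂ)) a b := by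
  refine (rep_atDot A z v a b).eq ?_
  have h1 := (A z).rep_deformation (t z) (Y z) (dTimes t z v) (dPoles A z v)
  have h2 := (A z).rep_at
  rw [Matrix.sub_apply, Matrix.mul_apply, Matrix.mul_apply]
  have h3 := (h1 a b).deriv.add ((Rep.sum (T := Finset.univ) fun c _ => (h1 a c).mul (h2 c b)).sub
      (Rep.sum (T := Finset.univ) fun c _ => (h2 a c).mul (h1 c b)))
  refine Rep.congr h3 ?_
  have hfin : ∀ᶠ x in Filter.cofinite, ∀ q, x ≠ (A z).pole q := by
    rw [Filter.eventually_cofinite]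
    refine (Set.finite_range (A z).pole).subset fun x hx => ?_
    simp only [ne_eq, not_forall, not_not] at hx
    obtain ⟨q, hq⟩ := hx
    exact ⟨q, hq.symm⟩
  filter_upwards [hfin] with x hx
  rw [← h.fderiv_at hU hz v hx, h.flow z hz v x hx, Matrix.sub_apply, Matrix.mul_apply,
    Matrix.mul_apply]

theorem map_mul_nodeExpand {κ : Type*} (γ : κ → ℂ) (P : Option κ) (X Z : Matrix ν ν (RatFunc ℂ)) :
    (X * Z).map (nodeExpand γ P) = X.map (nodeExpand γ P) * Z.map (nodeExpand γ P) := by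
  refine Matrix.ext fun a b => ?_
  simp only [Matrix.map_apply, Matrix.mul_apply, map_sum, map_mul]

theorem NormalizedIsomonodromic.famM_nodeAt (h : NormalizedIsomonodromic U A t Y) (hU : IsOpen U)
    (P : Option (φ ⊕ ι)) : FamM U (nodeAt A P) := by
  intro a b
  rcases U.eq_empty_or_nonempty with rfl | ⟨z, hz⟩
  · exact ⟨⟨0, by simp⟩, fun k => by simp⟩
  · exact (h.drv_node hU hz 0 P a b).fam

/-- Letting the frame move with the pole adds `dγ ∂_x A` to the derivative. Adding `dγ A` to the
deformation matrix accounts for it, as `A` commutes with itself, and the zero curvature equation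
keeps its form. Multiplying by `u` trades `∂_x` for `ε θ`. -/
theorem NormalizedIsomonodromic.dirM_nodeAt (h : NormalizedIsomonodromic U A t Y) (hU : IsOpen U)
    {z : E} (hz : z ∈ U) (v : E) (P : Option (φ ⊕ ι)) :
    dirM (fun z => (single (sgn P) 1 : LaurentSeries ℂ) • nodeAt A P z) z v =
      (HahnSeries.C (sgn P : ℂ) : LaurentSeries ℂ) • (movingFlow A t Y P z v).map euler
      + (movingFlow A t Y P z v * ((single (sgn P) 1 : LaurentSeries ℂ) • nodeAt A P z)
        - ((single (sgn P) 1 : LaurentSeries ℂ) • nodeAt A P z) * movingFlow A t Y P z v) := by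
  have hF := h.famM_nodeAt hU P
  have hcomm : movingFlow A t Y P z v * nodeAt A P z - nodeAt A P z * movingFlow A t Y P z v =
      nodeFlow A t Y P z v * nodeAt A P z - nodeAt A P z * nodeFlow A t Y P z v := by
    rw [movingFlow, add_mul, mul_add, laurent_smul_mul, laurent_mul_smul]
    abel
  rw [hF.dirM_const_smul hU _ hz, laurent_mul_smul, laurent_smul_mul]
  have e1 : (single (sgn P) 1 : LaurentSeries ℂ) • (movingFlow A t Y P z v * nodeAt A P z) -
      (single (sgn P) 1 : LaurentSeries ℂ) • (nodeAt A P z * movingFlow A t Y P z v) =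
      (single (sgn P) 1 : LaurentSeries ℂ) • (nodeFlow A t Y P z v * nodeAt A P z -
        nodeAt A P z * nodeFlow A t Y P z v) := by
    rw [← hcomm]
    refine Matrix.ext fun a b => ?_
    exact (mul_sub _ _ _).symm
  rw [e1]
  refine Matrix.ext fun a b => ?_
  have h1 := (h.drv_node hU hz v P a b).dir_eq
  have h2 := congrArg (nodeExpand (A z).pole P) (h.rat_flow hU hz v a b)
  have h3 := map_atDot A z v (nodeExpand (A z).pole P).toRingHom (fun c => AlgHom.commutes _ c)
    RatFunc.X a b
  rw [show (nodeExpand (A z).pole P).toRingHom RatFunc.X = nodeCoord (A z).pole P from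
    ratExpand_X _ _] at h3
  have h4 : (nodeExpand (A z).pole P) ((flowMat A t Y z v * (A z).at RatFunc.X -
        (A z).at RatFunc.X * flowMat A t Y z v : Matrix ν ν (RatFunc ℂ)) a b) = (nodeFlow A t Y P z v * nodeAt A P z -
        nodeAt A P z * nodeFlow A t Y P z v) a b := by
    rw [nodeAt, ← (A z).nodeExpand_at, nodeFlow, ← map_mul_nodeExpand, ← map_mul_nodeExpand,
      Matrix.sub_apply, Matrix.sub_apply, map_sub]
    rfl
  have h5 := euler_nodeExpand (A z).pole P (flowMat A t Y z v a b)
  rw [map_add, h4] at h2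
  have h6 : (single (sgn P) 1 : LaurentSeries ℂ) = HahnSeries.C (sgn P : ℂ) *
      euler (nodeCoord (A z).pole P) := by
    rw [euler_nodeCoord, C_apply, single_mul_single, zero_add]
    congr 1
    exact_mod_cast (sgn_mul_self P).symm
  have hne := euler_nodeCoord_ne_zero (A z).pole P
  rw [Matrix.smul_apply, Matrix.add_apply, Matrix.smul_apply, Matrix.smul_apply, smul_eq_mul,
    smul_eq_mul, smul_eq_mul]
  have h7 : (movingFlow A t Y P z v).map euler a b = euler (nodeExpand (A z).pole P
      (flowMat A t Y z v a b)) + HahnSeries.C (P.elim 0 (dPoles A z v)) *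
        euler (nodeAt A P z a b) := by
    rw [Matrix.map_apply, movingFlow, Matrix.add_apply, map_add, Matrix.smul_apply, smul_eq_mul,
      euler_mul, euler_C, zero_mul, zero_add]
    rfl
  have h8 : dirM (nodeAt A P) z v a b = atDot A z v (nodeCoord (A z).pole P) a b +
    HahnSeries.C (P.elim 0 (dPoles A z v)) * (euler (nodeCoord (A z).pole P))⁻¹ *
      euler (nodeAt A P z a b) := h1
  rw [h7, h8, h5, ← h3, show (nodeExpand (A z).pole P).toRingHom (atDot A z v RatFunc.X a b) =
    nodeExpand (A z).pole P (atDot A z v RatFunc.X a b) from rfl, h2, h6]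
  field_simp
  ring

end Flow

/-! ### Families of formal gauges -/

section GaugeFamily

variable {ι : Type*} {p : Option ι} {s : ℕ} {n : Fin s → ℕ} {r : ℕ}

/-- The bare system is affine in the times, and its inhomogeneous part does not vary. -/
theorem bareM_eq_bareVar_sub (t : Fin s → ℕ → ℂ) : bareM p n r t = bareVar p n r t -
    Matrix.blockDiagonal' fun j => (HahnSeries.C ((n j : ℂ)⁻¹) : LaurentSeries ℂ) • gradMat (n j) := by
  refine Matrix.ext fun ⟨i, a⟩ ⟨k, b⟩ => ?_
  rw [Matrix.sub_apply, bareVar, Matrix.sum_apply, bareM]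
  by_cases hik : i = k
  · subst hik
    rw [Matrix.blockDiagonal'_apply_eq, Matrix.blockDiagonal'_apply_eq, Finset.sum_eq_single i]
    · rw [Matrix.sum_apply, Matrix.smul_apply, Matrix.smul_apply, Matrix.sub_apply, smul_eq_mul,
        smul_eq_mul, mul_sub, Matrix.sum_apply, Finset.mul_sum]
      congr 1
      refine Finset.sum_congr rfl fun J _ => ?_
      rw [Matrix.smul_apply, Matrix.smul_apply, blockH, Matrix.blockDiagonal'_apply_eq,
        Pi.single_eq_same, smul_eq_mul, smul_eq_mul, ← mul_assoc, ← map_mul]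
      congr 2
      rw [div_eq_mul_inv, mul_comm]
    · intro j _ hj
      rw [Matrix.sum_apply]
      refine Finset.sum_eq_zero fun J _ => ?_
      rw [Matrix.smul_apply, blockH, Matrix.blockDiagonal'_apply_eq, Pi.single_eq_of_ne hj.symm,
        Matrix.zero_apply, smul_zero]
    · simp
  · rw [Matrix.blockDiagonal'_apply_ne _ _ _ hik, Matrix.blockDiagonal'_apply_ne _ _ _ hik, sub_zero]
    refine (Finset.sum_eq_zero fun j _ => ?_).symm
    rw [Matrix.sum_apply]
    refine Finset.sum_eq_zero fun J _ => ?_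
    rw [Matrix.smul_apply, blockH, Matrix.blockDiagonal'_apply_ne _ _ _ hik, smul_zero]

variable {E : Type*} [NormedAddCommGroup E] [NormedSpace ℂ E] {U : Set E}
  {t : E → Fin s → ℕ → ℂ}
  {𝒜 Y Yi : E → Matrix (Σ j : Fin s, Fin (n j)) (Σ j : Fin s, Fin (n j)) (LaurentSeries ℂ)}

theorem famM_bareVar (hU : IsOpen U) (ht : ∀ j, ∀ J ∈ Finset.range (r * n j + 1),
    AnalyticOnNhd ℂ (fun z => t z j J) U) :
    FamM U (fun z => bareVar p n r (t z)) ∧ ∀ z ∈ U, ∀ v, dirM (fun z => bareVar p n r (t z)) z v =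
      bareVar p n r fun j J => fderiv ℂ (fun z => t z j J) z v := by
  have h0 : ∀ j, ∀ J ∈ Finset.range (r * n j + 1),
      AnalyticOnNhd ℂ (fun z => t z j J * (n j : ℂ)⁻¹) U :=
    fun j J hJ => (ht j J hJ).mul analyticOnNhd_const
  have h1 : ∀ j, ∀ J ∈ Finset.range (r * n j + 1), ∀ x y,
      Fam U fun z => (HahnSeries.C (t z j J * (n j : ℂ)⁻¹) : LaurentSeries ℂ) * blockH p n j J x y :=
    fun j J hJ x y => (Fam.C (h0 j J hJ)).mul hU (Fam.const _)
  have e : ∀ t : Fin s → ℕ → ℂ, ∀ x y, bareVar p n r t x y = ∑ j, ∑ J ∈ Finset.range (r * n j + 1),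
      HahnSeries.C (t j J * (n j : ℂ)⁻¹) * blockH p n j J x y := by
    intro t x y
    simp only [bareVar, Matrix.sum_apply, Matrix.smul_apply, smul_eq_mul, div_eq_mul_inv]
  refine ⟨fun x y => ?_, fun z hz v => Matrix.ext fun x y => ?_⟩
  · simp only [e]
    exact Fam.sum fun j _ => Fam.sum fun J hJ => h1 j J hJ x y
  · simp only [dirM, Matrix.of_apply, e]
    rw [Fam.dir_sum hU (fun j _ => Fam.sum fun J hJ => h1 j J hJ x y) hz]
    refine Finset.sum_congr rfl fun j _ => ?_
    rw [Fam.dir_sum hU (fun J hJ => h1 j J hJ x y) hz]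
    refine Finset.sum_congr rfl fun J hJ => ?_
    rw [(Fam.C (h0 j J hJ)).dir_mul hU (Fam.const _) hz, dir_const, mul_zero, add_zero,
      dir_C hU (h0 j J hJ) hz, fderiv_mul_const (ht j J hJ z hz).differentiableAt]
    congr 2
    simp [mul_comm]

theorem LocalGauge.bareM_eq {t : Fin s → ℕ → ℂ}
    {𝒜 Y Yi : Matrix (Σ j : Fin s, Fin (n j)) (Σ j : Fin s, Fin (n j)) (LaurentSeries ℂ)}
    (G : LocalGauge p r t 𝒜 Y Yi) : bareM p n r t = Yi * (𝒜 * Y) +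
      (HahnSeries.C (-(sgn p : ℂ)) : LaurentSeries ℂ) • (Yi * Y.map euler) := by
  rw [G.eq, Matrix.mul_add, ← Matrix.mul_assoc, G.inv_mul, Matrix.one_mul, laurent_mul_smul, map_neg]
  refine Matrix.ext fun x y => ?_
  simp only [Matrix.add_apply, Matrix.smul_apply, smul_eq_mul]
  ring

/-- Analyticity of `t_0` is not part of the hypotheses. It is recovered from the constant
coefficient of one diagonal entry of the bare system, which the system and the gauge determine. -/
theorem analyticOnNhd_times (hn : ∀ j, 0 < n j) (hU : IsOpen U)
    (G : ∀ z ∈ U, LocalGauge p r (t z) (𝒜 z) (Y z) (Yi z))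
    (h𝒜 : FamM U 𝒜) (hY : FamM U Y) (hYi : FamM U Yi)
    (ht : ∀ j, ∀ J ∈ Finset.Icc 1 (r * n j), AnalyticOnNhd ℂ (fun z => t z j J) U) :
    ∀ j, ∀ J ∈ Finset.range (r * n j + 1), AnalyticOnNhd ℂ (fun z => t z j J) U := by
  intro j J hJ
  rcases Nat.eq_zero_or_pos J with rfl | hJ0
  swap
  · exact ht j J (by rw [Finset.mem_Icc]; rw [Finset.mem_range] at hJ; omega)
  have hM : FamM U fun z => Yi z * (𝒜 z * Y z) +
      (HahnSeries.C (-(sgn p : ℂ)) : LaurentSeries ℂ) • (Yi z * (Y z).map euler) :=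
    (hYi.mul hU (h𝒜.mul hU hY)).add (FamM.smul hU (Fam.const _) (hYi.mul hU hY.euler))
  have hfun : ∀ z ∈ U, n j * ((Yi z * (𝒜 z * Y z) + (HahnSeries.C (-(sgn p : ℂ)) :
      LaurentSeries ℂ) • (Yi z * (Y z).map euler)) ⟨j, lowerOrder p _ ⟨0, hn j⟩⟩
        ⟨j, lowerOrder p _ ⟨0, hn j⟩⟩).coeff 0 + ((lowerOrder p (n j) ⟨0, hn j⟩ : ℕ) : ℂ) =
      t z j 0 := by
    intro z hz
    have hn0 : (n j : ℂ) ≠ 0 := by exact_mod_cast (hn j).ne'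
    rw [← (G z hz).bareM_eq, coeff_bareM, Finset.sum_eq_single 0]
    · rw [mul_inv_cancel_left₀ hn0]
      simp
    · intro J _ hJ
      rw [if_neg]
      simpa using hJ
    · simp
  refine AnalyticOnNhd.congr hU ?_ hfun
  exact (analyticOnNhd_const.mul ((hM _ _).an 0)).add analyticOnNhd_const

theorem dirM_inverse {I : Type*} [Fintype I] [DecidableEq I]
    {Y Yi : E → Matrix I I (LaurentSeries ℂ)} (hU : IsOpen U) (h : ∀ z ∈ U, Yi z * Y z = 1)
    (hY : FamM U Y) (hYi : FamM U Yi) {z : E} (hz : z ∈ U) (v : E) :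
    dirM Yi z v = -(Yi z * dirM Y z v * Yi z) := by
  have h1 := hYi.dirM_mul hU hY hz v
  have h2 : dirM (fun z => Yi z * Y z) z v = 0 := by
    refine Matrix.ext fun x y => ?_
    have : dir (fun z => (Yi z * Y z) x y) z v = dir (fun _ => (1 : Matrix I I _) x y) z v :=
      dir_congr hU (fun z hz => by rw [h z hz]) hz v
    refine this.trans ?_
    rw [dir_const, Matrix.zero_apply]
  rw [h2] at h1
  have h3 : Y z * Yi z = 1 := mul_eq_one_comm.mp (h z hz)
  have h4 := congrArg (fun X => X * Yi z) h1
  simp only [Matrix.zero_mul, Matrix.add_mul] at h4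
  rw [Matrix.mul_assoc (dirM Yi z v), h3, Matrix.mul_one] at h4
  exact eq_neg_of_add_eq_zero_left h4.symm

/-- The variation of the logarithmic derivative of the gauge. -/
theorem dirM_log {I : Type*} [Fintype I] [DecidableEq I]
    {Y Yi : E → Matrix I I (LaurentSeries ℂ)} (hU : IsOpen U) (h : ∀ z ∈ U, Yi z * Y z = 1)
    (hY : FamM U Y) (hYi : FamM U Yi) {z : E} (hz : z ∈ U) (v : E) :
    dirM (fun z => Yi z * (Y z).map euler) z v =
      nabla (Yi z * (Y z).map euler) (Yi z * dirM Y z v) := by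
  have h3 : Y z * Yi z = 1 := mul_eq_one_comm.mp (h z hz)
  have e : dirM Y z v = Y z * (Yi z * dirM Y z v) := by
    rw [← Matrix.mul_assoc, h3, Matrix.one_mul]
  rw [hYi.dirM_mul hU hY.euler hz, dirM_inverse hU h hY hYi hz, hY.dirM_euler hU hz, nabla]
  set b := Yi z * dirM Y z v with hb
  rw [e, map_euler_mul, Matrix.mul_add, ← Matrix.mul_assoc (Yi z), ← Matrix.mul_assoc (Yi z),
    h z hz, Matrix.one_mul,
    Matrix.neg_mul, Matrix.mul_assoc b]
  abel

/-- The variation of the bare system in terms of the deformation matrix in the gauge. -/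
theorem bareVar_eq (hn : ∀ j, 0 < n j) (hU : IsOpen U)
    (G : ∀ z ∈ U, LocalGauge p r (t z) (𝒜 z) (Y z) (Yi z))
    (h𝒜 : FamM U 𝒜) (hY : FamM U Y) (hYi : FamM U Yi)
    (ht : ∀ j, ∀ J ∈ Finset.Icc 1 (r * n j), AnalyticOnNhd ℂ (fun z => t z j J) U)
    {z : E} (hz : z ∈ U) (v : E)
    {T : Matrix (Σ j : Fin s, Fin (n j)) (Σ j : Fin s, Fin (n j)) (LaurentSeries ℂ)}
    (hT : dirM 𝒜 z v = (HahnSeries.C (sgn p : ℂ) : LaurentSeries ℂ) • T.map euler +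
      (T * 𝒜 z - 𝒜 z * T)) :
    bareVar p n r (fun j J => fderiv ℂ (fun z => t z j J) z v) =
      (HahnSeries.C (sgn p : ℂ) : LaurentSeries ℂ) •
        (Yi z * T * Y z - Yi z * dirM Y z v).map euler +
      ((Yi z * T * Y z - Yi z * dirM Y z v) * bareM p n r (t z) -
        bareM p n r (t z) * (Yi z * T * Y z - Yi z * dirM Y z v)) := by
  have ht0 := analyticOnNhd_times hn hU G h𝒜 hY hYi ht
  obtain ⟨hV, hV'⟩ := famM_bareVar (p := p) hU ht0
  have hinv : ∀ z ∈ U, Yi z * Y z = 1 := fun z hz => (G z hz).inv_mul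
  have h3 : Y z * Yi z = 1 := (G z hz).mul_inv
  have hconst : FamM U fun _ : E => (Matrix.blockDiagonal' fun j =>
      (HahnSeries.C ((n j : ℂ)⁻¹) : LaurentSeries ℂ) • gradMat (n j)) := fun _ _ => Fam.const _
  -- differentiate the two expressions of the bare system
  have h1 : dirM (fun z => bareVar p n r (t z)) z v =
      dirM (fun z => Yi z * (𝒜 z * Y z) + (HahnSeries.C (-(sgn p : ℂ)) : LaurentSeries ℂ) •
        (Yi z * (Y z).map euler)) z v := by
    have h4 : ∀ z ∈ U, bareVar p n r (t z) = (Yi z * (𝒜 z * Y z) +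
        (HahnSeries.C (-(sgn p : ℂ)) : LaurentSeries ℂ) • (Yi z * (Y z).map euler)) +
        Matrix.blockDiagonal' fun j => (HahnSeries.C ((n j : ℂ)⁻¹) : LaurentSeries ℂ) •
          gradMat (n j) := by
      intro z hz
      rw [← (G z hz).bareM_eq, bareM_eq_bareVar_sub, sub_add_cancel]
    have hM : FamM U fun z => Yi z * (𝒜 z * Y z) +
        (HahnSeries.C (-(sgn p : ℂ)) : LaurentSeries ℂ) • (Yi z * (Y z).map euler) :=
      (hYi.mul hU (h𝒜.mul hU hY)).add (FamM.smul hU (Fam.const _) (hYi.mul hU hY.euler))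
    refine Matrix.ext fun x y => ?_
    refine (dir_congr hU (fun z hz => congrArg (fun X => X x y) (h4 z hz)) hz v).trans ?_
    refine ((hM x y).dir_add hU (hconst x y) hz v).trans ?_
    rw [dir_const, add_zero]
    rfl
  rw [← hV' z hz v, h1, FamM.dirM_add hU (hYi.mul hU (h𝒜.mul hU hY))
    (FamM.smul hU (Fam.const _) (hYi.mul hU hY.euler)) hz,
    (hYi.mul hU hY.euler).dirM_const_smul hU _ hz, dirM_log hU hinv hY hYi hz,
    hYi.dirM_mul hU (h𝒜.mul hU hY) hz, h𝒜.dirM_mul hU hY hz, dirM_inverse hU hinv hY hYi hz, hT]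
  set a := Yi z * (Y z).map euler with ha
  set b := Yi z * dirM Y z v with hb
  set ε : LaurentSeries ℂ := HahnSeries.C (sgn p : ℂ) with hε
  set N := Yi z * T * Y z with hN
  have hM : Yi z * (𝒜 z * Y z) = bareM p n r (t z) + ε • a := by
    rw [(G z hz).bareM_eq]
    refine Matrix.ext fun x y => ?_
    simp only [Matrix.add_apply, Matrix.smul_apply, smul_eq_mul, map_neg]
    rw [hε]
    ring
  set M := bareM p n r (t z) with hMdef
  have e1 : Yi z * (T.map euler * Y z) = nabla a N := by
    rw [← Matrix.mul_assoc, (G z hz).conj_nabla]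
  have e2 : Yi z * (T * 𝒜 z * Y z) = N * (M + ε • a) := by
    rw [← hM, hN, Matrix.mul_assoc (Yi z * T), ← Matrix.mul_assoc (Y z), h3, Matrix.one_mul]
    simp only [Matrix.mul_assoc]
  have e3 : Yi z * (𝒜 z * T * Y z) = (M + ε • a) * N := by
    rw [← hM, hN, Matrix.mul_assoc (Yi z) T, Matrix.mul_assoc (Yi z) (𝒜 z * Y z),
      Matrix.mul_assoc (𝒜 z) (Y z), ← Matrix.mul_assoc (Y z) (Yi z), h3, Matrix.one_mul]
    simp only [Matrix.mul_assoc]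
  have e4 : Yi z * (𝒜 z * dirM Y z v) = (M + ε • a) * b := by
    rw [← hM, hb, Matrix.mul_assoc (Yi z) (𝒜 z * Y z), Matrix.mul_assoc (𝒜 z) (Y z),
      ← Matrix.mul_assoc (Y z) (Yi z), h3, Matrix.one_mul]
  have e5 : -(b * Yi z) * (𝒜 z * Y z) = -(b * (M + ε • a)) := by
    rw [Matrix.neg_mul, Matrix.mul_assoc, hM]
  have e6 : Yi z * ((ε • T.map euler + (T * 𝒜 z - 𝒜 z * T)) * Y z + 𝒜 z * dirM Y z v) =
      ε • nabla a N + (N * (M + ε • a) - (M + ε • a) * N) + (M + ε • a) * b := by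
    rw [Matrix.mul_add, e4, Matrix.add_mul, Matrix.sub_mul, Matrix.mul_add, Matrix.mul_sub, e2, e3,
      laurent_smul_mul, laurent_mul_smul, e1]
  rw [e5, e6, nabla, nabla, Matrix.map_sub _ (map_sub euler)]
  simp only [Matrix.mul_add, Matrix.add_mul, Matrix.sub_mul, Matrix.mul_sub]
  simp only [laurent_smul_mul, laurent_mul_smul]
  refine Matrix.ext fun x y => ?_
  simp only [Matrix.add_apply, Matrix.sub_apply, Matrix.neg_apply, Matrix.smul_apply, smul_eq_mul,
    map_neg]
  rw [hε]
  ring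

end GaugeFamily

/-! ### The local exterior derivative at an irregular pole -/

section LocalForm

variable {φ ι ν : Type*} [Fintype φ] [Fintype ι] [Fintype ν] [DecidableEq ν]
  {L : Option ι → LocalType ν}

theorem bareT_submatrix (p : Option ι) (j : Fin (L p).s) (J : ℕ) :
    (bareT L p j J).submatrix (L p).e (L p).e =
      (HahnSeries.C (-(sgn p : ℂ) / J) : LaurentSeries ℂ) • blockH p (L p).n j J := by
  have e : bareSign p = -(sgn p : ℂ) := by cases p <;> simp [bareSign, sgn]
  refine Matrix.ext fun x y => ?_
  rw [bareT, matrix_smul_eq, Matrix.submatrix_apply, Matrix.smul_apply, Matrix.smul_apply, e,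
    LocalType.blocks, Matrix.reindex_apply, Matrix.submatrix_apply, Equiv.symm_apply_apply,
    Equiv.symm_apply_apply]
  rfl

theorem bareForm_submatrix (p : Option ι) (t dt : Fin (L p).s → ℕ → ℂ) (dγ : ℂ) :
    (bareForm L p t dt dγ).submatrix (L p).e (L p).e = bareB p (L p).n (L p).r dt -
      (HahnSeries.C dγ : LaurentSeries ℂ) • (bareD L p t).submatrix (L p).e (L p).e := by
  refine Matrix.ext fun x y => ?_
  rw [bareForm, Matrix.submatrix_apply, Matrix.sub_apply, Matrix.sub_apply, matrix_smul_eq, bareB,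
    Matrix.sum_apply, Matrix.sum_apply]
  congr 1
  refine Finset.sum_congr rfl fun j _ => ?_
  rw [Matrix.sum_apply, Matrix.sum_apply]
  refine Finset.sum_congr rfl fun J _ => ?_
  have h := congrArg (fun X => X x y) (bareT_submatrix (L := L) p j J)
  simp only [Matrix.submatrix_apply] at h
  rw [matrix_smul_eq, Matrix.smul_apply, h, Matrix.smul_apply, Matrix.smul_apply, smul_eq_mul,
    smul_eq_mul, smul_eq_mul, ← mul_assoc, ← map_mul]
  congr 2
  ring

theorem resPair_submatrix {I I' : Type*} [Fintype I] [Fintype I'] (e : I' ≃ I)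
    (X Z : Matrix I I (LaurentSeries ℂ)) :
    resPair (X.submatrix e e) (Z.submatrix e e) = resPair X Z := by
  rw [resPair, resPair, Matrix.submatrix_mul_equiv, Matrix.trace, Matrix.trace]
  simp only [Matrix.diag_apply, Matrix.submatrix_apply]
  rw [Equiv.sum_comp e fun i => (X * Z) i i]

variable {E : Type*} [NormedAddCommGroup E] [NormedSpace ℂ E] {U : Set E}
  {A : E → Connection φ L} {t : E → ∀ p, Fin (L p).s → ℕ → ℂ}
  {Y : E → Option ι → Matrix ν ν (PowerSeries ℂ)}

/-- An irregular pole, among all poles. -/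
def irrNode (φ : Type*) {ι : Type*} (p : Option ι) : Option (φ ⊕ ι) := p.map Sum.inr

theorem sgn_irrNode (p : Option ι) : sgn (irrNode φ p) = sgn p := by cases p <;> rfl

theorem nodeAt_irrNode (p : Option ι) (z : E) :
    nodeAt A (irrNode φ p) z = (A z).at ((A z).coord p 1) := by cases p <;> rfl

theorem localSystem_eq (p : Option ι) (z : E) : (A z).localSystem p =
    ((single (sgn (irrNode φ p)) 1 : LaurentSeries ℂ) • nodeAt A (irrNode φ p) z).submatrix
      (L p).e (L p).e := by
  rw [nodeAt_irrNode, sgn_irrNode]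
  rfl

/-- The formal gauge at an irregular pole, as a family. -/
noncomputable def gaugeFam (L : Option ι → LocalType ν) (Y : E → Option ι → Matrix ν ν (PowerSeries ℂ)) (p : Option ι) (z : E) :
    Matrix (Σ j : Fin (L p).s, Fin ((L p).n j)) (Σ j : Fin (L p).s, Fin ((L p).n j))
      (LaurentSeries ℂ) :=
  localGaugeMat (L p) (Y z p)

/-- The inverse of the formal gauge at an irregular pole, as a family. -/
noncomputable def gaugeInvFam (L : Option ι → LocalType ν) (Y : E → Option ι → Matrix ν ν (PowerSeries ℂ)) (p : Option ι) (z : E) :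
    Matrix (Σ j : Fin (L p).s, Fin ((L p).n j)) (Σ j : Fin (L p).s, Fin ((L p).n j))
      (LaurentSeries ℂ) :=
  (toLaurent (Y z p))⁻¹.submatrix (L p).e (L p).e

/-- The logarithmic derivative of the formal gauge at an irregular pole. -/
noncomputable def gaugeLog (L : Option ι → LocalType ν) (Y : E → Option ι → Matrix ν ν (PowerSeries ℂ)) (p : Option ι) (z : E) :
    Matrix (Σ j : Fin (L p).s, Fin ((L p).n j)) (Σ j : Fin (L p).s, Fin ((L p).n j))
      (LaurentSeries ℂ) :=
  gaugeInvFam L Y p z * (gaugeFam L Y p z).map euler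

namespace NormalizedIsomonodromic

theorem localGauge (h : NormalizedIsomonodromic U A t Y) (p : Option ι) {z : E} (hz : z ∈ U) :
    LocalGauge p (L p).r (t z p) ((A z).localSystem p) (gaugeFam L Y p z) (gaugeInvFam L Y p z) :=
  (h.gauge z hz p).localGauge

theorem famM_toLaurent (h : NormalizedIsomonodromic U A t Y) (p : Option ι) :
    FamM U fun z => toLaurent (Y z p) := by
  intro a b
  refine ⟨⟨0, fun z _ => LB.ofPowerSeries _⟩, fun k => ?_⟩
  simp only [toLaurent, Matrix.map_apply, PowerSeries.coeff_coe]
  split_ifs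
  · exact analyticOnNhd_const
  · exact h.analytic_gauge p _ a b

theorem famM_gaugeFam (h : NormalizedIsomonodromic U A t Y) (p : Option ι) :
    FamM U (gaugeFam L Y p) := fun a b => h.famM_toLaurent p ((L p).e a) ((L p).e b)

theorem famM_gaugeInvFam (h : NormalizedIsomonodromic U A t Y) (hU : IsOpen U) (p : Option ι) :
    FamM U (gaugeInvFam L Y p) := by
  have h1 : FamM U fun z => (toLaurent (Y z p))⁻¹ := by
    refine (h.famM_toLaurent p).inv hU (fun z _ a b => LB.ofPowerSeries _) fun z hz => ?_
    have e : ((toLaurent (Y z p)).map fun f => f.coeff 0) =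
        (Y z p).map (PowerSeries.constantCoeff (R := ℂ)) := by
      refine Matrix.ext fun a b => ?_
      simp only [toLaurent, Matrix.map_apply]
      rw [PowerSeries.coeff_coe]
      simp
    rw [e]
    exact (h.gauge z hz p).1.ne_zero
  exact fun a b => h1 ((L p).e a) ((L p).e b)

theorem famM_localSystem (h : NormalizedIsomonodromic U A t Y) (hU : IsOpen U) (p : Option ι) :
    FamM U fun z => (A z).localSystem p := by
  simp only [localSystem_eq]
  exact fun a b => FamM.smul hU (Fam.const _) (h.famM_nodeAt hU (irrNode φ p)) ((L p).e a) ((L p).e b)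

theorem dirM_localSystem (h : NormalizedIsomonodromic U A t Y) (hU : IsOpen U) (p : Option ι)
    {z : E} (hz : z ∈ U) (v : E) : dirM (fun z => (A z).localSystem p) z v =
      (HahnSeries.C (sgn p : ℂ) : LaurentSeries ℂ) •
        ((movingFlow A t Y (irrNode φ p) z v).submatrix (L p).e (L p).e).map euler +
      ((movingFlow A t Y (irrNode φ p) z v).submatrix (L p).e (L p).e * (A z).localSystem p -
        (A z).localSystem p * (movingFlow A t Y (irrNode φ p) z v).submatrix (L p).e (L p).e) := by
  have h1 := h.dirM_nodeAt hU hz v (irrNode φ p)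
  simp only [localSystem_eq]
  rw [Matrix.submatrix_mul_equiv, Matrix.submatrix_mul_equiv]
  rw [sgn_irrNode] at h1 ⊢
  exact congrArg (fun X => X.submatrix (L p).e (L p).e) h1

theorem lb_nodeFlow_sub (h : NormalizedIsomonodromic U A t Y) (p : Option ι) {z : E} (hz : z ∈ U)
    (v : E) (a b : ν) : LB 0 (nodeFlow A t Y (irrNode φ p) z v a b -
      gaugedForm (t z) (Y z) (dTimes t z v) (dPoles A z v) p a b) := by
  cases p with
  | none => exact (A z).lb_ratDeformation_inf _ _ _ _ a b
  | some i => exact (A z).lb_ratDeformation_irr _ _ _ _ (h.distinct_poles z hz) i a b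

/-- The term `-D dγ` in the bare form is designed for this: the `dγ A` of the moving frame cancels
it in the gauge, so only the bare deformation of the times remains singular. -/
theorem lb_conj_movingFlow_sub (h : NormalizedIsomonodromic U A t Y) (p : Option ι) {z : E}
    (hz : z ∈ U) (v : E) (x y : Σ j : Fin (L p).s, Fin ((L p).n j)) : LB 0 ((gaugeInvFam L Y p z *
      (movingFlow A t Y (irrNode φ p) z v).submatrix (L p).e (L p).e * gaugeFam L Y p z -
        bareB p (L p).n (L p).r (dTimes t z v p) : Matrix _ _ (LaurentSeries ℂ)) x y) := by
  have G := h.localGauge p hz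
  set γ' : ℂ := p.elim 0 fun i => dPoles A z v (.inr i) with hγ'
  have hγ : (irrNode φ p).elim 0 (dPoles A z v) = γ' := by cases p <;> rfl
  set Q := (gaugedForm (t z) (Y z) (dTimes t z v) (dPoles A z v) p).submatrix (L p).e (L p).e with hQ
  set D := (bareD L p (t z p)).submatrix (L p).e (L p).e with hD
  set B := bareB p (L p).n (L p).r (dTimes t z v p) with hB
  set Yi := gaugeInvFam L Y p z with hYi
  set Ym := gaugeFam L Y p z with hYm
  set R := (nodeFlow A t Y (irrNode φ p) z v).submatrix (L p).e (L p).e - Q with hR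
  set At := (nodeAt A (irrNode φ p) z).submatrix (L p).e (L p).e with hAt
  have h1 : Yi * Q * Ym = B - (HahnSeries.C γ' : LaurentSeries ℂ) • D := by
    have e : Q = Ym * (B - (HahnSeries.C γ' : LaurentSeries ℂ) • D) * Yi := by
      rw [hQ, gaugedForm, hB, hD, ← bareForm_submatrix, hYm, hYi, gaugeFam, gaugeInvFam,
        localGaugeMat, Matrix.submatrix_mul_equiv, Matrix.submatrix_mul_equiv]
    rw [e, Matrix.mul_assoc Ym, ← Matrix.mul_assoc Yi, G.inv_mul, Matrix.one_mul, Matrix.mul_assoc,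
      G.inv_mul, Matrix.mul_one]
  -- The gauge equation divided by `u`. At a finite pole the last term is regular, since the
  -- logarithmic derivative of the gauge vanishes at the pole; at infinity it is multiplied by `dγ =
  -- 0`.
  have h2 : Yi * At * Ym = D + (single (-sgn p) (sgn p : ℂ) : LaurentSeries ℂ) • (Yi * Ym.map euler) := by
    have e1 : At = (single (-sgn p) 1 : LaurentSeries ℂ) • (A z).localSystem p := by
      rw [localSystem_eq, sgn_irrNode]
      refine Matrix.ext fun a b => ?_
      simp only [hAt, Matrix.smul_apply, Matrix.submatrix_apply, smul_eq_mul, ← mul_assoc]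
      rw [single_mul_single]
      simp
    have e2 : D = (single (-sgn p) 1 : LaurentSeries ℂ) • bareM p (L p).n (L p).r (t z p) := by
      rw [← bareD_submatrix]
      refine Matrix.ext fun a b => ?_
      simp only [hD, Matrix.smul_apply, Matrix.submatrix_apply, smul_eq_mul, ← mul_assoc]
      rw [single_mul_single]
      simp
    have e3 : (single (-sgn p) (sgn p : ℂ) : LaurentSeries ℂ) =
        single (-sgn p) 1 * HahnSeries.C (sgn p : ℂ) := by
      rw [C_apply, single_mul_single, add_zero, one_mul]
    rw [e1, e2, laurent_mul_smul, laurent_smul_mul, Matrix.mul_assoc, G.eq, Matrix.mul_add,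
      ← Matrix.mul_assoc, G.inv_mul, Matrix.one_mul, laurent_mul_smul, laurent_smul_add, e3]
    congr 1
    refine Matrix.ext fun a b => ?_
    simp only [Matrix.smul_apply, smul_eq_mul, mul_assoc]
  have h3 : (movingFlow A t Y (irrNode φ p) z v).submatrix (L p).e (L p).e =
      R + Q + (HahnSeries.C γ' : LaurentSeries ℂ) • At := by
    rw [hR, sub_add_cancel, movingFlow, hγ]
    rfl
  have h4 : Yi * (R + Q + (HahnSeries.C γ' : LaurentSeries ℂ) • At) * Ym - B =
      Yi * R * Ym + (HahnSeries.C γ' * single (-sgn p) (sgn p : ℂ) : LaurentSeries ℂ) •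
        (Yi * Ym.map euler) := by
    rw [Matrix.mul_add, Matrix.mul_add, Matrix.add_mul, Matrix.add_mul, h1, laurent_mul_smul,
      laurent_smul_mul, h2]
    refine Matrix.ext fun a b => ?_
    simp only [Matrix.add_apply, Matrix.sub_apply, Matrix.smul_apply, smul_eq_mul]
    ring
  rw [h3, h4, Matrix.add_apply]
  refine LB.add ?_ ?_
  · have := LB.matrix_mul (b := 0) (c := 0) (LB.matrix_mul (b := 0) (c := 0) G.lb_inv
      (Z := R) fun a b => h.lb_nodeFlow_sub p hz v _ _) G.lb x y
    simpa using this
  · rw [Matrix.smul_apply, smul_eq_mul]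
    cases p with
    | none => rw [hγ', Option.elim_none, map_zero, zero_mul, zero_mul]; exact LB.zero _
    | some i =>
      exact ((LB.C _).mul (LB.single _ _)).mul_of_le (G.lb_log x y) (by simp [sgn])

theorem genericTimes (h : NormalizedIsomonodromic U A t Y) (p : Option ι) {z : E} (hz : z ∈ U) :
    GenericTimes (L p).n (L p).r (t z p) :=
  (h.gauge z hz p).genericTimes (h.minimally_resonant z hz p)

theorem famM_gaugeLog (h : NormalizedIsomonodromic U A t Y) (hU : IsOpen U) (p : Option ι) :
    FamM U (gaugeLog L Y p) := (h.famM_gaugeInvFam hU p).mul hU (h.famM_gaugeFam p).euler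

/-- The exterior derivative of the local part of the tau form at an irregular pole. -/
theorem resPair_bareB_dirM_gaugeLog (h : NormalizedIsomonodromic U A t Y) (hU : IsOpen U)
    (p : Option ι) {z : E} (hz : z ∈ U) (v w : E) :
    resPair (bareB p (L p).n (L p).r (dTimes t z w p)) (dirM (gaugeLog L Y p) z v) -
      resPair (bareB p (L p).n (L p).r (dTimes t z v p)) (dirM (gaugeLog L Y p) z w) =
    resPair ((movingFlow A t Y (irrNode φ p) z v).map euler) (movingFlow A t Y (irrNode φ p) z w) := by
  have hY := h.famM_gaugeFam p
  have hYi := h.famM_gaugeInvFam hU p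
  have G := fun z (hz : z ∈ U) => h.localGauge p hz
  have hb : ∀ v x y, LB 0 ((gaugeInvFam L Y p z * dirM (gaugeFam L Y p) z v :
      Matrix _ _ (LaurentSeries ℂ)) x y) := by
    intro v x y
    have := LB.matrix_mul (b := 0) (c := 0) (G z hz).lb_inv (Z := dirM (gaugeFam L Y p) z v)
      (fun a b => (hY a b).dir_lb hU hz v fun z hz => (G z hz).lb a b) x y
    simpa using this
  have hvar : ∀ v, _ := fun v => bareVar_eq (t := fun z => t z p) (L p).n_pos hU G
    (h.famM_localSystem hU p) hY hYi (h.analytic_times p) hz v (h.dirM_localSystem hU p hz v)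
  have hlog : ∀ v, dirM (gaugeLog L Y p) z v = _ := fun v =>
    dirM_log hU (fun z hz => (G z hz).inv_mul) hY hYi hz v
  rw [hlog, hlog]
  have key := (G z hz).resPair_deformation (L p).n_pos (L p).r_pos (h.genericTimes p hz) (hb v) (hb w)
    (hvar v) (hvar w) (h.lb_conj_movingFlow_sub p hz v) (h.lb_conj_movingFlow_sub p hz w)
  refine key.trans ?_
  exact resPair_submatrix (L p).e ((movingFlow A t Y (irrNode φ p) z v).map euler)
    (movingFlow A t Y (irrNode φ p) z w)

end NormalizedIsomonodromic

end LocalForm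

/-! ### One-forms and their exterior derivatives -/

section Forms

variable {E : Type*} [NormedAddCommGroup E] [NormedSpace ℂ E] {U : Set E}

/-- The one-form `ω` is analytic on `U` and has the exterior derivative `κ`. -/
structure FormD (U : Set E) (ω : E → E →L[ℂ] ℂ) (κ : E → E → E → ℂ) : Prop where
  an : AnalyticOnNhd ℂ ω U
  eq : ∀ z ∈ U, ∀ v w, fderiv ℂ ω z v w - fderiv ℂ ω z w v = κ z v w

namespace FormD

variable {ω ω' : E → E →L[ℂ] ℂ} {κ κ' : E → E → E → ℂ}

theorem add (h : FormD U ω κ) (h' : FormD U ω' κ') :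
    FormD U (fun z => ω z + ω' z) (fun z v w => κ z v w + κ' z v w) := by
  refine ⟨h.an.add h'.an, fun z hz v w => ?_⟩
  rw [fderiv_fun_add (h.an z hz).differentiableAt (h'.an z hz).differentiableAt, ← h.eq z hz v w,
    ← h'.eq z hz v w]
  simp only [add_apply]
  ring

theorem sum {α : Type*} {S : Finset α} {ω : α → E → E →L[ℂ] ℂ} {κ : α → E → E → E → ℂ}
    (h : ∀ i ∈ S, FormD U (ω i) (κ i)) :
    FormD U (fun z => ∑ i ∈ S, ω i z) (fun z v w => ∑ i ∈ S, κ i z v w) := by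
  classical
  induction S using Finset.induction_on with
  | empty =>
    simp only [Finset.sum_empty]
    exact ⟨analyticOnNhd_const, fun z _ v w => by simp⟩
  | insert i S hi ih =>
    simp only [Finset.sum_insert hi]
    exact (h i (Finset.mem_insert_self _ _)).add (ih fun k hk => h k (Finset.mem_insert_of_mem hk))

theorem congr (h : FormD U ω κ) (hU : IsOpen U) (hω : ∀ z ∈ U, ω z = ω' z)
    (hκ : ∀ z ∈ U, ∀ v w, κ z v w = κ' z v w) : FormD U ω' κ' := by
  refine ⟨h.an.congr hU hω, fun z hz v w => ?_⟩
  have : ω =ᶠ[nhds z] ω' := by filter_upwards [hU.mem_nhds hz] with z' hz' using hω z' hz'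
  rw [← this.fderiv_eq, h.eq z hz, hκ z hz]

/-- `d(c dg) = dc ∧ dg`, because second derivatives are symmetric. -/
theorem smul_fderiv {c g : E → ℂ} (hc : AnalyticOnNhd ℂ c U) (hg : AnalyticOnNhd ℂ g U) :
    FormD U (fun z => c z • fderiv ℂ g z)
      (fun z v w => fderiv ℂ c z v * fderiv ℂ g z w - fderiv ℂ c z w * fderiv ℂ g z v) := by
  refine ⟨hc.smul hg.fderiv, fun z hz v w => ?_⟩
  have hs : IsSymmSndFDerivAt ℂ g z := (hg z hz).contDiffAt.isSymmSndFDerivAt (n := 2)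
    (by rw [minSmoothness_of_isRCLikeNormedField])
  rw [fderiv_fun_smul (hc z hz).differentiableAt (hg.fderiv z hz).differentiableAt]
  simp only [add_apply, smul_apply,
    ContinuousLinearMap.smulRight_apply, smul_eq_mul]
  rw [hs v w]
  ring

/-- Poincaré lemma on a ball. Convexity is a real notion, so differentiability is restricted to real
scalars for the symmetry hypothesis only. -/
theorem exists_primitive (h : FormD U ω fun _ _ _ => 0) (hU : IsOpen U) {z : E} (hz : z ∈ U) :
    ∃ V ⊆ U, IsOpen V ∧ z ∈ V ∧ ∃ f : E → ℂ, ∀ z' ∈ V, HasFDerivAt f (ω z') z' := by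
  obtain ⟨ε, hε, hball⟩ := Metric.isOpen_iff.1 hU z hz
  refine ⟨Metric.ball z ε, hball, Metric.isOpen_ball, Metric.mem_ball_self hε, ?_⟩
  refine (convex_ball z ε).exists_forall_hasFDerivAt_of_fderiv_symmetric Metric.isOpen_ball
    (fun z' hz' => ((h.an z' (hball hz')).differentiableAt.restrictScalars
      ℝ).differentiableWithinAt) fun z' hz' v w => ?_
  have h1 := h.eq z' (hball hz') v w
  rw [((h.an z' (hball hz')).differentiableAt).fderiv_restrictScalars ℝ]
  exact sub_eq_zero.1 h1

end FormD

end Forms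

/-! ### The residue pairing in analytic families -/

section Pairing

variable {E : Type*} [NormedAddCommGroup E] [NormedSpace ℂ E] {U : Set E} {I : Type*} [Fintype I]

theorem FamM.const (H : Matrix I I (LaurentSeries ℂ)) : FamM U fun _ : E => H :=
  fun _ _ => Fam.const _

theorem dirM_const (H : Matrix I I (LaurentSeries ℂ)) (z v : E) : dirM (fun _ => H) z v = 0 :=
  Matrix.ext fun _ _ => dir_const _ _ _

theorem FamM.resPair_const (hU : IsOpen U) {X : E → Matrix I I (LaurentSeries ℂ)} (hX : FamM U X)
    (H : Matrix I I (LaurentSeries ℂ)) : AnalyticOnNhd ℂ (fun z => resPair H (X z)) U ∧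
      ∀ z ∈ U, ∀ v, fderiv ℂ (fun z => resPair H (X z)) z v = resPair H (dirM X z v) := by
  have h1 := (FamM.const H).mul hU hX
  refine ⟨h1.trace.an 0, fun z hz v => ?_⟩
  have h2 := h1.trace.coeff_dir hU hz v 0
  rw [h1.dir_trace hU hz, (FamM.const H).dirM_mul hU hX hz, dirM_const, Matrix.zero_mul,
    zero_add] at h2
  exact h2.symm

theorem laurent_trace_smul (c : LaurentSeries ℂ) (X : Matrix I I (LaurentSeries ℂ)) :
    (c • X).trace = c * X.trace := by
  rw [Matrix.trace, Matrix.trace, Finset.mul_sum]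
  rfl

theorem resPair_smul_left (c : ℂ) (X Z : Matrix I I (LaurentSeries ℂ)) :
    resPair ((HahnSeries.C c : LaurentSeries ℂ) • X) Z = c * resPair X Z := by
  rw [resPair, resPair, laurent_smul_mul, laurent_trace_smul, HahnSeries.C_mul_eq_smul, coeff_smul, smul_eq_mul]

theorem resPair_smul_right (c : ℂ) (X Z : Matrix I I (LaurentSeries ℂ)) :
    resPair X ((HahnSeries.C c : LaurentSeries ℂ) • Z) = c * resPair X Z := by
  rw [resPair_comm, resPair_smul_left, resPair_comm]

theorem resPair_sum_left {α : Type*} (S : Finset α) (X : α → Matrix I I (LaurentSeries ℂ))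
    (Z : Matrix I I (LaurentSeries ℂ)) :
    resPair (∑ i ∈ S, X i) Z = ∑ i ∈ S, resPair (X i) Z := by
  rw [resPair, Finset.sum_mul, Matrix.trace_sum, coeff_sum]
  rfl

theorem resPair_bareB {ι : Type*} (p : Option ι) {s : ℕ} (n : Fin s → ℕ) (r : ℕ)
    (dt : Fin s → ℕ → ℂ)
    (X : Matrix (Σ j : Fin s, Fin (n j)) (Σ j : Fin s, Fin (n j)) (LaurentSeries ℂ)) :
    resPair (bareB p n r dt) X = -∑ j, ∑ J ∈ Finset.Icc 1 (r * n j),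
      (sgn p / J * resPair (blockH p n j J) X) * dt j J := by
  rw [bareB, resPair_sum_left, ← Finset.sum_neg_distrib]
  refine Finset.sum_congr rfl fun j _ => ?_
  rw [resPair_sum_left, ← Finset.sum_neg_distrib]
  refine Finset.sum_congr rfl fun J _ => ?_
  rw [resPair_smul_left]
  ring

theorem resPair_euler_left (X Z : Matrix I I (LaurentSeries ℂ)) :
    resPair (X.map euler) Z = -resPair (Z.map euler) X := by
  have h := coeff_zero_trace_map_euler (X * Z)
  rw [map_euler_mul, Matrix.trace_add, coeff_add] at h
  rw [resPair_comm (Z.map euler)]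
  exact eq_neg_of_add_eq_zero_left h

end Pairing

/-! ### The exterior derivative of the tau form -/

section TauForm

variable {φ ι ν : Type*} [Fintype φ] [Fintype ι] [Fintype ν] [DecidableEq ν]
  {L : Option ι → LocalType ν}
  {E : Type*} [NormedAddCommGroup E] [NormedSpace ℂ E] {U : Set E}
  {A : E → Connection φ L} {t : E → ∀ p, Fin (L p).s → ℕ → ℂ}
  {Y : E → Option ι → Matrix ν ν (PowerSeries ℂ)}

theorem secondOrderConst_eq_zero {s : ℕ} {n : Fin s → ℕ} (p : Option ι) (hn : ∀ j, 0 < n j)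
    {j : Fin s} (hj : n j < 2) : secondOrderConst p hn j = 0 := by
  have : Finset.univ.erase (⟨0, hn j⟩ : Fin (n j)) = ∅ := by
    refine Finset.eq_empty_of_forall_notMem fun k hk => Finset.ne_of_mem_erase hk ?_
    ext
    have := k.2
    simp only
    omega
  rw [secondOrderConst, this, Finset.sum_empty, mul_zero]

namespace NormalizedIsomonodromic

/-- The terms of second order do not contribute to the exterior derivative. -/
theorem formD_secondOrder (h : NormalizedIsomonodromic U A t Y) (hU : IsOpen U) (p : Option ι)
    (j : Fin (L p).s) {J : ℕ} (hJ : J ∈ Finset.Icc 1 ((L p).r * (L p).n j)) :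
    FormD U (fun z => ((1 / J : ℂ) * secondOrderTerm (L p) p (t z p) j J) •
      fderiv ℂ (fun z' => t z' p j J) z) fun _ _ _ => 0 := by
  have hzero : FormD U (fun _ => (0 : E →L[ℂ] ℂ)) fun _ _ _ => 0 :=
    ⟨analyticOnNhd_const, fun z _ v w => by simp⟩
  by_cases hJr : J = (L p).r * (L p).n j - 1
  swap
  · refine hzero.congr hU (fun z _ => ?_) fun _ _ _ _ => rfl
    rw [secondOrderTerm, if_neg hJr, mul_zero]
    ext w
    simp
  by_cases hnj : (L p).n j < 2
  · refine hzero.congr hU (fun z _ => ?_) fun _ _ _ _ => rfl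
    rw [secondOrderTerm, secondOrderConst_eq_zero p _ hnj, zero_div, ite_self, mul_zero]
    ext w
    simp
  have hg := h.analytic_times p j J hJ
  have hne : ∀ z ∈ U, t z p j J ≠ 0 := fun z hz => by
    rw [hJr]
    exact (h.genericTimes p hz).ne_zero j (by omega)
  -- This number does not depend on the point of `U`, so the form is `c d log t` and closed.
  set c : ℂ := 1 / J * secondOrderConst p (L p).n_pos j with hc
  have han : AnalyticOnNhd ℂ (fun z => c * (t z p j J)⁻¹) U := analyticOnNhd_const.mul (hg.inv hne)
  refine (FormD.smul_fderiv han hg).congr hU (fun z _ => ?_) fun z hz v w => ?_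
  · rw [secondOrderTerm, if_pos hJr, ← hJr, hc, div_eq_mul_inv (secondOrderConst _ _ _), mul_assoc]
  · have hd := (hg z hz).differentiableAt
    have h1 : fderiv ℂ (fun z => c * (t z p j J)⁻¹) z =
        c • (-((t z p j J) ^ 2)⁻¹ • fderiv ℂ (fun z' => t z' p j J) z) := by
      rw [fderiv_const_mul (hd.fun_inv (hne z hz))]
      congr 1
      exact ((hasDerivAt_inv (hne z hz)).comp_hasFDerivAt z hd.hasFDerivAt).fderiv
    rw [h1]
    simp only [smul_apply, smul_eq_mul]
    ring

/-- The local part of the tau form at an irregular pole. -/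
theorem formD_irregular (h : NormalizedIsomonodromic U A t Y) (hU : IsOpen U) (p : Option ι) :
    FormD U (fun z => ∑ j, ∑ J ∈ Finset.Icc 1 ((L p).r * (L p).n j),
        (sgn p / J * resPair (blockH p (L p).n j J) (gaugeLog L Y p z)) •
          fderiv ℂ (fun z' => t z' p j J) z)
      fun z v w => -resPair ((movingFlow A t Y (irrNode φ p) z v).map euler)
        (movingFlow A t Y (irrNode φ p) z w) := by
  have hX := h.famM_gaugeLog hU p
  have hc : ∀ (j : Fin (L p).s) (J : ℕ), AnalyticOnNhd ℂ (fun z => (sgn p / J : ℂ) *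
      resPair (blockH p (L p).n j J) (gaugeLog L Y p z)) U ∧ ∀ z ∈ U, ∀ v, fderiv ℂ (fun z =>
      (sgn p / J : ℂ) * resPair (blockH p (L p).n j J) (gaugeLog L Y p z)) z v = (sgn p / J : ℂ) *
      resPair (blockH p (L p).n j J) (dirM (gaugeLog L Y p) z v) := by
    intro j J
    obtain ⟨h1, h2⟩ := hX.resPair_const hU (blockH p (L p).n j J)
    refine ⟨analyticOnNhd_const.mul h1, fun z hz v => ?_⟩
    rw [fderiv_const_mul (h1 z hz).differentiableAt, smul_apply, h2 z hz,
      smul_eq_mul]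
  refine (FormD.sum fun j _ => FormD.sum fun J hJ => FormD.smul_fderiv (hc j J).1
    (h.analytic_times p j J hJ)).congr hU (fun _ _ => rfl) fun z hz v w => ?_
  rw [← h.resPair_bareB_dirM_gaugeLog hU p hz v w, resPair_bareB, resPair_bareB, neg_sub_neg,
    neg_sub, ← Finset.sum_sub_distrib]
  refine Finset.sum_congr rfl fun j _ => ?_
  rw [← Finset.sum_sub_distrib]
  refine Finset.sum_congr rfl fun J _ => ?_
  rw [(hc j J).2 z hz, (hc j J).2 z hz]
  rfl

/-- The part of the tau form along the positions of the poles. -/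
theorem formD_pole (h : NormalizedIsomonodromic U A t Y) (hU : IsOpen U) (q : φ ⊕ ι) :
    FormD U (fun z => ((1 / 2 : ℂ) * formRes (finCoord ((A z).pole q) 1)
        ((A z).at (finCoord ((A z).pole q) 1) ^ 2).trace) • fderiv ℂ (fun z' => (A z').pole q) z)
      fun z v w =>
        resPair ((movingFlow A t Y (some q) z v).map euler) (nodeAt A (some q) z) * dPoles A z w q -
        resPair ((movingFlow A t Y (some q) z w).map euler) (nodeAt A (some q) z) *
          dPoles A z v q := by
  have hX := h.famM_nodeAt hU (some q)
  have hX2 := hX.mul hU hX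
  have e : ∀ z, formRes (finCoord ((A z).pole q) 1)
      ((A z).at (finCoord ((A z).pole q) 1) ^ 2).trace =
      (nodeAt A (some q) z * nodeAt A (some q) z).trace.coeff (-1) := by
    intro z
    have h1 := euler_nodeCoord (A z).pole (some q)
    rw [formRes_eq, show finCoord ((A z).pole q) 1 = nodeCoord (A z).pole (some q) from rfl, h1,
      mul_comm, coeff_single_mul, pow_two]
    simp [sgn, nodeAt]
  have han : AnalyticOnNhd ℂ (fun z => (1 / 2 : ℂ) *
      (nodeAt A (some q) z * nodeAt A (some q) z).trace.coeff (-1)) U :=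
    analyticOnNhd_const.mul (hX2.trace.an (-1))
  -- The derivative of `½ Tr A²` is `Tr (A δA)`, and `s δA = θT + [T, sA]` for the moving
  -- deformation matrix `T`.
  have hd : ∀ z ∈ U, ∀ v, fderiv ℂ (fun z => (1 / 2 : ℂ) *
      (nodeAt A (some q) z * nodeAt A (some q) z).trace.coeff (-1)) z v =
      resPair ((movingFlow A t Y (some q) z v).map euler) (nodeAt A (some q) z) := by
    intro z hz v
    have h1 := h.dirM_nodeAt hU hz v (some q)
    rw [hX.dirM_const_smul hU _ hz] at h1
    set D := dirM (nodeAt A (some q)) z v with hD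
    set B := nodeAt A (some q) z with hB
    set T := movingFlow A t Y (some q) z v with hT
    have h2 : (D * B).trace.coeff (-1) =
        resPair ((single (sgn (some q)) 1 : LaurentSeries ℂ) • D) B := by
      rw [resPair, laurent_smul_mul, laurent_trace_smul, coeff_single_mul]
      simp [sgn]
    -- A commutator with `A` is orthogonal to `A` for the trace, so only `θT` is left.
    have h3 : resPair (T * ((single (sgn (some q)) 1 : LaurentSeries ℂ) • B) -
        ((single (sgn (some q)) 1 : LaurentSeries ℂ) • B) * T) B = 0 := by
      rw [resPair, Matrix.sub_mul, Matrix.trace_sub, laurent_mul_smul, laurent_smul_mul,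
        laurent_smul_mul, laurent_smul_mul, Matrix.mul_assoc B, laurent_trace_smul,
        laurent_trace_smul, Matrix.trace_mul_comm B, sub_self, coeff_zero]
    rw [fderiv_const_mul (hX2.trace.differentiableAt_coeff hz (-1)), smul_apply,
      ← hX2.trace.coeff_dir hU hz, hX2.dir_trace hU hz, hX.dirM_mul hU hX hz, Matrix.trace_add,
      coeff_add, Matrix.trace_mul_comm B, h2, h1, resPair_add_left, h3, resPair_smul_left]
    simp only [sgn, Int.cast_one, one_mul, add_zero, smul_eq_mul]
    ring
  refine (FormD.smul_fderiv han (h.analytic_pole q)).congr hU (fun z _ => by rw [e]) fun z hz v w => ?_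
  rw [hd z hz, hd z hz]
  rfl

end NormalizedIsomonodromic

end TauForm

/-! ### Closedness of the tau form by the residue theorem -/

section TauClosed

variable {φ ι ν : Type*} [Fintype φ] [Fintype ι] [Fintype ν] [DecidableEq ν]
  {L : Option ι → LocalType ν}
  {E : Type*} [NormedAddCommGroup E] [NormedSpace ℂ E] {U : Set E}
  {A : E → Connection φ L} {t : E → ∀ p, Fin (L p).s → ℕ → ℂ}
  {Y : E → Option ι → Matrix ν ν (PowerSeries ℂ)}

theorem resPair_self_euler {I : Type*} [Fintype I] (X : Matrix I I (LaurentSeries ℂ)) :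
    resPair (X.map euler) X = 0 := by
  have h := resPair_euler_left X X
  exact self_eq_neg.1 h

/-- The change of the residue pairing from the moving frame to the fixed one. -/
theorem resPair_movingFlow (P : Option (φ ⊕ ι)) (z v w : E) :
    -resPair ((movingFlow A t Y P z v).map euler) (movingFlow A t Y P z w) +
      (resPair ((movingFlow A t Y P z v).map euler) (nodeAt A P z) * P.elim 0 (dPoles A z w) -
        resPair ((movingFlow A t Y P z w).map euler) (nodeAt A P z) * P.elim 0 (dPoles A z v)) =
    -resPair ((nodeFlow A t Y P z v).map euler) (nodeFlow A t Y P z w) := by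
  have e : ∀ v, (movingFlow A t Y P z v).map euler = (nodeFlow A t Y P z v).map euler +
      (HahnSeries.C (P.elim 0 (dPoles A z v)) : LaurentSeries ℂ) • (nodeAt A P z).map euler := by
    intro v
    refine Matrix.ext fun a b => ?_
    rw [movingFlow, Matrix.map_apply, Matrix.add_apply, map_add, Matrix.smul_apply, smul_eq_mul,
      euler_mul, euler_C, zero_mul, zero_add]
    rfl
  rw [e, e]
  simp only [movingFlow, resPair_add_left, resPair_add_right, resPair_smul_left, resPair_smul_right,
    resPair_self_euler]
  rw [resPair_euler_left (nodeAt A P z) (nodeFlow A t Y P z w)]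
  ring

namespace NormalizedIsomonodromic

/-- Entry by entry this is the sum over all poles of the residues of `g df`, with `f` and `g`
rational and without other poles. -/
theorem sum_resPair_nodeFlow (h : NormalizedIsomonodromic U A t Y) {z : E} (hz : z ∈ U) (v w : E) :
    ∑ P, resPair ((nodeFlow A t Y P z v).map euler) (nodeFlow A t Y P z w) = 0 := by
  have e : ∀ P, resPair ((nodeFlow A t Y P z v).map euler) (nodeFlow A t Y P z w) =
      ∑ a, ∑ b, (euler (nodeExpand (A z).pole P (flowMat A t Y z v a b)) *
        nodeExpand (A z).pole P (flowMat A t Y z w b a)).coeff 0 := by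
    intro P
    rw [resPair, Matrix.trace, coeff_sum]
    refine Finset.sum_congr rfl fun a _ => ?_
    rw [Matrix.diag_apply, Matrix.mul_apply, coeff_sum]
    rfl
  simp only [e]
  rw [Finset.sum_comm]
  refine Finset.sum_eq_zero fun a _ => ?_
  rw [Finset.sum_comm]
  refine Finset.sum_eq_zero fun b _ => ?_
  exact sum_coeff_zero_euler_mul (h.distinct_poles z hz) ((A z).ratDeformation_mem _ _ _ _ a b)
    ((A z).ratDeformation_mem _ _ _ _ b a)

theorem resPair_movingFlow_fuchs (h : NormalizedIsomonodromic U A t Y) {z : E} (hz : z ∈ U)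
    (f : φ) (v w : E) : resPair ((movingFlow A t Y (some (.inl f)) z v).map euler)
      (movingFlow A t Y (some (.inl f)) z w) = 0 := by
  have hlb : ∀ v a b, LB 0 (movingFlow A t Y (some (.inl f)) z v a b) := fun v a b =>
    (A z).lb_ratDeformation_fuchs _ _ _ _ (h.distinct_poles z hz) f a b
  refine resPair_eq_zero_of_lb (b := 1) (c := 0) (fun a b k hk => ?_) (hlb w) (by norm_num)
  rw [Matrix.map_apply, coeff_euler]
  rcases eq_or_ne k 0 with rfl | hk0
  · simp
  · rw [hlb v a b k (by omega), mul_zero]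

/-- `resPair_movingFlow` is summed over all nodes. The moving pairing is zero at the Fuchsian nodes
and the `dγ` terms are zero at infinity, so the left side is what remains of a sum that the residue
theorem makes vanish. -/
theorem sum_exterior_eq_zero (h : NormalizedIsomonodromic U A t Y) {z : E} (hz : z ∈ U) (v w : E) :
    ∑ p : Option ι, (-resPair ((movingFlow A t Y (irrNode φ p) z v).map euler)
        (movingFlow A t Y (irrNode φ p) z w)) +
      ∑ q : φ ⊕ ι, (resPair ((movingFlow A t Y (some q) z v).map euler) (nodeAt A (some q) z) *
          dPoles A z w q -
        resPair ((movingFlow A t Y (some q) z w).map euler) (nodeAt A (some q) z) *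
          dPoles A z v q) = 0 := by
  have h1 := h.sum_resPair_nodeFlow hz v w
  have h2 := Finset.sum_congr rfl fun P (_ : P ∈ (Finset.univ : Finset (Option (φ ⊕ ι)))) =>
    resPair_movingFlow (A := A) (t := t) (Y := Y) P z v w
  rw [Finset.sum_neg_distrib, h1, neg_zero, Finset.sum_add_distrib] at h2
  rw [← h2, Fintype.sum_option (fun P : Option (φ ⊕ ι) => -resPair _ _),
    Fintype.sum_option (fun P : Option (φ ⊕ ι) => resPair _ _ * _ - _), Fintype.sum_option,
    Fintype.sum_sum_type (fun q : φ ⊕ ι => -resPair _ _)]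
  simp only [h.resPair_movingFlow_fuchs hz, Option.elim_none, Option.elim_some, mul_zero, sub_self,
    neg_zero, Finset.sum_const_zero, zero_add, irrNode, Option.map_none, Option.map_some]

/-- The tau form is analytic and closed. -/
theorem formD_tauForm (h : NormalizedIsomonodromic U A t Y) (hU : IsOpen U)
    {y : E → ∀ p, Fin (L p).s → LaurentSeries ℂ}
    (hy : ∀ z ∈ U, ∀ p j, (A z).IsSpectralPoint p (t z p) j (y z p j)) :
    FormD U (tauForm A t y) fun _ _ _ => 0 := by
  -- The residues in the tau form split into the pairing with the logarithmic derivative of the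
  -- gauge and the second order term; only the first has a nontrivial exterior derivative, to be
  -- balanced against the pole part.
  have h1 := (FormD.sum (S := (Finset.univ : Finset (Option ι))) fun p _ =>
    (h.formD_irregular hU p).add (FormD.sum (S := Finset.univ) fun j _ => FormD.sum fun J hJ =>
      h.formD_secondOrder hU p j hJ)).add
    (FormD.sum (S := (Finset.univ : Finset (φ ⊕ ι))) fun q _ => h.formD_pole hU q)
  refine h1.congr hU (fun z hz => ?_) fun z hz v w => ?_
  · rw [tauForm]
    congr 1
    refine Finset.sum_congr rfl fun p _ => ?_
    rw [← Finset.sum_add_distrib]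
    refine Finset.sum_congr rfl fun j _ => ?_
    rw [← Finset.sum_add_distrib]
    refine Finset.sum_congr rfl fun J hJ => ?_
    refine ContinuousLinearMap.ext fun w => ?_
    simp only [add_apply, smul_apply, smul_eq_mul]
    rw [(((h.gauge z hz p).existsUnique_spectralPoint (h.minimally_resonant z hz p) j).2 _
      (hy z hz p j)).2.2 J hJ]
    simp only [resPair, gaugeLog, gaugeInvFam, gaugeFam]
    ring
  · simp only [Finset.sum_const_zero, add_zero]
    exact h.sum_exterior_eq_zero hz v w

end NormalizedIsomonodromic

end TauClosed

end MinRes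

theorem mainTheorem3 {φ ι ν : Type*} [Fintype φ] [Fintype ι] [Fintype ν] [DecidableEq ν]
    {L : Option ι → MinRes.LocalType ν}
    {E : Type*} [NormedAddCommGroup E] [NormedSpace ℂ E] [FiniteDimensional ℂ E]
    (U : Set E) (hU : IsOpen U)
    (A : E → MinRes.Connection φ L) (t : E → ∀ p, Fin (L p).s → ℕ → ℂ)
    (Y : E → Option ι → Matrix ν ν (PowerSeries ℂ))
    (h : MinRes.NormalizedIsomonodromic U A t Y) :
    (∀ z ∈ U, ∀ p j, ∃! y, (A z).IsSpectralPoint p (t z p) j y) ∧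
    ∀ y : E → ∀ p, Fin (L p).s → LaurentSeries ℂ,
      (∀ z ∈ U, ∀ p j, (A z).IsSpectralPoint p (t z p) j (y z p j)) →
      (∀ z ∈ U, ∀ p j, ∀ J ∈ Finset.Icc 1 ((L p).r * (L p).n j),
        t z p j J = (A z).spectralRes p ((L p).n j) (y z p j) J) ∧
      (∀ z ∈ U, ∀ p j,
        t z p j 0 = (A z).spectralRes p ((L p).n j) (y z p j) 0 + ((L p).n j - 1 : ℂ) / 2) ∧
      AnalyticOnNhd ℂ (MinRes.tauForm A t y) U ∧
      (∀ z ∈ U, ∀ v w : E, fderiv ℂ (MinRes.tauForm A t y) z v w =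
        fderiv ℂ (MinRes.tauForm A t y) z w v) ∧
      (∀ z ∈ U, ∃ V ⊆ U, IsOpen V ∧ z ∈ V ∧ ∃ lnτ : E → ℂ,
        ∀ z' ∈ V, HasFDerivAt lnτ (MinRes.tauForm A t y z') z') := by
  have key := fun z (hz : z ∈ U) p j =>
    (h.gauge z hz p).existsUnique_spectralPoint (h.minimally_resonant z hz p) j
  refine ⟨fun z hz p j => (key z hz p j).1, fun y hy => ?_⟩
  have hform := h.formD_tauForm hU hy
  exact ⟨fun z hz p j => ((key z hz p j).2 _ (hy z hz p j)).1,
    fun z hz p j => ((key z hz p j).2 _ (hy z hz p j)).2.1, hform.an,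
    fun z hz v w => sub_eq_zero.1 (hform.eq z hz v w),
    fun z hz => hform.exists_primitive hU hz⟩
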